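/- **Setting.** Let $M=\mathbb T^2=\mathbb R^2/\mathbb Z^2$ with coordinates $(\theta,r)$ and Lebesgue measure $\mu$, and let $R_t(\theta,r)=(\theta+t,r)$. All torus diffeomorphisms below are smooth and homotopic to the identity; we identify them with fixed lifts to $\mathbb R^2$. The projectivized tangent bundle is trivialized as $\mathbb PTM=\mathbb T^2\times\mathbb R/\mathbb Z$, where $t\in\mathbb R/\mathbb Z$ stands for the line of angle $\pi t$; it carries the flat product distance, and $(F,\mathrm dF)$ denotes the map of $\mathbb PTM$ induced by the derivative of $F$. Let $T_{j}=[\frac jk,\frac{j+1}{k}]\subset\mathbb R/\mathbb Z$, $0\le j<k$. For a real function $u$, $\|u\|_0$ is the supremum of $|u|$ over $(0,1)^2$; $\|DF\|_0=\max_{i,j}\|\partial_jF_i\|_0$; $N_s(F)$ is the maximum of $\|D_aF_i\|_0$, $\|D_a(F^{-1})_i\|_0$ over $i$ and multi-indices $|a|\le s$; $d_s$ is the usual $C^s$-distance of torus diffeomorphisms, which compares $F$ with $G$ (modulo $\mathbb Z^2$ in order $0$) and $F^{-1}$ with $G^{-1}$. **Parameters and conjugations.** Fix $\sigma\in(\frac14,\frac12)$.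 Let $k_n,l_n,q_n,m_n\in\mathbb N$, $p_n\in\mathbb Z$, $\alpha_n=p_n/q_n$, with $p_n,q_n$ coprime and $\alpha_{n+1}=\alpha_n+\frac1{k_nl_nq_n^2}$ for $n\ge1$. Let $g_n,\phi_n$ ($n\ge1$) be smooth area-preserving diffeomorphisms, $h_n=g_n\circ\phi_n$, $H_n=h_1\circ\dots\circ h_n$, $H_0=\mathrm{id}$. Assume for all $n\ge1$: (P1) $k_n\ge n^5$, and $(H_{n-1},\mathrm dH_{n-1})$ maps every subset of $\mathbb PTM$ of diameter less than $3/k_n$ to a set of diameter at most $1/n^2$; moreover $\sum_{u\ge0}k_{n+u}^{-5}\le\frac1{4k_n^4}$; (P2) $2k_n<q_n^{1/4}$, $\;l_n\ge 2k_n^{10}q_n^2\|DH_{n-1}\|_0$, $\;q_{n+1}>2k_n^{12}q_n^2$; (P3) with $a_n=k_n^5$, $b_n=\lfloor nq_n^\sigma\rfloor$: $\;n\,b_n\le k_n^3$ for $n>4$; (g) $g_n$ commutes with $R_{1/q_n}$ and, with $e_n=\frac1{2n^5k_n^{10}}$, acts on each strip $\mathbb T\times[\frac{j+2e_n}{a_n},\frac{j+1-2e_n}{a_n}]$,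 $0\le j<a_n$, as the translation by $\frac{b_nj}{a_n}$ in the $\theta$-direction; the union of these strips is the good domain of $g_n$; ($\phi$) $\phi_n$ commutes with $R_{\alpha_n}$. Let $\hat g_n,\hat\phi_n$ be area-preserving diffeomorphisms whose lifts extend to entire maps of $\mathbb C^2$, which commute with $R_{\alpha_n}$, and satisfy $d_2(g_n,\hat g_n)<\epsilon_n$, $d_2(\phi_n,\hat\phi_n)<\epsilon_n$, where $$\epsilon_n=\frac{1}{2^{n^2+1}n^2l_n}\cdot\frac{1}{2k_n^8q_n^2\,\|DH_{n-1}\|_0^2\,(2N_2(\phi_n)+1)}.$$ Put $\hat h_n=\hat g_n\circ\hat\phi_n$, $\hat H_n=\hat h_1\circ\dots\circ\hat h_n$, $\hat f_n=\hat H_n\circ R_{\alpha_{n+1}}\circ\hat H_n^{-1}$ and $\hat\Phi_n=\hat\phi_n\circ R_{\alpha_{n+1}}^{m_n}\circ\hat\phi_n^{-1}$. **Limit objects.** Let $\hat f$ be a smooth torus diffeomorphism with $d_1(\hat f_n,\hat f)\to0$ and $d_1(\hat f_n^{m_n},\hat f^{m_n})<2^{-n}$ for all $n\ge1$. Let $\omega_\infty$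 be a measurable field of symmetric matrices on $\mathbb T^2$ such that, with $\omega_0$ the flat metric, $(\hat H_n^{-1})^*\omega_0\to\omega_\infty$ $\mu$-almost everywhere (so that $\omega_\infty$ is a measurable Riemannian metric), and let $\bar\mu$ be the measure on $\mathbb PTM$ induced by $\omega_\infty$ (its Riemannian volume on $\mathbb T^2$ times its normalized arc length in the fibres). **Partitions.** For $n\ge1$ let $I_{n,i,l}\subset\mathbb T^2$ ($1\le i\le N_n$, $0\le l<k_n$) be pairwise disjoint sets of one common measure, each a countable union of closed axis-parallel squares of side less than $\frac1{2k_n^5q_n}$ that lie in the good domain of $g_n$ and on each of which $h_n$ is a rotation followed by a translation, such that $$\mu(I_{n,i,l})\ge\tfrac1{2k_n^6q_n}\big(1-\tfrac{16}{k_n^5}\big),\qquad \mu\Big(\bigcup_{i,l}I_{n,i,l}\Big)\ge1-\tfrac{25}{k_n^5}.$$ Let $\hat\eta_n$ consist of the sets $\hat I_{n,i,j}=\big(\bigcup_lI_{n,i,l}\big)\times T_{j}$ (with $k=k_n$), and let $\hat{\hat\nu}_n=\{(\hat H_{n-1},\mathrm d\hat H_{n-1})\circ(\hat g_n,\mathrm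 d\hat g_n)(\hat I):\hat I\in\hat\eta_n\}$. Assume that $\hat\eta_n\to\varepsilon$ and $\hat{\hat\nu}_n\to\varepsilon$ (the decomposition into points) with respect to $\bar\mu$, that is, every measurable set is approximated in $\bar\mu$-measure by unions of partition elements as $n\to\infty$. **Distribution.** Assume that there are $\gamma<\frac1{k_n^3q_n}$, $\delta<\frac{50}{k_n^2}$, $\varepsilon_1,\varepsilon_2<\frac{150}n$ (which may depend on $n$) such that for every $n\ge 1$ and $i$ the map $(\hat\Phi_n,\mathrm d\hat\Phi_n)$ is $(\gamma,\delta,\varepsilon_1,\varepsilon_2)$-distributing the sets $\hat I_{n,i,j}$, $0\le j<k_n$: for each $l$ there are $c_l\in\mathbb R$ and a measurable $J_l\subset\pi_r(\hat\Phi_n(I_{n,i,l}))$ with Lebesgue measure $1-\delta\le\lambda(J_l)\le1$ such that $\hat\Phi_n(I_{n,i,l})\subset[c_l,c_l+\gamma]\times\mathbb T$, and for every measurable $\tilde J\subset J_l$ $$\Big|\frac{\mu(I_{n,i,l}\cap\hat\Phi_n^{-1}(\mathbb T\times\tilde J))}{\mu(I_{n,i,l})}-\frac{\lambda(\tilde J)}{\lambda(J_l)}\Big|\le\varepsilon_1\frac{\lambda(\tilde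 J)}{\lambda(J_l)},$$ and for all $0\le j,c<k_n$, with $l$ the index such that $c\equiv l+j \pmod{k_n}$, and every measurable $\tilde J\subset J_l$, $$\Big|\frac{\mu\big(\pi_M\big((I_{n,i,l}\times T_{j})\cap(\hat\Phi_n,\mathrm d\hat\Phi_n)^{-1}(\mathbb T\times\tilde J\times T_{c})\big)\big)}{\mu(I_{n,i,l})}-\frac{\lambda(\tilde J)}{\lambda(J_l)}\Big|\le\varepsilon_2\frac{\lambda(\tilde J)}{\lambda(J_l)}.$$ **Conclusion.** Then $(\hat f,\mathrm d\hat f)$ is weakly mixing on $\mathbb PTM$ with respect to $\bar\mu$: $\bar\mu$ is an invariant probability measure, and every $L^2(\bar\mu)$-eigenfunction of $(\hat f,\mathrm d\hat f)$ is $\bar\mu$-almost everywhere constant. -/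

import Mathlib

open MeasureTheory Filter Topology Set
open scoped Matrix

noncomputable section

namespace AbC

/-! ### The torus, its diffeomorphisms and their projectivized derivatives -/

/-- The universal cover of the two-torus; coordinate `0` is `θ` and coordinate `1` is `r`. -/
abbrev Plane := Fin 2 → ℝ

/-- The torus `𝕋² = ℝ²/ℤ²`; its `volume` is the normalized Lebesgue measure `μ`. -/
abbrev Torus := UnitAddTorus (Fin 2)

/-- The projectivized tangent bundle of the torus, trivialized as `𝕋² × ℝ/ℤ`. The point `t` of the
fibre stands for the line of angle `π * t`; the product `volume` is Lebesgue measure. -/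
abbrev ProjBundle := Torus × UnitAddCircle

/-- The representative in `[0, 1)` of a point of the circle. -/
def circleRep (t : UnitAddCircle) : ℝ := (AddCircle.equivIco (1 : ℝ) 0 t : ℝ)

/-- The representative in `[0, 1)²` of a point of the torus. -/
def torusRep (z : Torus) : Plane := fun i => circleRep (z i)

/-- The covering map. -/
def toTorus (x : Plane) : Torus := fun i => ((x i : ℝ) : UnitAddCircle)

/-- `F` is the lift of a smooth diffeomorphism of the torus that is homotopic to the identity.
Products and inverses of such maps are those of the group `Equiv.Perm Plane`. -/
def IsTorusDiffeo (F : Equiv.Perm Plane) : Prop :=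
  ContDiff ℝ ((⊤ : ℕ∞) : WithTop ℕ∞) (⇑F) ∧ ContDiff ℝ ((⊤ : ℕ∞) : WithTop ℕ∞) (⇑F⁻¹) ∧
    ∀ (x : Plane) (v : Fin 2 → ℤ), F (x + fun i => (v i : ℝ)) = F x + fun i => (v i : ℝ)

/-- The Jacobian matrix. -/
def jac (F : Plane → Plane) (x : Plane) : Matrix (Fin 2) (Fin 2) ℝ :=
  Matrix.of fun i j => fderiv ℝ F x (Pi.single j 1) i

/-- Lifts of smooth area-preserving torus diffeomorphisms homotopic to the identity (such maps
preserve orientation, so that preserving `μ` means having Jacobian determinant `1`). -/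
def IsAreaDiffeo (F : Equiv.Perm Plane) : Prop :=
  IsTorusDiffeo F ∧ ∀ x, (jac F x).det = 1

/-- The map extends to an entire map of `ℂ²`. -/
def HasEntireExtension (F : Plane → Plane) : Prop :=
  ∃ G : (Fin 2 → ℂ) → (Fin 2 → ℂ), Differentiable ℂ G ∧
    ∀ x : Plane, G (fun i => (x i : ℂ)) = fun i => ((F x i : ℝ) : ℂ)

/-- The map of the torus induced by a lift. -/
def torusMap (F : Plane → Plane) (z : Torus) : Torus := toTorus (F (torusRep z))

/-- The unit vector of angle `π * t`. -/
def dir (t : ℝ) : Plane := ![Real.cos (Real.pi * t), Real.sin (Real.pi * t)]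

/-- The coordinate in `ℝ/ℤ` of the line spanned by a nonzero vector. -/
def lineCoord (v : Plane) : UnitAddCircle :=
  ((Complex.arg ⟨v 0, v 1⟩ / Real.pi : ℝ) : UnitAddCircle)

/-- The projectivized derivative extension `(f, df)` of the torus map with lift `F`. -/
def projExt (F : Plane → Plane) (X : ProjBundle) : ProjBundle :=
  (torusMap F X.1, lineCoord (jac F (torusRep X.1) *ᵥ dir (circleRep X.2)))

/-- The flat product distance on the projectivized tangent bundle. -/
def projDist (X Y : ProjBundle) : ℝ :=
  Real.sqrt (dist (X.1 0) (Y.1 0) ^ 2 + dist (X.1 1) (Y.1 1) ^ 2 + dist X.2 Y.2 ^ 2)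

/-- The circle action `R_t (θ, r) = (θ + t, r)`. -/
def rot (t : ℝ) : Equiv.Perm Plane := Equiv.addRight (![t, 0] : Plane)

/-! ### Norms and distances of torus diffeomorphisms -/

/-- `‖u‖₀`, the supremum of `|u|` over the open unit square. -/
def supNorm (u : Plane → ℝ) : ℝ :=
  sSup ((fun x => |u x|) '' {x : Plane | ∀ i, x i ∈ Ioo (0 : ℝ) 1})

/-- The partial derivative in direction `i`. -/
def pderiv (i : Fin 2) (u : Plane → ℝ) (x : Plane) : ℝ := fderiv ℝ u x (Pi.single i 1)

/-- The iterated partial derivative `D_a = ∂^{a₁ + a₂} / ∂r^{a₂} ∂θ^{a₁}`. -/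
def multiDeriv (a : ℕ × ℕ) (u : Plane → ℝ) : Plane → ℝ := (pderiv 1)^[a.2] ((pderiv 0)^[a.1] u)

/-- `⦀F⦀_s`, the maximum of `‖D_a F_i‖₀` and `‖D_a (F⁻¹)_i‖₀` over `i` and `|a| ≤ s`. -/
def fullNorm (s : ℕ) (F : Equiv.Perm Plane) : ℝ :=
  sSup {y | ∃ (i : Fin 2) (a : ℕ × ℕ), a.1 + a.2 ≤ s ∧
    (y = supNorm (multiDeriv a fun x => F x i) ∨ y = supNorm (multiDeriv a fun x => F⁻¹ x i))}

/-- `‖DF‖₀`, the maximum of `‖∂_j F_i‖₀`. -/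
def derivNorm (F : Plane → Plane) : ℝ :=
  sSup {y | ∃ i j : Fin 2, y = supNorm (pderiv j fun x => F x i)}

/-- The one-sided distance `d̃_s`. -/
def preDist (s : ℕ) (F G : Plane → Plane) : ℝ :=
  sSup ({y | ∃ i : Fin 2, y = ⨅ v : ℤ, supNorm fun x => F x i - G x i + (v : ℝ)} ∪
    {y | ∃ (i : Fin 2) (a : ℕ × ℕ), 1 ≤ a.1 + a.2 ∧ a.1 + a.2 ≤ s ∧
      y = supNorm (multiDeriv a fun x => F x i - G x i)})

/-- The distance `d_s` between torus diffeomorphisms. -/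
def diffeoDist (s : ℕ) (F G : Equiv.Perm Plane) : ℝ :=
  max (preDist s F G) (preDist s (⇑F⁻¹) (⇑G⁻¹))

/-! ### The approximation-by-conjugation scheme -/

/-- `H_n = h_1 ∘ ⋯ ∘ h_n` with `h_n = g_n ∘ φ_n`, and `H_0 = id`. -/
def conjMap (g φ : ℕ → Equiv.Perm Plane) : ℕ → Equiv.Perm Plane
  | 0 => 1
  | n + 1 => conjMap g φ n * (g (n + 1) * φ (n + 1))

/-- `f_n = H_n ∘ R_{α_{n+1}} ∘ H_n⁻¹`. -/
def abcMap (H : ℕ → Equiv.Perm Plane) (α : ℕ → ℝ) (n : ℕ) : Equiv.Perm Plane :=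
  H n * rot (α (n + 1)) * (H n)⁻¹

/-- `Φ_n = φ_n ∘ R_{α_{n+1}}^{m_n} ∘ φ_n⁻¹`. -/
def innerMap (φ : ℕ → Equiv.Perm Plane) (α : ℕ → ℝ) (m : ℕ → ℕ) (n : ℕ) : Equiv.Perm Plane :=
  φ n * rot (α (n + 1)) ^ m n * (φ n)⁻¹

/-- The requirements on the parameters `k_n`, `l_n`, `α_n = p_n / q_n`, for `n ≥ 1`. The condition
`diam` is stated for pairs of points, which amounts to the same as stating it for sets of diameter
less than `3 / k_n`. -/
structure IsParameterSystem (k l q : ℕ → ℕ) (p : ℕ → ℤ) (H : ℕ → Equiv.Perm Plane) : Prop where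
  coprime : ∀ n, 1 ≤ n → IsCoprime (p n) (q n : ℤ)
  step : ∀ n, 1 ≤ n →
    (p (n + 1) : ℝ) / q (n + 1) = (p n : ℝ) / q n + 1 / ((k n : ℝ) * l n * (q n : ℝ) ^ 2)
  le_k : ∀ n, 1 ≤ n → n ^ 5 ≤ k n
  diam : ∀ n, 1 ≤ n → ∀ X Y : ProjBundle, projDist X Y < 3 / (k n : ℝ) →
    projDist (projExt (H (n - 1)) X) (projExt (H (n - 1)) Y) ≤ 1 / (n : ℝ) ^ 2
  tail : ∀ n, 1 ≤ n → ∑' u : ℕ, 1 / (k (n + u) : ℝ) ^ 5 ≤ 1 / (4 * (k n : ℝ) ^ 4)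
  q_large : ∀ n, 1 ≤ n → 2 * (k n : ℝ) < (q n : ℝ) ^ (1 / 4 : ℝ)
  l_large : ∀ n, 1 ≤ n →
    2 * (k n : ℝ) ^ 10 * (q n : ℝ) ^ 2 * derivNorm (H (n - 1)) ≤ (l n : ℝ)
  q_growth : ∀ n, 1 ≤ n → 2 * k n ^ 12 * q n ^ 2 < q (n + 1)

/-- `b_n = [n q_n^σ]`. -/
def shearSize (n q : ℕ) (σ : ℝ) : ℕ := ⌊(n : ℝ) * (q : ℝ) ^ σ⌋₊

/-- The `j`-th closed horizontal annulus `𝕋 × [(j + 2ε)/a, (j + 1 - 2ε)/a]`, where `a = k⁵` and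
`ε = 1 / (2 n⁵ k¹⁰)`. -/
def goodStrip (n k j : ℕ) : Set Torus :=
  {z | circleRep (z 1) ∈ Icc (((j : ℝ) + 2 * (1 / (2 * (n : ℝ) ^ 5 * (k : ℝ) ^ 10))) / (k : ℝ) ^ 5)
    (((j : ℝ) + 1 - 2 * (1 / (2 * (n : ℝ) ^ 5 * (k : ℝ) ^ 10))) / (k : ℝ) ^ 5)}

/-- The good domain of `g_n`. -/
def goodDomain (n k : ℕ) : Set Torus := ⋃ j ∈ Finset.range (k ^ 5), goodStrip n k j

/-- The stepwise shear `g_n`: it commutes with `R_{1/q}` and translates the `j`-th annulus by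
`b_n j / a_n` in the `θ`-direction. -/
structure IsStepShear (n k q : ℕ) (σ : ℝ) (g : Equiv.Perm Plane) : Prop where
  area : IsAreaDiffeo g
  comm : Commute g (rot (1 / (q : ℝ)))
  translate : ∀ j < k ^ 5, ∀ z ∈ goodStrip n k j,
    torusMap g z = z + toTorus ![(shearSize n q σ : ℝ) * j / (k : ℝ) ^ 5, 0]

/-- `𝔡_n = 1 / (2^(n²+1) n² l_n)`. -/
def fineScale (n l : ℕ) : ℝ := 1 / (2 ^ (n ^ 2 + 1) * (n : ℝ) ^ 2 * (l : ℝ))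

/-- The precision `ε_n = 𝔡_n / (2 k_n⁸ q_n² ‖DH_{n-1}‖₀² (2⦀φ_n⦀₂ + 1))`. -/
def precision (n k l q : ℕ) (Hprev φ : Equiv.Perm Plane) : ℝ :=
  fineScale n l /
    (2 * (k : ℝ) ^ 8 * (q : ℝ) ^ 2 * derivNorm Hprev ^ 2 * (2 * fullNorm 2 φ + 1))

/-- `F'` is an area-preserving diffeomorphism with entire lift that commutes with `R_α` and
approximates `F` up to precision `ε` in the distance `d_2`. -/
structure IsAnalyticApprox (α ε : ℝ) (F F' : Equiv.Perm Plane) : Prop where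
  area : IsAreaDiffeo F'
  entire : HasEntireExtension F'
  comm : Commute F' (rot α)
  close : diffeoDist 2 F F' < ε

/-! ### Partial partitions and distribution -/

/-- The closed axis-parallel square with lower left corner `x` and side `s`. -/
def square (x : Plane) (s : ℝ) : Set Plane := {y | ∀ i, y i ∈ Icc (x i) (x i + s)}

/-- On the set `S` the map is the composition of a rotation and a translation. -/
def IsRigidOn (F : Plane → Plane) (S : Set Plane) : Prop :=
  ∃ (β : ℝ) (c : Plane), ∀ x ∈ S,
    F x = !![Real.cos β, -Real.sin β; Real.sin β, Real.cos β] *ᵥ x + c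

/-- The partial partition of the torus into the sets `⋃ l, I i l`, each of which consists of `k`
pieces `I i l`. Every piece is a union of small squares in the good domain on which `h` is rigid. -/
structure IsBasePartition (n k q : ℕ) (h : Plane → Plane) {N : ℕ}
    (I : Fin N → Fin k → Set Torus) : Prop where
  disjoint : ∀ i l i' l', (i, l) ≠ (i', l') → Disjoint (I i l) (I i' l')
  squares : ∀ i l, ∃ Q : Set (Plane × ℝ), Q.Countable ∧
    (∀ s ∈ Q, 0 < s.2 ∧ s.2 < 1 / (2 * (k : ℝ) ^ 5 * q) ∧
      toTorus '' square s.1 s.2 ⊆ goodDomain n k ∧ IsRigidOn h (square s.1 s.2)) ∧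
    I i l = ⋃ s ∈ Q, toTorus '' square s.1 s.2
  same_measure : ∀ i l i' l', volume (I i l) = volume (I i' l')
  measure_ge : ∀ i l,
    1 / (2 * (k : ℝ) ^ 6 * q) * (1 - 16 / (k : ℝ) ^ 5) ≤ volume.real (I i l)
  cover : 1 - 25 / (k : ℝ) ^ 5 ≤ volume.real (⋃ i, ⋃ l, I i l)

/-- The image in the circle of the interval `[a, b]`. -/
def arc (a b : ℝ) : Set UnitAddCircle := (fun x : ℝ => (x : UnitAddCircle)) '' Icc a b

/-- The interval `T_j = [j/k, (j+1)/k]` of tangent directions. -/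
def dirArc (k j : ℕ) : Set UnitAddCircle := arc ((j : ℝ) / k) (((j : ℝ) + 1) / k)

/-- The partial partition of the projectivized tangent bundle into the sets `(⋃ l, I i l) × T_j`. -/
def bundlePartition {N k : ℕ} (I : Fin N → Fin k → Set Torus) : Set (Set ProjBundle) :=
  {S | ∃ (i : Fin N) (j : Fin k), S = (⋃ l, I i l) ×ˢ dirArc k j}

/-- `(Φ, dΦ)` is `(γ, δ, ε₁, ε₂)`-distributing the sets `(⋃ l, I l) × T_j`. In the last condition
`l` is the unique index with `i ≡ l + j` modulo `k`. -/
def IsDistributing (Φ : Plane → Plane) {k : ℕ} (I : Fin k → Set Torus) (γ δ ε₁ ε₂ : ℝ) : Prop :=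
  ∃ (J : Fin k → Set UnitAddCircle) (c : Fin k → ℝ),
    (∀ l, MeasurableSet (J l) ∧ J l ⊆ (fun z => torusMap Φ z 1) '' I l ∧
      1 - δ ≤ volume.real (J l) ∧ volume.real (J l) ≤ 1) ∧
    (∀ l, ∀ z ∈ I l, torusMap Φ z 0 ∈ arc (c l) (c l + γ)) ∧
    (∀ l, ∀ J' ⊆ J l, MeasurableSet J' →
      |volume.real (I l ∩ {z | torusMap Φ z 1 ∈ J'}) / volume.real (I l)
          - volume.real J' / volume.real (J l)|
        ≤ ε₁ * (volume.real J' / volume.real (J l))) ∧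
    (∀ j i l : Fin k, (i : ℕ) ≡ (l : ℕ) + (j : ℕ) [MOD k] → ∀ J' ⊆ J l, MeasurableSet J' →
      |volume.real (Prod.fst '' ((I l ×ˢ dirArc k j) ∩
            projExt Φ ⁻¹' {Y | Y.1 1 ∈ J' ∧ Y.2 ∈ dirArc k i})) / volume.real (I l)
          - volume.real J' / volume.real (J l)|
        ≤ ε₂ * (volume.real J' / volume.real (J l)))

/-- A sequence of partial partitions converges to the decomposition into points. -/
def ConvergesToPoints {X : Type*} [MeasurableSpace X] (ν : Measure X) (P : ℕ → Set (Set X)) :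
    Prop :=
  ∀ A : Set X, MeasurableSet A → ∃ C : ℕ → Set (Set X), (∀ n, C n ⊆ P n) ∧
    Tendsto (fun n => ν (symmDiff A (⋃₀ C n))) atTop (𝓝 0)

/-! ### The invariant measure and weak mixing -/

/-- The matrix at a point of the torus of `(F⁻¹)^* ω₀`, with `ω₀` the flat metric. -/
def transportedMetric (F : Equiv.Perm Plane) (z : Torus) : Matrix (Fin 2) (Fin 2) ℝ :=
  (jac (⇑F⁻¹) (torusRep z))ᵀ * jac (⇑F⁻¹) (torusRep z)

/-- The measure on the projectivized tangent bundle induced by a Riemannian metric `ω`: the product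
of the Riemannian volume `√(det ω) dμ` on the torus and of the arc length
`√(det ω) / ω(u, u) dt`, `u = dir t`, of the metric in the fibres (normalized to total mass `1`). -/
def metricMeasure (ω : Torus → Matrix (Fin 2) (Fin 2) ℝ) : Measure ProjBundle :=
  volume.withDensity fun X => ENNReal.ofReal
    (Real.sqrt (ω X.1).det *
      (Real.sqrt (ω X.1).det /
        (dir (circleRep X.2) ⬝ᵥ (ω X.1 *ᵥ dir (circleRep X.2)))))

/-- Weak mixing: `T` preserves the probability measure `ν` and every `L²` eigenfunction of `T` is
almost everywhere constant. -/
def IsWeaklyMixing {X : Type*} [MeasurableSpace X] (T : X → X) (ν : Measure X) : Prop :=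
  IsProbabilityMeasure ν ∧ MeasurePreserving T ν ν ∧
    ∀ (h : X → ℂ) (ξ : ℂ), MemLp h 2 ν → (∀ᵐ x ∂ν, h (T x) = ξ * h x) →
      ∃ c : ℂ, ∀ᵐ x ∂ν, h x = c

end AbC

end

open AbC

/-! Weak mixing follows from mixing along one sequence of iterates. Suppose ∫_A ψ∘T^{m_n} dν →
ν(A)∫ψ dν for all A and ψ, and let h be an eigenfunction with eigenvalue ξ, |ξ| = 1. For a limit
point ζ of ξ^{m_n}, every function F(ζh) with F bounded and continuous is then constant, hence so is
h (`isWeaklyMixing_of_mixing`).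

Measures: Lebesgue measure of the bundle pushed forward by Ĥ_n is the measure induced by the metric
(Ĥ_n⁻¹)^*ω₀ (`map_projExt`). By Scheffé's lemma the almost everywhere convergence of these metrics
becomes convergence in total variation to μ̄. So μ̄ is almost invariant under the powers of f̂_n,
and invariant under f̂. The same convergence bounds, off small sets, how strongly f̂_n^{m_n}
contracts directions, which allows f̂^{m_n} to be replaced by f̂_n^{m_n}
(`tendsto_volume_dist_projExt_lt`).

Mixing: f̂_n^{m_n} is conjugate to Φ̂_n by P = Ĥ_{n-1}∘ĝ_n. A measurable set is nearly a union of
sets P(Î), which are carried to PΦ̂_n(Î). The l-th piece of an element is spread by Φ̂_n along an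
almost full vertical circle, with directions near T_{l+j}. The shear ĝ_n turns that circle into a
graph of slope at least 2k_n, and varying l produces all directions. Hence ĝ_nΦ̂_n(Î) is
equidistributed for functions that vary little at scale 3/k_n (`abs_setIntegral_element_sub_le`).

By (P1) the functions χ∘(H_{n-1}, dH_{n-1}) with χ continuous vary little at this scale, but the
dynamics contains Ĥ_{n-1} instead. The bridge is the sequence of comparison maps H_n∘Ĥ_n⁻¹. On the
set where h_n is rigid, consecutive comparison maps differ by at most 1/n², so they converge almost
everywhere to a map L by Borel–Cantelli. L is injective on a conull set: on the torus because the
remaining drift is far smaller than the inverse expansion of the maps (`base_injective`), on the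
fibres by a cross-ratio argument (`fibre_injective`). Therefore each bounded measurable ψ is close
in L¹ to some χ∘L with χ continuous (`exists_limit`), and χ∘L is the limit of functions which become
χ∘(H_n, dH_n) after composition with Ĥ_n. `tendsto_setIntegral_abcMap` puts these parts together. -/

/-! ### Representatives, lifts and the quotient map to the torus. -/

theorem coe_circleRep (t : UnitAddCircle) : ((circleRep t : ℝ) : UnitAddCircle) = t :=
  (AddCircle.equivIco (1 : ℝ) 0).symm_apply_apply t

theorem circleRep_mem (t : UnitAddCircle) : circleRep t ∈ Ico (0 : ℝ) 1 := by
  have := (AddCircle.equivIco (1 : ℝ) 0 t).2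
  simpa [circleRep] using this

theorem circleRep_coe {x : ℝ} (hx : x ∈ Ico (0 : ℝ) 1) : circleRep (x : UnitAddCircle) = x := by
  have h := (AddCircle.equivIco (1 : ℝ) 0).apply_symm_apply ⟨x, by simpa using hx⟩
  exact congrArg Subtype.val h

theorem toTorus_torusRep (z : Torus) : toTorus (torusRep z) = z :=
  funext fun i => coe_circleRep (z i)

theorem toTorus_add (x y : Plane) : toTorus (x + y) = toTorus x + toTorus y := rfl

theorem toTorus_sub (x y : Plane) : toTorus (x - y) = toTorus x - toTorus y := rfl

theorem coe_eq_coe_iff {x y : ℝ} :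
    (x : UnitAddCircle) = (y : UnitAddCircle) ↔ ∃ n : ℤ, x = y + n := by
  rw [eq_comm, QuotientAddGroup.eq, AddSubgroup.mem_zmultiples_iff]
  constructor
  · rintro ⟨n, hn⟩
    exact ⟨n, by simp at hn; linarith⟩
  · rintro ⟨n, hn⟩
    exact ⟨n, by simp; linarith⟩

theorem coe_add_intCast (x : ℝ) (n : ℤ) :
    ((x + n : ℝ) : UnitAddCircle) = (x : UnitAddCircle) := coe_eq_coe_iff.2 ⟨n, rfl⟩

theorem toTorus_eq_iff {x y : Plane} :
    toTorus x = toTorus y ↔ ∃ v : Fin 2 → ℤ, x = y + fun i => (v i : ℝ) := by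
  constructor
  · intro h
    choose v hv using fun i => coe_eq_coe_iff.1 (congrFun h i)
    exact ⟨v, funext hv⟩
  · rintro ⟨v, rfl⟩
    exact funext fun i => coe_add_intCast _ _

theorem toTorus_surjective : Function.Surjective toTorus := fun z => ⟨_, toTorus_torusRep z⟩

/-- Continuity of maps out of the torus or the bundle is tested on lifts through this quotient map,
since `circleRep` jumps at 0. -/
theorem isOpenQuotientMap_coe : IsOpenQuotientMap (fun x : ℝ => (x : UnitAddCircle)) :=
  ⟨QuotientAddGroup.mk_surjective, AddCircle.continuous_mk' 1, QuotientAddGroup.isOpenMap_coe⟩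

theorem isOpenQuotientMap_toTorus : IsOpenQuotientMap toTorus :=
  IsOpenQuotientMap.piMap (f := fun (_ : Fin 2) (x : ℝ) => (x : UnitAddCircle))
    fun _ => isOpenQuotientMap_coe

theorem continuous_toTorus : Continuous toTorus := isOpenQuotientMap_toTorus.continuous

theorem measurable_circleRep : Measurable circleRep :=
  measurable_subtype_coe.comp (AddCircle.measurableEquivIco (1 : ℝ) 0).measurable

theorem measurable_torusRep : Measurable torusRep :=
  measurable_pi_lambda _ fun i => measurable_circleRep.comp (measurable_pi_apply i)

/-! ### Torus maps and Jacobians induced by lifts. -/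

namespace AbC.IsTorusDiffeo

variable {F G : Equiv.Perm Plane}

theorem map_add (hF : IsTorusDiffeo F) (x : Plane) (v : Fin 2 → ℤ) :
    F (x + fun i => (v i : ℝ)) = F x + fun i => (v i : ℝ) := hF.2.2 x v

theorem inv (hF : IsTorusDiffeo F) : IsTorusDiffeo F⁻¹ := by
  refine ⟨hF.2.1, by simpa using hF.1, fun x v => ?_⟩
  rw [Equiv.Perm.inv_eq_iff_eq, hF.map_add]
  simp

theorem one : IsTorusDiffeo 1 := ⟨contDiff_id, contDiff_id, fun _ _ => rfl⟩

theorem mul (hF : IsTorusDiffeo F) (hG : IsTorusDiffeo G) : IsTorusDiffeo (F * G) := by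
  refine ⟨hF.1.comp hG.1, ?_, fun x v => ?_⟩
  · rw [mul_inv_rev]
    exact hG.2.1.comp hF.2.1
  · simp only [Equiv.Perm.mul_apply]
    rw [hG.map_add, hF.map_add]

theorem pow (hF : IsTorusDiffeo F) : ∀ n : ℕ, IsTorusDiffeo (F ^ n)
  | 0 => by simpa using one
  | n + 1 => by rw [pow_succ]; exact (pow hF n).mul hF

theorem rot (t : ℝ) : IsTorusDiffeo (rot t) := by
  refine ⟨contDiff_id.add contDiff_const, ?_, fun x v => ?_⟩
  · have : (⇑(AbC.rot t)⁻¹ : Plane → Plane) = fun x => x - ![t, 0] := by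
      funext x
      rw [Equiv.Perm.inv_eq_iff_eq]
      exact (sub_add_cancel x ![t, 0]).symm
    rw [this]
    exact contDiff_id.sub contDiff_const
  · simp [AbC.rot, add_right_comm]

theorem continuous (hF : IsTorusDiffeo F) : Continuous F := hF.1.continuous

theorem differentiable (hF : IsTorusDiffeo F) : Differentiable ℝ F :=
  hF.1.differentiable (by simp)

theorem continuous_fderiv (hF : IsTorusDiffeo F) : Continuous (fderiv ℝ F) :=
  hF.1.continuous_fderiv (by simp)

/-- Equivariance under ℤ² makes the choice of representative irrelevant, so that any lift of a point
may be used in computations. -/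
theorem torusMap_toTorus (hF : IsTorusDiffeo F) (x : Plane) :
    torusMap F (toTorus x) = toTorus (F x) := by
  obtain ⟨v, hv⟩ := toTorus_eq_iff.1 (toTorus_torusRep (toTorus x))
  rw [torusMap, hv, hF.map_add, toTorus_eq_iff]
  exact ⟨v, rfl⟩

theorem torusMap_mul (hF : IsTorusDiffeo F) (G : Equiv.Perm Plane) (z : Torus) :
    torusMap (⇑(F * G)) z = torusMap F (torusMap G z) := by
  rw [torusMap, torusMap.eq_1 G, hF.torusMap_toTorus]
  rfl

theorem torusMap_inv_torusMap (hF : IsTorusDiffeo F) (z : Torus) :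
    torusMap (⇑F⁻¹) (torusMap F z) = z := by
  rw [← hF.inv.torusMap_mul, inv_mul_cancel, torusMap]
  exact toTorus_torusRep z

theorem torusMap_torusMap_inv (hF : IsTorusDiffeo F) (z : Torus) :
    torusMap F (torusMap (⇑F⁻¹) z) = z := by
  rw [← hF.torusMap_mul, mul_inv_cancel, torusMap]
  exact toTorus_torusRep z

theorem continuous_torusMap (hF : IsTorusDiffeo F) : Continuous (torusMap F) := by
  rw [← isOpenQuotientMap_toTorus.continuous_comp_iff]
  have : torusMap F ∘ toTorus = toTorus ∘ F := funext hF.torusMap_toTorus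
  rw [this]
  exact continuous_toTorus.comp hF.continuous

theorem fderiv_add (hF : IsTorusDiffeo F) (x : Plane) (v : Fin 2 → ℤ) :
    fderiv ℝ F (x + fun i => (v i : ℝ)) = fderiv ℝ F x := by
  rw [← fderiv_comp_add_right]
  have : (fun x => F (x + fun i => (v i : ℝ))) = fun x => F x + fun i => (v i : ℝ) :=
    funext fun x => hF.map_add x v
  rw [this, fderiv_add_const]

theorem jac_add (hF : IsTorusDiffeo F) (x : Plane) (v : Fin 2 → ℤ) :
    jac F (x + fun i => (v i : ℝ)) = jac F x := by
  simp only [jac, hF.fderiv_add]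

theorem jac_torusRep (hF : IsTorusDiffeo F) (x : Plane) :
    jac F (torusRep (toTorus x)) = jac F x := by
  obtain ⟨v, hv⟩ := toTorus_eq_iff.1 (toTorus_torusRep (toTorus x))
  rw [hv, hF.jac_add]

theorem jac_torusRep_torusMap (hF : IsTorusDiffeo F) (G : Equiv.Perm Plane) (z : Torus) :
    jac F (torusRep (torusMap G z)) = jac F (G (torusRep z)) := by
  rw [torusMap, hF.jac_torusRep]

end AbC.IsTorusDiffeo

theorem jac_mulVec (F : Plane → Plane) (x v : Plane) : jac F x *ᵥ v = fderiv ℝ F x v := by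
  have : v = ∑ j, v j • (Pi.single j 1 : Plane) := by
    ext i; fin_cases i <;> simp
  conv_rhs => rw [this]
  ext i
  simp [Matrix.mulVec, dotProduct, jac, mul_comm]

theorem toLin'_jac (F : Plane → Plane) (x : Plane) :
    Matrix.toLin' (jac F x) = (fderiv ℝ F x : Plane →ₗ[ℝ] Plane) := by
  refine LinearMap.ext fun v => ?_
  rw [Matrix.toLin'_apply, jac_mulVec]
  rfl

theorem det_jac (F : Plane → Plane) (x : Plane) : (jac F x).det = (fderiv ℝ F x).det := by
  rw [ContinuousLinearMap.det, ← toLin'_jac, LinearMap.det_toLin']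

theorem jac_comp {F G : Plane → Plane} {x : Plane} (hF : DifferentiableAt ℝ F (G x))
    (hG : DifferentiableAt ℝ G x) : jac (F ∘ G) x = jac F (G x) * jac G x := by
  apply Matrix.toLin'.injective
  rw [Matrix.toLin'_mul, toLin'_jac, toLin'_jac, toLin'_jac, fderiv_comp x hF hG]
  rfl

theorem jac_id (x : Plane) : jac (⇑(1 : Equiv.Perm Plane)) x = 1 := by
  apply Matrix.toLin'.injective
  rw [toLin'_jac, Matrix.toLin'_one]
  have : (⇑(1 : Equiv.Perm Plane)) = (id : Plane → Plane) := rfl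
  rw [this, fderiv_id]
  rfl

theorem jac_rot (t : ℝ) (x : Plane) : jac (rot t) x = 1 := by
  rw [← jac_id x]
  have : (⇑(rot t) : Plane → Plane) = fun x => x + ![t, 0] := rfl
  rw [this, jac, fderiv_add_const]
  rfl

theorem jac_apply {F : Plane → Plane} {x : Plane} (hF : DifferentiableAt ℝ F x) (i j : Fin 2) :
    jac F x i j = pderiv j (fun x => F x i) x := by
  have h := (ContinuousLinearMap.proj (R := ℝ) (φ := fun _ : Fin 2 => ℝ) i).hasFDerivAt.comp x
    hF.hasFDerivAt
  have h' : fderiv ℝ (fun x => F x i) x = _ := h.fderiv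
  rw [pderiv, h']
  rfl

namespace AbC.IsTorusDiffeo

variable {F G : Equiv.Perm Plane}

theorem jac_mul (hF : IsTorusDiffeo F) (hG : IsTorusDiffeo G) (x : Plane) :
    jac (⇑(F * G)) x = jac F (G x) * jac G x :=
  jac_comp (hF.differentiable _) (hG.differentiable _)

theorem jac_inv_mul_jac (hF : IsTorusDiffeo F) (x : Plane) :
    jac (⇑F⁻¹) (F x) * jac F x = 1 := by
  rw [← hF.inv.jac_mul hF, inv_mul_cancel, jac_id]

theorem continuous_jac (hF : IsTorusDiffeo F) : Continuous (jac F) := by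
  refine continuous_matrix fun i j => ?_
  exact (continuous_apply i).comp (hF.continuous_fderiv.clm_apply continuous_const)

end AbC.IsTorusDiffeo

namespace AbC.IsAreaDiffeo

variable {F G : Equiv.Perm Plane}

theorem one : IsAreaDiffeo 1 := ⟨.one, fun x => by rw [jac_id, Matrix.det_one]⟩

theorem rot (t : ℝ) : IsAreaDiffeo (rot t) := ⟨.rot t, fun x => by rw [jac_rot, Matrix.det_one]⟩

theorem mul (hF : IsAreaDiffeo F) (hG : IsAreaDiffeo G) : IsAreaDiffeo (F * G) :=
  ⟨hF.1.mul hG.1, fun x => by rw [hF.1.jac_mul hG.1, Matrix.det_mul, hF.2, hG.2, one_mul]⟩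

theorem inv (hF : IsAreaDiffeo F) : IsAreaDiffeo F⁻¹ := by
  refine ⟨hF.1.inv, fun x => ?_⟩
  have h := congrArg Matrix.det (hF.1.jac_inv_mul_jac (F⁻¹ x))
  rw [Matrix.det_mul, hF.2, mul_one, Matrix.det_one] at h
  simpa using h

theorem pow (hF : IsAreaDiffeo F) : ∀ n : ℕ, IsAreaDiffeo (F ^ n)
  | 0 => by simpa using one
  | n + 1 => by rw [pow_succ]; exact (pow hF n).mul hF

end AbC.IsAreaDiffeo

/-! ### Lines in the plane and the projective action of matrices. -/

/-- The exterior product of two plane vectors. -/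
def wedge (u v : Plane) : ℝ := u 0 * v 1 - u 1 * v 0

/-- The Euclidean norm of a plane vector. -/
noncomputable def eucl (u : Plane) : ℝ := Real.sqrt (u 0 ^ 2 + u 1 ^ 2)

theorem eucl_sq (u : Plane) : eucl u ^ 2 = u 0 ^ 2 + u 1 ^ 2 := Real.sq_sqrt (by positivity)

theorem eucl_nonneg (u : Plane) : 0 ≤ eucl u := Real.sqrt_nonneg _

theorem eucl_pos {u : Plane} (hu : u ≠ 0) : 0 < eucl u := by
  refine Real.sqrt_pos.2 ?_
  by_contra h
  apply hu
  have h0 : u 0 = 0 := by nlinarith [sq_nonneg (u 0), sq_nonneg (u 1)]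
  have h1 : u 1 = 0 := by nlinarith [sq_nonneg (u 0), sq_nonneg (u 1)]
  ext i; fin_cases i <;> simp [h0, h1]

theorem continuous_eucl : Continuous eucl := by unfold eucl; fun_prop

theorem eucl_smul (c : ℝ) (u : Plane) : eucl (c • u) = |c| * eucl u := by
  rw [eucl, eucl, ← Real.sqrt_sq_eq_abs, ← Real.sqrt_mul (sq_nonneg c)]
  congr 1
  simp; ring

theorem abs_wedge_le (u v : Plane) : |wedge u v| ≤ eucl u * eucl v := by
  refine abs_le_of_sq_le_sq ?_ (mul_nonneg (eucl_nonneg _) (eucl_nonneg _))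
  rw [mul_pow, eucl_sq, eucl_sq, wedge]
  nlinarith [sq_nonneg (u 0 * v 0 + u 1 * v 1)]

theorem wedge_add_left (u v w : Plane) : wedge (u + v) w = wedge u w + wedge v w := by
  simp [wedge]; ring

theorem wedge_add_right (u v w : Plane) : wedge u (v + w) = wedge u v + wedge u w := by
  simp [wedge]; ring

theorem wedge_self (u : Plane) : wedge u u = 0 := by simp [wedge]; ring

theorem wedge_smul_left (c : ℝ) (u v : Plane) : wedge (c • u) v = c * wedge u v := by
  simp [wedge]; ring

theorem wedge_smul_right (c : ℝ) (u v : Plane) : wedge u (c • v) = c * wedge u v := by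
  simp [wedge]; ring

theorem wedge_mulVec (A : Matrix (Fin 2) (Fin 2) ℝ) (u v : Plane) :
    wedge (A *ᵥ u) (A *ᵥ v) = A.det * wedge u v := by
  simp [wedge, Matrix.mulVec, dotProduct, Matrix.det_fin_two]; ring

theorem eucl_dir (t : ℝ) : eucl (dir t) = 1 := by
  simp [eucl, dir]

theorem dir_ne_zero (t : ℝ) : dir t ≠ 0 := by
  intro h
  have := eucl_dir t
  rw [h] at this
  simp [eucl] at this

theorem continuous_dir : Continuous dir := by
  refine continuous_pi fun i => ?_
  fin_cases i <;> simp [dir] <;> fun_prop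

theorem wedge_dir (s t : ℝ) : wedge (dir s) (dir t) = Real.sin (Real.pi * (t - s)) := by
  rw [mul_sub, Real.sin_sub]; simp [wedge, dir]; ring

theorem dir_add_intCast (t : ℝ) (n : ℤ) : dir (t + n) = ((-1 : ℝ) ^ n) • dir t := by
  have h : Real.pi * (t + n) = Real.pi * t + n * Real.pi := by ring
  ext i
  fin_cases i
  · simp [dir, h, Real.cos_add_int_mul_pi]
  · simp [dir, h, Real.sin_add_int_mul_pi]

theorem coe_div_pi_eq {x y : ℝ} (h : (x : Real.Angle) = (y : Real.Angle)) :
    ((x / Real.pi : ℝ) : UnitAddCircle) = ((y / Real.pi : ℝ) : UnitAddCircle) := by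
  obtain ⟨n, hn⟩ := Real.Angle.angle_eq_iff_two_pi_dvd_sub.1 h
  rw [coe_eq_coe_iff]
  -- Angles are taken modulo 2π but lines have period π, so n full turns shift the line coordinate
  -- by 2n.
  refine ⟨2 * n, ?_⟩
  have := Real.pi_ne_zero
  field_simp
  push_cast
  linarith

theorem lineCoord_smul_dir {c : ℝ} (hc : c ≠ 0) (t : ℝ) :
    lineCoord (c • dir t) = (t : UnitAddCircle) := by
  have key : ∀ c : ℝ, 0 < c → ∀ t : ℝ, lineCoord (c • dir t) = (t : UnitAddCircle) := by
    intro c hc t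
    have h1 : (⟨(c • dir t) 0, (c • dir t) 1⟩ : ℂ)
        = (c : ℂ) * (Complex.cos (Real.pi * t : ℝ) + Complex.sin (Real.pi * t : ℝ) * Complex.I) := by
      apply Complex.ext <;>
        simp [dir, ← Complex.ofReal_cos, ← Complex.ofReal_sin, -Complex.ofReal_mul]
    have h2 : ((Complex.arg ⟨(c • dir t) 0, (c • dir t) 1⟩ : ℝ) : Real.Angle)
        = ((Real.pi * t : ℝ) : Real.Angle) := by
      rw [h1, Complex.arg_mul_coe_angle (by exact_mod_cast hc.ne'), Complex.arg_ofReal_of_nonneg hc.le,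
        Real.Angle.coe_zero, zero_add]
      · exact (congrArg _ (by rw [← Complex.ofReal_cos, ← Complex.ofReal_sin,
            Real.Angle.cos_coe, Real.Angle.sin_coe])).trans
          (Complex.arg_cos_add_sin_mul_I_coe_angle ((Real.pi * t : ℝ) : Real.Angle))
      · intro h
        have := congrArg Complex.normSq h
        rw [← Complex.ofReal_cos, ← Complex.ofReal_sin] at this
        rw [Complex.normSq_add_mul_I] at this
        simp at this
    rw [lineCoord, coe_div_pi_eq h2, mul_div_cancel_left₀ _ Real.pi_ne_zero]
  rcases lt_or_gt_of_ne hc with h | h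
  -- A negative factor is absorbed by dir (t + 1) = -dir t.
  · have : c • dir t = (-c) • dir (t + (1 : ℤ)) := by
      rw [dir_add_intCast]; simp
    rw [this, key _ (by linarith), coe_add_intCast]
  · exact key c h t

theorem lineCoord_dir (t : ℝ) : lineCoord (dir t) = (t : UnitAddCircle) := by
  simpa using lineCoord_smul_dir one_ne_zero t

theorem exists_eq_eucl_smul_dir (v : Plane) : ∃ s : ℝ, v = eucl v • dir s := by
  refine ⟨Complex.arg ⟨v 0, v 1⟩ / Real.pi, ?_⟩
  have h : Real.pi * (Complex.arg ⟨v 0, v 1⟩ / Real.pi) = Complex.arg ⟨v 0, v 1⟩ :=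
    mul_div_cancel₀ _ Real.pi_ne_zero
  have hn : ‖(⟨v 0, v 1⟩ : ℂ)‖ = eucl v := by
    rw [Complex.norm_def, Complex.normSq_mk, eucl]; ring_nf
  have h0 := Complex.norm_mul_cos_arg ⟨v 0, v 1⟩
  have h1 := Complex.norm_mul_sin_arg ⟨v 0, v 1⟩
  rw [hn] at h0 h1
  ext i
  fin_cases i
  · simp [dir, h, h0]
  · simp [dir, h, h1]

theorem lineCoord_smul {c : ℝ} (hc : c ≠ 0) {v : Plane} (hv : v ≠ 0) :
    lineCoord (c • v) = lineCoord v := by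
  obtain ⟨s, hs⟩ := exists_eq_eucl_smul_dir v
  have h := (eucl_pos hv).ne'
  rw [hs, smul_smul, lineCoord_smul_dir (mul_ne_zero hc h), lineCoord_smul_dir h]

theorem exists_dir_circleRep_coe (s : ℝ) : ∃ c : ℝ, |c| = 1 ∧ dir (circleRep (s : UnitAddCircle)) = c • dir s := by
  obtain ⟨n, hn⟩ := coe_eq_coe_iff.1 (coe_circleRep (s : UnitAddCircle))
  rw [hn, dir_add_intCast]
  exact ⟨_, by simp, rfl⟩

theorem mulVec_ne_zero {A : Matrix (Fin 2) (Fin 2) ℝ} (hA : A.det ≠ 0) {v : Plane} (hv : v ≠ 0) :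
    A *ᵥ v ≠ 0 := fun h => hv (Matrix.eq_zero_of_mulVec_eq_zero hA h)

/-- The action of a matrix on the circle of lines. -/
noncomputable def lineMap (A : Matrix (Fin 2) (Fin 2) ℝ) (t : UnitAddCircle) : UnitAddCircle :=
  lineCoord (A *ᵥ dir (circleRep t))

theorem lineMap_coe {A : Matrix (Fin 2) (Fin 2) ℝ} (hA : A.det ≠ 0) (s : ℝ) :
    lineMap A (s : UnitAddCircle) = lineCoord (A *ᵥ dir s) := by
  obtain ⟨c, hc, h⟩ := exists_dir_circleRep_coe s
  have hc' : c ≠ 0 := by rintro rfl; simp at hc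
  rw [lineMap, h, Matrix.mulVec_smul, lineCoord_smul hc' (mulVec_ne_zero hA (dir_ne_zero s))]

theorem lineMap_lineCoord {A : Matrix (Fin 2) (Fin 2) ℝ} (hA : A.det ≠ 0) {v : Plane} (hv : v ≠ 0) :
    lineMap A (lineCoord v) = lineCoord (A *ᵥ v) := by
  obtain ⟨s, hs⟩ := exists_eq_eucl_smul_dir v
  have h := (eucl_pos hv).ne'
  rw [hs, lineCoord_smul_dir h, lineMap_coe hA, Matrix.mulVec_smul,
    lineCoord_smul h (mulVec_ne_zero hA (dir_ne_zero s))]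

theorem lineMap_mul {A B : Matrix (Fin 2) (Fin 2) ℝ} (hA : A.det ≠ 0) (hB : B.det ≠ 0)
    (t : UnitAddCircle) : lineMap (A * B) t = lineMap A (lineMap B t) := by
  conv_rhs => rw [lineMap.eq_1 B, lineMap_lineCoord hA (mulVec_ne_zero hB (dir_ne_zero _))]
  rw [lineMap, Matrix.mulVec_mulVec]

theorem lineMap_one (t : UnitAddCircle) : lineMap 1 t = t := by
  rw [lineMap, Matrix.one_mulVec, lineCoord_dir, coe_circleRep]

/-- Both sides have period 1 and are even, so they depend only on the distance to the nearest
integer. -/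
theorem abs_sin_pi_mul (x : ℝ) : |Real.sin (Real.pi * x)| = Real.sin (Real.pi * ‖(x : UnitAddCircle)‖) := by
  have h1 : |Real.sin (Real.pi * x)| = |Real.sin (Real.pi * (x - round x))| := by
    have : Real.pi * (x - round x) = Real.pi * x - (round x : ℤ) * Real.pi := by ring
    rw [this, Real.sin_sub_int_mul_pi, abs_mul, abs_zpow]
    simp
  rw [UnitAddCircle.norm_eq, h1]
  have hr := abs_sub_round x
  have hp := Real.pi_pos
  have : Real.sin (Real.pi * |x - round x|) = |Real.sin (Real.pi * (x - round x))| := by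
    have h0 : 0 ≤ Real.sin (Real.pi * |x - round x|) := by
      apply Real.sin_nonneg_of_nonneg_of_le_pi
      · positivity
      · nlinarith [abs_nonneg (x - round x)]
    rcases abs_cases (x - round x) with ⟨h, _⟩ | ⟨h, _⟩
    · rw [h] at h0 ⊢; rw [abs_of_nonneg h0]
    · rw [h, mul_neg, Real.sin_neg] at h0 ⊢; rw [← abs_neg, abs_of_nonneg h0]
  rw [this]

theorem norm_circle_le_half (t : UnitAddCircle) : ‖t‖ ≤ 1 / 2 := by
  simpa using AddCircle.norm_le_half_period (1 : ℝ) (x := t) one_ne_zero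

/-- Jordan's inequality sin x ≥ 2x/π on [0, π/2]; it applies because norms on the circle are at most
1/2. -/
theorem two_mul_norm_le_sin (t : UnitAddCircle) : 2 * ‖t‖ ≤ Real.sin (Real.pi * ‖t‖) := by
  have h := norm_circle_le_half t
  have hp := Real.pi_pos
  have := Real.mul_le_sin (x := Real.pi * ‖t‖) (by positivity) (by nlinarith)
  calc 2 * ‖t‖ = 2 / Real.pi * (Real.pi * ‖t‖) := by field_simp
    _ ≤ _ := this

/-- The area of a parallelogram expressed by the distance of the two lines. As unimodular matrices
preserve `wedge`, this is the source of the quantitative estimates for directions. -/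
theorem abs_wedge_eq {u v : Plane} (hu : u ≠ 0) (hv : v ≠ 0) :
    |wedge u v| = eucl u * eucl v * Real.sin (Real.pi * dist (lineCoord u) (lineCoord v)) := by
  obtain ⟨s, hs⟩ := exists_eq_eucl_smul_dir u
  obtain ⟨t, ht⟩ := exists_eq_eucl_smul_dir v
  have hu' := eucl_pos hu
  have hv' := eucl_pos hv
  have h1 : lineCoord u = (s : UnitAddCircle) := by
    conv_lhs => rw [hs]
    exact lineCoord_smul_dir hu'.ne' s
  have h2 : lineCoord v = (t : UnitAddCircle) := by
    conv_lhs => rw [ht]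
    exact lineCoord_smul_dir hv'.ne' t
  have h3 : wedge u v = eucl u * (eucl v * Real.sin (Real.pi * (t - s))) := by
    conv_lhs => rw [hs, ht]
    rw [wedge_smul_left, wedge_smul_right, wedge_dir]
  rw [h1, h2, h3, dist_comm, dist_eq_norm, ← AddCircle.coe_sub, ← abs_sin_pi_mul, abs_mul, abs_mul,
    abs_of_pos hu', abs_of_pos hv']
  ring

theorem two_mul_dist_lineCoord_le {u v : Plane} (hu : u ≠ 0) (hv : v ≠ 0) :
    2 * dist (lineCoord u) (lineCoord v) * (eucl u * eucl v) ≤ |wedge u v| := by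
  rw [abs_wedge_eq hu hv, mul_comm, dist_eq_norm]
  exact mul_le_mul_of_nonneg_left (two_mul_norm_le_sin _)
    (mul_nonneg (eucl_nonneg _) (eucl_nonneg _))

/-- Since u ∧ u = 0, the area spanned by u and u + e is that of u and e, and the length of u
cancels. Only the length of the perturbed vector remains as a denominator. -/
theorem two_mul_dist_lineCoord_add_le {u e : Plane} (hu : u ≠ 0) (hv : u + e ≠ 0) :
    2 * dist (lineCoord u) (lineCoord (u + e)) * eucl (u + e) ≤ eucl e := by
  have h := two_mul_dist_lineCoord_le hu hv
  rw [wedge_add_right, wedge_self, zero_add] at h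
  have h2 := h.trans (abs_wedge_le u e)
  have hu' := eucl_pos hu
  refine le_of_mul_le_mul_left ?_ hu'
  nlinarith

/-- The jump of `Complex.arg` along the negative axis is invisible modulo π; the area estimate for
line distances avoids treating it separately. -/
theorem continuousAt_lineCoord {u : Plane} (hu : u ≠ 0) : ContinuousAt lineCoord u := by
  rw [ContinuousAt, tendsto_iff_dist_tendsto_zero]
  have hlim : Tendsto (fun v => |wedge v u| / (2 * (eucl v * eucl u))) (𝓝 u) (𝓝 0) := by
    have : ContinuousAt (fun v => |wedge v u| / (2 * (eucl v * eucl u))) u := by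
      refine ContinuousAt.div ?_ ?_ ?_
      · unfold wedge; fun_prop
      · exact ((continuous_eucl.mul continuous_const).const_mul 2 |>.continuousAt)
      · have := eucl_pos hu; positivity
    have h := this.tendsto
    rwa [wedge_self, abs_zero, zero_div] at h
  refine squeeze_zero' (Eventually.of_forall fun _ => dist_nonneg) ?_ hlim
  filter_upwards [isOpen_ne.mem_nhds hu] with v hv
  have hv' := eucl_pos hv
  have hu' := eucl_pos hu
  rw [le_div_iff₀ (by positivity)]
  have := two_mul_dist_lineCoord_le hv hu
  linarith

/-- A matrix of positive determinant maps lines between two given ones to lines between their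
images. -/
theorem exists_lineCoord_mulVec_eq {A : Matrix (Fin 2) (Fin 2) ℝ} (hA : 0 < A.det)
    {s₁ s s₂ a₁ a₂ : ℝ} (h1 : s₁ ≤ s) (h2 : s ≤ s₂) (h12 : s₁ < s₂) (hs : s₂ < s₁ + 1)
    (ha : a₁ ≤ a₂) (ha' : a₂ ≤ a₁ + 1)
    (e1 : lineCoord (A *ᵥ dir s₁) = (a₁ : UnitAddCircle))
    (e2 : lineCoord (A *ᵥ dir s₂) = (a₂ : UnitAddCircle)) :
    ∃ b ∈ Icc a₁ a₂, lineCoord (A *ᵥ dir s) = (b : UnitAddCircle) := by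
  have hp := Real.pi_pos
  have hdir : ∀ {v : Plane} {a : ℝ}, v ≠ 0 → lineCoord v = (a : UnitAddCircle) →
      ∃ x : ℝ, v = x • dir a := by
    intro v a hv h
    obtain ⟨t, ht⟩ := exists_eq_eucl_smul_dir v
    rw [ht, lineCoord_smul_dir (eucl_pos hv).ne'] at h
    obtain ⟨n, hn⟩ := coe_eq_coe_iff.1 h
    rw [hn, dir_add_intCast, smul_smul] at ht
    exact ⟨_, ht⟩
  obtain ⟨x, hx⟩ := hdir (mulVec_ne_zero hA.ne' (dir_ne_zero s₁)) e1
  obtain ⟨y, hy⟩ := hdir (mulVec_ne_zero hA.ne' (dir_ne_zero s₂)) e2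
  have hw : x * (y * Real.sin (Real.pi * (a₂ - a₁))) = A.det * Real.sin (Real.pi * (s₂ - s₁)) := by
    rw [← wedge_dir, ← wedge_dir, ← wedge_mulVec, hx, hy, wedge_smul_left, wedge_smul_right]
  have hsin : 0 < Real.sin (Real.pi * (s₂ - s₁)) :=
    Real.sin_pos_of_pos_of_lt_pi (by nlinarith) (by nlinarith)
  have hsa : 0 ≤ Real.sin (Real.pi * (a₂ - a₁)) :=
    Real.sin_nonneg_of_nonneg_of_le_pi (by nlinarith) (by nlinarith)
  -- This is where the positive determinant enters: the area identity forces both scalars to have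
  -- the same sign, because the two sines are nonnegative.
  have hxy : 0 < x * y := by
    by_contra hcon
    push Not at hcon
    have : x * (y * Real.sin (Real.pi * (a₂ - a₁))) ≤ 0 := by
      rw [← mul_assoc]; exact mul_nonpos_of_nonpos_of_nonneg hcon hsa
    rw [hw] at this
    have := mul_pos hA hsin
    linarith
  have hp1 : 0 ≤ Real.sin (Real.pi * (s₂ - s)) :=
    Real.sin_nonneg_of_nonneg_of_le_pi (by nlinarith) (by nlinarith)
  have hq1 : 0 ≤ Real.sin (Real.pi * (s - s₁)) :=
    Real.sin_nonneg_of_nonneg_of_le_pi (by nlinarith) (by nlinarith)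
  -- The addition theorem writes an intermediate direction as a nonnegative combination of the two
  -- outer ones.
  have hcomb : Real.sin (Real.pi * (s₂ - s₁)) • dir s
      = Real.sin (Real.pi * (s₂ - s)) • dir s₁ + Real.sin (Real.pi * (s - s₁)) • dir s₂ := by
    have e1 := Real.sin_sq_add_cos_sq (Real.pi * s)
    ext i
    fin_cases i
    · simp only [dir, mul_sub, Real.sin_sub, Pi.smul_apply, Pi.add_apply, smul_eq_mul,
        Matrix.cons_val_zero, Fin.zero_eta]
      ring
    · simp only [dir, mul_sub, Real.sin_sub, Pi.smul_apply, Pi.add_apply, smul_eq_mul,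
        Matrix.cons_val_one, Fin.mk_one, Matrix.cons_val_fin_one]
      ring
  have hv0 := mulVec_ne_zero hA.ne' (dir_ne_zero s)
  have himg : Real.sin (Real.pi * (s₂ - s₁)) • (A *ᵥ dir s)
      = (Real.sin (Real.pi * (s₂ - s)) * x) • dir a₁ + (Real.sin (Real.pi * (s - s₁)) * y) • dir a₂ := by
    rw [← Matrix.mulVec_smul, hcomb, Matrix.mulVec_add, Matrix.mulVec_smul, Matrix.mulVec_smul,
      hx, hy, smul_smul, smul_smul]
  set v := A *ᵥ dir s with hv
  have hfun : ContinuousOn (fun b => x * wedge v (dir b)) (Icc a₁ a₂) := by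
    have := continuous_dir
    unfold wedge
    fun_prop
  have hx2 : 0 ≤ x * x := mul_self_nonneg x
  have hl : 0 ≤ Real.sin (Real.pi * (s₂ - s₁)) * (x * wedge v (dir a₂)) := by
    have : Real.sin (Real.pi * (s₂ - s₁)) * (x * wedge v (dir a₂))
        = x * wedge (Real.sin (Real.pi * (s₂ - s₁)) • v) (dir a₂) := by
      rw [wedge_smul_left]; ring
    rw [this, himg, wedge_add_left, wedge_smul_left, wedge_smul_left, wedge_dir, wedge_self]
    have : x * (Real.sin (Real.pi * (s₂ - s)) * x * Real.sin (Real.pi * (a₂ - a₁))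
        + Real.sin (Real.pi * (s - s₁)) * y * 0)
        = (x * x) * (Real.sin (Real.pi * (s₂ - s)) * Real.sin (Real.pi * (a₂ - a₁))) := by ring
    rw [this]
    positivity
  have hr : Real.sin (Real.pi * (s₂ - s₁)) * (x * wedge v (dir a₁)) ≤ 0 := by
    have : Real.sin (Real.pi * (s₂ - s₁)) * (x * wedge v (dir a₁))
        = x * wedge (Real.sin (Real.pi * (s₂ - s₁)) • v) (dir a₁) := by
      rw [wedge_smul_left]; ring
    rw [this, himg, wedge_add_left, wedge_smul_left, wedge_smul_left, wedge_self, wedge_dir]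
    have : x * (Real.sin (Real.pi * (s₂ - s)) * x * 0
        + Real.sin (Real.pi * (s - s₁)) * y * Real.sin (Real.pi * (a₁ - a₂)))
        = - ((x * y) * (Real.sin (Real.pi * (s - s₁)) * Real.sin (Real.pi * (a₂ - a₁)))) := by
      have : Real.pi * (a₁ - a₂) = - (Real.pi * (a₂ - a₁)) := by ring
      rw [this, Real.sin_neg]; ring
    rw [this]
    have := mul_nonneg hxy.le (mul_nonneg hq1 hsa)
    linarith
  have hl' : 0 ≤ x * wedge v (dir a₂) := nonneg_of_mul_nonneg_right hl hsin
  have hr' : x * wedge v (dir a₁) ≤ 0 := nonpos_of_mul_nonpos_right hr hsin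
  -- The area spanned with the image vector changes sign between a₁ and a₂; at a zero the two lines
  -- agree.
  obtain ⟨b, hb, hb0⟩ := intermediate_value_Icc ha hfun ⟨hr', hl'⟩
  refine ⟨b, hb, ?_⟩
  have hx0 : x ≠ 0 := by rintro rfl; simp at hxy
  have hwb : wedge v (dir b) = 0 := (mul_eq_zero.1 hb0).resolve_left hx0
  have h := two_mul_dist_lineCoord_le hv0 (dir_ne_zero b)
  rw [hwb, abs_zero, eucl_dir, mul_one, lineCoord_dir] at h
  have hpos := eucl_pos hv0
  refine dist_le_zero.1 ?_
  by_contra hcon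
  push Not at hcon
  have := mul_pos hcon hpos
  linarith

/-! ### The projectivized derivative as a continuous group action. -/

namespace AbC.IsTorusDiffeo

variable {F G : Equiv.Perm Plane}

theorem det_jac_ne_zero (hF : IsTorusDiffeo F) (x : Plane) : (jac F x).det ≠ 0 := by
  intro h
  have := congrArg Matrix.det (hF.jac_inv_mul_jac x)
  rw [Matrix.det_mul, h, mul_zero, Matrix.det_one] at this
  exact zero_ne_one this

theorem projExt_coe (hF : IsTorusDiffeo F) (x : Plane) (s : ℝ) :
    projExt F (toTorus x, (s : UnitAddCircle)) = (toTorus (F x), lineCoord (jac F x *ᵥ dir s)) := by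
  refine Prod.ext (hF.torusMap_toTorus x) ?_
  change lineMap (jac F (torusRep (toTorus x))) _ = _
  rw [hF.jac_torusRep, lineMap_coe (hF.det_jac_ne_zero x)]

theorem projExt_mul (hF : IsTorusDiffeo F) (hG : IsTorusDiffeo G) (X : ProjBundle) :
    projExt (⇑(F * G)) X = projExt F (projExt G X) := by
  refine Prod.ext (hF.torusMap_mul G X.1) ?_
  change lineMap _ _ = lineMap (jac F (torusRep (torusMap G X.1))) (lineMap _ _)
  rw [hF.jac_torusRep_torusMap, hF.jac_mul hG,
    lineMap_mul (hF.det_jac_ne_zero _) (hG.det_jac_ne_zero _)]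

theorem _root_.projExt_one (X : ProjBundle) : projExt (⇑(1 : Equiv.Perm Plane)) X = X := by
  refine Prod.ext (toTorus_torusRep _) ?_
  change lineMap _ _ = _
  rw [jac_id, lineMap_one]

theorem projExt_inv_projExt (hF : IsTorusDiffeo F) (X : ProjBundle) :
    projExt (⇑F⁻¹) (projExt F X) = X := by
  rw [← hF.inv.projExt_mul hF, inv_mul_cancel, projExt_one]

theorem projExt_projExt_inv (hF : IsTorusDiffeo F) (X : ProjBundle) :
    projExt F (projExt (⇑F⁻¹) X) = X := by
  rw [← hF.projExt_mul hF.inv, mul_inv_cancel, projExt_one]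

theorem continuous_projExt (hF : IsTorusDiffeo F) : Continuous (projExt F) := by
  rw [← (isOpenQuotientMap_toTorus.prodMap isOpenQuotientMap_coe).continuous_comp_iff]
  have : projExt F ∘ Prod.map toTorus (fun x : ℝ => (x : UnitAddCircle))
      = fun p => (toTorus (F p.1), lineCoord (jac F p.1 *ᵥ dir p.2)) :=
    funext fun p => hF.projExt_coe p.1 p.2
  rw [this]
  refine (continuous_toTorus.comp (hF.continuous.comp continuous_fst)).prodMk ?_
  rw [continuous_iff_continuousAt]
  intro p
  refine ContinuousAt.comp (f := fun p : Plane × ℝ => jac F p.1 *ᵥ dir p.2)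
    (continuousAt_lineCoord (mulVec_ne_zero (hF.det_jac_ne_zero _) (dir_ne_zero _))) ?_
  exact ((hF.continuous_jac.comp continuous_fst).matrix_mulVec
    (continuous_dir.comp continuous_snd)).continuousAt

theorem measurable_projExt (hF : IsTorusDiffeo F) : Measurable (projExt F) :=
  hF.continuous_projExt.measurable

end AbC.IsTorusDiffeo

/-! ### Change of variables -/

instance isProbabilityMeasure_circle : IsProbabilityMeasure (volume : Measure UnitAddCircle) :=
  ⟨UnitAddCircle.measure_univ⟩

instance isProbabilityMeasure_torus : IsProbabilityMeasure (volume : Measure Torus) :=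
  inferInstanceAs (IsProbabilityMeasure (Measure.pi fun _ : Fin 2 => (volume : Measure UnitAddCircle)))

instance isProbabilityMeasure_projBundle : IsProbabilityMeasure (volume : Measure ProjBundle) :=
  inferInstanceAs (IsProbabilityMeasure
    ((volume : Measure Torus).prod (volume : Measure UnitAddCircle)))

/-- The half-open unit square. -/
def unitBox : Set Plane := {x | ∀ i, x i ∈ Ioc (0 : ℝ) (0 + 1)}

theorem measurableSet_unitBox : MeasurableSet unitBox :=
  MeasurableSet.univ_pi' fun _ => measurableSet_Ioc

/-- The integer lattice in the plane. -/
def intLattice : AddSubgroup Plane :=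
  (AddMonoidHom.compLeft (Int.castAddHom ℝ) (Fin 2)).range

theorem mem_intLattice {x : Plane} : x ∈ intLattice ↔ ∃ v : Fin 2 → ℤ, (fun i => (v i : ℝ)) = x :=
  Iff.rfl

instance : Countable intLattice :=
  (Set.countable_range (AddMonoidHom.compLeft (Int.castAddHom ℝ) (Fin 2))).to_subtype

theorem isAddFundamentalDomain_unitBox : IsAddFundamentalDomain intLattice unitBox volume := by
  refine IsAddFundamentalDomain.mk' measurableSet_unitBox.nullMeasurableSet fun x => ?_
  have h : ∀ i, ∃! m : ℤ, x i + m • (1 : ℝ) ∈ Ioc (0 : ℝ) (0 + 1) := fun i =>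
    existsUnique_add_zsmul_mem_Ioc one_pos (x i) 0
  choose v hv huniq using h
  refine ⟨⟨fun i => (v i : ℝ), mem_intLattice.2 ⟨v, rfl⟩⟩, ?_, ?_⟩
  · intro i
    have := hv i
    simp only [zsmul_eq_mul, mul_one] at this
    change (v i : ℝ) + x i ∈ Ioc (0 : ℝ) (0 + 1)
    rwa [add_comm (v i : ℝ)]
  · rintro ⟨y, hy⟩ h
    obtain ⟨w, rfl⟩ := mem_intLattice.1 hy
    refine Subtype.ext (funext fun i => ?_)
    have := huniq i (w i) (by
      have := h i
      change (w i : ℝ) + x i ∈ Ioc (0 : ℝ) (0 + 1) at this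
      simp only [zsmul_eq_mul, mul_one]
      rwa [add_comm (w i : ℝ)] at this)
    simp [this]

theorem measurePreserving_toTorus :
    MeasurePreserving toTorus (volume.restrict unitBox) volume := by
  have h := measurePreserving_pi (fun _ : Fin 2 => volume.restrict (Ioc (0 : ℝ) (0 + 1)))
    (fun _ => (volume : Measure UnitAddCircle)) (fun _ => AddCircle.measurePreserving_mk 1 0)
  have hb : volume.restrict unitBox
      = Measure.pi fun _ : Fin 2 => volume.restrict (Ioc (0 : ℝ) (0 + 1)) := by
    rw [← Measure.restrict_pi_pi]
    congr 1
    ext x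
    simp [unitBox]
  rw [hb]
  exact h

theorem lintegral_torus {u : Torus → ENNReal} (hu : Measurable u) :
    ∫⁻ z, u z = ∫⁻ x in unitBox, u (toTorus x) :=
  (measurePreserving_toTorus.lintegral_comp hu).symm

namespace AbC.IsAreaDiffeo

variable {F : Equiv.Perm Plane}

theorem abs_det_fderiv (hF : IsAreaDiffeo F) (x : Plane) : |(fderiv ℝ F x).det| = 1 := by
  rw [← det_jac, hF.2, abs_one]

theorem measurePreserving (hF : IsAreaDiffeo F) : MeasurePreserving F volume volume := by
  refine ⟨hF.1.continuous.measurable, Measure.ext fun S hS => ?_⟩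
  rw [Measure.map_apply hF.1.continuous.measurable hS]
  have h := lintegral_abs_det_fderiv_eq_addHaar_image volume
    (hF.1.continuous.measurable hS) (f := F) (f' := fderiv ℝ F)
    (fun x _ => (hF.1.differentiable x).hasFDerivAt.hasFDerivWithinAt) F.injective.injOn
  rw [image_preimage_eq _ F.surjective] at h
  rw [← h]
  simp [hF.abs_det_fderiv]

theorem isAddFundamentalDomain_image (hF : IsAreaDiffeo F) :
    IsAddFundamentalDomain intLattice (F '' unitBox) volume := by
  refine isAddFundamentalDomain_unitBox.image_of_equiv F ?_ (Equiv.refl _) ?_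
  · exact hF.inv.measurePreserving.quasiMeasurePreserving
  · rintro ⟨y, hy⟩ x
    obtain ⟨v, rfl⟩ := mem_intLattice.1 hy
    change F ((fun i => (v i : ℝ)) + x) = (fun i => (v i : ℝ)) + F x
    rw [add_comm, hF.1.map_add, add_comm]

/-- Change of variables turns an integral over the unit box into one over its image. This image is
again a fundamental domain of the lattice, because lifts commute with integer translations, so
periodic functions have the same integral over both. -/
theorem measurePreserving_torusMap (hF : IsAreaDiffeo F) :
    MeasurePreserving (torusMap F) volume volume := by
  have hm := hF.1.continuous_torusMap.measurable
  refine ⟨hm, Measure.ext fun S hS => ?_⟩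
  rw [Measure.map_apply hm hS, ← lintegral_indicator_one hS, ← lintegral_indicator_one (hm hS),
    lintegral_torus (measurable_one.indicator (hm hS)), lintegral_torus (measurable_one.indicator hS)]
  have h1 : ∀ x, (torusMap F ⁻¹' S).indicator (1 : Torus → ENNReal) (toTorus x)
      = S.indicator 1 (toTorus (F x)) := by
    intro x
    rw [← hF.1.torusMap_toTorus]
    rfl
  simp_rw [h1]
  have h2 := lintegral_image_eq_lintegral_abs_det_fderiv_mul volume measurableSet_unitBox
    (f := F) (f' := fderiv ℝ F)
    (fun x _ => (hF.1.differentiable x).hasFDerivAt.hasFDerivWithinAt) F.injective.injOn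
    (fun y => S.indicator 1 (toTorus y))
  simp only [hF.abs_det_fderiv, ENNReal.ofReal_one, one_mul] at h2
  rw [← h2]
  refine hF.isAddFundamentalDomain_image.setLIntegral_eq isAddFundamentalDomain_unitBox _ ?_
  rintro ⟨y, hy⟩ x
  obtain ⟨v, rfl⟩ := mem_intLattice.1 hy
  have : toTorus ((⟨fun i => (v i : ℝ), hy⟩ : intLattice) +ᵥ x) = toTorus x :=
    toTorus_eq_iff.2 ⟨v, add_comm _ _⟩
  simp only [this]

end AbC.IsAreaDiffeo

theorem lintegral_Ioc_mul_self {R : ℝ} (hR : 0 < R) :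
    ∫⁻ r in Ioo 0 R, ENNReal.ofReal r = ENNReal.ofReal (R ^ 2 / 2) := by
  rw [restrict_Ioo_eq_restrict_Ioc, ← ofReal_integral_eq_lintegral_ofReal]
  · rw [← intervalIntegral.integral_of_le hR.le, integral_id]
    simp
  · exact (continuous_id.integrableOn_Icc).mono_set Ioc_subset_Icc_self
  · filter_upwards [ae_restrict_mem measurableSet_Ioc] with x hx using hx.1.le

theorem measurable_lineCoord : Measurable lineCoord := by
  unfold lineCoord
  refine AddCircle.measurable_mk'.comp (Measurable.div_const ?_ _)
  refine Complex.measurable_arg.comp ?_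
  have : (fun v : Plane => (⟨v 0, v 1⟩ : ℂ)) = fun v => Complex.measurableEquivRealProd.symm (v 0, v 1) := rfl
  rw [this]
  fun_prop

theorem eucl_mulVec_dir_circleRep (B : Matrix (Fin 2) (Fin 2) ℝ) (s : ℝ) :
    eucl (B *ᵥ dir (circleRep (s : UnitAddCircle))) = eucl (B *ᵥ dir s) := by
  obtain ⟨c, hc, h⟩ := exists_dir_circleRep_coe s
  rw [h, Matrix.mulVec_smul, eucl_smul, hc, one_mul]

theorem measurable_dir_circleRep : Measurable fun t : UnitAddCircle => dir (circleRep t) :=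
  continuous_dir.measurable.comp measurable_circleRep

theorem continuous_mulVec_const (B : Matrix (Fin 2) (Fin 2) ℝ) : Continuous fun v : Plane => B *ᵥ v :=
  (Matrix.mulVecLin B).continuous_of_finiteDimensional

/-- Integration in polar coordinates of a function of the direction over an ellipse. -/
theorem lintegral_lineCoord_ellipse {B : Matrix (Fin 2) (Fin 2) ℝ} (hB : B.det ≠ 0)
    {u : UnitAddCircle → ENNReal} (hu : Measurable u) :
    ∫⁻ v : Plane, u (lineCoord v) * {v | eucl (B *ᵥ v) < 1}.indicator 1 v
      = ENNReal.ofReal Real.pi *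
        ∫⁻ t, u t * ENNReal.ofReal (1 / eucl (B *ᵥ dir (circleRep t)) ^ 2) := by
  have hpi := Real.pi_pos
  set φ : Plane → ENNReal := fun v => u (lineCoord v) * {v | eucl (B *ᵥ v) < 1}.indicator 1 v with hφ
  have hcB : Continuous fun v : Plane => eucl (B *ᵥ v) := continuous_eucl.comp (continuous_mulVec_const B)
  have hφm : Measurable φ := (hu.comp measurable_lineCoord).mul
    (measurable_one.indicator (measurableSet_lt hcB.measurable measurable_const))
  set ρ : UnitAddCircle → ENNReal :=
    fun t => u t * ENNReal.ofReal (1 / eucl (B *ᵥ dir (circleRep t)) ^ 2) with hρ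
  have hρm : Measurable ρ := hu.mul (ENNReal.measurable_ofReal.comp
    (measurable_const.div ((hcB.measurable.comp measurable_dir_circleRep).pow_const 2)))
  have h1 : ∫⁻ v, φ v = ∫⁻ p : ℝ × ℝ, φ ![p.1, p.2] :=
    ((volume_preserving_finTwoArrow ℝ).symm.lintegral_comp hφm).symm
  -- The ray of angle θ leaves the ellipse at r = 1/c, and the integral of r over (0, 1/c) is
  -- 1/(2c²).
  have hinner : ∀ θ : ℝ, ∫⁻ r in Ioi (0 : ℝ), ENNReal.ofReal r * φ ![r * Real.cos θ, r * Real.sin θ]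
      = ENNReal.ofReal (1 / 2) * ρ ((θ / Real.pi : ℝ) : UnitAddCircle) := by
    intro θ
    set c := eucl (B *ᵥ dir (θ / Real.pi)) with hc
    have hc0 : 0 < c := eucl_pos (mulVec_ne_zero hB (dir_ne_zero _))
    have hval : ∀ r ∈ Ioi (0 : ℝ), ENNReal.ofReal r * φ ![r * Real.cos θ, r * Real.sin θ]
        = u ((θ / Real.pi : ℝ) : UnitAddCircle) * (Ioo 0 (1 / c)).indicator ENNReal.ofReal r := by
      intro r hr
      have hr : 0 < r := hr
      have hv : (![r * Real.cos θ, r * Real.sin θ] : Plane) = r • dir (θ / Real.pi) := by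
        ext i; fin_cases i <;> simp [dir, mul_div_cancel₀ _ hpi.ne']
      have hmem : eucl (B *ᵥ (r • dir (θ / Real.pi))) < 1 ↔ r ∈ Ioo 0 (1 / c) := by
        rw [Matrix.mulVec_smul, eucl_smul, abs_of_pos hr, mem_Ioo, lt_div_iff₀ hc0]
        exact ⟨fun h => ⟨hr, h⟩, fun h => h.2⟩
      rw [hφ, hv]
      simp only [lineCoord_smul_dir hr.ne']
      by_cases h : r ∈ Ioo 0 (1 / c)
      · rw [indicator_of_mem (by exact hmem.2 h), indicator_of_mem h]
        simp [mul_comm]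
      · rw [indicator_of_notMem (by exact fun h' => h (hmem.1 h')), indicator_of_notMem h]
        simp
    rw [setLIntegral_congr_fun measurableSet_Ioi hval, lintegral_const_mul _ (by
      exact ENNReal.measurable_ofReal.indicator measurableSet_Ioo)]
    rw [setLIntegral_indicator measurableSet_Ioo, Ioo_inter_Ioi, max_self,
      lintegral_Ioc_mul_self (by positivity), hρ]
    simp only [eucl_mulVec_dir_circleRep, ← hc]
    rw [mul_left_comm, ← ENNReal.ofReal_mul (by norm_num)]
    congr 2
    ring
  have h2 : ∫⁻ p : ℝ × ℝ, φ ![p.1, p.2]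
      = ∫⁻ θ in Ioo (-Real.pi) Real.pi, ENNReal.ofReal (1 / 2) * ρ ((θ / Real.pi : ℝ) : UnitAddCircle) := by
    rw [← lintegral_comp_polarCoord_symm, polarCoord_target, Measure.volume_eq_prod,
      ← Measure.prod_restrict, lintegral_prod_symm]
    · refine lintegral_congr fun θ => ?_
      rw [← hinner]
      rfl
    · refine Measurable.aemeasurable ?_
      refine (ENNReal.measurable_ofReal.comp measurable_fst).mul (hφm.comp ?_)
      have := continuous_polarCoord_symm.measurable
      refine measurable_pi_lambda _ fun i => ?_
      fin_cases i
      · exact this.fst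
      · exact this.snd
  have h3 : ∫⁻ θ in Ioo (-Real.pi) Real.pi, ENNReal.ofReal (1 / 2) * ρ ((θ / Real.pi : ℝ) : UnitAddCircle)
      = ENNReal.ofReal Real.pi *
        (ENNReal.ofReal (1 / 2) * ∫⁻ s in Ioc (-1 : ℝ) 1, ρ (s : UnitAddCircle)) := by
    have him : (fun s : ℝ => Real.pi * s) '' Ioo (-1) 1 = Ioo (-Real.pi) Real.pi := by
      rw [image_mul_left_Ioo hpi]; simp
    have := lintegral_image_eq_lintegral_abs_deriv_mul (s := Ioo (-1 : ℝ) 1) measurableSet_Ioo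
      (f := fun s : ℝ => Real.pi * s) (f' := fun _ => Real.pi)
      (fun x _ => by simpa using ((hasDerivAt_id x).const_mul Real.pi).hasDerivWithinAt)
      (fun x _ y _ h => mul_left_cancel₀ hpi.ne' h)
      (fun θ => ENNReal.ofReal (1 / 2) * ρ ((θ / Real.pi : ℝ) : UnitAddCircle))
    rw [him] at this
    rw [this, restrict_Ioo_eq_restrict_Ioc]
    simp only [mul_div_cancel_left₀ _ hpi.ne', abs_of_pos hpi]
    have hm : Measurable fun s : ℝ => ρ (s : UnitAddCircle) := hρm.comp AddCircle.measurable_mk'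
    rw [lintegral_const_mul _ (hm.const_mul _), lintegral_const_mul _ hm]
  -- A full turn of the angle runs twice through the circle of lines, which compensates the factor
  -- 1/2.
  have h4 : ∫⁻ s in Ioc (-1 : ℝ) 1, ρ (s : UnitAddCircle) = 2 * ∫⁻ t, ρ t := by
    have hun : Ioc (-1 : ℝ) 1 = Ioc (-1 : ℝ) (-1 + 1) ∪ Ioc (0 : ℝ) (0 + 1) := by
      norm_num
    rw [hun, lintegral_union measurableSet_Ioc, UnitAddCircle.lintegral_preimage,
      UnitAddCircle.lintegral_preimage, two_mul]
    norm_num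
  rw [h1, h2, h3, h4, ← mul_assoc (ENNReal.ofReal (1 / 2))]
  have : ENNReal.ofReal (1 / 2) * 2 = 1 := by
    have : (2 : ENNReal) = ENNReal.ofReal 2 := by simp
    rw [this, ← ENNReal.ofReal_mul (by norm_num)]
    norm_num
  rw [this, one_mul]

theorem measurable_lineMap (A : Matrix (Fin 2) (Fin 2) ℝ) : Measurable (lineMap A) :=
  measurable_lineCoord.comp ((continuous_mulVec_const A).measurable.comp measurable_dir_circleRep)

/-- The linear map A preserves area and carries the unit disc to the ellipse |Bv| < 1. Comparing the
polar integrals over both yields the fibre density without differentiating the action on lines. -/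
theorem lintegral_lineMap {A B : Matrix (Fin 2) (Fin 2) ℝ} (hA : A.det = 1) (hBA : B * A = 1)
    {u : UnitAddCircle → ENNReal} (hu : Measurable u) :
    ∫⁻ t, u (lineMap A t)
      = ∫⁻ t, u t * ENNReal.ofReal (1 / eucl (B *ᵥ dir (circleRep t)) ^ 2) := by
  have hA0 : A.det ≠ 0 := by rw [hA]; exact one_ne_zero
  have hB0 : B.det ≠ 0 := by
    have := congrArg Matrix.det hBA
    rw [Matrix.det_mul, hA, mul_one, Matrix.det_one] at this
    rw [this]; exact one_ne_zero
  have h1 := lintegral_lineCoord_ellipse (B := 1) (by simp) (hu.comp (measurable_lineMap A))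
  have h2 := lintegral_lineCoord_ellipse hB0 hu
  have hcB : Continuous fun v : Plane => eucl (B *ᵥ v) := continuous_eucl.comp (continuous_mulVec_const B)
  have hmp : MeasurePreserving (fun v : Plane => A *ᵥ v) volume volume := by
    refine ⟨(continuous_mulVec_const A).measurable, ?_⟩
    have := Measure.map_linearMap_addHaar_eq_smul_addHaar (volume : Measure Plane)
      (f := Matrix.toLin' A) (by rw [LinearMap.det_toLin']; exact hA0)
    rw [LinearMap.det_toLin', hA] at this
    rw [inv_one, abs_one, ENNReal.ofReal_one, one_smul] at this
    exact this
  have h3 : ∫⁻ v : Plane, (u ∘ lineMap A) (lineCoord v)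
        * {v : Plane | eucl ((1 : Matrix (Fin 2) (Fin 2) ℝ) *ᵥ v) < 1}.indicator 1 v
      = ∫⁻ v : Plane, u (lineCoord v) * {v | eucl (B *ᵥ v) < 1}.indicator 1 v := by
    refine Eq.trans (lintegral_congr_ae ?_) (hmp.lintegral_comp ((hu.comp measurable_lineCoord).mul
      (measurable_one.indicator (measurableSet_lt hcB.measurable measurable_const))))
    have : ∀ᵐ v : Plane, v ≠ 0 := by simp [ae_iff]
    filter_upwards [this] with v hv
    simp only [Function.comp_apply, lineMap_lineCoord hA0 hv]
    congr 1
    simp only [indicator, mem_ofPred_eq, Matrix.mulVec_mulVec, hBA, Matrix.one_mulVec]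
    rfl
  have hpi : ENNReal.ofReal Real.pi ≠ 0 := by simpa using Real.pi_pos
  rw [h1, h2] at h3
  have := (ENNReal.mul_right_inj hpi ENNReal.ofReal_ne_top).1 h3
  rw [← this]
  refine lintegral_congr fun t => ?_
  rw [Matrix.one_mulVec, eucl_dir]
  simp

/-! ### Densities of the measures induced by metrics. -/

/-- The density of `metricMeasure ω`. -/
noncomputable def metricDensity (ω : Torus → Matrix (Fin 2) (Fin 2) ℝ) (X : ProjBundle) : ℝ :=
  Real.sqrt (ω X.1).det *
    (Real.sqrt (ω X.1).det / (dir (circleRep X.2) ⬝ᵥ (ω X.1 *ᵥ dir (circleRep X.2))))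

theorem measurable_metricDensity {ω : Torus → Matrix (Fin 2) (Fin 2) ℝ}
    (hω : ∀ i j, Measurable fun z => ω z i j) : Measurable (metricDensity ω) := by
  have h : ∀ i j, Measurable fun X : ProjBundle => ω X.1 i j := fun i j => (hω i j).comp measurable_fst
  have hd : ∀ i, Measurable fun X : ProjBundle => dir (circleRep X.2) i := fun i =>
    (measurable_pi_apply i).comp (measurable_dir_circleRep.comp measurable_snd)
  unfold metricDensity
  simp only [Matrix.det_fin_two, dotProduct, Matrix.mulVec, Fin.sum_univ_two]
  have := h 0 0; have := h 0 1; have := h 1 0; have := h 1 1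
  have := hd 0; have := hd 1
  fun_prop

theorem dotProduct_transpose_mul_self (J : Matrix (Fin 2) (Fin 2) ℝ) (v : Plane) :
    v ⬝ᵥ ((Jᵀ * J) *ᵥ v) = eucl (J *ᵥ v) ^ 2 := by
  rw [eucl_sq]
  simp [dotProduct, Matrix.mulVec, Matrix.mul_apply, Fin.sum_univ_two]
  ring

theorem metricDensity_of_eq {ω : Torus → Matrix (Fin 2) (Fin 2) ℝ} {X : ProjBundle}
    {J : Matrix (Fin 2) (Fin 2) ℝ} (hJ : J.det = 1) (h : ω X.1 = Jᵀ * J) :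
    metricDensity ω X = 1 / eucl (J *ᵥ dir (circleRep X.2)) ^ 2 := by
  rw [metricDensity, h, dotProduct_transpose_mul_self, Matrix.det_mul, Matrix.det_transpose, hJ]
  simp

namespace AbC.IsAreaDiffeo

variable {F : Equiv.Perm Plane}

theorem metricDensity_transportedMetric (hF : IsAreaDiffeo F) (X : ProjBundle) :
    metricDensity (transportedMetric F) X
      = 1 / eucl (jac (⇑F⁻¹) (torusRep X.1) *ᵥ dir (circleRep X.2)) ^ 2 :=
  metricDensity_of_eq (hF.inv.2 _) rfl

theorem measurable_transportedMetric (hF : IsAreaDiffeo F) (i j : Fin 2) :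
    Measurable fun z => transportedMetric F z i j := by
  have h : ∀ i j, Measurable fun z => jac (⇑F⁻¹) (torusRep z) i j := fun i j =>
    (((hF.1.inv.continuous_jac).matrix_elem i j).measurable).comp measurable_torusRep
  simp only [transportedMetric, Matrix.mul_apply, Matrix.transpose_apply, Fin.sum_univ_two]
  exact ((h _ _).mul (h _ _)).add ((h _ _).mul (h _ _))

/-- By Fubini: the base map preserves Lebesgue measure, and `lintegral_lineMap` on each fibre
produces the factor 1/|d(F⁻¹)u|², which is the density of the transported metric. -/
theorem map_projExt (hF : IsAreaDiffeo F) :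
    (volume : Measure ProjBundle).map (projExt F) = metricMeasure (transportedMetric F) := by
  have hm := hF.1.measurable_projExt
  have hρ : Measurable fun X => ENNReal.ofReal (metricDensity (transportedMetric F) X) :=
    (measurable_metricDensity hF.measurable_transportedMetric).ennreal_ofReal
  refine Measure.ext_of_lintegral _ fun u hu => ?_
  rw [lintegral_map hu hm]
  change _ = ∫⁻ X, u X ∂(volume.withDensity fun X => ENNReal.ofReal
    (metricDensity (transportedMetric F) X))
  rw [lintegral_withDensity_eq_lintegral_mul _ hρ hu, Measure.volume_eq_prod,
    lintegral_prod (fun X => u (projExt F X)) (hu.comp hm).aemeasurable,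
    lintegral_prod _ (hρ.mul hu).aemeasurable]
  rw [← hF.measurePreserving_torusMap.lintegral_comp (hρ.mul hu).lintegral_prod_right']
  refine lintegral_congr fun z => ?_
  have hz : jac (⇑F⁻¹) (torusRep (torusMap F z)) * jac F (torusRep z) = 1 := by
    rw [hF.1.inv.jac_torusRep_torusMap]
    exact hF.1.jac_inv_mul_jac _
  have := lintegral_lineMap (hF.2 (torusRep z)) hz
    (hu.comp (measurable_prodMk_left (x := torusMap F z)))
  refine Eq.trans this (lintegral_congr fun t => ?_)
  simp only [Pi.mul_apply, hF.metricDensity_transportedMetric, Function.comp_apply, mul_comm]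

end AbC.IsAreaDiffeo

/-! ### Consequences of closeness in the distances of diffeomorphisms -/

theorem supNorm_nonneg (u : Plane → ℝ) : 0 ≤ supNorm u := by
  refine Real.sSup_nonneg ?_
  rintro _ ⟨x, _, rfl⟩
  exact abs_nonneg _

/-- `supNorm` only sees the open unit square. Points without integer coordinates are dense and have
a translate in that square, so continuity extends the bound everywhere. Continuity also makes the
supremum a genuine one, by compactness of the closed square. -/
theorem abs_le_supNorm {v : Plane → ℝ} (hc : Continuous v)
    (hper : ∀ (x : Plane) (w : Fin 2 → ℤ), v (x + fun i => (w i : ℝ)) = v x) (x : Plane) :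
    |v x| ≤ supNorm v := by
  have hbdd : BddAbove ((fun x => |v x|) '' {x : Plane | ∀ i, x i ∈ Ioo (0 : ℝ) 1}) := by
    have hcomp : IsCompact (Icc (0 : Plane) 1) := isCompact_Icc
    refine (hcomp.bddAbove_image hc.abs.continuousOn).mono (image_mono ?_)
    intro x hx
    exact ⟨fun i => (hx i).1.le, fun i => (hx i).2.le⟩
  have hd : Dense {x : Plane | ∀ i, x i ∉ range ((↑) : ℤ → ℝ)} := by
    have h1 : Dense (range ((↑) : ℤ → ℝ))ᶜ := (countable_range _).dense_compl ℝ
    have := dense_pi (univ : Set (Fin 2)) (s := fun _ => (range ((↑) : ℤ → ℝ))ᶜ) fun i _ => h1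
    convert! this using 1
    ext x; simp
  have hcl : IsClosed {x : Plane | |v x| ≤ supNorm v} := isClosed_le hc.abs continuous_const
  have hsub : {x : Plane | ∀ i, x i ∉ range ((↑) : ℤ → ℝ)} ⊆ {x : Plane | |v x| ≤ supNorm v} := by
    intro x hx
    have h := hper (x + fun i => ((-⌊x i⌋ : ℤ) : ℝ)) fun i => ⌊x i⌋
    have hx' : (x + fun i => ((-⌊x i⌋ : ℤ) : ℝ)) + (fun i => (⌊x i⌋ : ℝ)) = x := by
      ext i; simp
    rw [hx'] at h
    change |v x| ≤ _
    rw [h]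
    refine le_csSup hbdd ⟨_, fun i => ?_, rfl⟩
    have h1 := Int.floor_le (x i)
    have h2 := Int.lt_floor_add_one (x i)
    have h3 : (⌊x i⌋ : ℝ) ≠ x i := fun h => hx i ⟨_, h⟩
    simp only [Pi.add_apply, Int.cast_neg, mem_Ioo]
    constructor
    · have := lt_of_le_of_ne h1 h3
      linarith
    · linarith
  exact (hcl.closure_subset_iff.2 hsub) (hd x)

theorem finite_orders (s : ℕ) (c : Fin 2 → ℕ × ℕ → ℝ) :
    {y | ∃ (i : Fin 2) (a : ℕ × ℕ), a.1 + a.2 ≤ s ∧ y = c i a}.Finite := by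
  refine ((Set.finite_univ (α := Fin 2)).prod ((Set.finite_Iic s).prod (Set.finite_Iic s))
    |>.image fun p => c p.1 p.2).subset ?_
  rintro y ⟨i, a, ha, rfl⟩
  exact ⟨(i, a), ⟨mem_univ _, by simp; omega, by simp; omega⟩, rfl⟩

/-- The set is finite, so each of its members is really below the supremum that defines the
distance. -/
theorem bddAbove_preDist (s : ℕ) (F G : Plane → Plane) :
    BddAbove ({y | ∃ i : Fin 2, y = ⨅ v : ℤ, supNorm fun x => F x i - G x i + (v : ℝ)} ∪
    {y | ∃ (i : Fin 2) (a : ℕ × ℕ), 1 ≤ a.1 + a.2 ∧ a.1 + a.2 ≤ s ∧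
      y = supNorm (multiDeriv a fun x => F x i - G x i)}) := by
  refine (Set.Finite.union ?_ ?_).bddAbove
  · exact (Set.finite_range fun i : Fin 2 => ⨅ v : ℤ, supNorm fun x => F x i - G x i + (v : ℝ)).subset
      fun y ⟨i, hi⟩ => ⟨i, hi.symm⟩
  · exact (finite_orders s fun i a => supNorm (multiDeriv a fun x => F x i - G x i)).subset
      fun y ⟨i, a, _, h, h'⟩ => ⟨i, a, h, h'⟩

theorem fullNorm_nonneg (s : ℕ) (F : Equiv.Perm Plane) : 0 ≤ fullNorm s F := by
  refine Real.sSup_nonneg ?_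
  rintro y ⟨i, a, _, rfl | rfl⟩ <;> exact supNorm_nonneg _

theorem norm_toTorus_le (x : Plane) : ‖toTorus x‖ ≤ ‖x‖ := by
  refine (pi_norm_le_iff_of_nonneg (norm_nonneg _)).2 fun i => ?_
  refine le_trans ?_ (norm_le_pi_norm x i)
  change ‖((x i : ℝ) : UnitAddCircle)‖ ≤ |x i|
  rw [UnitAddCircle.norm_eq]
  simpa using round_le (x i) 0

theorem exists_coe_eq_abs (t : UnitAddCircle) : ∃ a : ℝ, (a : UnitAddCircle) = t ∧ |a| = ‖t‖ := by
  obtain ⟨x, rfl⟩ := QuotientAddGroup.mk_surjective t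
  refine ⟨x - round x, ?_, ?_⟩
  · have := coe_add_intCast (x - round x) (round x)
    rw [sub_add_cancel] at this
    exact this.symm
  · exact UnitAddCircle.norm_eq.symm

theorem exists_toTorus_eq_norm (z : Torus) : ∃ x : Plane, toTorus x = z ∧ ‖x‖ = ‖z‖ := by
  choose a ha ha' using fun i => exists_coe_eq_abs (z i)
  refine ⟨a, funext ha, ?_⟩
  simp only [Pi.norm_def]
  congr 2
  ext i
  simp [ha']

/-- Lifts that realize the distance let Lipschitz estimates descend from the plane to the torus. -/
theorem exists_lifts (z w : Torus) :
    ∃ x y : Plane, toTorus x = z ∧ toTorus y = w ∧ ‖x - y‖ = dist z w := by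
  obtain ⟨d, hd, hd'⟩ := exists_toTorus_eq_norm (z - w)
  obtain ⟨y, rfl⟩ := toTorus_surjective w
  refine ⟨d + y, y, ?_, rfl, ?_⟩
  · rw [toTorus_add, hd, sub_add_cancel]
  · rw [add_sub_cancel_right, hd', dist_eq_norm]

theorem norm_mulVec_le {A : Matrix (Fin 2) (Fin 2) ℝ} {M : ℝ} (hA : ∀ i j, |A i j| ≤ M) (v : Plane) :
    ‖A *ᵥ v‖ ≤ 2 * M * ‖v‖ := by
  have hM : 0 ≤ M := (abs_nonneg _).trans (hA 0 0)
  refine (pi_norm_le_iff_of_nonneg (by positivity)).2 fun i => ?_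
  simp only [Matrix.mulVec, dotProduct, Fin.sum_univ_two]
  refine (norm_add_le _ _).trans ?_
  rw [norm_mul, norm_mul]
  have h0 := mul_le_mul (hA i 0) (norm_le_pi_norm v 0) (norm_nonneg _) hM
  have h1 := mul_le_mul (hA i 1) (norm_le_pi_norm v 1) (norm_nonneg _) hM
  simp only [Real.norm_eq_abs] at *
  linarith

theorem norm_sub_le_of_jac_le {E : Plane → Plane} (hE : Differentiable ℝ E) {M : ℝ}
    (hM : ∀ x i j, |jac E x i j| ≤ M) (x y : Plane) : ‖E x - E y‖ ≤ 2 * M * ‖x - y‖ := by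
  have hM0 : 0 ≤ M := (abs_nonneg _).trans (hM 0 0 0)
  refine Convex.norm_image_sub_le_of_norm_fderiv_le (fun x _ => hE x) (fun x _ => ?_)
    convex_univ (mem_univ y) (mem_univ x)
  refine ContinuousLinearMap.opNorm_le_bound _ (by positivity) fun v => ?_
  rw [← jac_mulVec]
  exact norm_mulVec_le (hM x) v

theorem jac_sub {F G : Plane → Plane} (hF : Differentiable ℝ F) (hG : Differentiable ℝ G) (x : Plane) :
    jac (F - G) x = jac F x - jac G x := by
  ext i j
  simp only [jac, Matrix.of_apply, Matrix.sub_apply]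
  rw [fderiv_sub (hF x) (hG x)]
  rfl

namespace AbC.IsTorusDiffeo

variable {F G : Equiv.Perm Plane}

theorem dist_torusMap_le_of_jac_le (hF : IsTorusDiffeo F) {M : ℝ}
    (hM : ∀ x i j, |jac F x i j| ≤ M) (z w : Torus) :
    dist (torusMap F z) (torusMap F w) ≤ 2 * M * dist z w := by
  obtain ⟨x, y, rfl, rfl, h⟩ := exists_lifts z w
  rw [← h, hF.torusMap_toTorus, hF.torusMap_toTorus, dist_eq_norm, ← toTorus_sub]
  exact (norm_toTorus_le _).trans (norm_sub_le_of_jac_le hF.differentiable hM x y)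

/-- The mean value inequality is applied to F - G, so the error is proportional to the distance of
the two points; a C⁰ bound would only give an additive constant. -/
theorem dist_torusMap_le_of_jac_sub_le (hF : IsTorusDiffeo F) (hG : IsTorusDiffeo G) {ε : ℝ}
    (hε : ∀ x i j, |jac F x i j - jac G x i j| ≤ ε) (z w : Torus) :
    dist (torusMap G z) (torusMap G w)
      ≤ dist (torusMap F z) (torusMap F w) + 2 * ε * dist z w := by
  obtain ⟨x, y, rfl, rfl, h⟩ := exists_lifts z w
  have hd := norm_sub_le_of_jac_le (E := ⇑F - ⇑G) (hF.differentiable.sub hG.differentiable)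
    (fun x i j => by rw [jac_sub hF.differentiable hG.differentiable]; exact hε x i j) x y
  rw [← h]
  simp only [hF.torusMap_toTorus, hG.torusMap_toTorus, dist_eq_norm]
  have e : toTorus (G x) - toTorus (G y) = (toTorus (F x) - toTorus (F y))
      - toTorus ((⇑F - ⇑G) x - (⇑F - ⇑G) y) := by
    rw [← toTorus_sub, ← toTorus_sub, ← toTorus_sub]
    congr 1
    simp only [Pi.sub_apply]
    abel
  rw [e]
  exact (norm_sub_le _ _).trans (add_le_add_right ((norm_toTorus_le _).trans hd) _)

theorem differentiable_apply (hF : IsTorusDiffeo F) (i : Fin 2) : Differentiable ℝ fun x => F x i :=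
  fun x => (differentiableAt_pi.1 (hF.differentiable x)) i

theorem multiDeriv_sub (hF : IsTorusDiffeo F) (hG : IsTorusDiffeo G) (i j : Fin 2) (x : Plane) :
    pderiv j (fun x => F x i - G x i) x = jac F x i j - jac G x i j := by
  rw [jac_apply (hF.differentiable x), jac_apply (hG.differentiable x), pderiv,
    fderiv_fun_sub (hF.differentiable_apply i x) (hG.differentiable_apply i x)]
  rfl

theorem abs_jac_sub_le (hF : IsTorusDiffeo F) (hG : IsTorusDiffeo G) {s : ℕ} (hs : 1 ≤ s)
    (x : Plane) (i j : Fin 2) : |jac F x i j - jac G x i j| ≤ preDist s F G := by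
  set v := pderiv j (fun x => F x i - G x i) with hv
  have hvx : v = fun x => jac F x i j - jac G x i j := funext (hF.multiDeriv_sub hG i j)
  have h1 : |v x| ≤ supNorm v := by
    refine abs_le_supNorm ?_ (fun x w => ?_) x
    · rw [hvx]
      exact (hF.continuous_jac.matrix_elem i j).sub (hG.continuous_jac.matrix_elem i j)
    · simp only [hvx, hF.jac_add, hG.jac_add]
  rw [hvx] at h1
  refine h1.trans (le_csSup (bddAbove_preDist s F G) (Or.inr ?_))
  fin_cases j
  · exact ⟨i, (1, 0), by simp, by simpa using hs, by rw [← hvx]; rfl⟩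
  · exact ⟨i, (0, 1), by simp, by simpa using hs, by rw [← hvx]; rfl⟩

theorem dist_torusMap_le (hF : IsTorusDiffeo F) (hG : IsTorusDiffeo G) {s : ℕ} {ε : ℝ}
    (hε : preDist s F G < ε) (z : Torus) : dist (torusMap F z) (torusMap G z) ≤ ε := by
  obtain ⟨x, rfl⟩ := toTorus_surjective z
  have hi : ∀ i, dist (torusMap F (toTorus x) i) (torusMap G (toTorus x) i) ≤ ε := by
    intro i
    have h1 : (⨅ v : ℤ, supNorm fun x => F x i - G x i + (v : ℝ)) < ε :=
      lt_of_le_of_lt (le_csSup (bddAbove_preDist s F G) (Or.inl ⟨i, rfl⟩)) hε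
    -- The distance of order 0 is an infimum over integer shifts, chosen separately in each
    -- coordinate; the strict inequality provides a shift below ε.
    obtain ⟨v, hv⟩ := exists_lt_of_ciInf_lt h1
    have h2 : |F x i - G x i + (v : ℝ)| ≤ supNorm fun x => F x i - G x i + (v : ℝ) := by
      refine abs_le_supNorm (v := fun x => F x i - G x i + (v : ℝ)) ?_ (fun x w => ?_) x
      · have := hF.continuous; have := hG.continuous; fun_prop
      · simp [hF.map_add, hG.map_add]
    rw [hF.torusMap_toTorus, hG.torusMap_toTorus, dist_eq_norm]
    have h3 : toTorus (F x) i - toTorus (G x) i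
        = toTorus (fun _ : Fin 2 => F x i - G x i + (v : ℝ)) i := by
      change ((F x i : ℝ) : UnitAddCircle) - ((G x i : ℝ) : UnitAddCircle) = _
      rw [← AddCircle.coe_sub]
      exact (coe_add_intCast _ v).symm
    rw [h3]
    refine (norm_le_pi_norm _ i).trans ((norm_toTorus_le _).trans ?_)
    refine (pi_norm_le_iff_of_nonneg ((abs_nonneg _).trans (h2.trans hv.le))).2 fun _ => ?_
    exact h2.trans hv.le
  exact (dist_pi_le_iff (dist_nonneg.trans (hi 0))).2 hi

theorem abs_jac_le_derivNorm (hF : IsTorusDiffeo F) (x : Plane) (i j : Fin 2) :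
    |jac F x i j| ≤ derivNorm F := by
  set v := pderiv j (fun x => F x i) with hv
  have hvx : v = fun x => jac F x i j := funext fun x => (jac_apply (hF.differentiable x) i j).symm
  have h1 : |v x| ≤ supNorm v := by
    refine abs_le_supNorm ?_ (fun x w => ?_) x
    · rw [hvx]; exact hF.continuous_jac.matrix_elem i j
    · simp only [hvx, hF.jac_add]
  rw [hvx] at h1
  refine h1.trans (le_csSup ?_ ⟨i, j, by rw [← hvx]⟩)
  refine ((Set.finite_range fun p : Fin 2 × Fin 2 => supNorm (pderiv p.2 fun x => F x p.1)).subset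
    ?_).bddAbove
  rintro y ⟨i, j, rfl⟩
  exact ⟨(i, j), rfl⟩

theorem derivNorm_nonneg (hF : IsTorusDiffeo F) : 0 ≤ derivNorm F :=
  (abs_nonneg _).trans (hF.abs_jac_le_derivNorm 0 0 0)

theorem dist_torusMap_le_derivNorm (hF : IsTorusDiffeo F) (z w : Torus) :
    dist (torusMap F z) (torusMap F w) ≤ 2 * derivNorm F * dist z w :=
  hF.dist_torusMap_le_of_jac_le hF.abs_jac_le_derivNorm z w

end AbC.IsTorusDiffeo

/-- In dimension two the inverse of a unimodular matrix is its adjugate, which has the same entries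
up to order and sign. Hence `derivNorm F` also controls the derivative of the inverse of an
area-preserving map. -/
theorem abs_le_of_mul_eq_one {A B : Matrix (Fin 2) (Fin 2) ℝ} {M : ℝ} (hA : A.det = 1)
    (hBA : B * A = 1) (hM : ∀ i j, |A i j| ≤ M) (i j : Fin 2) : |B i j| ≤ M := by
  have h : B = A.adjugate := by
    have := congrArg (· * A.adjugate) hBA
    simpa [Matrix.mul_assoc, Matrix.mul_adjugate, hA] using this
  rw [h, Matrix.adjugate_fin_two]
  fin_cases i <;> fin_cases j <;> simp [hM]

namespace AbC.IsAreaDiffeo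

variable {F : Equiv.Perm Plane}

theorem one_le_two_mul_derivNorm_sq (hF : IsAreaDiffeo F) : 1 ≤ 2 * derivNorm F ^ 2 := by
  have h := hF.2 0
  rw [Matrix.det_fin_two] at h
  have hb := hF.1.abs_jac_le_derivNorm 0
  have h0 := hF.1.derivNorm_nonneg
  have h1 := mul_le_mul (hb 0 0) (hb 1 1) (abs_nonneg _) h0
  have h2 := mul_le_mul (hb 0 1) (hb 1 0) (abs_nonneg _) h0
  rw [← abs_mul] at h1 h2
  have := le_abs_self (jac F 0 0 0 * jac F 0 1 1)
  have := neg_abs_le (jac F 0 0 1 * jac F 0 1 0)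
  nlinarith

theorem half_lt_derivNorm (hF : IsAreaDiffeo F) : 1 / 2 < derivNorm F := by
  have h := hF.one_le_two_mul_derivNorm_sq
  have h0 := hF.1.derivNorm_nonneg
  nlinarith

theorem abs_jac_inv_le (hF : IsAreaDiffeo F) (x : Plane) (i j : Fin 2) :
    |jac (⇑F⁻¹) x i j| ≤ derivNorm F := by
  obtain ⟨y, rfl⟩ := F.surjective x
  exact abs_le_of_mul_eq_one (hF.2 y) (hF.1.jac_inv_mul_jac y) (hF.1.abs_jac_le_derivNorm y) i j

theorem dist_torusMap_inv_le (hF : IsAreaDiffeo F) (z w : Torus) :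
    dist (torusMap (⇑F⁻¹) z) (torusMap (⇑F⁻¹) w) ≤ 2 * derivNorm F * dist z w :=
  hF.1.inv.dist_torusMap_le_of_jac_le hF.abs_jac_inv_le z w

end AbC.IsAreaDiffeo

/-! ### Closeness of measures in total variation -/

/-- The integrals of measurable functions bounded by one with respect to two measures differ by at
most `τ`. -/
def IntegralClose {X : Type*} [MeasurableSpace X] (μ ν : Measure X) (τ : ℝ) : Prop :=
  ∀ ψ : X → ℝ, Measurable ψ → (∀ x, |ψ x| ≤ 1) → |∫ x, ψ x ∂μ - ∫ x, ψ x ∂ν| ≤ τ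

namespace IntegralClose

variable {X Y : Type*} [MeasurableSpace X] [MeasurableSpace Y] {μ ν ξ : Measure X} {τ τ' : ℝ}

theorem symm (h : IntegralClose μ ν τ) : IntegralClose ν μ τ := fun ψ hψ hb => by
  rw [abs_sub_comm]; exact h ψ hψ hb

theorem trans (h : IntegralClose μ ν τ) (h' : IntegralClose ν ξ τ') :
    IntegralClose μ ξ (τ + τ') := fun ψ hψ hb =>
  (abs_sub_le _ _ _).trans (add_le_add (h ψ hψ hb) (h' ψ hψ hb))

theorem map (h : IntegralClose μ ν τ) {S : X → Y} (hS : Measurable S) :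
    IntegralClose (μ.map S) (ν.map S) τ := fun ψ hψ hb => by
  rw [integral_map hS.aemeasurable hψ.aestronglyMeasurable,
    integral_map hS.aemeasurable hψ.aestronglyMeasurable]
  exact h _ (hψ.comp hS) fun x => hb _

theorem abs_sub_le (h : IntegralClose μ ν τ) {ψ : X → ℝ} (hψ : Measurable ψ) {M : ℝ} (hM : 0 < M)
    (hb : ∀ x, |ψ x| ≤ M) : |∫ x, ψ x ∂μ - ∫ x, ψ x ∂ν| ≤ M * τ := by
  have h1 := h (fun x => ψ x / M) (hψ.div_const M) fun x => by
    rw [abs_div, abs_of_pos hM, div_le_one hM]; exact hb x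
  rw [integral_div, integral_div, ← sub_div, abs_div, abs_of_pos hM, div_le_iff₀ hM] at h1
  linarith

end IntegralClose

section Scheffe

variable {X : Type*} [MeasurableSpace X] {μ : Measure X}

theorem integralClose_withDensity {u v : X → ℝ} (hu : Measurable u) (hv : Measurable v)
    (hu0 : ∀ x, 0 ≤ u x) (hv0 : ∀ x, 0 ≤ v x) (hui : Integrable u μ) (hvi : Integrable v μ) :
    IntegralClose (μ.withDensity fun x => ENNReal.ofReal (u x))
      (μ.withDensity fun x => ENNReal.ofReal (v x)) (∫ x, |u x - v x| ∂μ) := by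
  intro ψ hψ hb
  rw [integral_withDensity_eq_integral_toReal_smul hu.ennreal_ofReal (by simp),
    integral_withDensity_eq_integral_toReal_smul hv.ennreal_ofReal (by simp)]
  simp only [ENNReal.toReal_ofReal (hu0 _), ENNReal.toReal_ofReal (hv0 _), smul_eq_mul]
  have hi : ∀ {w : X → ℝ}, Integrable w μ → Integrable (fun x => w x * ψ x) μ := fun hw =>
    hw.mul_bdd (c := 1) hψ.aestronglyMeasurable (Eventually.of_forall hb)
  rw [← integral_sub (hi hui) (hi hvi)]
  refine (abs_integral_le_integral_abs).trans (integral_mono_of_nonneg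
    (Eventually.of_forall fun _ => abs_nonneg _) (hui.sub hvi).abs (Eventually.of_forall fun x => ?_))
  change |u x * ψ x - v x * ψ x| ≤ |u x - v x|
  rw [← sub_mul, abs_mul]
  exact mul_le_of_le_one_right (abs_nonneg _) (hb x)

/-- Scheffé's lemma. -/
theorem tendsto_integral_abs_sub_of_ae {u : ℕ → X → ℝ} {v : X → ℝ} (hu : ∀ n, Measurable (u n))
    (hv : Measurable v) (hu0 : ∀ n x, 0 ≤ u n x) (hv0 : ∀ x, 0 ≤ v x)
    (hui : ∀ n, Integrable (u n) μ) (hvi : Integrable v μ)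
    (hint : ∀ n, ∫ x, u n x ∂μ = ∫ x, v x ∂μ)
    (hlim : ∀ᵐ x ∂μ, Tendsto (fun n => u n x) atTop (𝓝 (v x))) :
    Tendsto (fun n => ∫ x, |u n x - v x| ∂μ) atTop (𝓝 0) := by
  -- The positive part of v - u_n is dominated by v, and equality of the total masses makes the L¹
  -- distance twice its integral.
  have h1 : Tendsto (fun n => ∫ x, max (v x - u n x) 0 ∂μ) atTop (𝓝 (∫ _, (0 : ℝ) ∂μ)) := by
    refine tendsto_integral_of_dominated_convergence v (fun n => ?_) hvi (fun n => ?_) ?_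
    · exact ((hv.sub (hu n)).max measurable_const).aestronglyMeasurable
    · refine Eventually.of_forall fun x => ?_
      rw [Real.norm_of_nonneg (le_max_right _ _)]
      exact max_le (by linarith [hu0 n x]) (hv0 x)
    · filter_upwards [hlim] with x hx
      have := (tendsto_const_nhds (x := v x)).sub hx
      have := this.max (tendsto_const_nhds (x := (0 : ℝ)))
      simpa using this
  rw [integral_zero] at h1
  have h2 : ∀ n, ∫ x, |u n x - v x| ∂μ = 2 * ∫ x, max (v x - u n x) 0 ∂μ := by
    intro n
    have e : ∀ x, |u n x - v x| = 2 * max (v x - u n x) 0 + (u n x - v x) := by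
      intro x
      rcases le_total (u n x) (v x) with h | h
      · rw [max_eq_left (by linarith), abs_of_nonpos (by linarith)]; ring
      · rw [max_eq_right (by linarith), abs_of_nonneg (by linarith)]; ring
    have hm : Integrable (fun x => max (v x - u n x) 0) μ := (hvi.sub (hui n)).pos_part
    simp_rw [e]
    have hd : Integrable (fun x => u n x - v x) μ := (hui n).sub hvi
    rw [integral_add (hm.const_mul 2) hd, integral_const_mul,
      integral_sub (hui n) hvi, hint n]
    ring
  simp_rw [h2]
  simpa using h1.const_mul 2

end Scheffe

/-- Cholesky factorization: determinant 1 and a nonnegative corner entry force that entry to be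
positive. It lets the limit metric be handled like a transported one. -/
theorem exists_transpose_mul_self {W : Matrix (Fin 2) (Fin 2) ℝ} (hs : W 1 0 = W 0 1)
    (hdet : W.det = 1) (h0 : 0 ≤ W 0 0) :
    ∃ J : Matrix (Fin 2) (Fin 2) ℝ, J.det = 1 ∧ W = Jᵀ * J := by
  rw [Matrix.det_fin_two, hs] at hdet
  have hpos : 0 < W 0 0 := by
    refine lt_of_le_of_ne h0 fun h => ?_
    rw [← h] at hdet
    nlinarith
  have hsq := Real.mul_self_sqrt h0
  have hsp := Real.sqrt_pos.2 hpos
  refine ⟨!![√(W 0 0), W 0 1 / √(W 0 0); 0, 1 / √(W 0 0)], ?_, ?_⟩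
  · rw [Matrix.det_fin_two_of]; field_simp; simp
  · ext i j
    fin_cases i <;> fin_cases j
    · simp [Matrix.mul_apply, hsq]
    · simp [Matrix.mul_apply]; field_simp
    · simp [Matrix.mul_apply, hs]; field_simp
    · simp only [Fin.mk_one, Matrix.mul_apply, Matrix.transpose_apply, Fin.sum_univ_two,
        Matrix.of_apply, Matrix.cons_val', Matrix.cons_val_one, Matrix.cons_val_zero,
        Matrix.cons_val_fin_one]
      field_simp
      rw [Real.sq_sqrt h0]
      linarith

/-- The constant function 1 in `lintegral_lineMap`: the fibre measures are normalized. -/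
theorem lintegral_inv_eucl_sq {J : Matrix (Fin 2) (Fin 2) ℝ} (hJ : J.det = 1) :
    ∫⁻ t, ENNReal.ofReal (1 / eucl (J *ᵥ dir (circleRep t)) ^ 2) = 1 := by
  have h := lintegral_lineMap (A := J.adjugate) (B := J)
    (by rw [Matrix.det_adjugate]; simp [hJ])
    (by rw [Matrix.mul_adjugate, hJ, one_smul]) (u := fun _ => 1) measurable_const
  simpa using h.symm

/-! ### Convergence of the induced measures to that of the limit metric. -/

section LimitMetric

variable {H : ℕ → Equiv.Perm Plane} {ω : Torus → Matrix (Fin 2) (Fin 2) ℝ}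

theorem tendsto_matrix_elem {ι : Type*} {l : Filter ι} {A : ι → Matrix (Fin 2) (Fin 2) ℝ}
    {B : Matrix (Fin 2) (Fin 2) ℝ} (h : Tendsto A l (𝓝 B)) (i j : Fin 2) :
    Tendsto (fun n => A n i j) l (𝓝 (B i j)) :=
  ((continuous_id.matrix_elem i j).tendsto B).comp h

theorem det_transportedMetric {F : Equiv.Perm Plane} (hF : IsAreaDiffeo F) (z : Torus) :
    (transportedMetric F z).det = 1 := by
  rw [transportedMetric, Matrix.det_mul, Matrix.det_transpose, hF.inv.2, one_mul]

/-- Symmetry, determinant 1 and nonnegativity of the corner entry are closed conditions, and they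
suffice for the factorization. -/
theorem exists_eq_transpose_mul_self_of_tendsto (hH : ∀ n, IsAreaDiffeo (H n)) {z : Torus}
    (hz : Tendsto (fun n => transportedMetric (H n) z) atTop (𝓝 (ω z))) :
    ∃ J : Matrix (Fin 2) (Fin 2) ℝ, J.det = 1 ∧ ω z = Jᵀ * J := by
  refine exists_transpose_mul_self ?_ ?_ ?_
  · refine tendsto_nhds_unique (tendsto_matrix_elem hz 1 0) ?_
    refine (tendsto_matrix_elem hz 0 1).congr fun n => ?_
    simp only [transportedMetric, Matrix.mul_apply, Matrix.transpose_apply, Fin.sum_univ_two]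
    ring
  · have h1 : Tendsto (fun n => (transportedMetric (H n) z).det) atTop (𝓝 (ω z).det) :=
      (((continuous_id (X := Matrix (Fin 2) (Fin 2) ℝ)).matrix_det).tendsto (ω z)).comp hz
    simp only [det_transportedMetric (hH _)] at h1
    exact (tendsto_nhds_unique tendsto_const_nhds h1).symm
  · refine ge_of_tendsto' (tendsto_matrix_elem hz 0 0) fun n => ?_
    simp only [transportedMetric, Matrix.mul_apply, Matrix.transpose_apply, Fin.sum_univ_two]
    nlinarith [sq_nonneg (jac (⇑(H n)⁻¹) (torusRep z) 0 0), sq_nonneg (jac (⇑(H n)⁻¹) (torusRep z) 1 0)]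

theorem ae_fst {p : Torus → Prop} (h : ∀ᵐ z, p z) : ∀ᵐ X : ProjBundle, p X.1 :=
  Measure.quasiMeasurePreserving_fst.ae h

theorem tendsto_metricDensity (hH : ∀ n, IsAreaDiffeo (H n)) {X : ProjBundle}
    (hz : Tendsto (fun n => transportedMetric (H n) X.1) atTop (𝓝 (ω X.1))) :
    Tendsto (fun n => metricDensity (transportedMetric (H n)) X) atTop (𝓝 (metricDensity ω X)) := by
  obtain ⟨J, hJ, e⟩ := exists_eq_transpose_mul_self_of_tendsto hH hz
  have hdet : Tendsto (fun n => √(transportedMetric (H n) X.1).det) atTop (𝓝 √(ω X.1).det) :=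
    ((Real.continuous_sqrt.comp
      (continuous_id (X := Matrix (Fin 2) (Fin 2) ℝ)).matrix_det).tendsto (ω X.1)).comp hz
  refine hdet.mul (hdet.div ?_ ?_)
  · have : Continuous fun W : Matrix (Fin 2) (Fin 2) ℝ =>
        dir (circleRep X.2) ⬝ᵥ (W *ᵥ dir (circleRep X.2)) :=
      continuous_const.dotProduct (continuous_id.matrix_mulVec continuous_const)
    exact (this.tendsto _).comp hz
  · rw [e, dotProduct_transpose_mul_self]
    have := eucl_pos (mulVec_ne_zero (A := J) (by simp [hJ]) (dir_ne_zero (circleRep X.2)))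
    positivity

theorem lintegral_metricDensity (hω : ∀ i j, Measurable fun z => ω z i j)
    (h : ∀ᵐ z, ∃ J : Matrix (Fin 2) (Fin 2) ℝ, J.det = 1 ∧ ω z = Jᵀ * J) :
    ∫⁻ X, ENNReal.ofReal (metricDensity ω X) = 1 := by
  rw [Measure.volume_eq_prod, lintegral_prod _ (measurable_metricDensity hω).ennreal_ofReal.aemeasurable]
  have h1 : ∫⁻ _ : Torus, (1 : ENNReal) = 1 := by simp
  conv_rhs => rw [← h1]
  refine lintegral_congr_ae ?_
  filter_upwards [h] with z hz
  obtain ⟨J, hJ, e⟩ := hz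
  rw [← lintegral_inv_eucl_sq hJ]
  refine lintegral_congr fun t => ?_
  rw [metricDensity_of_eq (X := (z, t)) hJ e]

theorem isProbabilityMeasure_of_lintegral {X : Type*} [MeasurableSpace X] {μ : Measure X}
    {u : X → ENNReal} (h : ∫⁻ x, u x ∂μ = 1) : IsProbabilityMeasure (μ.withDensity u) :=
  ⟨by rw [withDensity_apply _ MeasurableSet.univ, Measure.restrict_univ, h]⟩

/-- `ENNReal.ofReal` truncates at 0, so the measure only sees the positive part of its density. The
truncation matters because nothing is known about ω on the null set where the metrics fail to
converge. -/
theorem integrable_max_of_lintegral {X : Type*} [MeasurableSpace X] {μ : Measure X} {u : X → ℝ}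
    (hu : Measurable u) (h : ∫⁻ x, ENNReal.ofReal (u x) ∂μ = 1) :
    Integrable (fun x => max (u x) 0) μ ∧ ∫ x, max (u x) 0 ∂μ = 1 := by
  have hm : ∀ x, ENNReal.ofReal (max (u x) 0) = ENNReal.ofReal (u x) := fun x => by
    rcases le_total (u x) 0 with h | h
    · rw [max_eq_right h, ENNReal.ofReal_zero, ENNReal.ofReal_of_nonpos h]
    · rw [max_eq_left h]
  have hmeas : Measurable fun x => max (u x) 0 := hu.max measurable_const
  constructor
  · refine (lintegral_ofReal_ne_top_iff_integrable hmeas.aestronglyMeasurable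
      (Eventually.of_forall fun x => le_max_right _ _)).1 ?_
    simp_rw [hm, h]
    exact ENNReal.one_ne_top
  · rw [integral_eq_lintegral_of_nonneg_ae (f := fun x => max (u x) 0)
      (Eventually.of_forall fun x => le_max_right _ _) hmeas.aestronglyMeasurable]
    simp_rw [hm, h]
    simp

/-- The measures induced by the transported metrics converge in total variation to the measure
induced by the limit metric. -/
theorem exists_integralClose_metricMeasure (hH : ∀ n, IsAreaDiffeo (H n))
    (hω : ∀ i j, Measurable fun z => ω z i j)
    (hlim : ∀ᵐ z, Tendsto (fun n => transportedMetric (H n) z) atTop (𝓝 (ω z))) :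
    IsProbabilityMeasure (metricMeasure ω) ∧ ∃ τ : ℕ → ℝ, Tendsto τ atTop (𝓝 0) ∧
      ∀ n, IntegralClose ((volume : Measure ProjBundle).map (projExt (H n))) (metricMeasure ω)
        (τ n) := by
  have hone := lintegral_metricDensity hω
    (hlim.mono fun z hz => exists_eq_transpose_mul_self_of_tendsto hH hz)
  have honen : ∀ n, ∫⁻ X, ENNReal.ofReal (metricDensity (transportedMetric (H n)) X) = 1 :=
    fun n => lintegral_metricDensity (hH n).measurable_transportedMetric
      (Eventually.of_forall fun z => ⟨_, (hH n).inv.2 _, rfl⟩)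
  have hmeas := measurable_metricDensity hω
  have hmeasn := fun n => measurable_metricDensity (hH n).measurable_transportedMetric
  have hmax : ∀ (w : ProjBundle → ℝ) X, ENNReal.ofReal (max (w X) 0) = ENNReal.ofReal (w X) :=
    fun w X => by
      rcases le_total (w X) 0 with h | h
      · rw [max_eq_right h, ENNReal.ofReal_zero, ENNReal.ofReal_of_nonpos h]
      · rw [max_eq_left h]
  have hi := integrable_max_of_lintegral hmeas hone
  have hin := fun n => integrable_max_of_lintegral (hmeasn n) (honen n)
  refine ⟨isProbabilityMeasure_of_lintegral hone, _,
    tendsto_integral_abs_sub_of_ae (u := fun n X => max (metricDensity (transportedMetric (H n)) X) 0)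
      (v := fun X => max (metricDensity ω X) 0)
      (fun n => (hmeasn n).max measurable_const) (hmeas.max measurable_const)
      (fun n x => le_max_right _ _) (fun x => le_max_right _ _) (fun n => (hin n).1) hi.1
      (fun n => (hin n).2.trans hi.2.symm) ?_, fun n => ?_⟩
  · filter_upwards [ae_fst hlim] with X hX
    exact (tendsto_metricDensity hH hX).max tendsto_const_nhds
  · have := integralClose_withDensity ((hmeasn n).max measurable_const)
      (hmeas.max measurable_const) (fun x => le_max_right _ (0 : ℝ)) (fun x => le_max_right _ (0 : ℝ))
      (hin n).1 hi.1
    simp only [hmax] at this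
    rw [(hH n).map_projExt]
    exact this

theorem metricMeasure_absolutelyContinuous (ω : Torus → Matrix (Fin 2) (Fin 2) ℝ) :
    metricMeasure ω ≪ volume :=
  withDensity_absolutelyContinuous _ _

/-- Sets whose Lebesgue measure tends to zero are asymptotically null for `metricMeasure ω`. -/
theorem tendsto_metricMeasure_of_tendsto_volume [IsFiniteMeasure (metricMeasure ω)] {ι : Type*}
    {l : Filter ι} {S : ι → Set ProjBundle} (hS : Tendsto (fun n => volume (S n)) l (𝓝 0)) :
    Tendsto (fun n => metricMeasure ω (S n)) l (𝓝 0) := by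
  have h : ∀ s, metricMeasure ω s = ∫⁻ X in s, ENNReal.ofReal (metricDensity ω X) := fun s =>
    withDensity_apply' _ s
  simp_rw [h]
  refine tendsto_setLIntegral_zero ?_ hS
  have := measure_ne_top (metricMeasure ω) univ
  rw [h, Measure.restrict_univ] at this
  exact this

end LimitMetric

/-! ### Convergence of the projectivized derivatives -/

theorem tendsto_projExt_of_tendsto_jac {ι : Type*} {l : Filter ι} {F : ι → Plane → Plane}
    {G : Equiv.Perm Plane} (hG : IsTorusDiffeo G) (X : ProjBundle)
    (h0 : Tendsto (fun n => torusMap (F n) X.1) l (𝓝 (torusMap G X.1)))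
    (h1 : ∀ i j, Tendsto (fun n => jac (F n) (torusRep X.1) i j) l (𝓝 (jac G (torusRep X.1) i j))) :
    Tendsto (fun n => projExt (F n) X) l (𝓝 (projExt G X)) := by
  refine h0.prodMk_nhds ?_
  have hm : Tendsto (fun n => jac (F n) (torusRep X.1)) l (𝓝 (jac G (torusRep X.1))) :=
    tendsto_pi_nhds.2 fun i => tendsto_pi_nhds.2 fun j => h1 i j
  have hv : Tendsto (fun n => jac (F n) (torusRep X.1) *ᵥ dir (circleRep X.2)) l
      (𝓝 (jac G (torusRep X.1) *ᵥ dir (circleRep X.2))) :=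
    ((continuous_id.matrix_mulVec continuous_const).tendsto _).comp hm
  exact (continuousAt_lineCoord (mulVec_ne_zero (hG.det_jac_ne_zero _) (dir_ne_zero _))).tendsto.comp hv

theorem tendsto_projExt_of_diffeoDist {F : ℕ → Equiv.Perm Plane} {G : Equiv.Perm Plane}
    (hF : ∀ n, IsTorusDiffeo (F n)) (hG : IsTorusDiffeo G)
    (h : Tendsto (fun n => diffeoDist 1 (F n) G) atTop (𝓝 0)) (X : ProjBundle) :
    Tendsto (fun n => projExt (F n) X) atTop (𝓝 (projExt G X)) := by
  refine tendsto_projExt_of_tendsto_jac hG X ?_ fun i j => ?_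
  · refine Metric.tendsto_atTop.2 fun ε hε => ?_
    obtain ⟨n₀, hn₀⟩ := eventually_atTop.1 (h.eventually (gt_mem_nhds (half_pos hε)))
    refine ⟨n₀, fun n hn => lt_of_le_of_lt ?_ (half_lt_self hε)⟩
    exact (hF n).dist_torusMap_le hG (lt_of_le_of_lt (le_max_left _ _) (hn₀ n hn)) _
  · rw [tendsto_iff_dist_tendsto_zero]
    refine squeeze_zero (fun _ => dist_nonneg) (fun n => ?_) h
    exact ((hF n).abs_jac_sub_le hG le_rfl _ i j).trans (le_max_left _ _)

section Invariance

variable {ν : Measure ProjBundle} [IsProbabilityMeasure ν] {ν' : ℕ → Measure ProjBundle} {τ : ℕ → ℝ}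

/-- The measure ν' n is exactly invariant under S n and close to ν, so the integrals of ψ∘S_n and ψ
against ν differ by O(τ_n). Dominated convergence passes to T for continuous ψ, and these determine
the measure. -/
theorem measurePreserving_of_integralClose (hτ : Tendsto τ atTop (𝓝 0))
    (hν : ∀ n, IntegralClose (ν' n) ν (τ n)) {S : ℕ → ProjBundle → ProjBundle}
    {T : ProjBundle → ProjBundle} (hS : ∀ n, Measurable (S n)) (hT : Measurable T)
    (hinv : ∀ n, (ν' n).map (S n) = ν' n) (hlim : ∀ X, Tendsto (fun n => S n X) atTop (𝓝 (T X))) :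
    MeasurePreserving T ν ν := by
  refine ⟨hT, ?_⟩
  have : IsProbabilityMeasure (ν.map T) := Measure.isProbabilityMeasure_map hT.aemeasurable
  refine ext_of_forall_integral_eq_of_IsFiniteMeasure fun ψ => ?_
  have hψ := ψ.continuous.measurable
  rw [integral_map hT.aemeasurable hψ.aestronglyMeasurable]
  have hM : 0 < ‖ψ‖ + 1 := by positivity
  have hb : ∀ X, |ψ X| ≤ ‖ψ‖ + 1 := fun X => (ψ.norm_coe_le_norm X).trans (by linarith)
  have h1 : Tendsto (fun n => ∫ X, ψ (S n X) ∂ν) atTop (𝓝 (∫ X, ψ (T X) ∂ν)) :=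
    tendsto_integral_of_dominated_convergence (fun _ => ‖ψ‖)
      (fun n => (hψ.comp (hS n)).aestronglyMeasurable) (integrable_const _)
      (fun n => Eventually.of_forall fun X => ψ.norm_coe_le_norm _)
      (Eventually.of_forall fun X => (ψ.continuous.tendsto _).comp (hlim X))
  refine tendsto_nhds_unique h1 ?_
  rw [tendsto_iff_dist_tendsto_zero]
  have hc : Tendsto (fun n => (‖ψ‖ + 1) * τ n + (‖ψ‖ + 1) * τ n) atTop (𝓝 0) := by
    simpa using (hτ.const_mul (‖ψ‖ + 1)).add (hτ.const_mul (‖ψ‖ + 1))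
  refine squeeze_zero (fun _ => dist_nonneg) (fun n => ?_) hc
  have h2 := (hν n).symm.abs_sub_le (hψ.comp (hS n)) hM fun X => hb _
  have h3 := (hν n).abs_sub_le hψ hM hb
  have h4 : ∫ X, ψ (S n X) ∂(ν' n) = ∫ X, ψ X ∂(ν' n) := by
    conv_rhs => rw [← hinv n]
    rw [integral_map (hS n).aemeasurable hψ.aestronglyMeasurable]
  simp only [Function.comp_def] at h2
  rw [h4] at h2
  exact (abs_sub_le _ _ _).trans (add_le_add h2 h3)

end Invariance

/-- G is conjugated by F to a power of a rotation; rotations have derivative 1 and preserve Lebesgue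
measure on the bundle. -/
theorem IsAreaDiffeo.map_projExt_map {F G : Equiv.Perm Plane} (hF : IsAreaDiffeo F)
    (hG : IsAreaDiffeo G) {t : ℝ} {n : ℕ} (h : G * F = F * rot t ^ n) :
    ((volume : Measure ProjBundle).map (projExt F)).map (projExt G) = volume.map (projExt F) := by
  have hR : ∀ n : ℕ, IsAreaDiffeo (rot t ^ n) := fun n => (IsAreaDiffeo.rot t).pow n
  have hone : metricMeasure (transportedMetric (1 : Equiv.Perm Plane)) = volume := by
    rw [← IsAreaDiffeo.one.map_projExt]
    have : projExt (⇑(1 : Equiv.Perm Plane)) = id := funext projExt_one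
    rw [this, Measure.map_id]
  have hjac : ∀ (n : ℕ) (x : Plane), jac (⇑(rot t ^ n)) x = 1 := by
    intro n
    induction n with
    | zero => intro x; rw [pow_zero, jac_id]
    | succ n ih => intro x; rw [pow_succ, (hR n).1.jac_mul (.rot t), ih, jac_rot, one_mul]
  have hjac' : ∀ (n : ℕ) (x : Plane), jac (⇑(rot t ^ n)⁻¹) x = 1 := by
    intro n x
    have := (hR n).1.inv.jac_inv_mul_jac x
    rw [inv_inv, hjac, one_mul] at this
    exact this
  have hrot : (volume : Measure ProjBundle).map (projExt (⇑(rot t ^ n))) = volume := by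
    rw [(hR n).map_projExt, ← hone]
    congr 1
    funext z
    simp only [transportedMetric, hjac', inv_one, jac_id]
  rw [Measure.map_map hG.1.measurable_projExt hF.1.measurable_projExt]
  have e : projExt G ∘ projExt F = projExt F ∘ projExt (⇑(rot t ^ n)) := by
    funext X
    simp only [Function.comp_apply]
    rw [← hG.1.projExt_mul hF.1, h, hF.1.projExt_mul (hR n).1]
  rw [e, ← Measure.map_map hF.1.measurable_projExt (hR n).1.measurable_projExt, hrot]

/-! ### Asymptotically equal transformations -/

/-- The sum of the squares of the entries. -/
def sqSum (A : Matrix (Fin 2) (Fin 2) ℝ) : ℝ := A 0 0 ^ 2 + A 0 1 ^ 2 + A 1 0 ^ 2 + A 1 1 ^ 2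

theorem sqSum_nonneg (A : Matrix (Fin 2) (Fin 2) ℝ) : 0 ≤ sqSum A := by unfold sqSum; positivity

theorem eucl_mulVec_sq_le (A : Matrix (Fin 2) (Fin 2) ℝ) (v : Plane) :
    eucl (A *ᵥ v) ^ 2 ≤ sqSum A * eucl v ^ 2 := by
  rw [eucl_sq, eucl_sq, sqSum]
  simp only [Matrix.mulVec, dotProduct, Fin.sum_univ_two]
  nlinarith [sq_nonneg (A 0 0 * v 1 - A 0 1 * v 0), sq_nonneg (A 1 0 * v 1 - A 1 1 * v 0)]

theorem eucl_sq_le_mulVec {A : Matrix (Fin 2) (Fin 2) ℝ} (hA : A.det = 1) (v : Plane) :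
    eucl v ^ 2 ≤ sqSum A * eucl (A *ᵥ v) ^ 2 := by
  have h := eucl_mulVec_sq_le A.adjugate (A *ᵥ v)
  rw [Matrix.mulVec_mulVec, Matrix.adjugate_mul, hA, one_smul, Matrix.one_mulVec] at h
  have e : sqSum A.adjugate = sqSum A := by
    simp [sqSum, Matrix.adjugate_fin_two]; ring
  rwa [e] at h

theorem eucl_mulVec_le_of_abs_le {A : Matrix (Fin 2) (Fin 2) ℝ} {c : ℝ} (hA : ∀ i j, |A i j| ≤ c)
    (v : Plane) : eucl (A *ᵥ v) ≤ 2 * c * eucl v := by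
  have hc : 0 ≤ c := (abs_nonneg _).trans (hA 0 0)
  refine abs_le_of_sq_le_sq' ?_ (mul_nonneg (by positivity) (eucl_nonneg v)) |>.2
  have h : ∀ i j, A i j ^ 2 ≤ c ^ 2 := fun i j => sq_le_sq' (abs_le.1 (hA i j)).1 (abs_le.1 (hA i j)).2
  have hs : sqSum A ≤ 4 * c ^ 2 := by
    have := h 0 0; have := h 0 1; have := h 1 0; have := h 1 1
    unfold sqSum; linarith
  calc eucl (A *ᵥ v) ^ 2 ≤ sqSum A * eucl v ^ 2 := eucl_mulVec_sq_le A v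
    _ ≤ 4 * c ^ 2 * eucl v ^ 2 := mul_le_mul_of_nonneg_right hs (sq_nonneg _)
    _ = (2 * c * eucl v) ^ 2 := by ring

/-- Nearby matrices act on a direction in almost the same way if the direction is not contracted
too much. -/
theorem dist_lineCoord_mulVec_le {A B : Matrix (Fin 2) (Fin 2) ℝ} (hA : A.det ≠ 0) (hB : B.det ≠ 0)
    {c : ℝ} (hAB : ∀ i j, |A i j - B i j| ≤ c) {v : Plane} (hv : v ≠ 0) :
    dist (lineCoord (B *ᵥ v)) (lineCoord (A *ᵥ v)) * eucl (A *ᵥ v) ≤ c * eucl v := by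
  have e : A *ᵥ v = B *ᵥ v + (A - B) *ᵥ v := by
    rw [Matrix.sub_mulVec]; abel
  have hAv := mulVec_ne_zero hA hv
  rw [e] at hAv
  have h := two_mul_dist_lineCoord_add_le (mulVec_ne_zero hB hv) hAv
  rw [← e] at h
  have := h.trans (eucl_mulVec_le_of_abs_le (A := A - B) (c := c) hAB v)
  linarith

/-- At almost every point a convergent sequence is eventually below one that tends to infinity, so
the indicators of these sets tend to 0. -/
theorem tendsto_measure_lt_of_ae_tendsto {X : Type*} [MeasurableSpace X] {μ : Measure X}
    [IsFiniteMeasure μ] {u : ℕ → X → ℝ} {v : X → ℝ} (hu : ∀ n, Measurable (u n))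
    (hlim : ∀ᵐ x ∂μ, Tendsto (fun n => u n x) atTop (𝓝 (v x))) {c : ℕ → ℝ}
    (hc : Tendsto c atTop atTop) : Tendsto (fun n => μ {x | c n < u n x}) atTop (𝓝 0) := by
  have := tendsto_measure_of_ae_tendsto_indicator_of_isFiniteMeasure (μ := μ) atTop
    (A := ∅) (As := fun n => {x | c n < u n x}) MeasurableSet.empty
    (fun n => measurableSet_lt measurable_const (hu n)) ?_
  · simpa using this
  · filter_upwards [hlim] with x hx
    have h1 : ∀ᶠ n in atTop, u n x < v x + 1 := hx.eventually_lt_const (by linarith)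
    filter_upwards [h1, hc.eventually_ge_atTop (v x + 1)] with n hn hn'
    simp only [mem_empty_iff_false, iff_false]
    intro h
    have h : c n < u n x := h
    linarith

/-- C¹-closeness does not control directions that the derivative contracts strongly. By the
conjugacy to a rotation, the contraction at x is bounded in terms of dH_n⁻¹ at x and at A_n(x). The
squared norms of these derivatives are traces of the transported metrics, which converge almost
everywhere; they exceed a divergent bound only on sets of vanishing measure, and A_n preserves the
measure of these sets. -/
theorem tendsto_volume_dist_projExt_lt {H A B : ℕ → Equiv.Perm Plane} {t : ℕ → ℝ} {m : ℕ → ℕ}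
    {ω : Torus → Matrix (Fin 2) (Fin 2) ℝ} (hH : ∀ n, IsAreaDiffeo (H n))
    (hlim : ∀ᵐ z, Tendsto (fun n => transportedMetric (H n) z) atTop (𝓝 (ω z)))
    (hA : ∀ n, IsAreaDiffeo (A n)) (hB : ∀ n, IsTorusDiffeo (B n))
    (hAH : ∀ n, A n * H n = H n * rot (t n) ^ m n)
    (hAB : ∀ n, 1 ≤ n → diffeoDist 1 (A n) (B n) < 1 / 2 ^ n) {η : ℝ} (hη : 0 < η) :
    Tendsto (fun n => volume {X | η < dist (projExt (A n) X) (projExt (B n) X)}) atTop (𝓝 0) := by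
  -- The square root of 2^n: one factor c_n pays for the contraction of directions, the other
  -- remains as the bound 1/c_n for their distance.
  set c : ℕ → ℝ := fun n => √2 ^ n with hc
  have hs2 : (1 : ℝ) < √2 := by
    rw [Real.lt_sqrt (by norm_num)]; norm_num
  have hcinf : Tendsto c atTop atTop := tendsto_pow_atTop_atTop_of_one_lt hs2
  have hcsq : ∀ n, c n * c n = 2 ^ n := fun n => by
    rw [hc, ← mul_pow, Real.mul_self_sqrt (by norm_num)]
  have hcpos : ∀ n, 0 < c n := fun n => by positivity
  set u : ℕ → Torus → ℝ := fun n z => sqSum (jac (⇑(H n)⁻¹) (torusRep z)) with hu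
  have hum : ∀ n, Measurable (u n) := fun n => by
    have h : ∀ i j, Measurable fun z => jac (⇑(H n)⁻¹) (torusRep z) i j := fun i j =>
      ((((hH n).1.inv.continuous_jac).matrix_elem i j).measurable).comp measurable_torusRep
    have := h 0 0; have := h 0 1; have := h 1 0; have := h 1 1
    simp only [hu, sqSum]
    fun_prop
  have hulim : ∀ᵐ z, Tendsto (fun n => u n z) atTop (𝓝 (ω z 0 0 + ω z 1 1)) := by
    filter_upwards [hlim] with z hz
    refine ((tendsto_matrix_elem hz 0 0).add (tendsto_matrix_elem hz 1 1)).congr fun n => ?_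
    simp only [transportedMetric, Matrix.mul_apply, Matrix.transpose_apply, Fin.sum_univ_two, hu,
      sqSum]
    ring
  set S : ℕ → Set Torus := fun n => {z | c n < u n z} with hS
  have hSm : ∀ n, MeasurableSet (S n) := fun n => measurableSet_lt measurable_const (hum n)
  have hS0 : Tendsto (fun n => volume (S n)) atTop (𝓝 0) :=
    tendsto_measure_lt_of_ae_tendsto hum hulim hcinf
  have hbound : ∀ n, volume (Prod.fst ⁻¹' (S n ∪ torusMap (A n) ⁻¹' S n) : Set ProjBundle)
      ≤ volume (S n) + volume (S n) := by
    intro n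
    have hm := (hA n).measurePreserving_torusMap
    rw [Measure.volume_eq_prod,
      measurePreserving_fst.measure_preimage ((hSm n).union (hm.measurable (hSm n))).nullMeasurableSet]
    refine (measure_union_le _ _).trans_eq ?_
    rw [hm.measure_preimage (hSm n).nullMeasurableSet]
  have hsmall : ∀ᶠ n in atTop, 1 / c n < η := by
    have : Tendsto (fun n => 1 / c n) atTop (𝓝 0) := by
      simp only [one_div]
      exact hcinf.inv_tendsto_atTop
    exact this.eventually_lt_const hη
  have hsum0 : Tendsto (fun n => volume (S n) + volume (S n)) atTop (𝓝 0) := by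
    simpa using hS0.add hS0
  refine tendsto_of_tendsto_of_tendsto_of_le_of_le' tendsto_const_nhds hsum0
    (Eventually.of_forall fun _ => zero_le) ?_
  filter_upwards [hsmall, eventually_ge_atTop 1] with n hn hn1
  refine le_trans (measure_mono fun X hX => ?_) (hbound n)
  by_contra hcon
  have hX : η < dist (projExt (A n) X) (projExt (B n) X) := hX
  have hz1 : u n X.1 ≤ c n := not_lt.1 fun h => hcon (Or.inl h)
  have hz2 : u n (torusMap (A n) X.1) ≤ c n := not_lt.1 fun h => hcon (Or.inr h)
  have hclose := hAB n hn1
  have hpre : preDist 1 (A n) (B n) < 1 / 2 ^ n := lt_of_le_of_lt (le_max_left _ _) hclose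
  have hinv : 1 / (2 : ℝ) ^ n ≤ 1 / c n := by
    rw [← hcsq n]
    have : 1 ≤ c n := one_le_pow₀ hs2.le
    exact one_div_le_one_div_of_le (hcpos n) (by nlinarith)
  have hd1 : dist (torusMap (A n) X.1) (torusMap (B n) X.1) ≤ 1 / c n :=
    ((hA n).1.dist_torusMap_le (hB n) hpre X.1).trans hinv
  set x := torusRep X.1 with hx
  set e := dir (circleRep X.2) with he
  -- The chain rule for H⁻¹∘A = R^m∘H⁻¹; the rotation will drop out because its derivative is 1.
  have hJ : jac (⇑(H n)⁻¹) (A n x) * jac (A n) x = jac (⇑(rot (t n) ^ m n)) ((H n)⁻¹ x) * jac (⇑(H n)⁻¹) x := by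
    rw [← (hH n).1.inv.jac_mul (hA n).1, ← ((IsTorusDiffeo.rot (t n)).pow (m n)).jac_mul (hH n).1.inv]
    congr 2
    rw [inv_mul_eq_iff_eq_mul, ← mul_assoc, ← hAH n, mul_assoc, mul_inv_cancel, mul_one]
  have hrot : ∀ (k : ℕ) (y : Plane), jac (⇑(rot (t n) ^ k)) y = 1 := by
    intro k
    induction k with
    | zero => intro y; rw [pow_zero, jac_id]
    | succ k ih => intro y; rw [pow_succ, ((IsTorusDiffeo.rot (t n)).pow k).jac_mul (.rot _), ih, jac_rot, one_mul]
  rw [hrot, one_mul] at hJ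
  have hu2 : u n (torusMap (A n) X.1) = sqSum (jac (⇑(H n)⁻¹) (A n x)) := by
    simp only [hu]
    rw [(hH n).1.inv.jac_torusRep_torusMap]
  have h1 : (1 : ℝ) ≤ u n X.1 * (u n (torusMap (A n) X.1) * eucl (jac (A n) x *ᵥ e) ^ 2) := by
    have h2 := eucl_sq_le_mulVec ((hH n).inv.2 x) e
    have hJe : jac (⇑(H n)⁻¹) x *ᵥ e = jac (⇑(H n)⁻¹) (A n x) *ᵥ (jac (A n) x *ᵥ e) := by
      rw [Matrix.mulVec_mulVec, hJ]
    rw [hJe, he, eucl_dir, one_pow] at h2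
    refine h2.trans (mul_le_mul_of_nonneg_left ?_ (sqSum_nonneg _))
    rw [hu2]
    exact eucl_mulVec_sq_le _ _
  have hE : (1 : ℝ) ≤ (c n * eucl (jac (A n) x *ᵥ e)) ^ 2 := by
    have h0 : 0 ≤ u n X.1 := sqSum_nonneg _
    have h0' : 0 ≤ u n (torusMap (A n) X.1) := sqSum_nonneg _
    have hq := sq_nonneg (eucl (jac (A n) x *ᵥ e))
    calc (1 : ℝ) ≤ _ := h1
      _ ≤ c n * (c n * eucl (jac (A n) x *ᵥ e) ^ 2) :=
        mul_le_mul hz1 (mul_le_mul_of_nonneg_right hz2 hq) (mul_nonneg h0' hq) (hcpos n).le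
      _ = _ := by ring
  have hE' : 1 ≤ c n * eucl (jac (A n) x *ᵥ e) := by
    have := abs_le_of_sq_le_sq' (a := 1) (by simpa using hE)
      (mul_nonneg (hcpos n).le (eucl_nonneg (jac (A n) x *ᵥ e)))
    exact this.2
  have hd2 : dist (projExt (A n) X).2 (projExt (B n) X).2 ≤ 1 / c n := by
    have h3 := dist_lineCoord_mulVec_le ((hA n).1.det_jac_ne_zero x) ((hB n).det_jac_ne_zero x)
      (c := 1 / 2 ^ n) (fun i j => ((hA n).1.abs_jac_sub_le (hB n) le_rfl x i j).trans hpre.le)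
      (dir_ne_zero (circleRep X.2))
    rw [eucl_dir, mul_one, dist_comm] at h3
    change dist (projExt (A n) X).2 (projExt (B n) X).2 * eucl (jac (A n) x *ᵥ e) ≤ _ at h3
    have h4 : (0 : ℝ) ≤ dist (projExt (A n) X).2 (projExt (B n) X).2 := dist_nonneg
    rw [le_div_iff₀ (hcpos n)]
    rw [← hcsq n, le_div_iff₀ (mul_pos (hcpos n) (hcpos n))] at h3
    calc dist (projExt (A n) X).2 (projExt (B n) X).2 * c n
        ≤ dist (projExt (A n) X).2 (projExt (B n) X).2 * c n * (c n * eucl (jac (A n) x *ᵥ e)) :=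
          le_mul_of_one_le_right (mul_nonneg h4 (hcpos n).le) hE'
      _ = dist (projExt (A n) X).2 (projExt (B n) X).2 * eucl (jac (A n) x *ᵥ e) * (c n * c n) := by ring
      _ ≤ 1 := h3
  exact absurd hX (not_lt.2 ((max_le hd1 hd2).trans hn.le))

section AsymptoticEquality

variable {X : Type*} [MetricSpace X] [CompactSpace X] [MeasurableSpace X] [BorelSpace X]
  {ν : Measure X} [IsProbabilityMeasure ν]

theorem integrable_of_abs_le {Y : Type*} [MeasurableSpace Y] {μ : Measure Y} [IsFiniteMeasure μ]
    {ψ : Y → ℝ} (hψ : Measurable ψ) {M : ℝ} (hM : ∀ x, |ψ x| ≤ M) : Integrable ψ μ :=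
  Integrable.of_bound hψ.aestronglyMeasurable M (Eventually.of_forall hM)

/-- If two sequences of maps are asymptotically equal in measure, then so are their compositions
with a bounded measurable function. -/
theorem tendsto_integral_abs_comp_sub_comp {S T : ℕ → X → X} {τ : ℕ → ℝ} (hS : ∀ n, Measurable (S n))
    (hT : ∀ n, MeasurePreserving (T n) ν ν) (hτ : Tendsto τ atTop (𝓝 0))
    (hSν : ∀ n, IntegralClose (ν.map (S n)) ν (τ n))
    (hST : ∀ η > 0, Tendsto (fun n => ν {x | η < dist (S n x) (T n x)}) atTop (𝓝 0))
    {ψ : X → ℝ} (hψ : Measurable ψ) {M : ℝ} (hM : ∀ x, |ψ x| ≤ M) :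
    Tendsto (fun n => ∫ x, |ψ (T n x) - ψ (S n x)| ∂ν) atTop (𝓝 0) := by
  refine Metric.tendsto_atTop.2 fun η hη => ?_
  obtain ⟨χ, hχ, -⟩ := (integrable_of_abs_le (μ := ν) hψ hM).exists_boundedContinuous_integral_sub_le
    (ε := η / 5) (by positivity)
  have hχm := χ.continuous.measurable
  set K := ‖χ‖ with hK
  have hχb : ∀ x, |χ x| ≤ K := χ.norm_coe_le_norm
  have hM0 : ∀ x : X, 0 ≤ M := fun x => (abs_nonneg _).trans (hM x)
  have hK0 : 0 ≤ K := norm_nonneg _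
  have hdb : ∀ x, |(|ψ x - χ x|)| ≤ |M| + K + 1 := fun x => by
    rw [abs_abs]
    have := (abs_sub (ψ x) (χ x)).trans (add_le_add (hM x) (hχb x))
    have := le_abs_self M
    linarith
  have hdm : Measurable fun x => |ψ x - χ x| := (hψ.sub hχm).abs
  have hunif := CompactSpace.uniformContinuous_of_continuous χ.continuous
  obtain ⟨δ, hδ, hχu⟩ := Metric.uniformContinuous_iff.1 hunif (η / 5) (by positivity)
  -- On the exceptional set the two values of χ differ by at most 2K, so this measure bound makes
  -- its contribution less than η/5.
  have hmeasure := ENNReal.tendsto_nhds_zero.1 (hST (δ / 2) (by positivity))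
    (ENNReal.ofReal (η / (5 * (2 * K + 1)))) (by simpa using by positivity)
  have hτs : ∀ᶠ n in atTop, (|M| + K + 1) * τ n < η / 5 := by
    have : Tendsto (fun n => (|M| + K + 1) * τ n) atTop (𝓝 0) := by simpa using hτ.const_mul _
    exact this.eventually_lt_const (by positivity)
  obtain ⟨n₀, hn₀⟩ := eventually_atTop.1 (hmeasure.and hτs)
  refine ⟨n₀, fun n hn => ?_⟩
  obtain ⟨h1, h2⟩ := hn₀ n hn
  have hTn := (hT n).measurable
  have hSn := hS n
  rw [Real.dist_eq, sub_zero, abs_of_nonneg (integral_nonneg fun _ => abs_nonneg _)]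
  set B := {x | δ / 2 < dist (S n x) (T n x)} with hB
  have hBm : MeasurableSet B := measurableSet_lt measurable_const (hSn.dist hTn)
  have hBr : ν.real B ≤ η / (5 * (2 * K + 1)) :=
    ENNReal.toReal_le_of_le_ofReal (by positivity) h1
  have hi : ∀ {u : X → ℝ}, Measurable u → ∀ {L : ℝ}, (∀ x, |u x| ≤ L) → Integrable u ν :=
    fun hu _ hL => integrable_of_abs_le hu hL
  -- The comparison goes through continuous χ: the outer terms are L¹ errors transported by almost
  -- invariant maps, the middle one is uniform continuity off B.
  have hpt : ∀ x, |ψ (T n x) - ψ (S n x)| ≤ |ψ (T n x) - χ (T n x)|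
      + (η / 5 + B.indicator (fun _ => 2 * K) x) + |ψ (S n x) - χ (S n x)| := by
    intro x
    have hmid : |χ (T n x) - χ (S n x)| ≤ η / 5 + B.indicator (fun _ => 2 * K) x := by
      by_cases hx : x ∈ B
      · rw [indicator_of_mem hx]
        have := (abs_sub (χ (T n x)) (χ (S n x))).trans (add_le_add (hχb _) (hχb _))
        have : 0 < η / 5 := by positivity
        linarith
      · rw [indicator_of_notMem hx, add_zero]
        have hx : dist (S n x) (T n x) ≤ δ / 2 := not_lt.1 hx
        have := hχu (a := T n x) (b := S n x) (by rw [dist_comm]; linarith)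
        rw [Real.dist_eq] at this
        exact this.le
    calc |ψ (T n x) - ψ (S n x)|
        = |(ψ (T n x) - χ (T n x)) + (χ (T n x) - χ (S n x)) + (χ (S n x) - ψ (S n x))| := by
          congr 1; ring
      _ ≤ |ψ (T n x) - χ (T n x)| + |χ (T n x) - χ (S n x)| + |χ (S n x) - ψ (S n x)| :=
          abs_add_three _ _ _
      _ ≤ _ := by rw [abs_sub_comm (χ (S n x))]; gcongr
  have i1 : Integrable (fun x => |ψ (T n x) - χ (T n x)|) ν := hi (hdm.comp hTn) fun x => hdb (T n x)
  have i3 : Integrable (fun x => |ψ (S n x) - χ (S n x)|) ν := hi (hdm.comp hSn) fun x => hdb (S n x)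
  have i2' : Integrable (B.indicator fun _ => 2 * K) ν := (integrable_const _).indicator hBm
  have i2 : Integrable (fun x => η / 5 + B.indicator (fun _ => 2 * K) x) ν :=
    (integrable_const _).add i2'
  have e1 : ∫ x, |ψ (T n x) - χ (T n x)| ∂ν ≤ η / 5 := by
    have : ∫ x, |ψ (T n x) - χ (T n x)| ∂ν = ∫ x, |ψ x - χ x| ∂ν := by
      conv_rhs => rw [← (hT n).map_eq]
      rw [integral_map hTn.aemeasurable hdm.aestronglyMeasurable]
    rw [this]
    exact hχ
  have e3 : ∫ x, |ψ (S n x) - χ (S n x)| ∂ν ≤ η / 5 + η / 5 := by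
    have h := (hSν n).abs_sub_le hdm (by positivity) hdb
    rw [integral_map hSn.aemeasurable hdm.aestronglyMeasurable] at h
    have := (abs_le.1 h).2
    have hχ' : ∫ x, |ψ x - χ x| ∂ν ≤ η / 5 := hχ
    linarith
  have e2 : ∫ x, (η / 5 + B.indicator (fun _ => 2 * K) x) ∂ν < η / 5 + η / 5 := by
    rw [integral_add (integrable_const _) i2', integral_const, integral_indicator_const _ hBm]
    simp only [probReal_univ, smul_eq_mul, one_mul]
    have : ν.real B * (2 * K) ≤ η / (5 * (2 * K + 1)) * (2 * K) :=
      mul_le_mul_of_nonneg_right hBr (by positivity)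
    have h5 : η / (5 * (2 * K + 1)) * (2 * K) < η / 5 := by
      rw [div_mul_eq_mul_div, div_lt_div_iff₀ (by positivity) (by positivity)]
      nlinarith
    linarith
  calc ∫ x, |ψ (T n x) - ψ (S n x)| ∂ν
      ≤ ∫ x, (|ψ (T n x) - χ (T n x)| + (η / 5 + B.indicator (fun _ => 2 * K) x)
        + |ψ (S n x) - χ (S n x)|) ∂ν :=
        integral_mono_of_nonneg (Eventually.of_forall fun _ => abs_nonneg _) ((i1.add i2).add i3)
          (Eventually.of_forall hpt)
    _ = ∫ x, |ψ (T n x) - χ (T n x)| ∂ν + ∫ x, (η / 5 + B.indicator (fun _ => 2 * K) x) ∂ν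
        + ∫ x, |ψ (S n x) - χ (S n x)| ∂ν := by
        have i12 : Integrable (fun x => |ψ (T n x) - χ (T n x)|
          + (η / 5 + B.indicator (fun _ => 2 * K) x)) ν := i1.add i2
        rw [integral_add i12 i3, integral_add i1 i2]
    _ < η := by linarith

end AsymptoticEquality

/-! ### The stepwise shear -/

/-- The quantity `ε / a` in the definition of the good strips. -/
noncomputable def stripMargin (n k : ℕ) : ℝ := 1 / (2 * (n : ℝ) ^ 5 * (k : ℝ) ^ 10) / (k : ℝ) ^ 5

/-- The heights that lie in a good strip, at a definite distance from its boundary. -/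
def innerHeights (n k : ℕ) : Set UnitAddCircle :=
  {t | ∃ j < k ^ 5, circleRep t ∈ Icc ((j : ℝ) / (k : ℝ) ^ 5 + 3 * stripMargin n k)
    (((j : ℝ) + 1) / (k : ℝ) ^ 5 - 3 * stripMargin n k)}

theorem stripMargin_nonneg (n k : ℕ) : 0 ≤ stripMargin n k := by unfold stripMargin; positivity

theorem mem_goodStrip_iff {n k j : ℕ} {z : Torus} :
    z ∈ goodStrip n k j ↔ circleRep (z 1) ∈ Icc ((j : ℝ) / (k : ℝ) ^ 5 + 2 * stripMargin n k)
      (((j : ℝ) + 1) / (k : ℝ) ^ 5 - 2 * stripMargin n k) := by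
  have e1 : ((j : ℝ) + 2 * (1 / (2 * (n : ℝ) ^ 5 * (k : ℝ) ^ 10))) / (k : ℝ) ^ 5
      = (j : ℝ) / (k : ℝ) ^ 5 + 2 * stripMargin n k := by unfold stripMargin; ring
  have e2 : ((j : ℝ) + 1 - 2 * (1 / (2 * (n : ℝ) ^ 5 * (k : ℝ) ^ 10))) / (k : ℝ) ^ 5
      = ((j : ℝ) + 1) / (k : ℝ) ^ 5 - 2 * stripMargin n k := by unfold stripMargin; ring
  rw [← e1, ← e2]
  rfl

theorem measurableSet_innerHeights (n k : ℕ) : MeasurableSet (innerHeights n k) := by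
  have : innerHeights n k = ⋃ j ∈ Finset.range (k ^ 5), circleRep ⁻¹'
      Icc ((j : ℝ) / (k : ℝ) ^ 5 + 3 * stripMargin n k)
        (((j : ℝ) + 1) / (k : ℝ) ^ 5 - 3 * stripMargin n k) := by
    ext t
    simp only [innerHeights, mem_ofPred_eq, mem_iUnion, Finset.mem_range, mem_preimage, exists_prop]
  rw [this]
  exact Finset.measurableSet_biUnion _ fun j _ => measurable_circleRep measurableSet_Icc

theorem volume_innerHeights_compl_le {n k : ℕ} (hk : 0 < k) :
    volume (innerHeights n k)ᶜ ≤ ENNReal.ofReal (6 * ((k : ℝ) ^ 5 * stripMargin n k)) := by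
  set m := stripMargin n k
  have hm0 : 0 ≤ m := stripMargin_nonneg n k
  have ha : (0 : ℝ) < (k : ℝ) ^ 5 := by positivity
  have hmeas := (measurableSet_innerHeights n k).compl
  rw [← (AddCircle.measurePreserving_mk 1 0).measure_preimage hmeas.nullMeasurableSet,
    Measure.restrict_apply (AddCircle.measurable_mk' hmeas)]
  set U : ℕ → Set ℝ := fun j => Icc ((j : ℝ) / (k : ℝ) ^ 5) ((j : ℝ) / (k : ℝ) ^ 5 + 3 * m) ∪
    Icc (((j : ℝ) + 1) / (k : ℝ) ^ 5 - 3 * m) (((j : ℝ) + 1) / (k : ℝ) ^ 5) with hU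
  -- The measure is computed on (0, 1], while `circleRep` takes values in [0, 1); the point 1 is
  -- split off as a null set. Every other uncontrolled height is within 3m of an end of its strip.
  have hsub : ((fun x : ℝ => (x : AddCircle (1 : ℝ))) ⁻¹' (innerHeights n k)ᶜ) ∩ Ioc (0 : ℝ) (0 + 1)
      ⊆ {1} ∪ ⋃ j ∈ Finset.range (k ^ 5), U j := by
    rintro x ⟨hx, hx0, hx1⟩
    rw [zero_add] at hx1
    rcases hx1.eq_or_lt with h1 | h1
    · exact Or.inl h1
    refine Or.inr ?_
    have hfl := Nat.floor_le (a := x * (k : ℝ) ^ 5) (by positivity)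
    have hfl' := Nat.lt_floor_add_one (x * (k : ℝ) ^ 5)
    set j := ⌊x * (k : ℝ) ^ 5⌋₊ with hj
    have hjlt : j < k ^ 5 := by
      have : (j : ℝ) < ((k ^ 5 : ℕ) : ℝ) := by
        push_cast
        nlinarith
      exact_mod_cast this
    have hl : (j : ℝ) / (k : ℝ) ^ 5 ≤ x := by rw [div_le_iff₀ ha]; exact hfl
    have hr : x ≤ ((j : ℝ) + 1) / (k : ℝ) ^ 5 := by rw [le_div_iff₀ ha]; exact hfl'.le
    simp only [mem_iUnion, Finset.mem_range]
    refine ⟨j, hjlt, ?_⟩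
    by_contra hcon
    apply hx
    refine ⟨j, hjlt, ?_⟩
    change circleRep (x : UnitAddCircle) ∈ _
    rw [circleRep_coe ⟨hx0.le, h1⟩]
    constructor
    · by_contra h
      exact hcon (Or.inl ⟨hl, (not_le.1 h).le⟩)
    · by_contra h
      exact hcon (Or.inr ⟨(not_le.1 h).le, hr⟩)
  refine (measure_mono hsub).trans ((measure_union_le _ _).trans ?_)
  rw [Real.volume_singleton, zero_add]
  refine (measure_biUnion_finset_le _ _).trans ?_
  have hUj : ∀ j ∈ Finset.range (k ^ 5), volume (U j) ≤ ENNReal.ofReal (6 * m) := by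
    intro j _
    refine (measure_union_le _ _).trans ?_
    rw [Real.volume_Icc, Real.volume_Icc, ← ENNReal.ofReal_add (by linarith) (by linarith)]
    refine ENNReal.ofReal_le_ofReal (le_of_eq ?_)
    ring
  refine (Finset.sum_le_sum hUj).trans_eq ?_
  rw [Finset.sum_const, Finset.card_range, ← ENNReal.ofReal_nsmul]
  congr 1
  rw [nsmul_eq_mul]
  push_cast
  ring

/-- Points close to an inner point of a good strip have representatives that are close. -/
theorem circleRep_mem_Ioo_of_dist_lt {t s : UnitAddCircle} {a b m : ℝ} (ha : 0 ≤ a) (hb : b ≤ 1)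
    (ht : circleRep t ∈ Icc (a + 3 * m) (b - 3 * m)) (h : dist t s < m) :
    circleRep s ∈ Ioo (a + 2 * m) (b - 2 * m) := by
  obtain ⟨d, hd, hd'⟩ := exists_coe_eq_abs (s - t)
  rw [dist_comm, dist_eq_norm, ← hd'] at h
  obtain ⟨h1, h2⟩ := abs_lt.1 h
  have hs : s = ((circleRep t + d : ℝ) : UnitAddCircle) := by
    rw [AddCircle.coe_add, coe_circleRep, hd]; abel
  have : circleRep s = circleRep t + d := by
    rw [hs, circleRep_coe]
    exact ⟨by linarith [ht.1], by linarith [ht.2]⟩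
  rw [this]
  exact ⟨by linarith [ht.1], by linarith [ht.2]⟩

theorem strip_bounds {k j : ℕ} (hj : j < k ^ 5) :
    0 ≤ (j : ℝ) / (k : ℝ) ^ 5 ∧ ((j : ℝ) + 1) / (k : ℝ) ^ 5 ≤ 1 := by
  refine ⟨by positivity, ?_⟩
  refine div_le_one_of_le₀ ?_ (by positivity)
  exact_mod_cast hj

section Shear

variable {n k q : ℕ} {σ : ℝ} {g : Equiv.Perm Plane}

/-- The translation property is known only modulo ℤ². The integer vector by which the lift differs
from the translation depends continuously on the point, so it is locally constant and the derivative
is the identity. -/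
theorem AbC.IsStepShear.jac_eq_one (hg : IsStepShear n k q σ g) {j : ℕ} (hj : j < k ^ 5) {z : Torus}
    (hz : circleRep (z 1) ∈ Ioo ((j : ℝ) / (k : ℝ) ^ 5 + 2 * stripMargin n k)
      (((j : ℝ) + 1) / (k : ℝ) ^ 5 - 2 * stripMargin n k)) : jac g (torusRep z) = 1 := by
  set x := torusRep z with hx
  set v : Plane := ![(shearSize n q σ : ℝ) * j / (k : ℝ) ^ 5, 0] with hv
  set w : Plane → Plane := fun y => g y - y - v with hw
  have hgc := hg.area.1.continuous
  have hwc : Continuous w := (hgc.sub continuous_id).sub continuous_const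
  have hb := strip_bounds hj
  have hm := stripMargin_nonneg n k
  set U : Set Plane := {y | y 1 ∈ Ioo ((j : ℝ) / (k : ℝ) ^ 5 + 2 * stripMargin n k)
      (((j : ℝ) + 1) / (k : ℝ) ^ 5 - 2 * stripMargin n k)} with hU
  have hUo : IsOpen U := isOpen_Ioo.preimage (continuous_apply 1)
  have hint : ∀ y ∈ U, ∃ a : Fin 2 → ℤ, w y = fun i => (a i : ℝ) := by
    intro y hy
    have hy : y 1 ∈ Ioo ((j : ℝ) / (k : ℝ) ^ 5 + 2 * stripMargin n k)
      (((j : ℝ) + 1) / (k : ℝ) ^ 5 - 2 * stripMargin n k) := hy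
    have hmem : toTorus y ∈ goodStrip n k j := by
      rw [mem_goodStrip_iff]
      change circleRep ((y 1 : ℝ) : UnitAddCircle) ∈ _
      rw [circleRep_coe ⟨by linarith [hy.1, hb.1], by linarith [hy.2, hb.2]⟩]
      exact Ioo_subset_Icc_self hy
    have h := hg.translate j hj _ hmem
    rw [hg.area.1.torusMap_toTorus, ← toTorus_add] at h
    obtain ⟨a, ha⟩ := toTorus_eq_iff.1 h
    refine ⟨a, ?_⟩
    change g y - y - v = _
    rw [ha]
    abel
  have hxU : x ∈ U := hz
  have hnear : ∀ᶠ y in 𝓝 x, w y = w x := by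
    have h1 : ∀ᶠ y in 𝓝 x, dist (w y) (w x) < 1 := hwc.continuousAt.eventually
      (Metric.ball_mem_nhds _ one_pos)
    filter_upwards [h1, hUo.mem_nhds hxU] with y hy hyU
    obtain ⟨a, ha⟩ := hint y hyU
    obtain ⟨b, hb⟩ := hint x hxU
    rw [ha, hb] at hy ⊢
    funext i
    have := lt_of_le_of_lt (dist_le_pi_dist _ _ i) hy
    simp only [Real.dist_eq] at this
    have h2 : |a i - b i| < 1 := by exact_mod_cast this
    have h3 : a i = b i := by
      have := Int.abs_lt_one_iff.1 h2
      omega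
    rw [h3]
  have heq : ⇑g =ᶠ[𝓝 x] fun y => y + (v + w x) := by
    filter_upwards [hnear] with y hy
    rw [← hy]
    simp only [hw]
    abel
  rw [← jac_id x]
  simp only [jac, heq.fderiv_eq]
  rw [fderiv_add_const]
  rfl

/-- If `z` is an inner point of a strip, and `w` is close to it, then `g` acts on both as the same
translation. -/
theorem AbC.IsStepShear.exists_translation (hg : IsStepShear n k q σ g) {z : Torus}
    (hz : z 1 ∈ innerHeights n k) : ∃ v : Torus, v 1 = 0 ∧
      (∀ w, dist (z 1) (w 1) < stripMargin n k → torusMap g w = w + v) ∧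
      (∀ w, dist (z 1) (w 1) < stripMargin n k → jac g (torusRep w) = 1) ∧
      dist (v 0) (shearSize n q σ • z 1) ≤ (shearSize n q σ : ℝ) / (k : ℝ) ^ 5 := by
  obtain ⟨j, hj, hzj⟩ := hz
  have hb := strip_bounds hj
  have hm := stripMargin_nonneg n k
  refine ⟨toTorus ![(shearSize n q σ : ℝ) * j / (k : ℝ) ^ 5, 0], rfl, fun w hw => ?_, fun w hw => ?_, ?_⟩
  · refine hg.translate j hj w (mem_goodStrip_iff.2 ?_)
    exact Ioo_subset_Icc_self (circleRep_mem_Ioo_of_dist_lt hb.1 hb.2 hzj hw)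
  · exact hg.jac_eq_one hj (circleRep_mem_Ioo_of_dist_lt hb.1 hb.2 hzj hw)
  · set b := shearSize n q σ
    change dist (((b : ℝ) * j / (k : ℝ) ^ 5 : ℝ) : UnitAddCircle) _ ≤ _
    have e : b • z 1 = ((b * circleRep (z 1) : ℝ) : UnitAddCircle) := by
      conv_lhs => rw [← coe_circleRep (z 1)]
      rw [← nsmul_eq_mul, AddCircle.coe_nsmul]
    rw [e, dist_eq_norm, ← AddCircle.coe_sub]
    refine (norm_toTorus_le (fun _ => (b : ℝ) * j / (k : ℝ) ^ 5 - b * circleRep (z 1)) |>.trans' ?_).trans ?_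
    · exact norm_le_pi_norm (toTorus fun _ => (b : ℝ) * j / (k : ℝ) ^ 5 - b * circleRep (z 1)) 0
    · refine (pi_norm_le_iff_of_nonneg (by positivity)).2 fun _ => ?_
      -- The translation length and b·z₁ are b times two heights of one strip, whose width is 1/k⁵:
      -- the stepwise shear is this close to the linear one.
      have e2 : (b : ℝ) * j / (k : ℝ) ^ 5 - b * circleRep (z 1)
          = b * ((j : ℝ) / (k : ℝ) ^ 5 - circleRep (z 1)) := by ring
      have e3 : (b : ℝ) / (k : ℝ) ^ 5 = b * (((j : ℝ) + 1) / (k : ℝ) ^ 5 - (j : ℝ) / (k : ℝ) ^ 5) := by ring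
      rw [e2, e3, Real.norm_eq_abs, abs_mul, Nat.abs_cast]
      refine mul_le_mul_of_nonneg_left ?_ (by positivity)
      rw [abs_le]
      constructor <;> linarith [hzj.1, hzj.2]

end Shear

/-! ### Comparison of one step of the two constructions -/

/-- The point may lie on the boundary of the closed square. A convex set with nonempty interior
still determines derivatives uniquely, so the full derivative is the rotation. -/
theorem fderiv_of_isRigidOn {F : Plane → Plane} {x₀ x : Plane} {s : ℝ} (hs : 0 < s)
    (hF : DifferentiableAt ℝ F x) (hR : IsRigidOn F (square x₀ s)) (hx : x ∈ square x₀ s) :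
    ∃ β : ℝ, jac F x = !![Real.cos β, -Real.sin β; Real.sin β, Real.cos β] := by
  obtain ⟨β, c, h⟩ := hR
  refine ⟨β, ?_⟩
  set R := !![Real.cos β, -Real.sin β; Real.sin β, Real.cos β]
  have hsq : square x₀ s = Icc x₀ (x₀ + fun _ => s) := by
    ext y
    exact ⟨fun h => ⟨fun i => (h i).1, fun i => (h i).2⟩, fun h i => ⟨h.1 i, h.2 i⟩⟩
  have hU : UniqueDiffWithinAt ℝ (square x₀ s) x := by
    refine uniqueDiffWithinAt_convex ?_ ?_ (subset_closure hx)
    · rw [hsq]; exact convex_Icc _ _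
    · refine ⟨x₀ + fun _ => s / 2, ?_⟩
      rw [mem_interior]
      refine ⟨univ.pi fun i => Ioo (x₀ i) (x₀ i + s), ?_, isOpen_set_pi finite_univ fun _ _ => isOpen_Ioo, ?_⟩
      · intro y hy i
        exact Ioo_subset_Icc_self (hy i (mem_univ i))
      · intro i _
        simp only [Pi.add_apply, mem_Ioo]
        constructor <;> linarith
  have h1 : HasFDerivWithinAt F (fderiv ℝ F x) (square x₀ s) x := hF.hasFDerivAt.hasFDerivWithinAt
  have h2 : HasFDerivWithinAt F (Matrix.mulVecLin R).toContinuousLinearMap (square x₀ s) x := by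
    have : HasFDerivAt (fun y : Plane => R *ᵥ y + c) (Matrix.mulVecLin R).toContinuousLinearMap x :=
      ((Matrix.mulVecLin R).toContinuousLinearMap.hasFDerivAt (x := x)).add_const c
    exact this.hasFDerivWithinAt.congr h (h x hx)
  have h3 := hU.eq h1 h2
  apply Matrix.toLin'.injective
  rw [toLin'_jac, h3]
  rfl

theorem eucl_rotation_mulVec (β : ℝ) (v : Plane) :
    eucl (!![Real.cos β, -Real.sin β; Real.sin β, Real.cos β] *ᵥ v) = eucl v := by
  rw [eucl, eucl]
  congr 1
  simp [Matrix.mulVec, dotProduct]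
  nlinarith [Real.sin_sq_add_cos_sq β]

theorem abs_rotation_le (β : ℝ) (i j : Fin 2) :
    |!![Real.cos β, -Real.sin β; Real.sin β, Real.cos β] i j| ≤ 1 := by
  fin_cases i <;> fin_cases j <;> simp [Real.abs_cos_le_one, Real.abs_sin_le_one]

theorem abs_mul_apply_le {A B : Matrix (Fin 2) (Fin 2) ℝ} {a b : ℝ} (hA : ∀ i j, |A i j| ≤ a)
    (hB : ∀ i j, |B i j| ≤ b) (i j : Fin 2) : |(A * B) i j| ≤ 2 * a * b := by
  have ha : 0 ≤ a := (abs_nonneg _).trans (hA 0 0)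
  rw [Matrix.mul_apply, Fin.sum_univ_two]
  refine (abs_add_le _ _).trans ?_
  rw [abs_mul, abs_mul]
  have h0 := mul_le_mul (hA i 0) (hB 0 j) (abs_nonneg _) ha
  have h1 := mul_le_mul (hA i 1) (hB 1 j) (abs_nonneg _) ha
  linarith

/-- From A - CB = (A - B) + (1 - C)B with the entries of B at most 2: the constant is 1 + 2·2. -/
theorem abs_sub_apply_le_of_perturbation {A B C : Matrix (Fin 2) (Fin 2) ℝ} {ε : ℝ} (hε : ε ≤ 1)
    (hA : ∀ i j, |A i j| ≤ 1) (hB : ∀ i j, |(A - B) i j| ≤ ε) (hC : ∀ i j, |(1 - C) i j| ≤ ε)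
    (i j : Fin 2) : |(A - C * B) i j| ≤ 5 * ε := by
  have hB2 : ∀ i j, |B i j| ≤ 2 := fun i j => by
    have h1 := abs_le.1 (hB i j)
    have h2 := abs_le.1 (hA i j)
    rw [Matrix.sub_apply] at h1
    rw [abs_le]
    constructor <;> linarith
  have e : A - C * B = (A - B) + (1 - C) * B := by rw [sub_mul, one_mul]; abel
  rw [e, Matrix.add_apply]
  refine (abs_add_le _ _).trans ?_
  have h1 := abs_mul_apply_le hC hB2 i j
  have h2 := hB i j
  linarith

section OneStep

variable {n k q : ℕ} {σ ε : ℝ} {g φ g' φ' : Equiv.Perm Plane}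

theorem preDist_lt_of_diffeoDist_lt {s : ℕ} {F G : Equiv.Perm Plane} (h : diffeoDist s F G < ε) :
    preDist s F G < ε := lt_of_le_of_lt (le_max_left _ _) h

/-- At points where `h` is rigid and that are mapped by `φ` well into a good strip, the two steps
are close together with their projectivized derivatives. -/
theorem dist_step_le (hg : IsStepShear n k q σ g) (hφ : IsAreaDiffeo φ) (hg' : IsAreaDiffeo g')
    (hφ' : IsAreaDiffeo φ') (hgg' : diffeoDist 2 g g' < ε) (hφφ' : diffeoDist 2 φ φ' < ε)
    (hε : ε < stripMargin n k) (hε1 : ε ≤ 1) {Y : ProjBundle}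
    (hY : (torusMap φ Y.1) 1 ∈ innerHeights n k)
    (hrig : ∃ β : ℝ, jac (⇑(g * φ)) (torusRep Y.1)
      = !![Real.cos β, -Real.sin β; Real.sin β, Real.cos β]) :
    dist (torusMap (⇑(g * φ)) Y.1) (torusMap (⇑(g' * φ')) Y.1) ≤ 2 * ε ∧
      dist (projExt (⇑(g * φ)) Y).2 (projExt (⇑(g' * φ')) Y).2 ≤ 5 * ε := by
  obtain ⟨v, hv1, htr, hjac, -⟩ := hg.exists_translation hY
  set y := Y.1 with hy
  have hpφ := preDist_lt_of_diffeoDist_lt hφφ'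
  have hpg := preDist_lt_of_diffeoDist_lt hgg'
  have hdφ := hφ.1.dist_torusMap_le hφ'.1 hpφ y
  have hd1 : dist (torusMap φ y 1) (torusMap φ' y 1) < stripMargin n k :=
    lt_of_le_of_lt (dist_le_pi_dist _ _ 1) (lt_of_le_of_lt hdφ hε)
  have hd0 : dist (torusMap φ y 1) (torusMap φ y 1) < stripMargin n k := by
    rw [dist_self]; exact lt_of_le_of_lt dist_nonneg (lt_of_le_of_lt hdφ hε)
  have hε0 : 0 ≤ ε := dist_nonneg.trans hdφ
  constructor
  · rw [hg.area.1.torusMap_mul, hg'.1.torusMap_mul]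
    calc dist (torusMap g (torusMap φ y)) (torusMap g' (torusMap φ' y))
        ≤ dist (torusMap g (torusMap φ y)) (torusMap g (torusMap φ' y))
          + dist (torusMap g (torusMap φ' y)) (torusMap g' (torusMap φ' y)) := dist_triangle _ _ _
      _ ≤ ε + ε := by
        refine add_le_add ?_ (hg.area.1.dist_torusMap_le hg'.1 hpg _)
        rw [htr _ hd0, htr _ hd1, dist_add_right]
        exact hdφ
      _ = 2 * ε := by ring
  · obtain ⟨β, hβ⟩ := hrig
    set x := torusRep y with hx
    have hj1 : jac g (φ x) = 1 := by
      rw [← hg.area.1.jac_torusRep_torusMap]; exact hjac _ hd0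
    have hj2 : jac g (φ' x) = 1 := by
      rw [← hg.area.1.jac_torusRep_torusMap]; exact hjac _ hd1
    -- As g has derivative 1 here, the rigidity of g∘φ passes to φ: its entries are at most 1. The
    -- image vector of g∘φ keeps its length, so no factor is lost in the distance of directions.
    have hφβ : jac φ x = !![Real.cos β, -Real.sin β; Real.sin β, Real.cos β] := by
      rw [← hβ, hg.area.1.jac_mul hφ.1, hj1, one_mul]
    have hE1 : ∀ i j, |(1 - jac g' (φ' x)) i j| ≤ ε := fun i j => by
      have := (hg.area.1.abs_jac_sub_le hg'.1 one_le_two (φ' x) i j).trans hpg.le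
      rwa [hj2] at this
    have hE2 : ∀ i j, |(jac φ x - jac φ' x) i j| ≤ ε := fun i j =>
      (hφ.1.abs_jac_sub_le hφ'.1 one_le_two x i j).trans hpφ.le
    have hφ1 : ∀ i j, |jac φ x i j| ≤ 1 := by
      rw [hφβ]; exact abs_rotation_le β
    have hdiff : ∀ i j, |(jac (⇑(g * φ)) x - jac (⇑(g' * φ')) x) i j| ≤ 5 * ε := by
      intro i j
      have e : jac (⇑(g * φ)) x = jac φ x := by rw [hg.area.1.jac_mul hφ.1, hj1, one_mul]
      have e' : jac (⇑(g' * φ')) x = jac g' (φ' x) * jac φ' x := hg'.1.jac_mul hφ'.1 x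
      generalize jac (⇑(g * φ)) x = P at e ⊢
      generalize jac (⇑(g' * φ')) x = P' at e' ⊢
      rw [e, e']
      exact abs_sub_apply_le_of_perturbation hε1 hφ1 hE2 hE1 i j
    have h := dist_lineCoord_mulVec_le ((hg.area.mul hφ).1.det_jac_ne_zero x)
      ((hg'.mul hφ').1.det_jac_ne_zero x) (fun i j => hdiff i j) (dir_ne_zero (circleRep Y.2))
    rw [hβ, eucl_rotation_mulVec, eucl_dir, mul_one, mul_one, ← hβ, dist_comm] at h
    exact h

set_option maxHeartbeats 1000000 in
/-- Near points that are mapped by `φ` well into a good strip, the analytic step is almost as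
Lipschitz as the smooth one. -/
theorem dist_analytic_step_le (hg : IsStepShear n k q σ g) (hφ : IsAreaDiffeo φ)
    (hg' : IsAreaDiffeo g') (hφ' : IsAreaDiffeo φ') (hgg' : diffeoDist 2 g g' < ε)
    (hφφ' : diffeoDist 2 φ φ' < ε) {D : ℝ} (hD : ∀ x i j, |jac (⇑(g * φ)) x i j| ≤ D) {y w : Torus}
    (hy : (torusMap φ y) 1 ∈ innerHeights n k) (hyw : 2 * D * dist y w + ε < stripMargin n k) :
    dist (torusMap (⇑(g' * φ')) y) (torusMap (⇑(g' * φ')) w)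
      ≤ (1 + 2 * ε) * ((2 * D + 2 * ε) * dist y w) := by
  obtain ⟨v, hv1, htr, hjac, -⟩ := hg.exists_translation hy
  have hpφ := preDist_lt_of_diffeoDist_lt hφφ'
  have hpg := preDist_lt_of_diffeoDist_lt hgg'
  have hdφ := hφ.1.dist_torusMap_le hφ'.1 hpφ y
  have hdφw := hφ.1.dist_torusMap_le hφ'.1 hpφ w
  have hε0 : 0 ≤ ε := dist_nonneg.trans hdφ
  have hdh := (hg.area.mul hφ).1.dist_torusMap_le_of_jac_le hD y w
  have hDd : 0 ≤ 2 * D * dist y w := dist_nonneg.trans hdh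
  have hd0 : dist (torusMap φ y 1) (torusMap φ y 1) < stripMargin n k := by
    rw [dist_self]; linarith
  have hgy : torusMap (⇑(g * φ)) y = torusMap φ y + v := by
    rw [hg.area.1.torusMap_mul]; exact htr _ hd0
  -- Nothing is known a priori about the height of φ(w). The candidate gφ(w) - v is close to φ(y) in
  -- height, hence g translates it by v to gφ(w), and injectivity of g identifies it with φ(w). In
  -- this way only a bound for d(g∘φ) is needed, not one for dφ.
  have hφw : torusMap φ w = torusMap (⇑(g * φ)) w - v := by
    have h1 : dist (torusMap φ y 1) ((torusMap (⇑(g * φ)) w - v) 1) < stripMargin n k := by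
      have e : torusMap φ y 1 = torusMap (⇑(g * φ)) y 1 := by
        rw [hgy, Pi.add_apply, hv1, add_zero]
      rw [e, Pi.sub_apply, hv1, sub_zero]
      exact lt_of_le_of_lt ((dist_le_pi_dist _ _ 1).trans hdh) (by linarith)
    have h2 := htr _ h1
    rw [sub_add_cancel, hg.area.1.torusMap_mul] at h2
    have h3 := congrArg (torusMap (⇑g⁻¹)) h2
    rw [hg.area.1.torusMap_inv_torusMap, hg.area.1.torusMap_inv_torusMap] at h3
    rw [← h3, hg.area.1.torusMap_mul]
  have hφyw : dist (torusMap φ y) (torusMap φ w) ≤ 2 * D * dist y w := by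
    have e : torusMap φ y = torusMap (⇑(g * φ)) y - v := by rw [hgy, add_sub_cancel_right]
    rw [e, hφw, dist_sub_right]
    exact hdh
  have hφ'yw : dist (torusMap φ' y) (torusMap φ' w) ≤ (2 * D + 2 * ε) * dist y w := by
    have := hφ.1.dist_torusMap_le_of_jac_sub_le hφ'.1
      (fun x i j => (hφ.1.abs_jac_sub_le hφ'.1 one_le_two x i j).trans hpφ.le) y w
    linarith
  have hin : ∀ u, dist (torusMap φ y) (torusMap φ u) ≤ 2 * D * dist y w →
      dist (torusMap φ u) (torusMap φ' u) ≤ ε →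
      dist (torusMap φ y 1) (torusMap φ' u 1) < stripMargin n k := by
    intro u h1 h2
    refine lt_of_le_of_lt (dist_le_pi_dist _ _ 1) ?_
    exact lt_of_le_of_lt ((dist_triangle _ _ _).trans (add_le_add h1 h2)) hyw
  have h1 := htr _ (hin y (by rw [dist_self]; exact hDd) hdφ)
  have h2 := htr _ (hin w hφyw hdφw)
  have h3 := hg.area.1.dist_torusMap_le_of_jac_sub_le hg'.1
      (fun x i j => (hg.area.1.abs_jac_sub_le hg'.1 one_le_two x i j).trans hpg.le)
      (torusMap φ' y) (torusMap φ' w)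
  rw [h1, h2, dist_add_right] at h3
  rw [hg'.1.torusMap_mul, hg'.1.torusMap_mul]
  calc _ ≤ (1 + 2 * ε) * dist (torusMap φ' y) (torusMap φ' w) := by linarith
    _ ≤ _ := mul_le_mul_of_nonneg_left hφ'yw (by linarith)

end OneStep

/-! ### Consequences of the requirements on the parameters -/

section Parameters

variable {k l q : ℕ → ℕ} {p : ℕ → ℤ} {H : ℕ → Equiv.Perm Plane}

theorem AbC.IsParameterSystem.one_le_k (h : IsParameterSystem k l q p H) {n : ℕ} (hn : 1 ≤ n) :
    1 ≤ k n := (Nat.one_le_pow _ _ hn).trans (h.le_k n hn)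

theorem AbC.IsParameterSystem.one_le_k_real (h : IsParameterSystem k l q p H) {n : ℕ} (hn : 1 ≤ n) :
    (1 : ℝ) ≤ k n := by exact_mod_cast h.one_le_k hn

theorem AbC.IsParameterSystem.k_lt_q (h : IsParameterSystem k l q p H) {n : ℕ} (hn : 1 ≤ n) :
    16 * (k n : ℝ) ^ 4 < q n := by
  have h1 := h.q_large n hn
  have h2 : ((q n : ℝ) ^ (1 / 4 : ℝ)) ^ 4 = q n := by
    rw [← Real.rpow_natCast, ← Real.rpow_mul (Nat.cast_nonneg _)]
    norm_num
  have h3 := pow_lt_pow_left₀ h1 (by positivity) (n := 4) (by norm_num)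
  rw [h2] at h3
  linarith [show (2 * (k n : ℝ)) ^ 4 = 16 * (k n : ℝ) ^ 4 by ring]

theorem AbC.IsParameterSystem.one_le_q (h : IsParameterSystem k l q p H) {n : ℕ} (hn : 1 ≤ n) :
    (1 : ℝ) ≤ q n := by
  have h1 := h.k_lt_q hn
  have h2 := one_le_pow₀ (h.one_le_k_real hn) (n := 4)
  linarith

theorem AbC.IsParameterSystem.le_l (h : IsParameterSystem k l q p H)
    (hH : ∀ n, IsAreaDiffeo (H n)) {n : ℕ} (hn : 1 ≤ n) :
    (k n : ℝ) ^ 10 * (q n : ℝ) ^ 2 ≤ l n := by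
  have h1 := h.l_large n hn
  have h2 := (hH (n - 1)).half_lt_derivNorm
  have h3 : 0 ≤ (k n : ℝ) ^ 10 * (q n : ℝ) ^ 2 := by positivity
  nlinarith

theorem AbC.IsParameterSystem.one_le_l (h : IsParameterSystem k l q p H)
    (hH : ∀ n, IsAreaDiffeo (H n)) {n : ℕ} (hn : 1 ≤ n) : (1 : ℝ) ≤ l n :=
  (one_le_mul_of_one_le_of_one_le (one_le_pow₀ (h.one_le_k_real hn))
    (one_le_pow₀ (h.one_le_q hn))).trans (h.le_l hH hn)

/-- Distinct fractions with denominators q_n and q_{n+1} differ by at least 1/(q_n q_{n+1}), whereas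
the step of α_n is 1/(k_n l_n q_n²). -/
theorem AbC.IsParameterSystem.mul_le_q_succ (h : IsParameterSystem k l q p H)
    (hH : ∀ n, IsAreaDiffeo (H n)) {n : ℕ} (hn : 1 ≤ n) :
    (k n : ℝ) * l n * q n ≤ q (n + 1) := by
  have hk := h.one_le_k_real hn
  have hq := h.one_le_q hn
  have hl := h.one_le_l hH hn
  have hq' := h.one_le_q (n := n + 1) (by omega)
  have hstep := h.step n hn
  have e : ((p (n + 1) : ℝ) * q n - p n * q (n + 1)) * ((k n : ℝ) * l n * q n) = q (n + 1) := by
    field_simp at hstep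
    linarith
  have hpos : 0 < (k n : ℝ) * l n * q n := by positivity
  have h1 : 0 < (p (n + 1) : ℝ) * q n - p n * q (n + 1) := by
    by_contra hcon
    have := mul_nonpos_of_nonpos_of_nonneg (not_lt.1 hcon) hpos.le
    linarith
  have h2 : (1 : ℝ) ≤ (p (n + 1) : ℝ) * q n - p n * q (n + 1) := by
    have : (0 : ℤ) < p (n + 1) * q n - p n * q (n + 1) := by exact_mod_cast h1
    have : (1 : ℤ) ≤ p (n + 1) * q n - p n * q (n + 1) := this
    exact_mod_cast this
  nlinarith

theorem AbC.IsParameterSystem.derivNorm_le (h : IsParameterSystem k l q p H)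
    (hH : ∀ n, IsAreaDiffeo (H n)) {n : ℕ} (hn : 1 ≤ n) :
    2 * (q n : ℝ) ^ 3 * derivNorm (H (n - 1)) ≤ q (n + 1) := by
  have hk := h.one_le_k_real hn
  have hq := h.one_le_q hn
  have hM := (hH (n - 1)).half_lt_derivNorm
  calc 2 * (q n : ℝ) ^ 3 * derivNorm (H (n - 1))
      = 1 * (2 * 1 * (q n : ℝ) ^ 2 * derivNorm (H (n - 1))) * q n := by ring
    _ ≤ k n * (2 * (k n : ℝ) ^ 10 * (q n : ℝ) ^ 2 * derivNorm (H (n - 1))) * q n := by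
        gcongr
        exact one_le_pow₀ hk
    _ ≤ k n * l n * q n := by
        gcongr
        exact h.l_large n hn
    _ ≤ _ := h.mul_le_q_succ hH hn

/-- The scale `1 / (2^(n²+1) q_n⁴ ‖DH_{n-1}‖²)`. -/
noncomputable def driftScale (q : ℕ → ℕ) (H : ℕ → Equiv.Perm Plane) (n : ℕ) : ℝ :=
  1 / (2 ^ (n ^ 2 + 1) * (q n : ℝ) ^ 4 * derivNorm (H (n - 1)) ^ 2)

/-- Successive drifts at least halve, so their tail is at most twice its first term. The growth of
q_{n+1} dominates ‖DH_{n-1}‖; of ‖DH_n‖ only the lower bound 1/2 is needed. -/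
theorem AbC.IsParameterSystem.driftScale_succ_le (h : IsParameterSystem k l q p H)
    (hH : ∀ n, IsAreaDiffeo (H n)) {n : ℕ} (hn : 1 ≤ n) :
    driftScale q H (n + 1) ≤ driftScale q H n / 2 := by
  have hq := h.one_le_q hn
  have hM := (hH (n - 1)).half_lt_derivNorm
  have hM1 := (hH n).half_lt_derivNorm
  have hqM := h.derivNorm_le hH hn
  unfold driftScale
  rw [Nat.add_sub_cancel, div_div]
  set M := derivNorm (H (n - 1))
  set M1 := derivNorm (H n)
  refine one_div_le_one_div_of_le (by positivity) ?_
  have e1 : (2 : ℝ) ^ (n ^ 2 + 1) * 2 ≤ 2 ^ ((n + 1) ^ 2 + 1) := by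
    rw [← pow_succ]
    exact pow_le_pow_right₀ one_le_two (by nlinarith)
  have e2 : (q n : ℝ) ^ 4 * M ^ 2 ≤ (q (n + 1) : ℝ) ^ 4 * M1 ^ 2 := by
    have a1 : (2 * (q n : ℝ) ^ 3 * M) ^ 4 ≤ (q (n + 1) : ℝ) ^ 4 :=
      pow_le_pow_left₀ (by positivity) hqM 4
    have a2 : (1 / 2 : ℝ) ^ 2 ≤ M1 ^ 2 := pow_le_pow_left₀ (by norm_num) hM1.le 2
    have a3 : (1 / 2 : ℝ) ^ 2 ≤ M ^ 2 := pow_le_pow_left₀ (by norm_num) hM.le 2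
    have a4 : (q n : ℝ) ^ 4 ≤ (q n : ℝ) ^ 12 := pow_le_pow_right₀ hq (by norm_num)
    calc (q n : ℝ) ^ 4 * M ^ 2 ≤ (q n : ℝ) ^ 12 * (M ^ 2 * (4 * M ^ 2)) := by
          gcongr
          nlinarith [sq_nonneg M]
      _ = (2 * (q n : ℝ) ^ 3 * M) ^ 4 * (1 / 2) ^ 2 := by ring
      _ ≤ _ := mul_le_mul a1 a2 (by positivity) (by positivity)
  calc (2 : ℝ) ^ (n ^ 2 + 1) * (q n : ℝ) ^ 4 * M ^ 2 * 2
      = (2 ^ (n ^ 2 + 1) * 2) * ((q n : ℝ) ^ 4 * M ^ 2) := by ring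
    _ ≤ 2 ^ ((n + 1) ^ 2 + 1) * ((q (n + 1) : ℝ) ^ 4 * M1 ^ 2) :=
        mul_le_mul e1 e2 (by positivity) (by positivity)
    _ = _ := by ring

theorem AbC.IsParameterSystem.precision_nonneg {n : ℕ} (φ : Equiv.Perm Plane) :
    0 ≤ precision n (k n) (l n) (q n) (H (n - 1)) φ := by
  have := fullNorm_nonneg 2 φ
  unfold precision fineScale
  positivity

theorem AbC.IsParameterSystem.precision_le (h : IsParameterSystem k l q p H)
    (hH : ∀ n, IsAreaDiffeo (H n)) {n : ℕ} (hn : 1 ≤ n) (φ : Equiv.Perm Plane) :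
    precision n (k n) (l n) (q n) (H (n - 1)) φ ≤ 1 / (64 * (k n : ℝ) ^ 26) := by
  have hN := fullNorm_nonneg 2 φ
  have hk := h.one_le_k_real hn
  have hq := h.one_le_q hn
  have hl := h.le_l hH hn
  have hkq := h.k_lt_q hn
  have hM := (hH (n - 1)).half_lt_derivNorm
  have hn' : (1 : ℝ) ≤ n := by exact_mod_cast hn
  unfold precision fineScale
  rw [div_div]
  set M := derivNorm (H (n - 1))
  refine one_div_le_one_div_of_le (by positivity) ?_
  have h2 : (1 / 2 : ℝ) ^ 2 ≤ M ^ 2 := pow_le_pow_left₀ (by norm_num) hM.le 2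
  have h4 : (4 : ℝ) ≤ 2 ^ (n ^ 2 + 1) := by
    calc (4 : ℝ) = 2 ^ 2 := by norm_num
      _ ≤ _ := pow_le_pow_right₀ one_le_two (by nlinarith)
  have h5 : (1 : ℝ) ≤ (n : ℝ) ^ 2 := one_le_pow₀ hn'
  have hq2 : (16 * (k n : ℝ) ^ 4) ^ 2 ≤ (q n : ℝ) ^ 2 :=
    pow_le_pow_left₀ (by positivity) hkq.le 2
  have h6 : (k n : ℝ) ^ 10 ≤ l n := by
    refine le_trans ?_ hl
    exact le_mul_of_one_le_right (by positivity) (one_le_pow₀ hq)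
  calc 64 * (k n : ℝ) ^ 26 ≤ 4 * 1 * (k n : ℝ) ^ 10 *
        (2 * (k n : ℝ) ^ 8 * (16 * (k n : ℝ) ^ 4) ^ 2 * (1 / 2) ^ 2 * (2 * 0 + 1)) := by
        ring_nf
        gcongr
        norm_num
    _ ≤ _ := by gcongr

/-- The factor on the left is the Lipschitz constant 2‖DH_{n-1}‖ of H_{n-1} times the distance 2ε
between the smooth and the analytic step. -/
theorem AbC.IsParameterSystem.precision_le_driftScale (h : IsParameterSystem k l q p H)
    (hH : ∀ n, IsAreaDiffeo (H n)) {n : ℕ} (hn : 1 ≤ n) (φ : Equiv.Perm Plane) :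
    4 * derivNorm (H (n - 1)) * precision n (k n) (l n) (q n) (H (n - 1)) φ
      ≤ driftScale q H n := by
  have hN := fullNorm_nonneg 2 φ
  have hk := h.one_le_k_real hn
  have hq := h.one_le_q hn
  have hl := h.l_large n hn
  have hM := (hH (n - 1)).half_lt_derivNorm
  have hn' : (1 : ℝ) ≤ n := by exact_mod_cast hn
  have hl1 := h.one_le_l hH hn
  unfold precision fineScale driftScale
  rw [div_div]
  set M := derivNorm (H (n - 1))
  rw [mul_one_div, div_le_div_iff₀ (by positivity) (by positivity), one_mul]
  have h5 : (1 : ℝ) ≤ (n : ℝ) ^ 2 := one_le_pow₀ hn'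
  calc 4 * M * (2 ^ (n ^ 2 + 1) * (q n : ℝ) ^ 4 * M ^ 2)
      = 2 ^ (n ^ 2 + 1) * 1 * (2 * 1 * (q n : ℝ) ^ 2 * M) *
        (2 * 1 * (q n : ℝ) ^ 2 * M ^ 2 * (2 * 0 + 1)) := by ring
    _ ≤ 2 ^ (n ^ 2 + 1) * (n : ℝ) ^ 2 * (2 * (k n : ℝ) ^ 10 * (q n : ℝ) ^ 2 * M) *
        (2 * (k n : ℝ) ^ 8 * (q n : ℝ) ^ 2 * M ^ 2 * (2 * fullNorm 2 φ + 1)) := by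
        gcongr
        · exact one_le_pow₀ hk
        · exact one_le_pow₀ hk
    _ ≤ _ := by gcongr

theorem AbC.IsParameterSystem.le_stripMargin (h : IsParameterSystem k l q p H) {n : ℕ}
    (hn : 1 ≤ n) : 1 / (2 * (k n : ℝ) ^ 16) ≤ stripMargin n (k n) := by
  have hk := h.one_le_k_real hn
  have hn' : (1 : ℝ) ≤ n := by exact_mod_cast hn
  have hkn : (n : ℝ) ^ 5 ≤ k n := by exact_mod_cast h.le_k n hn
  unfold stripMargin
  rw [div_div]
  refine one_div_le_one_div_of_le (by positivity) ?_
  calc 2 * (n : ℝ) ^ 5 * (k n : ℝ) ^ 10 * (k n : ℝ) ^ 5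
      ≤ 2 * k n * (k n : ℝ) ^ 10 * (k n : ℝ) ^ 5 := by gcongr
    _ = _ := by ring

theorem AbC.IsParameterSystem.precision_lt_stripMargin (h : IsParameterSystem k l q p H)
    (hH : ∀ n, IsAreaDiffeo (H n)) {n : ℕ} (hn : 1 ≤ n) (φ : Equiv.Perm Plane) :
    precision n (k n) (l n) (q n) (H (n - 1)) φ ≤ stripMargin n (k n) / 32 := by
  have hk := h.one_le_k_real hn
  refine (h.precision_le hH hn φ).trans ?_
  have := h.le_stripMargin hn
  have : 1 / (64 * (k n : ℝ) ^ 26) ≤ 1 / (2 * (k n : ℝ) ^ 16) / 32 := by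
    rw [div_div]
    refine one_div_le_one_div_of_le (by positivity) ?_
    have := pow_le_pow_right₀ hk (show 16 ≤ 26 by norm_num)
    linarith
  linarith

/-- The bound that allows to apply the Lipschitz estimate for an analytic step. -/
theorem AbC.IsParameterSystem.lipschitz_range (h : IsParameterSystem k l q p H)
    (hH : ∀ n, IsAreaDiffeo (H n)) {n : ℕ} (hn : 1 ≤ n) :
    2 * (2 * derivNorm (H (n - 1)) * derivNorm (H n)) *
      (8 * derivNorm (H n) * driftScale q H (n + 1)) ≤ stripMargin n (k n) / 2 := by
  have hk := h.one_le_k_real hn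
  have hq := h.one_le_q hn
  have hq1 := h.one_le_q (n := n + 1) (by omega)
  have hM := (hH (n - 1)).half_lt_derivNorm
  have hM1 := (hH n).half_lt_derivNorm
  have hqM := h.derivNorm_le hH hn
  have hgr : 2 * (k n : ℝ) ^ 12 * (q n : ℝ) ^ 2 ≤ q (n + 1) := by exact_mod_cast (h.q_growth n hn).le
  refine le_trans ?_ (div_le_div_of_nonneg_right (h.le_stripMargin hn) zero_le_two)
  unfold driftScale
  rw [Nat.add_sub_cancel, div_div]
  set M := derivNorm (H (n - 1))
  set M1 := derivNorm (H n)
  have e : 2 * (2 * M * M1) * (8 * M1 * (1 / (2 ^ ((n + 1) ^ 2 + 1) * (q (n + 1) : ℝ) ^ 4 * M1 ^ 2)))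
      = 32 * M / (2 ^ ((n + 1) ^ 2 + 1) * (q (n + 1) : ℝ) ^ 4) := by
    field_simp
    norm_num
  rw [e, div_le_div_iff₀ (by positivity) (by positivity), one_mul]
  have h32 : (32 : ℝ) ≤ 2 ^ ((n + 1) ^ 2 + 1) := by
    calc (32 : ℝ) = 2 ^ 5 := by norm_num
      _ ≤ _ := pow_le_pow_right₀ one_le_two (by nlinarith)
  have hq3 : 2 * M ≤ q (n + 1) := by
    refine le_trans ?_ hqM
    have : (1 : ℝ) ≤ (q n : ℝ) ^ 3 := one_le_pow₀ hq
    nlinarith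
  have hq4 : 2 * (k n : ℝ) ^ 16 ≤ (q (n + 1) : ℝ) ^ 3 := by
    have a : 2 * (k n : ℝ) ^ 12 ≤ q (n + 1) := by
      refine le_trans ?_ hgr
      exact le_mul_of_one_le_right (by positivity) (one_le_pow₀ hq)
    calc 2 * (k n : ℝ) ^ 16 ≤ 8 * (k n : ℝ) ^ 36 := by
          have := pow_le_pow_right₀ hk (show 16 ≤ 36 by norm_num)
          have : (0 : ℝ) ≤ (k n : ℝ) ^ 16 := by positivity
          linarith
      _ = (2 * (k n : ℝ) ^ 12) ^ 3 := by ring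
      _ ≤ _ := pow_le_pow_left₀ (by positivity) a 3
  calc 32 * M * (2 * (k n : ℝ) ^ 16 * 2) = 32 * ((2 * M) * (2 * (k n : ℝ) ^ 16)) := by ring
    _ ≤ 2 ^ ((n + 1) ^ 2 + 1) * (q (n + 1) * (q (n + 1) : ℝ) ^ 3) := by gcongr
    _ = _ := by ring

/-- The role of σ > 1/4: with 2k_n < q_n^{1/4} the slope of the shear exceeds 2k_n, so its graphs
are finer than the scale 1/k_n. -/
theorem AbC.IsParameterSystem.le_shearSize (h : IsParameterSystem k l q p H) {σ : ℝ}
    (hσ : 1 / 4 < σ) {n : ℕ} (hn : 1 ≤ n) : 2 * k n ≤ shearSize n (q n) σ := by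
  unfold shearSize
  apply Nat.le_floor
  push_cast
  have h1 := h.q_large n hn
  have h2 : (q n : ℝ) ^ (1 / 4 : ℝ) ≤ (q n : ℝ) ^ σ :=
    Real.rpow_le_rpow_of_exponent_le (h.one_le_q hn) hσ.le
  have h3 : (1 : ℝ) ≤ n := by exact_mod_cast hn
  have h4 : (0 : ℝ) ≤ (q n : ℝ) ^ σ := by positivity
  nlinarith

theorem AbC.IsParameterSystem.tendsto_k (h : IsParameterSystem k l q p H) :
    Tendsto (fun n => (k n : ℝ)) atTop atTop := by
  refine tendsto_natCast_atTop_atTop.comp (tendsto_atTop_mono' atTop ?_ tendsto_id)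
  filter_upwards [eventually_ge_atTop 1] with n hn
  exact (Nat.le_self_pow (by norm_num) n).trans (h.le_k n hn)

end Parameters

theorem AbC.isAreaDiffeo_conjMap {g φ : ℕ → Equiv.Perm Plane} (hg : ∀ n, 1 ≤ n → IsAreaDiffeo (g n))
    (hφ : ∀ n, 1 ≤ n → IsAreaDiffeo (φ n)) (n : ℕ) : IsAreaDiffeo (conjMap g φ n) := by
  induction n with
  | zero => exact IsAreaDiffeo.one
  | succ n ih => exact ih.mul ((hg _ (by omega)).mul (hφ _ (by omega)))

theorem AbC.conjMap_eq {g φ : ℕ → Equiv.Perm Plane} {n : ℕ} (hn : 1 ≤ n) :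
    conjMap g φ n = conjMap g φ (n - 1) * (g n * φ n) := by
  obtain ⟨n, rfl⟩ := Nat.exists_eq_add_of_le' hn
  rfl

/-! ### Smooth and analytic conjugation schemes -/

/-- A smooth conjugation scheme together with a close analytic one. -/
structure IsClosePair (σ : ℝ) (k l q : ℕ → ℕ) (p : ℕ → ℤ) (g φ g' φ' : ℕ → Equiv.Perm Plane)
    (N : ℕ → ℕ) (I : ∀ n, Fin (N n) → Fin (k n) → Set Torus) : Prop where
  par : IsParameterSystem k l q p (conjMap g φ)
  shear : ∀ n, 1 ≤ n → IsStepShear n (k n) (q n) σ (g n)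
  area : ∀ n, 1 ≤ n → IsAreaDiffeo (φ n)
  area_g' : ∀ n, 1 ≤ n → IsAreaDiffeo (g' n)
  area_φ' : ∀ n, 1 ≤ n → IsAreaDiffeo (φ' n)
  close_g : ∀ n, 1 ≤ n → diffeoDist 2 (g n) (g' n)
    < precision n (k n) (l n) (q n) (conjMap g φ (n - 1)) (φ n)
  close_φ : ∀ n, 1 ≤ n → diffeoDist 2 (φ n) (φ' n)
    < precision n (k n) (l n) (q n) (conjMap g φ (n - 1)) (φ n)
  base : ∀ n, 1 ≤ n → IsBasePartition n (k n) (q n) (⇑(g n * φ n)) (I n)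

/-- The points of the partition that are mapped by `φ` well into a good strip. -/
def goodBase (n k : ℕ) (φ : Plane → Plane) {N : ℕ} (I : Fin N → Fin k → Set Torus) : Set Torus :=
  (⋃ i, ⋃ l, I i l) ∩ {y | torusMap φ y 1 ∈ innerHeights n k}

theorem isCompact_square (x : Plane) (s : ℝ) : IsCompact (square x s) := by
  have : square x s = univ.pi fun i => Icc (x i) (x i + s) := by
    ext y; exact ⟨fun h i _ => h i, fun h i => h i trivial⟩
  rw [this]
  exact isCompact_univ_pi fun i => isCompact_Icc

section Partition

variable {n k q : ℕ} {h : Plane → Plane} {N : ℕ} {I : Fin N → Fin k → Set Torus}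

theorem AbC.IsBasePartition.measurableSet (hI : IsBasePartition n k q h I) (i : Fin N) (l : Fin k) :
    MeasurableSet (I i l) := by
  obtain ⟨Q, hQ, -, e⟩ := hI.squares i l
  rw [e]
  exact MeasurableSet.biUnion hQ fun s _ =>
    ((isCompact_square s.1 s.2).image continuous_toTorus).isClosed.measurableSet

theorem AbC.IsBasePartition.exists_rotation {h : Equiv.Perm Plane} (hh : IsTorusDiffeo h)
    (hI : IsBasePartition n k q h I) {i : Fin N} {l : Fin k} {y : Torus} (hy : y ∈ I i l) :
    ∃ β : ℝ, jac h (torusRep y) = !![Real.cos β, -Real.sin β; Real.sin β, Real.cos β] := by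
  obtain ⟨Q, -, hQ, e⟩ := hI.squares i l
  rw [e] at hy
  simp only [mem_iUnion] at hy
  obtain ⟨s, hs, x, hx, rfl⟩ := hy
  obtain ⟨h0, -, -, hR⟩ := hQ s hs
  rw [hh.jac_torusRep]
  exact fderiv_of_isRigidOn h0 (hh.differentiable x) hR hx

theorem volume_goodBase_compl_le {φ : Equiv.Perm Plane} (hφ : IsAreaDiffeo φ) (hk : 0 < k)
    (hI : IsBasePartition n k q h I) :
    volume (goodBase n k φ I)ᶜ
      ≤ ENNReal.ofReal (25 / (k : ℝ) ^ 5) + ENNReal.ofReal (6 * ((k : ℝ) ^ 5 * stripMargin n k)) := by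
  rw [goodBase, compl_inter]
  refine (measure_union_le _ _).trans (add_le_add ?_ ?_)
  · have hm : MeasurableSet (⋃ i, ⋃ l, I i l) :=
      MeasurableSet.iUnion fun i => MeasurableSet.iUnion fun l => hI.measurableSet i l
    rw [← ofReal_measureReal, probReal_compl_eq_one_sub hm]
    exact ENNReal.ofReal_le_ofReal (by linarith [hI.cover])
  · refine le_trans (le_of_eq ?_) (volume_innerHeights_compl_le (n := n) hk)
    have h1 : MeasurePreserving (fun z : Torus => torusMap φ z 1) volume volume :=
      (measurePreserving_eval (fun _ : Fin 2 => (volume : Measure UnitAddCircle)) 1).comp hφ.measurePreserving_torusMap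
    exact h1.measure_preimage (measurableSet_innerHeights n k).compl.nullMeasurableSet

end Partition

namespace IsClosePair

variable {σ : ℝ} {k l q : ℕ → ℕ} {p : ℕ → ℤ} {g φ g' φ' : ℕ → Equiv.Perm Plane}
  {N : ℕ → ℕ} {I : ∀ n, Fin (N n) → Fin (k n) → Set Torus}

theorem area_conj (hS : IsClosePair σ k l q p g φ g' φ' N I) (n : ℕ) :
    IsAreaDiffeo (conjMap g φ n) :=
  isAreaDiffeo_conjMap (fun n hn => (hS.shear n hn).area) hS.area n

theorem area_conj' (hS : IsClosePair σ k l q p g φ g' φ' N I) (n : ℕ) :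
    IsAreaDiffeo (conjMap g' φ' n) :=
  isAreaDiffeo_conjMap hS.area_g' hS.area_φ' n

/-- The points of the torus whose preimages are eventually good. -/
def goodPoints (k : ℕ → ℕ) (φ g' φ' : ℕ → Equiv.Perm Plane) {N : ℕ → ℕ}
    (I : ∀ n, Fin (N n) → Fin (k n) → Set Torus) : Set Torus :=
  {x | ∀ᶠ n in atTop, torusMap (⇑(conjMap g' φ' n)⁻¹) x ∈ goodBase n (k n) (φ n) (I n)}

theorem volume_goodBase_compl_le (hS : IsClosePair σ k l q p g φ g' φ' N I) {n : ℕ} (hn : 1 ≤ n) :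
    volume (goodBase n (k n) (φ n) (I n))ᶜ ≤ ENNReal.ofReal (28 / (n : ℝ) ^ 2) := by
  have hk := hS.par.one_le_k hn
  have hk1 := hS.par.one_le_k_real hn
  have hn1 : (1 : ℝ) ≤ n := by exact_mod_cast hn
  have hkn : (n : ℝ) ^ 5 ≤ k n := by exact_mod_cast hS.par.le_k n hn
  refine (_root_.volume_goodBase_compl_le (hS.area n hn) hk (hS.base n hn)).trans ?_
  rw [← ENNReal.ofReal_add (by positivity)
    (mul_nonneg (by norm_num) (mul_nonneg (by positivity) (stripMargin_nonneg _ _)))]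
  refine ENNReal.ofReal_le_ofReal ?_
  have hnk : (n : ℝ) ^ 2 ≤ (k n : ℝ) ^ 5 := by
    calc (n : ℝ) ^ 2 ≤ (n : ℝ) ^ 5 := pow_le_pow_right₀ hn1 (by norm_num)
      _ ≤ k n := hkn
      _ ≤ _ := le_self_pow₀ hk1 (by norm_num)
  have e1 : 25 / (k n : ℝ) ^ 5 ≤ 25 / (n : ℝ) ^ 2 := by gcongr
  have e2 : 6 * ((k n : ℝ) ^ 5 * stripMargin n (k n)) ≤ 3 / (n : ℝ) ^ 2 := by
    have : 6 * ((k n : ℝ) ^ 5 * stripMargin n (k n)) = 3 / ((n : ℝ) ^ 5 * (k n : ℝ) ^ 10) := by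
      unfold stripMargin; field_simp; norm_num
    rw [this]
    gcongr
    calc (n : ℝ) ^ 2 ≤ (n : ℝ) ^ 5 * 1 := by
          rw [mul_one]; exact pow_le_pow_right₀ hn1 (by norm_num)
      _ ≤ _ := by gcongr; exact one_le_pow₀ hk1
  calc _ ≤ 25 / (n : ℝ) ^ 2 + 3 / (n : ℝ) ^ 2 := add_le_add e1 e2
    _ = _ := by ring

/-- Borel–Cantelli: the exceptional sets have measure at most 28/n², and Ĥ_n preserves Lebesgue
measure. -/
theorem ae_mem_goodPoints (hS : IsClosePair σ k l q p g φ g' φ' N I) :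
    ∀ᵐ x : Torus, x ∈ goodPoints k φ g' φ' I := by
  have hsum : ∑' n, volume ({x : Torus | torusMap (⇑(conjMap g' φ' (n + 1))⁻¹) x
      ∉ goodBase (n + 1) (k (n + 1)) (φ (n + 1)) (I (n + 1))}) ≠ ⊤ := by
    refine ne_top_of_le_ne_top ?_ (ENNReal.tsum_le_tsum (g := fun n : ℕ =>
      ENNReal.ofReal (28 / ((n + 1 : ℕ) : ℝ) ^ 2)) fun n => ?_)
    · refine Summable.tsum_ofReal_ne_top ?_
      have h := (Real.summable_one_div_nat_pow (p := 2)).2 one_lt_two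
      have := ((summable_nat_add_iff 1).2 h).mul_left 28
      refine this.congr fun n => ?_
      ring
    · refine le_trans ?_ (hS.volume_goodBase_compl_le (n := n + 1) (by omega))
      exact ((hS.area_conj' (n + 1)).inv.measurePreserving_torusMap.measure_preimage_le _)
  filter_upwards [ae_eventually_notMem hsum] with x hx
  refine eventually_atTop.2 (?_ : ∃ a : ℕ, ∀ b ≥ a, _)
  obtain ⟨n₀, h₀⟩ := eventually_atTop.1 hx
  refine ⟨n₀ + 1, fun n hn => ?_⟩
  obtain ⟨m, rfl⟩ := Nat.exists_eq_add_of_le' (show 1 ≤ n by omega)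
  have := h₀ m (by omega)
  simp only [not_not] at this
  exact this

/-- The comparison map of the two schemes. -/
def compare (g φ g' φ' : ℕ → Equiv.Perm Plane) (n : ℕ) : Equiv.Perm Plane :=
  conjMap g φ n * (conjMap g' φ' n)⁻¹

theorem area_compare (hS : IsClosePair σ k l q p g φ g' φ' N I) (n : ℕ) :
    IsAreaDiffeo (compare g φ g' φ' n) := (hS.area_conj n).mul (hS.area_conj' n).inv

theorem compare_eq {n : ℕ} (hn : 1 ≤ n) :
    compare g φ g' φ' n = conjMap g φ (n - 1) * ((g n * φ n) * (conjMap g' φ' n)⁻¹) := by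
  rw [compare, conjMap_eq hn]; group

theorem conj_inv_pred {n : ℕ} (hn : 1 ≤ n) :
    (conjMap g' φ' (n - 1))⁻¹ = (g' n * φ' n) * (conjMap g' φ' n)⁻¹ := by
  rw [conjMap_eq hn]; group

/-- Together with `compare_eq` this shows consecutive comparison maps as H_{n-1} applied to the
images of one point Ĥ_n⁻¹(x) under the smooth and the analytic step, so their distance does not
involve DH_n. -/
theorem compare_pred {n : ℕ} (hn : 1 ≤ n) :
    compare g φ g' φ' (n - 1) = conjMap g φ (n - 1) * ((g' n * φ' n) * (conjMap g' φ' n)⁻¹) := by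
  rw [compare, conj_inv_pred hn]

section GoodStep

variable {n : ℕ} {x : Torus}

theorem precision_le_one (hS : IsClosePair σ k l q p g φ g' φ' N I) (hn : 1 ≤ n) :
    precision n (k n) (l n) (q n) (conjMap g φ (n - 1)) (φ n) ≤ 1 / (64 * k n) := by
  have hk := hS.par.one_le_k_real hn
  refine (hS.par.precision_le hS.area_conj hn _).trans ?_
  gcongr
  exact le_self_pow₀ hk (by norm_num)

/-- The two bounds serve different purposes. The first is tiny and yields injectivity of the limit
on the torus; the second, from the condition `diam`, is merely summable but also controls
directions. -/
theorem dist_compare_le (hS : IsClosePair σ k l q p g φ g' φ' N I) (hn : 1 ≤ n)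
    (hx : torusMap (⇑(conjMap g' φ' n)⁻¹) x ∈ goodBase n (k n) (φ n) (I n)) (t : UnitAddCircle) :
    dist (torusMap (compare g φ g' φ' n) x) (torusMap (compare g φ g' φ' (n - 1)) x)
        ≤ driftScale q (conjMap g φ) n ∧
      projDist (projExt (compare g φ g' φ' n) (x, t)) (projExt (compare g φ g' φ' (n - 1)) (x, t))
        ≤ 1 / (n : ℝ) ^ 2 := by
  obtain ⟨hx1, hx2⟩ := hx
  simp only [mem_iUnion] at hx1
  obtain ⟨i, j, hij⟩ := hx1
  have hk := hS.par.one_le_k_real hn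
  have hε := hS.precision_le_one hn
  have hεm := hS.par.precision_lt_stripMargin hS.area_conj hn (φ n)
  have hε0 : 0 ≤ precision n (k n) (l n) (q n) (conjMap g φ (n - 1)) (φ n) :=
    IsParameterSystem.precision_nonneg _
  have hεd := hS.par.precision_le_driftScale hS.area_conj hn (φ n)
  have hεs : precision n (k n) (l n) (q n) (conjMap g φ (n - 1)) (φ n) < stripMargin n (k n) := by
    have h0 : 0 < stripMargin n (k n) := lt_of_lt_of_le (by positivity) (hS.par.le_stripMargin hn)
    linarith
  have hkinv : 1 / (64 * (k n : ℝ)) ≤ 1 := by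
    rw [div_le_one (by positivity)]; linarith
  have hh := (hS.shear n hn).area.mul (hS.area n hn)
  have hh' := (hS.area_g' n hn).mul (hS.area_φ' n hn)
  set Y := projExt (⇑(conjMap g' φ' n)⁻¹) (x, t) with hY
  have hY1 : Y.1 = torusMap (⇑(conjMap g' φ' n)⁻¹) x := rfl
  obtain ⟨hd1, hd2⟩ := dist_step_le (hS.shear n hn) (hS.area n hn) (hS.area_g' n hn)
    (hS.area_φ' n hn) (hS.close_g n hn) (hS.close_φ n hn) hεs (hε.trans hkinv) (Y := Y) hx2
    ((hS.base n hn).exists_rotation hh.1 hij)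
  set ε := precision n (k n) (l n) (q n) (conjMap g φ (n - 1)) (φ n)
  have hH := hS.area_conj (n - 1)
  constructor
  · rw [compare_eq hn, compare_pred hn, hH.1.torusMap_mul, hH.1.torusMap_mul, hh.1.torusMap_mul,
      hh'.1.torusMap_mul, ← hY1]
    refine (hH.1.dist_torusMap_le_derivNorm _ _).trans (le_trans ?_ hεd)
    have := hH.half_lt_derivNorm
    calc _ ≤ 2 * derivNorm (conjMap g φ (n - 1)) * (2 * ε) := by gcongr
      _ = _ := by ring
  · rw [compare_eq hn, compare_pred hn, hH.1.projExt_mul (hh.1.mul (hS.area_conj' n).inv.1),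
      hH.1.projExt_mul (hh'.1.mul (hS.area_conj' n).inv.1),
      hh.1.projExt_mul (hS.area_conj' n).inv.1, hh'.1.projExt_mul (hS.area_conj' n).inv.1, ← hY]
    refine hS.par.diam n hn _ _ ?_
    have a0 := (dist_le_pi_dist (torusMap (⇑(g n * φ n)) Y.1) (torusMap (⇑(g' n * φ' n)) Y.1) 0).trans hd1
    have a1 := (dist_le_pi_dist (torusMap (⇑(g n * φ n)) Y.1) (torusMap (⇑(g' n * φ' n)) Y.1) 1).trans hd1
    -- The three coordinates differ by at most 2ε, 2ε and 5ε, well below 10ε in total, and ε ≤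
    -- 1/(64k_n).
    have hlt : 10 * ε < 3 / k n := by
      have : 10 * (1 / (64 * (k n : ℝ))) < 3 / k n := by
        rw [mul_one_div, div_lt_div_iff₀ (by positivity) (by positivity)]
        linarith
      linarith
    refine lt_of_le_of_lt ?_ hlt
    rw [projDist]
    refine Real.sqrt_le_iff.2 ⟨by positivity, ?_⟩
    have b0 := pow_le_pow_left₀ dist_nonneg a0 2
    have b1 := pow_le_pow_left₀ dist_nonneg a1 2
    have b2 := pow_le_pow_left₀ dist_nonneg hd2 2
    change dist (torusMap (⇑(g n * φ n)) Y.1 0) (torusMap (⇑(g' n * φ' n)) Y.1 0) ^ 2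
      + dist (torusMap (⇑(g n * φ n)) Y.1 1) (torusMap (⇑(g' n * φ' n)) Y.1 1) ^ 2 + _ ≤ _
    nlinarith [sq_nonneg ε]

end GoodStep

end IsClosePair

/-! ### Limits of the actions of unimodular matrices on the circle of lines -/

theorem abs_wedge_mulVec_dir {A : Matrix (Fin 2) (Fin 2) ℝ} (hA : A.det = 1) (s t : UnitAddCircle) :
    Real.sin (Real.pi * dist s t) = eucl (A *ᵥ dir (circleRep s)) * eucl (A *ᵥ dir (circleRep t)) *
      Real.sin (Real.pi * dist (lineMap A s) (lineMap A t)) := by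
  have hd : A.det ≠ 0 := by rw [hA]; exact one_ne_zero
  have h1 := abs_wedge_eq (dir_ne_zero (circleRep s)) (dir_ne_zero (circleRep t))
  have h2 := abs_wedge_eq (mulVec_ne_zero hd (dir_ne_zero (circleRep s)))
    (mulVec_ne_zero hd (dir_ne_zero (circleRep t)))
  rw [wedge_mulVec, hA, one_mul, h1] at h2
  simp only [eucl_dir, lineCoord_dir, coe_circleRep, one_mul] at h2
  exact h2

theorem sin_pi_mul_dist_nonneg (s t : UnitAddCircle) : 0 ≤ Real.sin (Real.pi * dist s t) := by
  rw [dist_eq_norm]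
  exact (mul_nonneg zero_le_two (norm_nonneg _)).trans (two_mul_norm_le_sin _)

theorem sin_pi_mul_dist_pos {s t : UnitAddCircle} (h : s ≠ t) :
    0 < Real.sin (Real.pi * dist s t) := by
  have h1 := two_mul_norm_le_sin (s - t)
  rw [← dist_eq_norm] at h1
  have := dist_pos.2 h
  linarith

/-- An inequality between cross-ratios of lines. -/
theorem cross_ratio_le {A : Matrix (Fin 2) (Fin 2) ℝ} (hA : A.det = 1) (u v w x : UnitAddCircle) :
    Real.sin (Real.pi * dist w x) * Real.sin (Real.pi * dist u v) *
      (Real.sin (Real.pi * dist (lineMap A u) (lineMap A w)) *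
        Real.sin (Real.pi * dist (lineMap A v) (lineMap A x)))
    ≤ Real.sin (Real.pi * dist (lineMap A u) (lineMap A v)) := by
  rw [abs_wedge_mulVec_dir hA w x, abs_wedge_mulVec_dir hA u v]
  have h1 := abs_wedge_mulVec_dir hA u w
  have h2 := abs_wedge_mulVec_dir hA v x
  have h1' := Real.sin_le_one (Real.pi * dist u w)
  have h2' := Real.sin_le_one (Real.pi * dist v x)
  rw [h1] at h1'
  rw [h2] at h2'
  have e1 := sin_pi_mul_dist_nonneg (lineMap A u) (lineMap A v)
  have e2 := sin_pi_mul_dist_nonneg (lineMap A w) (lineMap A x)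
  have e2' := Real.sin_le_one (Real.pi * dist (lineMap A w) (lineMap A x))
  have e3 := sin_pi_mul_dist_nonneg (lineMap A u) (lineMap A w)
  have e4 := sin_pi_mul_dist_nonneg (lineMap A v) (lineMap A x)
  set a := eucl (A *ᵥ dir (circleRep u))
  set b := eucl (A *ᵥ dir (circleRep v))
  set c := eucl (A *ᵥ dir (circleRep w))
  set d := eucl (A *ᵥ dir (circleRep x))
  have ha : 0 ≤ a := eucl_nonneg _
  have hb : 0 ≤ b := eucl_nonneg _
  have hc : 0 ≤ c := eucl_nonneg _
  have hd : 0 ≤ d := eucl_nonneg _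
  set S1 := Real.sin (Real.pi * dist (lineMap A u) (lineMap A v))
  set S2 := Real.sin (Real.pi * dist (lineMap A w) (lineMap A x))
  set S3 := Real.sin (Real.pi * dist (lineMap A u) (lineMap A w))
  set S4 := Real.sin (Real.pi * dist (lineMap A v) (lineMap A x))
  calc c * d * S2 * (a * b * S1) * (S3 * S4) = (a * c * S3) * (b * d * S4) * (S2 * S1) := by ring
    _ ≤ 1 * 1 * (1 * S1) := by gcongr
    _ = S1 := by ring

theorem lineMap_surjective {A : Matrix (Fin 2) (Fin 2) ℝ} (hA : A.det = 1) :
    Function.Surjective (lineMap A) := by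
  intro t
  have hd : A.det ≠ 0 := by rw [hA]; exact one_ne_zero
  have hd' : A.adjugate.det ≠ 0 := by rw [Matrix.det_adjugate]; simp [hA]
  refine ⟨lineMap A.adjugate t, ?_⟩
  rw [← lineMap_mul hd hd', Matrix.mul_adjugate, hA, one_smul, lineMap_one]

/-- A uniform limit of the actions of unimodular matrices on the circle of lines is injective. -/
theorem injective_of_tendsto_lineMap {A : ℕ → Matrix (Fin 2) (Fin 2) ℝ} (hA : ∀ n, (A n).det = 1)
    {P : UnitAddCircle → UnitAddCircle} {τ : ℕ → ℝ} (hτ : Tendsto τ atTop (𝓝 0))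
    (h : ∀ᶠ n in atTop, ∀ t, dist (lineMap (A n) t) (P t) ≤ τ n) : Function.Injective P := by
  have hlim : ∀ t, Tendsto (fun n => lineMap (A n) t) atTop (𝓝 (P t)) := fun t =>
    tendsto_iff_dist_tendsto_zero.2 (squeeze_zero' (Eventually.of_forall fun _ => dist_nonneg)
      (h.mono fun n hn => hn t) hτ)
  have hsin : ∀ s t, Tendsto
      (fun n => Real.sin (Real.pi * dist (lineMap (A n) s) (lineMap (A n) t))) atTop
      (𝓝 (Real.sin (Real.pi * dist (P s) (P t)))) := fun s t =>
    (Real.continuous_sin.tendsto _).comp (((hlim s).dist (hlim t)).const_mul _)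
  intro u v huv
  by_contra hne
  -- If P identifies u ≠ v, the right side of the cross-ratio inequality vanishes in the limit, so
  -- at most one point is mapped away from the common value.
  have key : ∀ w x, P w ≠ P u → P x ≠ P u → w = x := by
    intro w x hw hx
    by_contra hwx
    have h1 := le_of_tendsto_of_tendsto' (((hsin u w).mul (hsin v x)).const_mul
      (Real.sin (Real.pi * dist w x) * Real.sin (Real.pi * dist u v))) (hsin u v)
      fun n => cross_ratio_le (hA n) u v w x
    rw [← huv, dist_self, mul_zero, Real.sin_zero] at h1
    have p1 := sin_pi_mul_dist_pos hwx
    have p2 := sin_pi_mul_dist_pos hne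
    have p3 := sin_pi_mul_dist_pos hw.symm
    have p4 := sin_pi_mul_dist_pos hx.symm
    have := mul_pos (mul_pos p1 p2) (mul_pos p3 p4)
    linarith
  have hinj : ∀ a b : ℝ, a ∈ Ico (0 : ℝ) 1 → b ∈ Ico (0 : ℝ) 1 → a ≠ b →
      (a : UnitAddCircle) ≠ (b : UnitAddCircle) := fun a b ha hb hab e => hab <| by
    rw [← circleRep_coe ha, ← circleRep_coe hb, e]
  set a : UnitAddCircle := ((0 : ℝ) : UnitAddCircle)
  set b : UnitAddCircle := ((1 / 3 : ℝ) : UnitAddCircle)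
  set c : UnitAddCircle := ((2 / 3 : ℝ) : UnitAddCircle)
  have hab : a ≠ b := hinj _ _ (by norm_num) (by norm_num) (by norm_num)
  have hac : a ≠ c := hinj _ _ (by norm_num) (by norm_num) (by norm_num)
  have hbc : b ≠ c := hinj _ _ (by norm_num) (by norm_num) (by norm_num)
  set δ := min (dist a b) (min (dist a c) (dist b c)) with hδ
  have hδ0 : 0 < δ := lt_min (dist_pos.2 hab) (lt_min (dist_pos.2 hac) (dist_pos.2 hbc))
  -- One A_n uniformly close to P is surjective and reaches three separated points, so P takes three
  -- distinct values, at least two of them different from P u. This contradicts `key`.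
  obtain ⟨n, hn, hn'⟩ := (h.and (hτ.eventually (gt_mem_nhds (half_pos hδ0)))).exists
  have hsep : ∀ s t, δ ≤ dist (lineMap (A n) s) (lineMap (A n) t) → P s ≠ P t := by
    intro s t hst e
    have h1 := hn s
    have h2 := hn t
    rw [e] at h1
    have := dist_triangle_right (lineMap (A n) s) (lineMap (A n) t) (P t)
    linarith
  obtain ⟨s, hs⟩ := lineMap_surjective (hA n) a
  obtain ⟨t, ht⟩ := lineMap_surjective (hA n) b
  obtain ⟨r, hr⟩ := lineMap_surjective (hA n) c
  have hst : P s ≠ P t := hsep s t (by rw [hs, ht]; exact min_le_left _ _)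
  have hsr : P s ≠ P r := hsep s r (by rw [hs, hr]; exact (min_le_right _ _).trans (min_le_left _ _))
  have htr : P t ≠ P r := hsep t r (by rw [ht, hr]; exact (min_le_right _ _).trans (min_le_right _ _))
  by_cases h1 : P s = P u
  · exact htr (congrArg P (key t r (fun e => hst (h1.trans e.symm)) fun e => hsr (h1.trans e.symm)))
  · by_cases h2 : P t = P u
    · exact hsr (congrArg P (key s r h1 fun e => htr (h2.trans e.symm)))
    · exact hst (congrArg P (key s t h1 h2))

/-! ### Approximation along an almost everywhere injective map -/

/-- If `L` is injective on a conull set then bounded measurable functions are approximated by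
functions that factor through `L` and a continuous function. -/
theorem exists_continuous_comp_approx {X Y : Type*} [MeasurableSpace X] [StandardBorelSpace X]
    [MetricSpace Y] [SecondCountableTopology Y] [MeasurableSpace Y] [BorelSpace Y]
    {ν : Measure X} [IsFiniteMeasure ν] {L : X → Y} (hL : Measurable L) {E : Set X}
    (hE : ν Eᶜ = 0) (hinj : InjOn L E) {ψ : X → ℝ} (hψ : Measurable ψ) {M : ℝ}
    (hM : ∀ x, |ψ x| ≤ M) {ε : ℝ} (hε : 0 < ε) :
    ∃ χ : BoundedContinuousFunction Y ℝ, ∫ x, |ψ x - χ (L x)| ∂ν ≤ ε := by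
  obtain ⟨t, hEt, ht, hνt⟩ := exists_measurable_superset_of_null hE
  have hsub : tᶜ ⊆ E := compl_subset_comm.1 hEt
  have := ht.compl.standardBorel
  -- An injective Borel map on a standard Borel space is a measurable embedding (Lusin–Souslin), so
  -- ψ factors through L by a Borel function.
  have hemb : MeasurableEmbedding fun x : ↥(tᶜ) => L x :=
    (hL.comp measurable_subtype_coe).measurableEmbedding fun x y h =>
      Subtype.ext (hinj (hsub x.2) (hsub y.2) h)
  obtain ⟨ξ, hξ, hξψ⟩ := hemb.exists_measurable_extend (hψ.comp measurable_subtype_coe)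
    fun _ => ⟨0⟩
  -- The extension is uncontrolled off the image; truncation makes it integrable without changing it
  -- where it matters.
  set ξ' : Y → ℝ := fun y => max (-M) (min M (ξ y)) with hξ'
  have hξ'm : Measurable ξ' := measurable_const.max (measurable_const.min hξ)
  have hM0 : ∀ x : X, 0 ≤ M := fun x => (abs_nonneg _).trans (hM x)
  have hξ'M : ∀ x : X, ∀ y, |ξ' y| ≤ M := fun x y => by
    have := hM0 x
    exact abs_le.2 ⟨le_max_left _ _, max_le (by linarith) (min_le_left _ _)⟩
  have hae : ∀ᵐ x ∂ν, ψ x = ξ' (L x) := by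
    filter_upwards [compl_mem_ae_iff.2 hνt] with x hx
    have h1 : ξ (L x) = ψ x := congrFun hξψ ⟨x, hx⟩
    have h2 := abs_le.1 (hM x)
    rw [hξ']
    simp only [h1, min_eq_right h2.2, max_eq_right h2.1]
  have hint : Integrable ξ' (ν.map L) := by
    rcases isEmpty_or_nonempty X with hX | ⟨⟨x⟩⟩
    · rw [show ν = 0 from Measure.eq_zero_of_isEmpty ν, Measure.map_zero]
      exact integrable_zero_measure
    · exact Integrable.of_bound hξ'm.aestronglyMeasurable M (Eventually.of_forall (hξ'M x))
  obtain ⟨χ, hχ, -⟩ := hint.exists_boundedContinuous_integral_sub_le hε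
  refine ⟨χ, ?_⟩
  have hm : Measurable fun y => ‖ξ' y - χ y‖ := (hξ'm.sub χ.continuous.measurable).norm
  rw [integral_map hL.aemeasurable hm.aestronglyMeasurable] at hχ
  refine le_trans (le_of_eq (integral_congr_ae ?_)) hχ
  filter_upwards [hae] with x hx
  rw [hx, Real.norm_eq_abs]

instance : PolishSpace UnitAddCircle := inferInstance

instance : StandardBorelSpace ProjBundle :=
  inferInstanceAs (StandardBorelSpace ((Fin 2 → UnitAddCircle) × UnitAddCircle))

namespace IsClosePair

variable {σ : ℝ} {k l q : ℕ → ℕ} {p : ℕ → ℤ} {g φ g' φ' : ℕ → Equiv.Perm Plane}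
  {N : ℕ → ℕ} {I : ∀ n, Fin (N n) → Fin (k n) → Set Torus}

theorem dist_projExt_compare_le (hS : IsClosePair σ k l q p g φ g' φ' N I) {n : ℕ} {x : Torus}
    (hn : 1 ≤ n)
    (hx : torusMap (⇑(conjMap g' φ' n)⁻¹) x ∈ goodBase n (k n) (φ n) (I n)) (t : UnitAddCircle) :
    dist (projExt (compare g φ g' φ' (n - 1)) (x, t)) (projExt (compare g φ g' φ' n) (x, t))
      ≤ 1 / (n : ℝ) ^ 2 := by
  rw [dist_comm]
  refine le_trans ?_ (hS.dist_compare_le hn hx t).2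
  set X := projExt (compare g φ g' φ' n) (x, t)
  set Y := projExt (compare g φ g' φ' (n - 1)) (x, t)
  have h0 := sq_nonneg (dist (X.1 0) (Y.1 0))
  have h1 := sq_nonneg (dist (X.1 1) (Y.1 1))
  have h2 := sq_nonneg (dist X.2 Y.2)
  rw [Prod.dist_eq]
  refine max_le ((dist_pi_le_iff (Real.sqrt_nonneg _)).2 fun i => ?_) ?_
  · refine Real.le_sqrt_of_sq_le ?_
    fin_cases i
    · change dist (X.1 0) (Y.1 0) ^ 2 ≤ _
      linarith
    · change dist (X.1 1) (Y.1 1) ^ 2 ≤ _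
      linarith
  · exact Real.le_sqrt_of_sq_le (by linarith)

/-- The tails of `∑ 1 / n²`. -/
noncomputable def sqTail (n : ℕ) : ℝ := ∑' m : ℕ, 1 / ((n + m + 1 : ℕ) : ℝ) ^ 2

theorem tendsto_sqTail : Tendsto sqTail atTop (𝓝 0) := by
  have := tendsto_sum_nat_add fun m : ℕ => 1 / ((m + 1 : ℕ) : ℝ) ^ 2
  refine this.congr fun n => tsum_congr fun m => ?_
  rw [add_comm m n]

theorem summable_sq_shift (n : ℕ) : Summable fun m : ℕ => 1 / ((n + m + 1 : ℕ) : ℝ) ^ 2 := by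
  have h := (summable_nat_add_iff (n + 1)).2 (Real.summable_one_div_nat_pow.2 one_lt_two)
  refine h.congr fun m => ?_
  rw [show m + (n + 1) = n + m + 1 by ring]

theorem exists_tendsto_projExt_compare (hS : IsClosePair σ k l q p g φ g' φ' N I) {x : Torus}
    (hx : x ∈ goodPoints k φ g' φ' I) (t : UnitAddCircle) :
    ∃ Y, Tendsto (fun n => projExt (compare g φ g' φ' n) (x, t)) atTop (𝓝 Y) := by
  obtain ⟨n₀, h₀⟩ := eventually_atTop.1 hx
  suffices h : CauchySeq fun m => projExt (compare g φ g' φ' (n₀ + m)) (x, t) by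
    obtain ⟨Y, hY⟩ := cauchySeq_tendsto_of_complete h
    refine ⟨Y, (tendsto_add_atTop_iff_nat n₀).1 ?_⟩
    simpa only [add_comm] using hY
  refine cauchySeq_of_summable_dist (Summable.of_nonneg_of_le (fun _ => dist_nonneg) (fun m => ?_)
    (summable_sq_shift n₀))
  exact hS.dist_projExt_compare_le (n := n₀ + m + 1) (by omega) (h₀ _ (by omega)) t

/-- The threshold depends on the base point but not on the direction; this uniformity along the
fibre is what `injective_of_tendsto_lineMap` requires. -/
theorem eventually_dist_projExt_compare_le (hS : IsClosePair σ k l q p g φ g' φ' N I) {x : Torus}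
    (hx : x ∈ goodPoints k φ g' φ' I) :
    ∀ᶠ n in atTop, ∀ t Y, Tendsto (fun n => projExt (compare g φ g' φ' n) (x, t)) atTop (𝓝 Y) →
      dist (projExt (compare g φ g' φ' n) (x, t)) Y ≤ sqTail n := by
  obtain ⟨n₀, h₀⟩ := eventually_atTop.1 hx
  filter_upwards [eventually_ge_atTop n₀] with n hn t Y hY
  have hY' : Tendsto (fun m => projExt (compare g φ g' φ' (n + m)) (x, t)) atTop (𝓝 Y) := by
    have := (tendsto_add_atTop_iff_nat n).2 hY
    simpa only [add_comm] using this
  have := dist_le_tsum_of_dist_le_of_tendsto _ (fun m => ?_) (summable_sq_shift n) hY' 0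
  · simp only [add_zero, zero_add] at this
    exact this
  · exact hS.dist_projExt_compare_le (n := n + m + 1) (by omega) (h₀ _ (by omega)) t

/-- On the fibres over good points the limit of the comparison maps is injective. -/
theorem fibre_injective (hS : IsClosePair σ k l q p g φ g' φ' N I) {x : Torus}
    (hx : x ∈ goodPoints k φ g' φ' I) {t t' : UnitAddCircle} {Y : ProjBundle}
    (ht : Tendsto (fun n => projExt (compare g φ g' φ' n) (x, t)) atTop (𝓝 Y))
    (ht' : Tendsto (fun n => projExt (compare g φ g' φ' n) (x, t')) atTop (𝓝 Y)) : t = t' := by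
  choose P hP using hS.exists_tendsto_projExt_compare hx
  have hinj : Function.Injective fun t => (P t).2 := by
    refine injective_of_tendsto_lineMap
      (A := fun n => jac (compare g φ g' φ' n) (torusRep x)) (fun n => (hS.area_compare n).2 _)
      tendsto_sqTail ?_
    filter_upwards [hS.eventually_dist_projExt_compare_le hx] with n hn t
    exact (le_max_right _ _).trans (hn t _ (hP t))
  apply hinj
  change (P t).2 = (P t').2
  rw [tendsto_nhds_unique (hP t) ht, tendsto_nhds_unique (hP t') ht']

theorem dist_torusMap_compare_le (hS : IsClosePair σ k l q p g φ g' φ' N I) {x : Torus}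
    (hx : x ∈ goodPoints k φ g' φ' I) {y : Torus}
    (hy : Tendsto (fun n => torusMap (compare g φ g' φ' n) x) atTop (𝓝 y)) :
    ∀ᶠ n in atTop, dist (torusMap (compare g φ g' φ' n) x) y
      ≤ 2 * driftScale q (conjMap g φ) (n + 1) := by
  obtain ⟨n₀, h₀⟩ := eventually_atTop.1 hx
  filter_upwards [eventually_ge_atTop n₀] with n hn
  have hY' : Tendsto (fun m => torusMap (compare g φ g' φ' (n + m)) x) atTop (𝓝 y) := by
    have := (tendsto_add_atTop_iff_nat n).2 hy
    simpa only [add_comm] using this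
  have hs : ∀ m, driftScale q (conjMap g φ) (n + m + 1)
      ≤ driftScale q (conjMap g φ) (n + 1) / 2 ^ m := by
    intro m
    induction m with
    | zero => simp
    | succ m ih =>
      have := hS.par.driftScale_succ_le hS.area_conj (n := n + m + 1) (by omega)
      rw [pow_succ, ← div_div]
      exact this.trans (by linarith)
  refine dist_le_of_le_geometric_two_of_tendsto₀ (f := fun m => torusMap (compare g φ g' φ' (n + m)) x)
    (fun m => ?_) hY'
  rw [mul_div_cancel_left₀ _ two_ne_zero, dist_comm]
  exact ((hS.dist_compare_le (n := n + m + 1) (by omega) (h₀ _ (by omega)) 0).1).trans (hs m)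

/-- As h_n = H_{n-1}⁻¹∘H_n, its derivative is bounded by ‖DH_{n-1}‖‖DH_n‖ up to a constant. The
admitted range of distances is that of the preimages of two points with the same limit. -/
theorem dist_step_inv_le (hS : IsClosePair σ k l q p g φ g' φ' N I) {n : ℕ} (hn : 1 ≤ n) {y w : Torus}
    (hy : y ∈ goodBase n (k n) (φ n) (I n))
    (hyw : dist y w ≤ 8 * derivNorm (conjMap g φ n) * driftScale q (conjMap g φ) (n + 1)) :
    dist (torusMap (⇑(g' n * φ' n)) y) (torusMap (⇑(g' n * φ' n)) w)
      ≤ 16 * derivNorm (conjMap g φ (n - 1)) * derivNorm (conjMap g φ n) * dist y w := by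
  have hεm := hS.par.precision_lt_stripMargin hS.area_conj hn (φ n)
  have hrange := hS.par.lipschitz_range hS.area_conj hn
  have hε := hS.precision_le_one hn
  have hk := hS.par.one_le_k_real hn
  have hε0 : 0 ≤ precision n (k n) (l n) (q n) (conjMap g φ (n - 1)) (φ n) :=
    IsParameterSystem.precision_nonneg _
  have hm : 0 < stripMargin n (k n) := lt_of_lt_of_le (by positivity) (hS.par.le_stripMargin hn)
  have hM := (hS.area_conj (n - 1)).half_lt_derivNorm
  have hM1 := (hS.area_conj n).half_lt_derivNorm
  have hstep : g n * φ n = (conjMap g φ (n - 1))⁻¹ * conjMap g φ n := by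
    rw [conjMap_eq hn]; group
  have hD : ∀ x i j, |jac (⇑(g n * φ n)) x i j|
      ≤ 2 * derivNorm (conjMap g φ (n - 1)) * derivNorm (conjMap g φ n) := by
    intro x i j
    rw [hstep, (hS.area_conj (n - 1)).inv.1.jac_mul (hS.area_conj n).1]
    exact abs_mul_apply_le ((hS.area_conj (n - 1)).abs_jac_inv_le _)
      ((hS.area_conj n).1.abs_jac_le_derivNorm x) i j
  set M := derivNorm (conjMap g φ (n - 1))
  set M1 := derivNorm (conjMap g φ n)
  have h := dist_analytic_step_le (hS.shear n hn) (hS.area n hn) (hS.area_g' n hn)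
    (hS.area_φ' n hn) (hS.close_g n hn) (hS.close_φ n hn) hD hy.2 (w := w) ?_
  · refine h.trans ?_
    set ε := precision n (k n) (l n) (q n) (conjMap g φ (n - 1)) (φ n)
    have hε1 : ε ≤ 1 / 64 := by
      refine hε.trans ?_
      gcongr
      linarith
    have hMM : 1 / 4 < M * M1 := by nlinarith
    rw [← mul_assoc]
    refine mul_le_mul_of_nonneg_right ?_ dist_nonneg
    nlinarith
  · have : 2 * (2 * M * M1) * dist y w ≤ stripMargin n (k n) / 2 := by
      refine le_trans ?_ hrange
      gcongr
    linarith

/-- On good points the limit of the comparison maps is injective on the torus. -/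
theorem base_injective (hS : IsClosePair σ k l q p g φ g' φ' N I) {x x' y : Torus}
    (hx : x ∈ goodPoints k φ g' φ' I) (hx' : x' ∈ goodPoints k φ g' φ' I)
    (hy : Tendsto (fun n => torusMap (compare g φ g' φ' n) x) atTop (𝓝 y))
    (hy' : Tendsto (fun n => torusMap (compare g φ g' φ' n) x') atTop (𝓝 y)) : x = x' := by
  obtain ⟨n₀, h₀⟩ := eventually_atTop.1 ((hx.and (hS.dist_torusMap_compare_le hx hy)).and
    (hS.dist_torusMap_compare_le hx' hy'))
  set H := conjMap g φ with hH
  set z : ℕ → Torus := fun n => torusMap (⇑(conjMap g' φ' n)⁻¹) x with hz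
  set z' : ℕ → Torus := fun n => torusMap (⇑(conjMap g' φ' n)⁻¹) x' with hz'
  have hzx : ∀ n u, torusMap (⇑(conjMap g' φ' n)⁻¹) u
      = torusMap (⇑(H n)⁻¹) (torusMap (compare g φ g' φ' n) u) := by
    intro n u
    rw [← (hS.area_conj n).inv.1.torusMap_mul, compare, inv_mul_cancel_left]
  -- Both images are within twice the drift scale of the common limit, and H_n⁻¹ expands by at most
  -- 2‖DH_n‖.
  have hclose : ∀ n, n₀ ≤ n → dist (z n) (z' n) ≤ 8 * derivNorm (H n) * driftScale q H (n + 1) := by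
    intro n hn
    have h1 := (h₀ n hn).1.2
    have h2 := (h₀ n hn).2
    rw [hz, hz']
    simp only [hzx]
    refine ((hS.area_conj n).dist_torusMap_inv_le _ _).trans ?_
    have h3 := dist_triangle_right (torusMap (compare g φ g' φ' n) x)
      (torusMap (compare g φ g' φ' n) x') y
    have hM := (hS.area_conj n).half_lt_derivNorm
    calc _ ≤ 2 * derivNorm (H n) * (4 * driftScale q H (n + 1)) := by
          gcongr
          linarith
      _ = _ := by ring
  have hback : ∀ n, n₀ < n → dist (z (n - 1)) (z' (n - 1))
      ≤ 16 * derivNorm (H (n - 1)) * derivNorm (H n) * dist (z n) (z' n) := by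
    intro n hn
    have h1 := hS.dist_step_inv_le (n := n) (by omega) (h₀ n hn.le).1.1 (hclose n hn.le)
    have h2 : ∀ u, torusMap (⇑(conjMap g' φ' (n - 1))⁻¹) u
        = torusMap (⇑(g' n * φ' n)) (torusMap (⇑(conjMap g' φ' n)⁻¹) u) := by
      intro u
      rw [conj_inv_pred (by omega),
        ((hS.area_g' n (by omega)).mul (hS.area_φ' n (by omega))).1.torusMap_mul]
    rw [hz, hz']
    simp only [h2]
    exact h1
  set n₁ := n₀ + 1 with hn₁
  set C := 1 / ((q (n₁ + 1) : ℝ) ^ 2 * derivNorm (H n₁)) with hC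
  have hM : ∀ n, 0 < derivNorm (H n) := fun n => by
    have := (hS.area_conj n).half_lt_derivNorm
    exact lt_trans (by norm_num) this
  have hq : ∀ n, 1 ≤ n → (0 : ℝ) < q n := fun n hn => lt_of_lt_of_le one_pos (hS.par.one_le_q hn)
  have hC0 : 0 < C := by
    have := hM n₁
    have := hq (n₁ + 1) (by omega)
    positivity
  -- Going back from level n₁ + m, the norms of derivatives accumulate; each is absorbed by q_{n+1}
  -- ≥ q_n‖DH_{n-1}‖, so only the current norm, a square of q and the factors 16 survive.
  have hprod : ∀ m, dist (z n₁) (z' n₁)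
      ≤ C * 16 ^ m * (q (n₁ + m + 1) : ℝ) ^ 2 * derivNorm (H (n₁ + m)) *
        dist (z (n₁ + m)) (z' (n₁ + m)) := by
    intro m
    induction m with
    | zero =>
      have := hM n₁
      have := hq (n₁ + 1) (by omega)
      rw [hC]
      simp only [add_zero, pow_zero, mul_one]
      apply le_of_eq
      field_simp
    | succ m ih =>
      have h1 := hback (n₁ + m + 1) (by omega)
      rw [Nat.add_sub_cancel] at h1
      have h2 := hS.par.derivNorm_le hS.area_conj (n := n₁ + m + 1) (by omega)
      rw [Nat.add_sub_cancel] at h2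
      have h3 := hS.par.one_le_q (n := n₁ + m + 1) (by omega)
      have hM0 := hM (n₁ + m)
      have hM1 := hM (n₁ + m + 1)
      have h4 : (q (n₁ + m + 1) : ℝ) * derivNorm (H (n₁ + m)) ≤ q (n₁ + m + 1 + 1) := by
        refine le_trans ?_ h2
        gcongr
        calc (q (n₁ + m + 1) : ℝ) ≤ (q (n₁ + m + 1) : ℝ) ^ 3 := le_self_pow₀ h3 (by norm_num)
          _ ≤ _ := by linarith [pow_nonneg (zero_le_one.trans h3) 3]
      calc _ ≤ C * 16 ^ m * (q (n₁ + m + 1) : ℝ) ^ 2 * derivNorm (H (n₁ + m)) *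
            dist (z (n₁ + m)) (z' (n₁ + m)) := ih
        _ ≤ C * 16 ^ m * (q (n₁ + m + 1) : ℝ) ^ 2 * derivNorm (H (n₁ + m)) *
            (16 * derivNorm (H (n₁ + m)) * derivNorm (H (n₁ + m + 1)) *
              dist (z (n₁ + m + 1)) (z' (n₁ + m + 1))) := by gcongr
        _ = C * 16 ^ (m + 1) * ((q (n₁ + m + 1) : ℝ) * derivNorm (H (n₁ + m))) ^ 2 *
            derivNorm (H (n₁ + m + 1)) * dist (z (n₁ + m + 1)) (z' (n₁ + m + 1)) := by ring
        _ ≤ C * 16 ^ (m + 1) * (q (n₁ + m + 1 + 1) : ℝ) ^ 2 *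
            derivNorm (H (n₁ + m + 1)) * dist (z (n₁ + m + 1)) (z' (n₁ + m + 1)) := by gcongr
  -- The powers of q and the norms cancel against the drift scale, whose factor 2^{-n²} beats 16^m.
  have hbound : ∀ m, dist (z n₁) (z' n₁) ≤ 8 * C * (16 ^ m / 2 ^ ((m + 1) ^ 2)) := by
    intro m
    have h1 := hclose (n₁ + m) (by omega)
    have hM0 := hM (n₁ + m)
    have hq1 := hS.par.one_le_q (n := n₁ + m + 1) (by omega)
    have hq0 := hq (n₁ + m + 1) (by omega)
    have h2 : (q (n₁ + m + 1) : ℝ) ^ 2 * derivNorm (H (n₁ + m)) *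
        (8 * derivNorm (H (n₁ + m)) * driftScale q H (n₁ + m + 1)) ≤ 8 / 2 ^ ((m + 1) ^ 2) := by
      unfold driftScale
      rw [Nat.add_sub_cancel]
      have e : (q (n₁ + m + 1) : ℝ) ^ 2 * derivNorm (H (n₁ + m)) * (8 * derivNorm (H (n₁ + m)) *
          (1 / (2 ^ ((n₁ + m + 1) ^ 2 + 1) * (q (n₁ + m + 1) : ℝ) ^ 4 * derivNorm (H (n₁ + m)) ^ 2)))
          = 8 / (2 ^ ((n₁ + m + 1) ^ 2 + 1) * (q (n₁ + m + 1) : ℝ) ^ 2) := by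
        field_simp
      rw [e]
      gcongr
      calc (2 : ℝ) ^ ((m + 1) ^ 2) ≤ 2 ^ ((n₁ + m + 1) ^ 2 + 1) :=
            pow_le_pow_right₀ one_le_two
              ((Nat.pow_le_pow_left (by omega) 2).trans (Nat.le_succ _))
        _ ≤ _ := le_mul_of_one_le_right (by positivity) (one_le_pow₀ hq1)
    calc _ ≤ C * 16 ^ m * (q (n₁ + m + 1) : ℝ) ^ 2 * derivNorm (H (n₁ + m)) *
            dist (z (n₁ + m)) (z' (n₁ + m)) := hprod m
      _ ≤ C * 16 ^ m * (q (n₁ + m + 1) : ℝ) ^ 2 * derivNorm (H (n₁ + m)) *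
            (8 * derivNorm (H (n₁ + m)) * driftScale q H (n₁ + m + 1)) := by gcongr
      _ = C * 16 ^ m * ((q (n₁ + m + 1) : ℝ) ^ 2 * derivNorm (H (n₁ + m)) *
            (8 * derivNorm (H (n₁ + m)) * driftScale q H (n₁ + m + 1))) := by ring
      _ ≤ C * 16 ^ m * (8 / 2 ^ ((m + 1) ^ 2)) := by gcongr
      _ = _ := by ring
  have hzero : Tendsto (fun m : ℕ => 8 * C * ((16 : ℝ) ^ m / 2 ^ ((m + 1) ^ 2))) atTop (𝓝 0) := by
    have hsq : Tendsto (fun m : ℕ => ((1 / 2 : ℝ)) ^ m) atTop (𝓝 0) :=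
      tendsto_pow_atTop_nhds_zero_of_lt_one (by norm_num) (by norm_num)
    have : Tendsto (fun m : ℕ => (16 : ℝ) ^ m / 2 ^ ((m + 1) ^ 2)) atTop (𝓝 0) := by
      refine squeeze_zero' (Eventually.of_forall fun m => by positivity) ?_ hsq
      filter_upwards [eventually_ge_atTop 3] with m hm
      rw [div_pow, one_pow, div_le_div_iff₀ (by positivity) (by positivity), one_mul,
        show (16 : ℝ) = 2 ^ 4 by norm_num, ← pow_mul, ← pow_add]
      exact pow_le_pow_right₀ one_le_two (by nlinarith)
    simpa using this.const_mul (8 * C)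
  have h0 : dist (z n₁) (z' n₁) ≤ 0 := ge_of_tendsto' hzero hbound
  have h1 : z n₁ = z' n₁ := dist_le_zero.1 h0
  have h2 := congrArg (torusMap (conjMap g' φ' n₁)) h1
  rwa [hz, hz', (hS.area_conj' n₁).1.torusMap_torusMap_inv,
    (hS.area_conj' n₁).1.torusMap_torusMap_inv] at h2

/-- The comparison maps converge almost everywhere, and bounded measurable functions are
approximated by continuous functions of the limit. -/
theorem exists_limit (hS : IsClosePair σ k l q p g φ g' φ' N I) {ν : Measure ProjBundle}
    [IsFiniteMeasure ν] (hν : ν ≪ volume) :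
    ∃ L : ProjBundle → ProjBundle, Measurable L ∧
      (∀ᵐ X ∂ν, Tendsto (fun n => projExt (compare g φ g' φ' n) X) atTop (𝓝 (L X))) ∧
      ∀ ψ : ProjBundle → ℝ, Measurable ψ → ∀ M : ℝ, (∀ X, |ψ X| ≤ M) → ∀ ε > 0,
        ∃ χ : BoundedContinuousFunction ProjBundle ℝ, ∫ X, |ψ X - χ (L X)| ∂ν ≤ ε := by
  have hgood : ∀ᵐ X ∂ν, X.1 ∈ goodPoints k φ g' φ' I := hν.ae_le (ae_fst hS.ae_mem_goodPoints)
  obtain ⟨L, hL, hlim⟩ := measurable_limit_of_tendsto_metrizable_ae (μ := ν) (L := atTop)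
    (f := fun n => projExt (compare g φ g' φ' n))
    (fun n => (hS.area_compare n).1.measurable_projExt.aemeasurable)
    (hgood.mono fun X hX => hS.exists_tendsto_projExt_compare hX X.2)
  refine ⟨L, hL, hlim, fun ψ hψ M hM ε hε => ?_⟩
  refine exists_continuous_comp_approx hL (E := {X | X.1 ∈ goodPoints k φ g' φ' I ∧
    Tendsto (fun n => projExt (compare g φ g' φ' n) X) atTop (𝓝 (L X))}) (hgood.and hlim) ?_ hψ hM hε
  rintro ⟨x, t⟩ ⟨hx, hxt⟩ ⟨x', t'⟩ ⟨hx', hxt'⟩ h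
  rw [← h] at hxt'
  have e : x = x' := hS.base_injective hx hx' ((continuous_fst.tendsto _).comp hxt)
    ((continuous_fst.tendsto _).comp hxt')
  subst e
  rw [hS.fibre_injective hx hxt hxt']

end IsClosePair

/-! ### Averages of slowly varying functions -/

theorem dist_coe_le (s t : ℝ) : dist (s : UnitAddCircle) (t : UnitAddCircle) ≤ |s - t| := by
  rw [dist_eq_norm, ← AddCircle.coe_sub]
  have h := (norm_le_pi_norm (toTorus fun _ => s - t) 0).trans (norm_toTorus_le fun _ => s - t)
  refine h.trans ((pi_norm_le_iff_of_nonneg (abs_nonneg _)).2 fun _ => ?_)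
  rw [Real.norm_eq_abs]

/-- Riemann sums of functions on the circle. -/
theorem abs_riemannSum_sub_integral_le {k : ℕ} (hk : 0 < k) {f : UnitAddCircle → ℝ}
    (hf : Continuous f) {w : ℝ}
    (hw : ∀ s t : UnitAddCircle, dist s t ≤ 1 / k → |f s - f t| ≤ w) :
    |(∑ i ∈ Finset.range k, f ((i / k : ℝ) : UnitAddCircle)) / k - ∫ t, f t| ≤ w := by
  have hk' : (0 : ℝ) < k := by exact_mod_cast hk
  have hcont : Continuous fun x : ℝ => f (x : UnitAddCircle) := hf.comp (AddCircle.continuous_mk' 1)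
  have h1 : ∫ t, f t = ∑ i ∈ Finset.range k, ∫ x in (i / k : ℝ)..((i + 1 : ℕ) / k : ℝ), f x := by
    rw [intervalIntegral.sum_integral_adjacent_intervals (a := fun i : ℕ => (i / k : ℝ))
      fun i _ => hcont.intervalIntegrable _ _, ← UnitAddCircle.intervalIntegral_preimage 0]
    simp [div_self hk'.ne']
  have h2 : ∀ i ∈ Finset.range k, |f ((i / k : ℝ) : UnitAddCircle) / k
      - ∫ x in (i / k : ℝ)..((i + 1 : ℕ) / k : ℝ), f x| ≤ w / k := by
    intro i _
    have hlen : ((i + 1 : ℕ) / k : ℝ) - i / k = 1 / k := by push_cast; ring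
    have e : f ((i / k : ℝ) : UnitAddCircle) / k
        = ∫ x in (i / k : ℝ)..((i + 1 : ℕ) / k : ℝ), f ((i / k : ℝ) : UnitAddCircle) := by
      rw [intervalIntegral.integral_const, hlen, smul_eq_mul]; ring
    rw [e, ← intervalIntegral.integral_sub (by simp) (hcont.intervalIntegrable _ _)]
    have hle : (i / k : ℝ) ≤ ((i + 1 : ℕ) / k : ℝ) := by
      have : (0 : ℝ) < 1 / k := by positivity
      linarith
    have := intervalIntegral.norm_integral_le_of_norm_le_const (C := w) (a := (i / k : ℝ))
      (b := ((i + 1 : ℕ) / k : ℝ))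
      (f := fun x : ℝ => f ((i / k : ℝ) : UnitAddCircle) - f (x : UnitAddCircle)) (fun x hx => ?_)
    · rw [hlen, abs_of_pos (by positivity), mul_one_div] at this
      exact this
    · rw [uIoc_of_le hle] at hx
      -- Within one of the k intervals the function differs from its value at the left endpoint by
      -- at most w.
      refine hw _ _ ((dist_coe_le _ _).trans ?_)
      rw [abs_le]
      constructor <;> linarith [hx.1, hx.2]
  rw [h1, Finset.sum_div, ← Finset.sum_sub_distrib]
  refine (Finset.abs_sum_le_sum_abs _ _).trans ((Finset.sum_le_sum h2).trans_eq ?_)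
  rw [Finset.sum_const, Finset.card_range, nsmul_eq_mul]
  field_simp

theorem projDist_same_base (z : Torus) (s t : UnitAddCircle) :
    projDist (z, s) (z, t) = dist s t := by
  simp [projDist, Real.sqrt_sq]

section SlowlyVarying

variable {k : ℕ} {ψ : ProjBundle → ℝ} {w : ℝ}

theorem integrable_of_continuous {Y : Type*} [MeasurableSpace Y] [TopologicalSpace Y]
    [OpensMeasurableSpace Y] {μ : Measure Y} [IsFiniteMeasure μ] {f : Y → ℝ} (hf : Continuous f)
    (hb : ∀ y, |f y| ≤ 1) : Integrable f μ := integrable_of_abs_le hf.measurable hb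

/-- The average over the fibres over equidistributed directions. -/
theorem abs_fibre_average_sub_integral_le (hk : 0 < k) (hψ : Continuous ψ) (hb : ∀ X, |ψ X| ≤ 1)
    (hw : ∀ X Y, projDist X Y < 3 / k → |ψ X - ψ Y| ≤ w) :
    |(∑ i ∈ Finset.range k, ∫ z, ψ (z, ((i / k : ℝ) : UnitAddCircle))) / k - ∫ X, ψ X| ≤ w := by
  have hk' : (0 : ℝ) < k := by exact_mod_cast hk
  have hint : Integrable ψ := integrable_of_continuous hψ hb
  have hi : ∀ t : UnitAddCircle, Integrable fun z : Torus => ψ (z, t) := fun t =>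
    integrable_of_continuous (hψ.comp (by fun_prop)) fun z => hb _
  have hint' : Integrable fun z : Torus => ∫ t, ψ (z, t) := hint.integral_prod_left
  have hsum : Integrable fun z : Torus =>
      (∑ i ∈ Finset.range k, ψ (z, ((i / k : ℝ) : UnitAddCircle))) / k :=
    (integrable_finsetSum _ fun i _ => hi _).div_const _
  rw [Measure.volume_eq_prod, integral_prod _ hint, ← integral_finsetSum _ fun i _ => hi _,
    ← integral_div, ← integral_sub hsum hint']
  have := norm_integral_le_of_norm_le_const (μ := (volume : Measure Torus)) (C := w)
    (f := fun z => (∑ i ∈ Finset.range k, ψ (z, ((i / k : ℝ) : UnitAddCircle))) / k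
      - ∫ t, ψ (z, t)) (Eventually.of_forall fun z => ?_)
  · simpa using this
  · refine abs_riemannSum_sub_integral_le hk (f := fun t => ψ (z, t)) (hψ.comp (by fun_prop)) ?_
    intro s t hst
    refine hw _ _ ?_
    rw [projDist_same_base]
    refine lt_of_le_of_lt hst ?_
    gcongr
    norm_num

theorem integral_torus_eq {f : Torus → ℝ} (hf : Continuous f) (hb : ∀ z, |f z| ≤ 1) :
    ∫ z, f z = ∫ r : UnitAddCircle, ∫ θ : UnitAddCircle, f ![θ, r] := by
  have h1 := (volume_preserving_finTwoArrow UnitAddCircle).symm.integral_comp' f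
  have hc : Continuous fun x : UnitAddCircle × UnitAddCircle => f ![x.1, x.2] :=
    hf.comp (by fun_prop)
  have hint : Integrable fun x : UnitAddCircle × UnitAddCircle => f ![x.1, x.2] :=
    integrable_of_continuous hc fun z => hb _
  have e : ∀ x : UnitAddCircle × UnitAddCircle,
      (MeasurableEquiv.finTwoArrow (α := UnitAddCircle)).symm x = ![x.1, x.2] := fun x => rfl
  rw [← h1]
  simp only [e]
  rw [Measure.volume_eq_prod, integral_prod_symm _ hint]

/-- Averages over the graphs of linear maps of large slope. -/
theorem abs_graph_average_sub_integral_le {b : ℕ} (hb0 : 0 < b) (hbk : 1 / (b : ℝ) < 3 / k)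
    (hψ : Continuous ψ) (hb : ∀ X, |ψ X| ≤ 1)
    (hw : ∀ X Y, projDist X Y < 3 / k → |ψ X - ψ Y| ≤ w) (c t : UnitAddCircle) :
    |(∫ r : UnitAddCircle, ψ (![c + b • r, r], t)) - ∫ z, ψ (z, t)| ≤ w := by
  have hb' : (0 : ℝ) < b := by exact_mod_cast hb0
  have hc2 : Continuous fun x : UnitAddCircle × UnitAddCircle => ψ (![c + b • x.2 + x.1, x.2], t) :=
    hψ.comp (by fun_prop)
  have hcr : ∀ u : UnitAddCircle, Continuous fun r : UnitAddCircle => ψ (![c + b • r + u, r], t) :=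
    fun u => hψ.comp (by fun_prop)
  -- Translating r by u/b shifts the graph horizontally by u but changes heights by at most 1/b,
  -- less than the scale on which ψ varies. Averaging over u then gives the integral over the torus.
  have hshift : ∀ u : UnitAddCircle, |(∫ r : UnitAddCircle, ψ (![c + b • r, r], t))
      - ∫ r : UnitAddCircle, ψ (![c + b • r + u, r], t)| ≤ w := by
    intro u
    have hbu : b • ((circleRep u / b : ℝ) : UnitAddCircle) = u := by
      rw [← AddCircle.coe_nsmul, nsmul_eq_mul, mul_div_cancel₀ _ hb'.ne', coe_circleRep]
    set v : UnitAddCircle := ((circleRep u / b : ℝ) : UnitAddCircle)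
    have hv : dist v 0 ≤ 1 / b := by
      have h := dist_coe_le (circleRep u / b) 0
      rw [sub_zero, abs_of_nonneg (div_nonneg (circleRep_mem u).1 hb'.le)] at h
      refine h.trans ?_
      gcongr
      exact (circleRep_mem u).2.le
    rw [← integral_add_left_eq_self (fun r : UnitAddCircle => ψ (![c + b • r, r], t)) v]
    have hcs : Continuous fun r : UnitAddCircle => ψ (![c + b • (v + r), v + r], t) :=
      hψ.comp (by fun_prop)
    rw [← integral_sub (integrable_of_continuous hcs fun _ => hb _)
      (integrable_of_continuous (hcr u) fun _ => hb _)]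
    have := norm_integral_le_of_norm_le_const (μ := (volume : Measure UnitAddCircle)) (C := w)
      (f := fun r => ψ (![c + b • (v + r), v + r], t) - ψ (![c + b • r + u, r], t))
      (Eventually.of_forall fun r => ?_)
    · simpa using this
    · refine hw _ _ (lt_of_le_of_lt (le_trans (le_of_eq ?_) hv) hbk)
      have e : c + b • (v + r) = c + b • r + u := by rw [smul_add, hbu]; abel
      have e2 : dist (v + r) r = dist v 0 := by simp [dist_eq_norm]
      rw [e, ← e2]
      simp only [projDist, Matrix.cons_val_zero, Matrix.cons_val_one, dist_self]
      rw [zero_pow two_ne_zero, zero_add, add_zero, Real.sqrt_sq dist_nonneg]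
  have htor : ∫ z, ψ (z, t) = ∫ u : UnitAddCircle, ∫ r : UnitAddCircle, ψ (![c + b • r + u, r], t) := by
    rw [integral_torus_eq (f := fun z => ψ (z, t)) (hψ.comp (by fun_prop)) fun _ => hb _]
    have h1 : ∀ r : UnitAddCircle, ∫ θ : UnitAddCircle, ψ (![θ, r], t)
        = ∫ θ : UnitAddCircle, ψ (![c + b • r + θ, r], t) := fun r =>
      (integral_add_left_eq_self (fun θ : UnitAddCircle => ψ (![θ, r], t)) (c + b • r)).symm
    simp only [h1]
    exact (integral_integral_swap (f := fun u r : UnitAddCircle => ψ (![c + b • r + u, r], t))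
      (integrable_of_continuous hc2 fun _ => hb _)).symm
  have hi : Integrable fun u : UnitAddCircle => ∫ r : UnitAddCircle, ψ (![c + b • r + u, r], t) :=
    (integrable_of_continuous (μ := volume) hc2 fun _ => hb _).integral_prod_left
  have hconst : (∫ r : UnitAddCircle, ψ (![c + b • r, r], t))
      = ∫ _ : UnitAddCircle, ∫ r : UnitAddCircle, ψ (![c + b • r, r], t) := by simp
  rw [htor, hconst, ← integral_sub (integrable_const _) hi]
  have := norm_integral_le_of_norm_le_const (μ := (volume : Measure UnitAddCircle)) (C := w)
    (f := fun u => (∫ r : UnitAddCircle, ψ (![c + b • r, r], t))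
      - ∫ r : UnitAddCircle, ψ (![c + b • r + u, r], t)) (Eventually.of_forall hshift)
  simpa using this

end SlowlyVarying

/-! ### Integrals with respect to almost proportional measures -/

/-- If two measures are almost proportional on the subsets of `J`, then so are the integrals over
`J` of functions with values in `[0, 1]`. -/
theorem abs_setIntegral_sub_mul_le {X : Type*} [MeasurableSpace X] {μ ν : Measure X}
    [IsFiniteMeasure μ] [IsFiniteMeasure ν] {J : Set X} (hJ : MeasurableSet J) {c e : ℝ}
    (hc : 0 ≤ c) (he : 0 ≤ e)
    (h : ∀ J' ⊆ J, MeasurableSet J' → |μ.real J' - c * ν.real J'| ≤ e * ν.real J')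
    {G : X → ℝ} (hG : Measurable G) (hG0 : ∀ x, 0 ≤ G x) (hG1 : ∀ x, G x ≤ 1) :
    |∫ x in J, G x ∂μ - c * ∫ x in J, G x ∂ν| ≤ e * ν.real J := by
  have hGb : ∀ x, |G x| ≤ 1 := fun x => by rw [abs_of_nonneg (hG0 x)]; exact hG1 x
  have hi : ∀ (ξ : Measure X) [IsFiniteMeasure ξ], Integrable G ξ := fun ξ _ =>
    integrable_of_abs_le hG hGb
  have hsmul : ∀ (a : ℝ), 0 ≤ a → ∫ x, G x ∂(ENNReal.ofReal a • ν.restrict J)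
      = a * ∫ x in J, G x ∂ν := fun a ha => by
    rw [integral_smul_measure, ENNReal.toReal_ofReal ha, smul_eq_mul]
  have hle : ∫ x in J, G x ∂ν ≤ ν.real J := by
    have := setIntegral_mono (s := J) (hi ν).integrableOn (integrable_const (1 : ℝ)).integrableOn hG1
    simpa using this
  have hfin : ∀ a : ℝ, IsFiniteMeasure (ENNReal.ofReal a • ν.restrict J) := fun a =>
    Measure.smul_finite _ ENNReal.ofReal_ne_top
  -- The estimates on subsets sandwich μ on J between the multiples c ± e of ν; integrals of
  -- nonnegative functions inherit the sandwich.
  have hupper : μ.restrict J ≤ ENNReal.ofReal (c + e) • ν.restrict J := by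
    refine Measure.le_iff.2 fun s hs => ?_
    rw [Measure.restrict_apply hs, Measure.smul_apply, Measure.restrict_apply hs, smul_eq_mul]
    have h1 := (abs_le.1 (h (s ∩ J) inter_subset_right (hs.inter hJ))).2
    rw [← ofReal_measureReal (μ := μ), ← ofReal_measureReal (μ := ν), ← ENNReal.ofReal_mul (by linarith)]
    exact ENNReal.ofReal_le_ofReal (by linarith)
  have hlower : ENNReal.ofReal (c - e) • ν.restrict J ≤ μ.restrict J := by
    refine Measure.le_iff.2 fun s hs => ?_
    rw [Measure.restrict_apply hs, Measure.smul_apply, Measure.restrict_apply hs, smul_eq_mul]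
    have h1 := (abs_le.1 (h (s ∩ J) inter_subset_right (hs.inter hJ))).1
    rw [← ofReal_measureReal (μ := μ), ← ofReal_measureReal (μ := ν)]
    rcases le_total 0 (c - e) with hce | hce
    · rw [← ENNReal.ofReal_mul hce]
      exact ENNReal.ofReal_le_ofReal (by linarith)
    · rw [ENNReal.ofReal_of_nonpos hce, zero_mul]
      exact zero_le
  have hu : ∫ x in J, G x ∂μ ≤ (c + e) * ∫ x in J, G x ∂ν := by
    have := hfin (c + e)
    rw [← hsmul _ (by linarith)]
    exact integral_mono_measure hupper (Eventually.of_forall hG0) (hi _)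
  have hl : (c - e) * ∫ x in J, G x ∂ν ≤ ∫ x in J, G x ∂μ := by
    have h0 : 0 ≤ ∫ x in J, G x ∂μ := integral_nonneg hG0
    have h0' : 0 ≤ ∫ x in J, G x ∂ν := integral_nonneg hG0
    rcases le_total 0 (c - e) with hce | hce
    · rw [← hsmul _ hce]
      exact integral_mono_measure hlower (Eventually.of_forall hG0) (hi _)
    · exact (mul_nonpos_of_nonpos_of_nonneg hce h0').trans h0
  have := mul_le_mul_of_nonneg_left hle he
  rw [abs_le]
  constructor <;> linarith

/-! ### Directions of images -/

/-- Arcs are indexed modulo k. Lifting with an arbitrary integer index places the cyclic neighbours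
of an arc next to it on the line, also across 0. -/
theorem exists_mem_Icc_of_mem_dirArc {k a : ℕ} {a' : ℤ} (hk : 0 < k) (h : ∃ N : ℤ, a' = a + N * k)
    {t : UnitAddCircle} (ht : t ∈ dirArc k a) :
    ∃ s ∈ Icc (a' / k : ℝ) ((a' + 1) / k), (s : UnitAddCircle) = t := by
  obtain ⟨s, hs, rfl⟩ := ht
  obtain ⟨N, rfl⟩ := h
  have hk' : (k : ℝ) ≠ 0 := by exact_mod_cast hk.ne'
  refine ⟨s + N, ?_, coe_add_intCast s N⟩
  have e1 : (((a : ℤ) + N * k : ℤ) : ℝ) / k = a / k + N := by push_cast; field_simp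
  have e2 : ((((a : ℤ) + N * k : ℤ) : ℝ) + 1) / k = (a + 1) / k + N := by push_cast; field_simp; ring
  rw [e1, e2]
  exact ⟨by linarith [hs.1], by linarith [hs.2]⟩

/-- A direction between two directions whose images are controlled. -/
theorem dist_lineMap_le_of_between {A : Matrix (Fin 2) (Fin 2) ℝ} (hA : 0 < A.det) {k : ℕ}
    (hk : 4 ≤ k) {j i : ℤ} {s₁ s s₂ a₁ a₂ : ℝ} (h1 : s₁ ∈ Icc (((j - 1 : ℤ) : ℝ) / k)
      ((((j - 1 : ℤ) : ℝ) + 1) / k)) (h : s ∈ Icc ((j : ℝ) / k) ((j + 1) / k))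
    (h2 : s₂ ∈ Icc (((j + 1 : ℤ) : ℝ) / k) ((((j + 1 : ℤ) : ℝ) + 1) / k))
    (ha1 : a₁ ∈ Icc (((i - 1 : ℤ) : ℝ) / k) ((((i - 1 : ℤ) : ℝ) + 1) / k))
    (ha2 : a₂ ∈ Icc (((i + 1 : ℤ) : ℝ) / k) ((((i + 1 : ℤ) : ℝ) + 1) / k))
    (e1 : lineMap A s₁ = a₁) (e2 : lineMap A s₂ = a₂) :
    dist (lineMap A s) ((i / k : ℝ) : UnitAddCircle) ≤ 2 / k := by
  have hk4 : (4 : ℝ) ≤ k := by exact_mod_cast hk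
  have hk0 : (0 : ℝ) < k := by linarith
  have hkinv : 1 / (k : ℝ) ≤ 1 / 4 := one_div_le_one_div_of_le (by norm_num) hk4
  have hkpos : 0 < 1 / (k : ℝ) := by positivity
  push_cast at h1 h2 ha1 ha2
  have x1 : ((j : ℝ) - 1) / k = j / k - 1 / k := by ring
  have x2 : ((j : ℝ) - 1 + 1) / k = j / k := by ring
  have x3 : ((j : ℝ) + 1) / k = j / k + 1 / k := by ring
  have x4 : ((j : ℝ) + 1 + 1) / k = j / k + 2 * (1 / k) := by ring
  have y1 : ((i : ℝ) - 1) / k = i / k - 1 / k := by ring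
  have y2 : ((i : ℝ) - 1 + 1) / k = i / k := by ring
  have y3 : ((i : ℝ) + 1) / k = i / k + 1 / k := by ring
  have y4 : ((i : ℝ) + 1 + 1) / k = i / k + 2 * (1 / k) := by ring
  rw [x1, x2] at h1
  rw [x3] at h
  rw [x3, x4] at h2
  rw [y1, y2] at ha1
  rw [y3, y4] at ha2
  rw [lineMap_coe hA.ne'] at e1 e2 ⊢
  -- With k ≥ 4 the directions s₁, s₂ and the images a₁, a₂ span at most 3/k, less than a full turn
  -- of the circle of lines.
  obtain ⟨b, hb, e⟩ := exists_lineCoord_mulVec_eq hA (s₁ := s₁) (s := s) (s₂ := s₂) (a₁ := a₁)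
    (a₂ := a₂) (by linarith [h1.2, h.1]) (by linarith [h.2, h2.1]) (by linarith [h1.2, h2.1])
    (by linarith [h1.1, h2.2]) (by linarith [ha1.2, ha2.1]) (by linarith [ha1.1, ha2.2]) e1 e2
  rw [e]
  refine (dist_coe_le _ _).trans ?_
  rw [abs_le, show (2 : ℝ) / k = 2 * (1 / k) by ring]
  constructor <;> linarith [hb.1, hb.2, ha1.1, ha2.2]

section Piece

variable {n k q : ℕ} {σ ε γ : ℝ} {g g' Φ : Equiv.Perm Plane}

/-- Near the inner part of a strip the analytic shear is close to a linear map of large slope. -/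
theorem projDist_shear_lt (hg : IsStepShear n k q σ g) (hg' : IsAreaDiffeo g')
    (hgg' : diffeoDist 2 g g' < ε) (hε : ε < stripMargin n k) (hk : 0 < k) (hεk : ε ≤ 1 / (8 * k))
    (hγ : γ + (shearSize n q σ : ℝ) / (k : ℝ) ^ 5 + ε ≤ 1 / k) {c : ℝ} {Y : ProjBundle}
    (hY : Y.1 1 ∈ innerHeights n k) (hc : Y.1 0 ∈ arc c (c + γ)) {u : UnitAddCircle}
    (hu : dist Y.2 u ≤ 2 / k) :
    projDist (projExt g' Y) (![(c : UnitAddCircle) + shearSize n q σ • Y.1 1, Y.1 1], u) < 3 / k := by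
  obtain ⟨v, hv1, htr, hjac, hv⟩ := hg.exists_translation hY
  set b := shearSize n q σ
  have hk' : (0 : ℝ) < k := by exact_mod_cast hk
  have hpg := preDist_lt_of_diffeoDist_lt hgg'
  have hd := hg.area.1.dist_torusMap_le hg'.1 hpg Y.1
  have hε0 : 0 ≤ ε := dist_nonneg.trans hd
  have hs : dist (Y.1 1) (Y.1 1) < stripMargin n k := by rw [dist_self]; linarith
  rw [htr _ hs] at hd
  have h1 : dist (torusMap g' Y.1 1) (Y.1 1) ≤ ε := by
    have := (dist_le_pi_dist (Y.1 + v) (torusMap g' Y.1) 1).trans hd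
    rwa [Pi.add_apply, hv1, add_zero, dist_comm] at this
  have h0 : dist (torusMap g' Y.1 0) ((c : UnitAddCircle) + b • Y.1 1) ≤ 1 / k := by
    have a1 := (dist_le_pi_dist (Y.1 + v) (torusMap g' Y.1) 0).trans hd
    rw [Pi.add_apply, dist_comm] at a1
    have a2 : dist (Y.1 0) (c : UnitAddCircle) ≤ γ := by
      obtain ⟨x, hx, e⟩ := hc
      rw [← e]
      refine (dist_coe_le x c).trans ?_
      rw [abs_le]
      constructor <;> linarith [hx.1, hx.2]
    have a3 := dist_add_add_le (Y.1 0) (v 0) (c : UnitAddCircle) (b • Y.1 1)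
    have a4 := dist_triangle (torusMap g' Y.1 0) (Y.1 0 + v 0) ((c : UnitAddCircle) + b • Y.1 1)
    linarith
  have h2 : dist (projExt g' Y).2 u ≤ 2 / k + ε := by
    have hA := hjac _ hs
    have h := dist_lineCoord_mulVec_le (hg.area.1.det_jac_ne_zero (torusRep Y.1))
      (hg'.1.det_jac_ne_zero (torusRep Y.1))
      (fun i j => (hg.area.1.abs_jac_sub_le hg'.1 one_le_two (torusRep Y.1) i j).trans hpg.le)
      (dir_ne_zero (circleRep Y.2))
    rw [hA, Matrix.one_mulVec, eucl_dir, mul_one, mul_one, lineCoord_dir, coe_circleRep] at h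
    have h' : dist (projExt g' Y).2 Y.2 ≤ ε := h
    linarith [dist_triangle (projExt g' Y).2 Y.2 u]
  have b0 := pow_le_pow_left₀ dist_nonneg h0 2
  have b1 := pow_le_pow_left₀ dist_nonneg (h1.trans hεk) 2
  have b2 := pow_le_pow_left₀ dist_nonneg (h2.trans (add_le_add_right hεk _)) 2
  rw [projDist, Real.sqrt_lt' (by positivity)]
  change dist (torusMap g' Y.1 0) ((c : UnitAddCircle) + b • Y.1 1) ^ 2
    + dist (torusMap g' Y.1 1) (Y.1 1) ^ 2 + dist (projExt g' Y).2 u ^ 2 < _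
  -- In units of 1/k the three coordinates differ by at most 1, 1/8 and 17/8, whose squares add up
  -- to less than 9.
  have e0 : (3 / k : ℝ) ^ 2 = 9 * (1 / k) ^ 2 := by ring
  have e1 : (1 / (8 * k) : ℝ) ^ 2 = 1 / 64 * (1 / k) ^ 2 := by field_simp; norm_num
  have e2 : (2 / k + 1 / (8 * k) : ℝ) ^ 2 = 289 / 64 * (1 / k) ^ 2 := by field_simp; norm_num
  rw [e1] at b1
  rw [e2] at b2
  rw [e0]
  have : (0 : ℝ) < (1 / k) ^ 2 := by positivity
  linarith

theorem isClosed_arc (a b : ℝ) : IsClosed (arc a b) :=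
  (isCompact_Icc.image (AddCircle.continuous_mk' 1)).isClosed

theorem measurableSet_dirArc (k j : ℕ) : MeasurableSet (dirArc k j) := (isClosed_arc _ _).measurableSet

theorem fst_image_eq (Φ : Plane → Plane) (S : Set Torus) (J : Set UnitAddCircle) (T T' : Set UnitAddCircle) :
    Prod.fst '' ((S ×ˢ T) ∩ projExt Φ ⁻¹' {Y | Y.1 1 ∈ J ∧ Y.2 ∈ T'})
      = S ∩ {z | torusMap Φ z 1 ∈ J} ∩
        Prod.fst '' ((univ ×ˢ T) ∩ projExt Φ ⁻¹' (Prod.snd ⁻¹' T')) := by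
  ext z
  constructor
  · rintro ⟨⟨z, t⟩, ⟨⟨hz, ht⟩, hJ, hT⟩, rfl⟩
    exact ⟨⟨hz, hJ⟩, ⟨z, t⟩, ⟨⟨mem_univ _, ht⟩, hT⟩, rfl⟩
  · rintro ⟨⟨hz, hJ⟩, ⟨z, t⟩, ⟨⟨-, ht⟩, hT⟩, rfl⟩
    exact ⟨⟨z, t⟩, ⟨⟨hz, ht⟩, hJ, hT⟩, rfl⟩

theorem measurable_height (hΦ : IsTorusDiffeo Φ) : Measurable fun z : Torus => torusMap Φ z 1 :=
  ((continuous_apply 1).comp hΦ.continuous_torusMap).measurable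

/-- Projections of Borel sets need not be Borel. Here the height condition depends on the base point
alone, and the remaining condition on directions is the projection of a compact set. -/
theorem measurableSet_fst_image (hΦ : IsTorusDiffeo Φ) {S : Set Torus} (hS : MeasurableSet S)
    {J : Set UnitAddCircle} (hJ : MeasurableSet J) (k j i : ℕ) :
    MeasurableSet (Prod.fst '' ((S ×ˢ dirArc k j) ∩
      projExt Φ ⁻¹' {Y | Y.1 1 ∈ J ∧ Y.2 ∈ dirArc k i})) := by
  rw [fst_image_eq]
  refine (hS.inter (measurable_height hΦ hJ)).inter ?_
  have hc : IsClosed ((univ ×ˢ dirArc k j : Set ProjBundle) ∩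
      projExt Φ ⁻¹' (Prod.snd ⁻¹' dirArc k i)) :=
    (isClosed_univ.prod (isClosed_arc _ _)).inter
      (((isClosed_arc _ _).preimage continuous_snd).preimage hΦ.continuous_projExt)
  exact (hc.isCompact.image continuous_fst).isClosed.measurableSet

/-- The directions of the images of the points in a piece of the partition. -/
theorem dist_direction_le (hΦ : IsAreaDiffeo Φ) (hk : 4 ≤ k) {S : Set Torus} {J : Set UnitAddCircle}
    {j i jm jp im ip : ℕ} (hjm : ∃ N : ℤ, (j : ℤ) - 1 = jm + N * k)
    (hjp : ∃ N : ℤ, (j : ℤ) + 1 = jp + N * k) (him : ∃ N : ℤ, (i : ℤ) - 1 = im + N * k)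
    (hip : ∃ N : ℤ, (i : ℤ) + 1 = ip + N * k) {X : ProjBundle} (hX : X.2 ∈ dirArc k j)
    (hm : X.1 ∈ Prod.fst '' ((S ×ˢ dirArc k jm) ∩
      projExt Φ ⁻¹' {Y | Y.1 1 ∈ J ∧ Y.2 ∈ dirArc k im}))
    (hp : X.1 ∈ Prod.fst '' ((S ×ˢ dirArc k jp) ∩
      projExt Φ ⁻¹' {Y | Y.1 1 ∈ J ∧ Y.2 ∈ dirArc k ip})) :
    dist (projExt Φ X).2 ((i / k : ℝ) : UnitAddCircle) ≤ 2 / k := by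
  have hk0 : 0 < k := by omega
  obtain ⟨z, t⟩ := X
  obtain ⟨⟨z₁, t₁⟩, ⟨⟨-, ht₁⟩, -, hT₁⟩, e₁⟩ := hm
  obtain ⟨⟨z₂, t₂⟩, ⟨⟨-, ht₂⟩, -, hT₂⟩, e₂⟩ := hp
  simp only at e₁ e₂ ht₁ ht₂ hX
  subst e₁
  subst e₂
  obtain ⟨s, hs, rfl⟩ := exists_mem_Icc_of_mem_dirArc (a' := j) hk0 ⟨0, by ring⟩ hX
  obtain ⟨s₁, hs₁, rfl⟩ := exists_mem_Icc_of_mem_dirArc hk0 hjm ht₁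
  obtain ⟨s₂, hs₂, rfl⟩ := exists_mem_Icc_of_mem_dirArc hk0 hjp ht₂
  obtain ⟨a₁, ha₁, f₁⟩ := exists_mem_Icc_of_mem_dirArc hk0 him hT₁
  obtain ⟨a₂, ha₂, f₂⟩ := exists_mem_Icc_of_mem_dirArc hk0 hip hT₂
  -- The hypotheses provide only one direction in each neighbouring arc with a controlled image.
  -- Monotonicity of the action on lines traps the image of every direction of T_j between these
  -- two.
  have := dist_lineMap_le_of_between (A := jac Φ (torusRep z₂)) (by rw [hΦ.2]; exact one_pos) hk
    (i := i) hs₁ hs hs₂ ha₁ ha₂ f₁.symm f₂.symm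
  rw [Int.cast_natCast] at this
  exact this

end Piece

/-! ### Equidistribution of the images of the partition elements -/

section Piece

variable {n k q : ℕ} {σ ε γ : ℝ} {g g' Φ : Equiv.Perm Plane} {ψ : ProjBundle → ℝ} {w e d s : ℝ}
  {S : Set Torus} {J : Set UnitAddCircle}

/-- The part of a piece on which the images are not controlled is small. -/
theorem measureReal_uncontrolled_le (hΦ : IsAreaDiffeo Φ) (hS : MeasurableSet S)
    (hJ : MeasurableSet J) (he : 0 ≤ e) (hd : d ≤ 1 / 2) (hJd : 1 - d ≤ volume.real J)
    (hs : volume.real (innerHeights n k)ᶜ ≤ s)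
    (hE : ∀ J' ⊆ J, MeasurableSet J' →
      |volume.real (S ∩ {z | torusMap Φ z 1 ∈ J'})
        - volume.real S / volume.real J * volume.real J'|
        ≤ e * (volume.real S / volume.real J) * volume.real J')
    {jm jp im ip : ℕ}
    (hm : (1 - e) * volume.real S ≤ volume.real (Prod.fst '' ((S ×ˢ dirArc k jm) ∩
      projExt Φ ⁻¹' {Y | Y.1 1 ∈ J ∧ Y.2 ∈ dirArc k im})))
    (hp : (1 - e) * volume.real S ≤ volume.real (Prod.fst '' ((S ×ˢ dirArc k jp) ∩
      projExt Φ ⁻¹' {Y | Y.1 1 ∈ J ∧ Y.2 ∈ dirArc k ip}))) :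
    volume.real (S \ (Prod.fst '' ((S ×ˢ dirArc k jm) ∩
        projExt Φ ⁻¹' {Y | Y.1 1 ∈ J ∧ Y.2 ∈ dirArc k im}) ∩
      Prod.fst '' ((S ×ˢ dirArc k jp) ∩
        projExt Φ ⁻¹' {Y | Y.1 1 ∈ J ∧ Y.2 ∈ dirArc k ip}) ∩
      {z | torusMap Φ z 1 ∈ innerHeights n k}))
      ≤ (2 * e + 2 * (1 + e) * s) * volume.real S := by
  have hWm := measurableSet_fst_image hΦ.1 hS hJ k jm im
  have hWp := measurableSet_fst_image hΦ.1 hS hJ k jp ip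
  have hsubm : Prod.fst '' ((S ×ˢ dirArc k jm) ∩
      projExt Φ ⁻¹' {Y | Y.1 1 ∈ J ∧ Y.2 ∈ dirArc k im}) ⊆ S ∩ {z | torusMap Φ z 1 ∈ J} := by
    rw [fst_image_eq]; exact inter_subset_left
  have hsubp : Prod.fst '' ((S ×ˢ dirArc k jp) ∩
      projExt Φ ⁻¹' {Y | Y.1 1 ∈ J ∧ Y.2 ∈ dirArc k ip}) ⊆ S ∩ {z | torusMap Φ z 1 ∈ J} := by
    rw [fst_image_eq]; exact inter_subset_left
  set Wm := Prod.fst '' ((S ×ˢ dirArc k jm) ∩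
      projExt Φ ⁻¹' {Y | Y.1 1 ∈ J ∧ Y.2 ∈ dirArc k im})
  set Wp := Prod.fst '' ((S ×ˢ dirArc k jp) ∩
      projExt Φ ⁻¹' {Y | Y.1 1 ∈ J ∧ Y.2 ∈ dirArc k ip})
  have hinner := measurableSet_innerHeights n k
  -- A bad point has no good neighbouring direction on one side, or else its image has a height in J
  -- near the boundary of a strip.
  have hsub : S \ (Wm ∩ Wp ∩ {z | torusMap Φ z 1 ∈ innerHeights n k})
      ⊆ ((S \ Wm) ∪ (S \ Wp)) ∪ (S ∩ {z | torusMap Φ z 1 ∈ J \ innerHeights n k}) := by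
    rintro z ⟨hz, hn⟩
    by_cases h1 : z ∈ Wm
    · by_cases h2 : z ∈ Wp
      · exact Or.inr ⟨hz, (hsubm h1).2, fun h3 => hn ⟨⟨h1, h2⟩, h3⟩⟩
      · exact Or.inl (Or.inr ⟨hz, h2⟩)
    · exact Or.inl (Or.inl ⟨hz, h1⟩)
  have hm' : volume.real (S \ Wm) ≤ e * volume.real S := by
    rw [measureReal_sdiff (hsubm.trans inter_subset_left) hWm]; linarith
  have hp' : volume.real (S \ Wp) ≤ e * volume.real S := by
    rw [measureReal_sdiff (hsubp.trans inter_subset_left) hWp]; linarith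
  have h3 : volume.real (S ∩ {z | torusMap Φ z 1 ∈ J \ innerHeights n k})
      ≤ 2 * (1 + e) * s * volume.real S := by
    have h1 := (abs_le.1 (hE (J \ innerHeights n k) sdiff_subset (hJ.diff hinner))).2
    have h2 : volume.real (J \ innerHeights n k) ≤ s :=
      (measureReal_mono (fun t ht => ht.2)).trans hs
    have hJ2 : 1 / 2 ≤ volume.real J := by linarith
    have h4 : volume.real S / volume.real J ≤ 2 * volume.real S := by
      rw [div_le_iff₀ (by linarith)]
      have : 0 ≤ volume.real S := measureReal_nonneg
      nlinarith
    have h5 : 0 ≤ volume.real S / volume.real J := div_nonneg measureReal_nonneg measureReal_nonneg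
    have h6 : 0 ≤ volume.real (J \ innerHeights n k) := measureReal_nonneg
    have h7 : 0 ≤ volume.real S := measureReal_nonneg
    calc _ ≤ (1 + e) * (volume.real S / volume.real J) * volume.real (J \ innerHeights n k) := by
          linarith
      _ ≤ (1 + e) * (2 * volume.real S) * s := by gcongr
      _ = _ := by ring
  calc _ ≤ volume.real (((S \ Wm) ∪ (S \ Wp)) ∪ (S ∩ {z | torusMap Φ z 1 ∈ J \ innerHeights n k})) :=
        measureReal_mono hsub
    _ ≤ volume.real (S \ Wm) + volume.real (S \ Wp)
        + volume.real (S ∩ {z | torusMap Φ z 1 ∈ J \ innerHeights n k}) :=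
        (measureReal_union_le _ _).trans (add_le_add_left (measureReal_union_le _ _) _)
    _ ≤ _ := by linarith

/-- The heights of the images of a piece are almost uniformly distributed. -/
theorem abs_integral_height_sub_le (hΦ : IsAreaDiffeo Φ)
    (hJ : MeasurableSet J) (he : 0 ≤ e) (hd : d ≤ 1 / 2) (hJd : 1 - d ≤ volume.real J)
    (hE : ∀ J' ⊆ J, MeasurableSet J' →
      |volume.real (S ∩ {z | torusMap Φ z 1 ∈ J'})
        - volume.real S / volume.real J * volume.real J'|
        ≤ e * (volume.real S / volume.real J) * volume.real J')
    {G : UnitAddCircle → ℝ} (hG : Measurable G) (hG0 : ∀ r, 0 ≤ G r) (hG1 : ∀ r, G r ≤ 1) :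
    |(∫ z in S, G (torusMap Φ z 1)) - volume.real S * ∫ r, G r| ≤ (2 * e + 2 * d) * volume.real S := by
  have hr := measurable_height hΦ.1
  set ρ := (volume.restrict S).map (fun z : Torus => torusMap Φ z 1) with hρ
  have hρr : ∀ J', MeasurableSet J' → ρ.real J' = volume.real (S ∩ {z | torusMap Φ z 1 ∈ J'}) := by
    intro J' hJ'
    rw [hρ, map_measureReal_apply hr hJ', measureReal_restrict_apply (hr hJ'), inter_comm]
    rfl
  have hJ0 : 0 < volume.real J := by linarith
  have hJ1 : volume.real J ≤ 1 := measureReal_le_one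
  have hS0 : 0 ≤ volume.real S := measureReal_nonneg
  have hquot : volume.real S / volume.real J * volume.real J = volume.real S :=
    div_mul_cancel₀ _ hJ0.ne'
  have hGi : ∀ (ξ : Measure UnitAddCircle) [IsFiniteMeasure ξ], Integrable G ξ := fun ξ _ =>
    integrable_of_abs_le hG (M := 1) fun r => by rw [abs_of_nonneg (hG0 r)]; exact hG1 r
  have h1 : ∫ z in S, G (torusMap Φ z 1) = ∫ r in J, G r ∂ρ + ∫ r in Jᶜ, G r ∂ρ := by
    rw [integral_add_compl hJ (hGi ρ), hρ, integral_map hr.aemeasurable hG.aestronglyMeasurable]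
  have h2 := abs_setIntegral_sub_mul_le (μ := ρ) (ν := volume) hJ
    (c := volume.real S / volume.real J) (e := e * (volume.real S / volume.real J))
    (by positivity) (by positivity) (fun J' hJJ hJ' => by rw [hρr J' hJ']; exact hE J' hJJ hJ')
    hG hG0 hG1
  rw [mul_assoc, hquot] at h2
  have h3 : ρ.real Jᶜ ≤ e * volume.real S := by
    have h := (abs_le.1 (hE J subset_rfl hJ)).1
    rw [mul_assoc, hquot, ← hρr J hJ] at h
    have h4 := measureReal_compl (μ := ρ) hJ
    have h5 : ρ.real univ = volume.real S := by rw [hρr _ MeasurableSet.univ]; simp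
    rw [h5] at h4
    linarith
  have h4 : 0 ≤ ∫ r in Jᶜ, G r ∂ρ := integral_nonneg hG0
  have h5 : ∫ r in Jᶜ, G r ∂ρ ≤ ρ.real Jᶜ := by
    have := setIntegral_mono (s := Jᶜ) (hGi ρ).integrableOn (integrable_const (1 : ℝ)).integrableOn hG1
    simpa using this
  have h6 : ∫ r, G r = (∫ r in J, G r) + ∫ r in Jᶜ, G r := (integral_add_compl hJ (hGi volume)).symm
  have h7 : 0 ≤ ∫ r in Jᶜ, G r := integral_nonneg hG0
  have h8 : ∫ r in Jᶜ, G r ≤ d := by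
    have := setIntegral_mono (s := Jᶜ) (hGi volume).integrableOn
      (integrable_const (1 : ℝ)).integrableOn hG1
    have h9 : volume.real Jᶜ = 1 - volume.real J := probReal_compl_eq_one_sub hJ
    simp at this
    linarith
  have h9 : 0 ≤ ∫ r in J, G r := integral_nonneg hG0
  have h10 : ∫ r in J, G r ≤ volume.real J := by
    have := setIntegral_mono (s := J) (hGi volume).integrableOn
      (integrable_const (1 : ℝ)).integrableOn hG1
    simpa using this
  set a := ∫ r in J, G r
  -- Replaces normalized averages over J by averages over the whole circle; each correction is at
  -- most d times the measure of S, and they have opposite signs.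
  have h11 : |volume.real S / volume.real J * a - volume.real S * ∫ r, G r| ≤ d * volume.real S := by
    have e1 : volume.real S / volume.real J * a - volume.real S * ∫ r, G r
        = volume.real S * (a / volume.real J * (1 - volume.real J) - ∫ r in Jᶜ, G r) := by
      rw [h6]; field_simp; ring
    have h12 : a / volume.real J ≤ 1 := (div_le_one hJ0).2 h10
    have h13 : 0 ≤ a / volume.real J := div_nonneg h9 hJ0.le
    rw [e1, abs_mul, abs_of_nonneg hS0, mul_comm]
    refine mul_le_mul_of_nonneg_right ?_ hS0
    rw [abs_le]
    constructor <;> nlinarith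
  have hd0 : 0 ≤ d := by linarith
  rw [h1]
  rw [abs_le] at h2 h11 ⊢
  have := mul_nonneg hd0 hS0
  constructor <;> linarith

/-- The average of a slowly varying function over the image of one piece of a partition element. -/
theorem abs_setIntegral_piece_sub_le (hg : IsStepShear n k q σ g) (hg' : IsAreaDiffeo g')
    (hgg' : diffeoDist 2 g g' < ε) (hε : ε < stripMargin n k) (hk : 4 ≤ k) (hεk : ε ≤ 1 / (8 * k))
    (hγ : γ + (shearSize n q σ : ℝ) / (k : ℝ) ^ 5 + ε ≤ 1 / k)
    (hb0 : 0 < shearSize n q σ) (hbk : 1 / (shearSize n q σ : ℝ) < 3 / k)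
    (hΦ : IsAreaDiffeo Φ) (hψ : Continuous ψ) (hψ0 : ∀ X, 0 ≤ ψ X) (hψ1 : ∀ X, ψ X ≤ 1)
    (hw : ∀ X Y, projDist X Y < 3 / k → |ψ X - ψ Y| ≤ w)
    (hS : MeasurableSet S) (hJ : MeasurableSet J) (he : 0 ≤ e) (hd : d ≤ 1 / 2)
    (hJd : 1 - d ≤ volume.real J) (hs : volume.real (innerHeights n k)ᶜ ≤ s) {c : ℝ}
    (hc : ∀ z ∈ S, torusMap Φ z 0 ∈ arc c (c + γ))
    (hE : ∀ J' ⊆ J, MeasurableSet J' →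
      |volume.real (S ∩ {z | torusMap Φ z 1 ∈ J'})
        - volume.real S / volume.real J * volume.real J'|
        ≤ e * (volume.real S / volume.real J) * volume.real J')
    {j i jm jp im ip : ℕ} (hjm : ∃ N : ℤ, (j : ℤ) - 1 = jm + N * k)
    (hjp : ∃ N : ℤ, (j : ℤ) + 1 = jp + N * k) (him : ∃ N : ℤ, (i : ℤ) - 1 = im + N * k)
    (hip : ∃ N : ℤ, (i : ℤ) + 1 = ip + N * k)
    (hm : (1 - e) * volume.real S ≤ volume.real (Prod.fst '' ((S ×ˢ dirArc k jm) ∩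
      projExt Φ ⁻¹' {Y | Y.1 1 ∈ J ∧ Y.2 ∈ dirArc k im})))
    (hp : (1 - e) * volume.real S ≤ volume.real (Prod.fst '' ((S ×ˢ dirArc k jp) ∩
      projExt Φ ⁻¹' {Y | Y.1 1 ∈ J ∧ Y.2 ∈ dirArc k ip}))) :
    |(∫ X in S ×ˢ dirArc k j, ψ (projExt g' (projExt Φ X)))
      - volume.real S * volume.real (dirArc k j) * ∫ z, ψ (z, ((i / k : ℝ) : UnitAddCircle))|
      ≤ (2 * w + 4 * e + 2 * (1 + e) * s + 2 * d) *
        (volume.real S * volume.real (dirArc k j)) := by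
  have hψb : ∀ X, |ψ X| ≤ 1 := fun X => by rw [abs_of_nonneg (hψ0 X)]; exact hψ1 X
  have hbad := measureReal_uncontrolled_le (n := n) hΦ hS hJ he hd hJd hs hE hm hp
  have hWm := measurableSet_fst_image hΦ.1 hS hJ k jm im
  have hWp := measurableSet_fst_image hΦ.1 hS hJ k jp ip
  have hdir := fun (X : ProjBundle) hX h1 h2 => dist_direction_le (S := S) (J := J) hΦ hk hjm hjp
    him hip (X := X) hX h1 h2
  set Wm := Prod.fst '' ((S ×ˢ dirArc k jm) ∩
      projExt Φ ⁻¹' {Y | Y.1 1 ∈ J ∧ Y.2 ∈ dirArc k im})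
  set Wp := Prod.fst '' ((S ×ˢ dirArc k jp) ∩
      projExt Φ ⁻¹' {Y | Y.1 1 ∈ J ∧ Y.2 ∈ dirArc k ip})
  set B := S \ (Wm ∩ Wp ∩ {z | torusMap Φ z 1 ∈ innerHeights n k}) with hB
  have hBm : MeasurableSet B := hS.diff ((hWm.inter hWp).inter
    (measurable_height hΦ.1 (measurableSet_innerHeights n k)))
  set T := dirArc k j with hT
  have hTm : MeasurableSet T := measurableSet_dirArc k j
  set u : UnitAddCircle := ((i / k : ℝ) : UnitAddCircle) with hu
  -- The piece is mapped into a thin vertical strip at c, and the shear turns it into a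
  -- neighbourhood of this graph, with all directions close to u.
  set G : UnitAddCircle → ℝ := fun r => ψ (![(c : UnitAddCircle) + shearSize n q σ • r, r], u) with hG
  have hGc : Continuous G := hψ.comp (by fun_prop)
  have hw0 : 0 ≤ w := by
    refine (abs_nonneg _).trans (hw ((0 : Torus), (0 : UnitAddCircle)) (0, 0) ?_)
    rw [projDist_same_base, dist_self]
    have : (0 : ℝ) < k := by exact_mod_cast (by omega : 0 < k)
    positivity
  have hpt : ∀ X ∈ S ×ˢ T, |ψ (projExt g' (projExt Φ X)) - G (torusMap Φ X.1 1)|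
      ≤ w + B.indicator (fun _ => (1 : ℝ)) X.1 := by
    rintro X ⟨hX1, hX2⟩
    by_cases hXB : X.1 ∈ B
    · rw [indicator_of_mem hXB]
      have h1 := hψ0 (projExt g' (projExt Φ X))
      have h2 := hψ1 (projExt g' (projExt Φ X))
      have h3 : 0 ≤ G (torusMap Φ X.1 1) := hψ0 _
      have h4 : G (torusMap Φ X.1 1) ≤ 1 := hψ1 _
      rw [abs_le]
      constructor <;> linarith
    · rw [indicator_of_notMem hXB, add_zero]
      have hX3 : X.1 ∈ Wm ∩ Wp ∩ {z | torusMap Φ z 1 ∈ innerHeights n k} := by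
        by_contra h
        exact hXB ⟨hX1, h⟩
      exact hw _ _ (projDist_shear_lt hg hg' hgg' hε (by omega) hεk hγ (Y := projExt Φ X) hX3.2
        (hc _ hX1) (hdir X hX2 hX3.1.1 hX3.1.2))
  have hf : Continuous fun X => ψ (projExt g' (projExt Φ X)) :=
    hψ.comp (hg'.1.continuous_projExt.comp hΦ.1.continuous_projExt)
  have hGΦ : Continuous fun X : ProjBundle => G (torusMap Φ X.1 1) :=
    hGc.comp ((continuous_apply 1).comp (hΦ.1.continuous_torusMap.comp continuous_fst))
  have hfi : Integrable fun X => ψ (projExt g' (projExt Φ X)) :=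
    integrable_of_continuous hf fun _ => hψb _
  have hGi : Integrable fun X : ProjBundle => G (torusMap Φ X.1 1) :=
    integrable_of_continuous hGΦ fun _ => hψb _
  have hSTm : MeasurableSet (S ×ˢ T) := hS.prod hTm
  have hind : Measurable fun X : ProjBundle => B.indicator (fun _ => (1 : ℝ)) X.1 :=
    (measurable_const.indicator hBm).comp measurable_fst
  have hindi : Integrable fun X : ProjBundle => B.indicator (fun _ => (1 : ℝ)) X.1 :=
    integrable_of_abs_le hind (M := 1) fun X => by
      by_cases h : X.1 ∈ B <;> simp [h]
  have hprod : ∀ f : Torus → ℝ, ∫ X in S ×ˢ T, f X.1 = (∫ z in S, f z) * volume.real T := by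
    intro f
    have := setIntegral_prod_mul (μ := (volume : Measure Torus)) (ν := (volume : Measure UnitAddCircle))
      f (fun _ => (1 : ℝ)) S T
    simpa [Measure.volume_eq_prod] using this
  have h1 : |(∫ X in S ×ˢ T, ψ (projExt g' (projExt Φ X)))
      - ∫ X in S ×ˢ T, G (torusMap Φ X.1 1)|
      ≤ (w * volume.real S + volume.real B) * volume.real T := by
    rw [← integral_sub hfi.integrableOn hGi.integrableOn]
    refine (abs_integral_le_integral_abs).trans ?_
    have hdiff : Integrable fun X : ProjBundle =>
        |ψ (projExt g' (projExt Φ X)) - G (torusMap Φ X.1 1)| := (hfi.sub hGi).abs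
    have hsum : Integrable fun X : ProjBundle => w + B.indicator (fun _ => (1 : ℝ)) X.1 :=
      (integrable_const w).add hindi
    refine (setIntegral_mono_on hdiff.integrableOn hsum.integrableOn hSTm hpt).trans (le_of_eq ?_)
    rw [hprod fun z => w + B.indicator (fun _ => (1 : ℝ)) z]
    congr 1
    have hi1 : Integrable (B.indicator fun _ => (1 : ℝ)) :=
      (integrable_const (1 : ℝ)).indicator hBm
    rw [integral_add (integrable_const _) hi1.integrableOn, setIntegral_const, smul_eq_mul,
      setIntegral_indicator hBm, inter_eq_self_of_subset_right sdiff_subset]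
    simp [mul_comm]
    rfl
  rw [hprod fun z => G (torusMap Φ z 1)] at h1
  have h2 := abs_integral_height_sub_le (S := S) hΦ hJ he hd hJd hE hGc.measurable
    (fun r => hψ0 _) (fun r => hψ1 _)
  have h3 := abs_graph_average_sub_integral_le hb0 hbk hψ hψb hw (c : UnitAddCircle) u
  have hS0 : 0 ≤ volume.real S := measureReal_nonneg
  have hT0 : 0 ≤ volume.real T := measureReal_nonneg
  have h4 : |(∫ z in S, G (torusMap Φ z 1)) - volume.real S * ∫ z, ψ (z, u)|
      ≤ (w + 2 * e + 2 * d) * volume.real S := by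
    have h3' : |volume.real S * (∫ r, G r) - volume.real S * ∫ z, ψ (z, u)| ≤ w * volume.real S := by
      rw [← mul_sub, abs_mul, abs_of_nonneg hS0, mul_comm]
      exact mul_le_mul_of_nonneg_right h3 hS0
    have := abs_sub_le (∫ z in S, G (torusMap Φ z 1)) (volume.real S * ∫ r, G r)
      (volume.real S * ∫ z, ψ (z, u))
    linarith
  have h5 : |(∫ z in S, G (torusMap Φ z 1)) * volume.real T
      - volume.real S * volume.real T * ∫ z, ψ (z, u)|
      ≤ (w + 2 * e + 2 * d) * volume.real S * volume.real T := by
    have e1 : (∫ z in S, G (torusMap Φ z 1)) * volume.real T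
        - volume.real S * volume.real T * ∫ z, ψ (z, u)
        = ((∫ z in S, G (torusMap Φ z 1)) - volume.real S * ∫ z, ψ (z, u)) * volume.real T := by ring
    rw [e1, abs_mul, abs_of_nonneg hT0]
    exact mul_le_mul_of_nonneg_right h4 hT0
  refine (abs_sub_le _ _ _).trans ((add_le_add h1 h5).trans ?_)
  have := mul_le_mul_of_nonneg_right hbad hT0
  linarith

end Piece

section Element

/-- The average over the fibres over a rotated set of equidistributed directions. -/
theorem abs_fibre_average_shift_sub_integral_le {k : ℕ} {ψ : ProjBundle → ℝ} {w : ℝ} (hk : 0 < k)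
    (hψ : Continuous ψ) (hb : ∀ X, |ψ X| ≤ 1)
    (hw : ∀ X Y, projDist X Y < 3 / k → |ψ X - ψ Y| ≤ w) (j : ℕ) :
    |(∑ l : Fin k, ∫ z, ψ (z, (((l + j : ℕ) / k : ℝ) : UnitAddCircle))) / k - ∫ X, ψ X| ≤ w := by
  set c : UnitAddCircle := ((j / k : ℝ) : UnitAddCircle) with hc
  have hc' : Continuous fun X : ProjBundle => ψ (X.1, X.2 + c) := hψ.comp (by fun_prop)
  have h := abs_fibre_average_sub_integral_le (ψ := fun X => ψ (X.1, X.2 + c)) (w := w) hk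
    hc' (fun _ => hb _) fun X Y hXY => hw _ _ (by
      simpa only [projDist, dist_add_right] using hXY)
  have h1 : ∫ X : ProjBundle, ψ (X.1, X.2 + c) = ∫ X, ψ X := by
    have hi := integrable_of_continuous (μ := (volume : Measure ProjBundle)) hc' fun _ => hb _
    have hi' := integrable_of_continuous (μ := (volume : Measure ProjBundle)) hψ hb
    rw [Measure.volume_eq_prod] at hi hi' ⊢
    rw [integral_prod _ hi, integral_prod _ hi']
    refine integral_congr_ae (Eventually.of_forall fun z => ?_)
    exact integral_add_right_eq_self (fun t => ψ (z, t)) c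
  rw [h1, ← Fin.sum_univ_eq_sum_range
    (fun l => ∫ z, ψ (z, ((l / k : ℝ) : UnitAddCircle) + c)) k] at h
  have h2 : ∀ l : Fin k, (((l / k : ℝ) : UnitAddCircle) + c)
      = (((l + j : ℕ) / k : ℝ) : UnitAddCircle) := fun l => by
    rw [hc, ← AddCircle.coe_add]
    congr 1
    push_cast
    ring
  simpa only [h2] using h

/-- Closed neighbouring arcs share endpoints, so the partition elements are disjoint only up to null
sets. -/
theorem aedisjoint_dirArc {k j j' : ℕ} (hj : j < k) (hj' : j' < k) (hne : j ≠ j') :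
    volume (dirArc k j ∩ dirArc k j') = 0 := by
  have hk : (0 : ℝ) < k := by exact_mod_cast (by omega : 0 < k)
  have hsub : dirArc k j ∩ dirArc k j'
      ⊆ {((j / k : ℝ) : UnitAddCircle), (((j + 1) / k : ℝ) : UnitAddCircle)} := by
    rintro t ⟨⟨s, hs, rfl⟩, ⟨s', hs', e⟩⟩
    by_contra hcon
    simp only [mem_insert_iff, mem_singleton_iff, not_or] at hcon
    have h1 : (j / k : ℝ) < s := lt_of_le_of_ne hs.1 fun h => hcon.1 (by rw [h])
    have h2 : s < ((j + 1) / k : ℝ) := lt_of_le_of_ne hs.2 fun h => hcon.2 (by rw [← h])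
    have hjk : ((j : ℝ) + 1) / k ≤ 1 := by
      rw [div_le_one hk]; exact_mod_cast hj
    have hjk' : ((j' : ℝ) + 1) / k ≤ 1 := by
      rw [div_le_one hk]; exact_mod_cast hj'
    have h0 : (0 : ℝ) ≤ j / k := by positivity
    have h0' : (0 : ℝ) ≤ j' / k := by positivity
    obtain ⟨N, hN⟩ := coe_eq_coe_iff.1 e
    have hN1 : (N : ℝ) < 1 := by linarith [hs'.2]
    have hN2 : (-1 : ℝ) < N := by linarith [hs'.1]
    have hN0 : N = 0 := by
      have a : N < 1 := by exact_mod_cast hN1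
      have b : -1 < N := by exact_mod_cast hN2
      omega
    rw [hN0, Int.cast_zero, add_zero] at hN
    rw [hN] at hs'
    rw [div_lt_iff₀ hk] at h1
    rw [lt_div_iff₀ hk] at h2
    have h3 := (div_le_iff₀ hk).1 hs'.1
    have h4 := (le_div_iff₀ hk).1 hs'.2
    have a : (j : ℝ) < j' + 1 := by linarith
    have b : (j' : ℝ) < j + 1 := by linarith
    have a' : j < j' + 1 := by exact_mod_cast a
    have b' : j' < j + 1 := by exact_mod_cast b
    omega
  have hpt : ∀ x : UnitAddCircle, volume {x} = 0 := fun x => by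
    rw [← Metric.closedBall_zero, AddCircle.volume_closedBall]
    simp
  refine measure_mono_null hsub ?_
  rw [insert_eq]
  exact measure_union_null (hpt _) (hpt _)

variable {n k q : ℕ} {σ ε γ : ℝ} {g g' Φ : Equiv.Perm Plane} {ψ : ProjBundle → ℝ} {w e d s : ℝ}
  {S : Fin k → Set Torus}

/-- The distribution property with common bounds and without divisions. -/
theorem AbC.IsDistributing.exists_bounds {Φ : Plane → Plane} {δ ε₁ ε₂ : ℝ}
    (h : IsDistributing Φ S γ δ ε₁ ε₂) (hδ : δ ≤ d) (h1 : ε₁ ≤ e) (h2 : ε₂ ≤ e) (hd : d ≤ 1 / 2) :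
    ∃ (J : Fin k → Set UnitAddCircle) (c : Fin k → ℝ), ∀ l,
      MeasurableSet (J l) ∧ 1 - d ≤ volume.real (J l) ∧
      (∀ z ∈ S l, torusMap Φ z 0 ∈ arc (c l) (c l + γ)) ∧
      (∀ J' ⊆ J l, MeasurableSet J' →
        |volume.real (S l ∩ {z | torusMap Φ z 1 ∈ J'})
          - volume.real (S l) / volume.real (J l) * volume.real J'|
          ≤ e * (volume.real (S l) / volume.real (J l)) * volume.real J') ∧
      ∀ j i : Fin k, (i : ℕ) ≡ (l : ℕ) + (j : ℕ) [MOD k] →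
        (1 - e) * volume.real (S l) ≤ volume.real (Prod.fst '' ((S l ×ˢ dirArc k j) ∩
          projExt Φ ⁻¹' {Y | Y.1 1 ∈ J l ∧ Y.2 ∈ dirArc k i})) := by
  obtain ⟨J, c, hJ, hc, hE, hF⟩ := h
  refine ⟨J, c, fun l => ?_⟩
  have hJ0 : 1 - d ≤ volume.real (J l) := by linarith [(hJ l).2.2.1]
  have hJpos : 0 < volume.real (J l) := by linarith
  have hS0 : 0 ≤ volume.real (S l) := measureReal_nonneg
  refine ⟨(hJ l).1, hJ0, hc l, fun J' hJ' hm => ?_, fun j i hij => ?_⟩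
  -- For a null piece the quotients are 0 by convention and say nothing; the claim without division
  -- is trivial there.
  · rcases hS0.eq_or_lt with h0 | h0
    · rw [← h0]
      have : volume.real (S l ∩ {z | torusMap Φ z 1 ∈ J'}) = 0 :=
        le_antisymm ((measureReal_mono inter_subset_left).trans_eq h0.symm) measureReal_nonneg
      simp [this]
    · have h3 := hE l J' hJ' hm
      have hq : 0 ≤ volume.real J' / volume.real (J l) := div_nonneg measureReal_nonneg hJpos.le
      have h4 := mul_le_mul_of_nonneg_left (h3.trans (mul_le_mul_of_nonneg_right h1 hq)) hS0
      rw [← abs_of_nonneg hS0, ← abs_mul, abs_of_nonneg hS0, mul_sub,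
        mul_div_cancel₀ _ h0.ne'] at h4
      have e1 : volume.real (S l) / volume.real (J l) * volume.real J'
          = volume.real (S l) * (volume.real J' / volume.real (J l)) := by ring
      have e2 : e * (volume.real (S l) / volume.real (J l)) * volume.real J'
          = volume.real (S l) * (e * (volume.real J' / volume.real (J l))) := by ring
      rw [e1, e2]
      exact h4
  · rcases hS0.eq_or_lt with h0 | h0
    · rw [← h0, mul_zero]; exact measureReal_nonneg
    · have h3 := hF j i l hij (J l) subset_rfl (hJ l).1
      rw [div_self hJpos.ne', mul_one] at h3
      have h4 := (abs_le.1 (h3.trans h2)).1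
      have h5 : 1 - e ≤ volume.real (Prod.fst '' ((S l ×ˢ dirArc k j) ∩
          projExt Φ ⁻¹' {Y | Y.1 1 ∈ J l ∧ Y.2 ∈ dirArc k i})) / volume.real (S l) := by linarith
      exact (le_div_iff₀ h0).1 h5

/-- The average of a slowly varying function over the image of a partition element. -/
theorem abs_setIntegral_element_sub_le {δ ε₁ ε₂ : ℝ} (hg : IsStepShear n k q σ g)
    (hg' : IsAreaDiffeo g')
    (hgg' : diffeoDist 2 g g' < ε) (hε : ε < stripMargin n k) (hk : 4 ≤ k) (hεk : ε ≤ 1 / (8 * k))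
    (hγ : γ + (shearSize n q σ : ℝ) / (k : ℝ) ^ 5 + ε ≤ 1 / k)
    (hb0 : 0 < shearSize n q σ) (hbk : 1 / (shearSize n q σ : ℝ) < 3 / k)
    (hΦ : IsAreaDiffeo Φ) (hψ : Continuous ψ) (hψ0 : ∀ X, 0 ≤ ψ X) (hψ1 : ∀ X, ψ X ≤ 1)
    (hw : ∀ X Y, projDist X Y < 3 / k → |ψ X - ψ Y| ≤ w)
    (hS : ∀ l, MeasurableSet (S l)) (hdisj : Pairwise (Function.onFun Disjoint S))
    (hsame : ∀ l l', volume (S l) = volume (S l')) (he : 0 ≤ e) (hd : d ≤ 1 / 2)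
    (hs : volume.real (innerHeights n k)ᶜ ≤ s) (h : IsDistributing Φ S γ δ ε₁ ε₂) (hδ : δ ≤ d)
    (h1 : ε₁ ≤ e) (h2 : ε₂ ≤ e) (j : Fin k) :
    |∫ X in (⋃ l, S l) ×ˢ dirArc k j, (ψ (projExt g' (projExt Φ X)) - ∫ Y, ψ Y)|
      ≤ (3 * w + 4 * e + 2 * (1 + e) * s + 2 * d) *
        volume.real ((⋃ l, S l) ×ˢ dirArc k j) := by
  obtain ⟨J, c, hJ⟩ := h.exists_bounds hδ h1 h2 hd
  have hψb : ∀ X, |ψ X| ≤ 1 := fun X => by rw [abs_of_nonneg (hψ0 X)]; exact hψ1 X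
  have hk0 : 0 < k := by omega
  have hk' : (0 : ℝ) < k := by exact_mod_cast hk0
  have hpiece : ∀ l, |(∫ X in S l ×ˢ dirArc k j, ψ (projExt g' (projExt Φ X)))
      - volume.real (S l) * volume.real (dirArc k j) *
        ∫ z, ψ (z, (((l + j : ℕ) / k : ℝ) : UnitAddCircle))|
      ≤ (2 * w + 4 * e + 2 * (1 + e) * s + 2 * d) *
        (volume.real (S l) * volume.real (dirArc k j)) := by
    intro l
    obtain ⟨hJm, hJd, hJc, hJE, hJF⟩ := hJ l
    -- The cyclic neighbours of j, with k - 1 in place of -1. The distribution property sends them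
    -- to im and ip, the neighbours of l + j modulo k; the centre l + j need not be reduced, since
    -- only its image in the circle enters.
    have a1 := Nat.mod_add_div (j + (k - 1)) k
    have a2 := Nat.mod_add_div (j + 1) k
    set jm := (j + (k - 1)) % k with hjm
    set jp := (j + 1) % k with hjp
    have b1 := Nat.mod_add_div (l + jm) k
    have b2 := Nat.mod_add_div (l + jp) k
    set im := (l + jm) % k with him
    set ip := (l + jp) % k with hip
    obtain ⟨N1, hN1⟩ : ∃ N : ℕ, (j + (k - 1)) / k = N := ⟨_, rfl⟩
    obtain ⟨N2, hN2⟩ : ∃ N : ℕ, (j + 1) / k = N := ⟨_, rfl⟩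
    obtain ⟨N3, hN3⟩ : ∃ N : ℕ, (l + jm) / k = N := ⟨_, rfl⟩
    obtain ⟨N4, hN4⟩ : ∃ N : ℕ, (l + jp) / k = N := ⟨_, rfl⟩
    rw [hN1] at a1
    rw [hN2] at a2
    rw [hN3] at b1
    rw [hN4] at b2
    have c1 : (jm : ℤ) + k * N1 = j + k - 1 := by
      have : ((j + (k - 1) : ℕ) : ℤ) = j + k - 1 := by omega
      rw [← this]
      exact_mod_cast a1
    have c2 : (jp : ℤ) + k * N2 = j + 1 := by exact_mod_cast a2
    have d1 : (im : ℤ) + k * N3 = l + jm := by exact_mod_cast b1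
    have d2 : (ip : ℤ) + k * N4 = l + jp := by exact_mod_cast b2
    exact abs_setIntegral_piece_sub_le hg hg' hgg' hε hk hεk hγ hb0 hbk hΦ hψ hψ0 hψ1 hw (hS l) hJm
      he hd hJd hs hJc hJE (j := j) (i := l + j) (jm := jm) (jp := jp) (im := im)
      (ip := ip) ⟨N1 - 1, by linear_combination -c1⟩ ⟨N2, by linear_combination -c2⟩
      ⟨N3 + (N1 - 1), by push_cast; linear_combination -c1 - d1⟩
      ⟨N4 + N2, by push_cast; linear_combination -c2 - d2⟩
      (hJF ⟨jm, Nat.mod_lt _ hk0⟩ ⟨im, Nat.mod_lt _ hk0⟩ (Nat.mod_modEq _ _))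
      (hJF ⟨jp, Nat.mod_lt _ hk0⟩ ⟨ip, Nat.mod_lt _ hk0⟩ (Nat.mod_modEq _ _))
  set T := dirArc k j with hT
  have hTm : MeasurableSet T := measurableSet_dirArc k j
  set m₀ := volume.real (S ⟨0, hk0⟩) with hm₀
  have hsame' : ∀ l, volume.real (S l) = m₀ := fun l => by
    rw [hm₀, measureReal_def, hsame l ⟨0, hk0⟩, ← measureReal_def]
  simp only [hsame'] at hpiece
  have hf : Continuous fun X => ψ (projExt g' (projExt Φ X)) :=
    hψ.comp (hg'.1.continuous_projExt.comp hΦ.1.continuous_projExt)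
  have hfi : Integrable fun X => ψ (projExt g' (projExt Φ X)) :=
    integrable_of_continuous hf fun _ => hψb _
  have hset : (⋃ l, S l) ×ˢ T = ⋃ l, S l ×ˢ T := iUnion_prod_const
  have hpm : ∀ l, MeasurableSet (S l ×ˢ T) := fun l => (hS l).prod hTm
  have hpd : Pairwise (Function.onFun Disjoint fun l => S l ×ˢ T) := fun l l' hll =>
    Disjoint.set_prod_left (hdisj hll) _ _
  have hvol : volume.real ((⋃ l, S l) ×ˢ T) = k * (m₀ * volume.real T) := by
    rw [hset, measureReal_iUnion_fintype hpd hpm]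
    simp [Measure.volume_eq_prod, measureReal_prod_prod, hsame']
  have hint : ∫ X in (⋃ l, S l) ×ˢ T, ψ (projExt g' (projExt Φ X))
      = ∑ l, ∫ X in S l ×ˢ T, ψ (projExt g' (projExt Φ X)) := by
    rw [hset, integral_iUnion_fintype hpm hpd fun _ => hfi.integrableOn]
  have hsum := (Finset.abs_sum_le_sum_abs _ Finset.univ).trans
    (Finset.sum_le_sum fun l _ => hpiece l)
  rw [Finset.sum_sub_distrib, ← hint, ← Finset.mul_sum, Finset.sum_const, Finset.card_univ,
    Fintype.card_fin, nsmul_eq_mul] at hsum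
  -- As l runs over all k pieces, the directions l + j run through all arcs, so the fibre integrals
  -- average to the integral over the bundle. This is the third w.
  have havg := abs_fibre_average_shift_sub_integral_le hk0 hψ hψb hw j
  set A := ∑ l : Fin k, ∫ z, ψ (z, (((l + j : ℕ) / k : ℝ) : UnitAddCircle))
  have hm0 : 0 ≤ m₀ * volume.real T := mul_nonneg measureReal_nonneg measureReal_nonneg
  have h3 : |m₀ * volume.real T * A - k * (m₀ * volume.real T) * ∫ Y, ψ Y|
      ≤ w * (k * (m₀ * volume.real T)) := by
    have e1 : m₀ * volume.real T * A - k * (m₀ * volume.real T) * ∫ Y, ψ Y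
        = k * (m₀ * volume.real T) * (A / k - ∫ Y, ψ Y) := by field_simp
    rw [e1, abs_mul, abs_of_nonneg (by positivity), mul_comm]
    exact mul_le_mul_of_nonneg_right havg (by positivity)
  rw [integral_sub hfi.integrableOn (integrable_const _), setIntegral_const, smul_eq_mul, hvol]
  refine (abs_sub_le _ _ _).trans ((add_le_add hsum h3).trans (le_of_eq ?_))
  ring

/-- The average of a slowly varying function over the image of a union of partition elements. -/
theorem abs_setIntegral_union_sub_le {N : ℕ} {h : Plane → Plane} {I : Fin N → Fin k → Set Torus}
    (hI : IsBasePartition n k q h I) {f : ProjBundle → ℝ} (hf : Integrable f) {E : ℝ}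
    (hE : ∀ (i : Fin N) (j : Fin k), |∫ X in (⋃ l, I i l) ×ˢ dirArc k j, f X|
      ≤ E * volume.real ((⋃ l, I i l) ×ˢ dirArc k j)) (A : Set (Fin N × Fin k)) :
    |∫ X in ⋃ a : A, (⋃ l, I a.1.1 l) ×ˢ dirArc k a.1.2, f X|
      ≤ E * volume.real (⋃ a : A, (⋃ l, I a.1.1 l) ×ˢ dirArc k (a.1.2 : ℕ)) := by
  have hm : ∀ a : A, MeasurableSet ((⋃ l, I a.1.1 l) ×ˢ dirArc k (a.1.2 : ℕ)) := fun a =>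
    (MeasurableSet.iUnion fun l => hI.measurableSet a.1.1 l).prod (measurableSet_dirArc _ _)
  have hd : Pairwise (Function.onFun (AEDisjoint (volume : Measure ProjBundle))
      fun a : A => (⋃ l, I a.1.1 l) ×ˢ dirArc k (a.1.2 : ℕ)) := by
    rintro ⟨⟨i, j⟩, ha⟩ ⟨⟨i', j'⟩, ha'⟩ hne
    change volume (((⋃ l, I i l) ×ˢ dirArc k j) ∩ ((⋃ l, I i' l) ×ˢ dirArc k j')) = 0
    by_cases hii : i = i'
    · subst hii
      have hjj : (j : ℕ) ≠ j' := fun hjj => hne (by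
        have : j = j' := Fin.ext hjj
        subst this
        rfl)
      rw [prod_inter_prod, Measure.volume_eq_prod, Measure.prod_prod,
        aedisjoint_dirArc j.2 j'.2 hjj, mul_zero]
    · have : Disjoint ((⋃ l, I i l) ×ˢ dirArc k j) ((⋃ l, I i' l) ×ˢ dirArc k j') := by
        refine Disjoint.set_prod_left ?_ _ _
        rw [disjoint_iUnion_left]
        intro l
        rw [disjoint_iUnion_right]
        intro l'
        exact hI.disjoint i l i' l' fun h => hii (congrArg Prod.fst h)
      rw [this.inter_eq, measure_empty]
  have h1 := integral_iUnion_ae (μ := volume) (f := f) (fun a => (hm a).nullMeasurableSet) hd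
    hf.integrableOn
  have h2 := integral_iUnion_ae (μ := volume) (f := fun _ => (1 : ℝ))
    (fun a => (hm a).nullMeasurableSet) hd (integrable_const (1 : ℝ)).integrableOn
  have : Fintype A := Fintype.ofFinite A
  rw [tsum_fintype] at h1 h2
  simp only [setIntegral_const, smul_eq_mul, mul_one] at h2
  rw [h1, h2, Finset.mul_sum]
  exact (Finset.abs_sum_le_sum_abs _ _).trans (Finset.sum_le_sum fun a _ => hE a.1.1 a.1.2)

end Element

namespace IsClosePair

variable {σ : ℝ} {k l q : ℕ → ℕ} {p : ℕ → ℤ} {g φ g' φ' : ℕ → Equiv.Perm Plane}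
  {N : ℕ → ℕ} {I : ∀ n, Fin (N n) → Fin (k n) → Set Torus} {n : ℕ}

theorem strip_defect_le (hS : IsClosePair σ k l q p g φ g' φ' N I) (hn : 1 ≤ n) :
    6 * ((k n : ℝ) ^ 5 * stripMargin n (k n)) ≤ 3 / (n : ℝ) ^ 2 := by
  have hk1 := hS.par.one_le_k_real hn
  have hn1 : (1 : ℝ) ≤ n := by exact_mod_cast hn
  have : 6 * ((k n : ℝ) ^ 5 * stripMargin n (k n)) = 3 / ((n : ℝ) ^ 5 * (k n : ℝ) ^ 10) := by
    unfold stripMargin; field_simp; norm_num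
  rw [this]
  gcongr
  calc (n : ℝ) ^ 2 ≤ (n : ℝ) ^ 5 * 1 := by
        rw [mul_one]; exact pow_le_pow_right₀ hn1 (by norm_num)
    _ ≤ _ := by gcongr; exact one_le_pow₀ hk1

/-- The average of a slowly varying function over the image of a union of partition elements. -/
theorem abs_setIntegral_sub_le (hS : IsClosePair σ k l q p g φ g' φ' N I) (hσ : 1 / 4 < σ)
    (hn : 4 < n) (hsh : n * shearSize n (q n) σ ≤ k n ^ 3) {Φ : Equiv.Perm Plane}
    (hΦ : IsAreaDiffeo Φ) {γ δ ε₁ ε₂ : ℝ} (hγ : γ < 1 / ((k n : ℝ) ^ 3 * q n))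
    (hδ : δ < 50 / (k n : ℝ) ^ 2) (hε₁ : ε₁ < 150 / (n : ℝ)) (hε₂ : ε₂ < 150 / (n : ℝ))
    (hdist : ∀ i, IsDistributing Φ (I n i) γ δ ε₁ ε₂) {ψ : ProjBundle → ℝ} {w : ℝ}
    (hψ : Continuous ψ) (hψ0 : ∀ X, 0 ≤ ψ X) (hψ1 : ∀ X, ψ X ≤ 1)
    (hw : ∀ X Y, projDist X Y < 3 / k n → |ψ X - ψ Y| ≤ w) (A : Set (Fin (N n) × Fin (k n))) :
    |∫ X in ⋃ a : A, (⋃ l, I n a.1.1 l) ×ˢ dirArc (k n) a.1.2,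
        (ψ (projExt (g' n) (projExt Φ X)) - ∫ Y, ψ Y)| ≤ 3 * w + 1000 / n := by
  have hn1 : 1 ≤ n := by omega
  have hn5 : (5 : ℝ) ≤ n := by exact_mod_cast hn
  have hk := hS.par.one_le_k hn1
  have hk1 := hS.par.one_le_k_real hn1
  have hkn5 : n ^ 5 ≤ k n := hS.par.le_k n hn1
  have hkn : (n : ℝ) ≤ k n := by
    have : n ≤ k n := (Nat.le_self_pow (by norm_num) n).trans hkn5
    exact_mod_cast this
  have hk0 : (0 : ℝ) < k n := by linarith
  have hk100 : (3125 : ℝ) ≤ k n := by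
    have : 5 ^ 5 ≤ k n := (Nat.pow_le_pow_left hn 5).trans hkn5
    exact_mod_cast this
  have hε := hS.precision_le_one hn1
  have hεm := hS.par.precision_lt_stripMargin hS.area_conj hn1 (φ n)
  have hm0 : 0 < stripMargin n (k n) :=
    lt_of_lt_of_le (by positivity) (hS.par.le_stripMargin hn1)
  set ε := precision n (k n) (l n) (q n) (conjMap g φ (n - 1)) (φ n)
  have hw0 : 0 ≤ w := by
    refine (abs_nonneg _).trans (hw ((0 : Torus), (0 : UnitAddCircle)) (0, 0) ?_)
    rw [projDist_same_base, dist_self]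
    positivity
  have hb := hS.par.le_shearSize hσ hn1
  have hb' : 2 * (k n : ℝ) ≤ shearSize n (q n) σ := by exact_mod_cast hb
  have hε8 : ε ≤ 1 / (8 * k n) := hε.trans (by gcongr; norm_num)
  have hqk : 16 * (k n : ℝ) ^ 4 < q n := hS.par.k_lt_q hn1
  -- In units of 1/k_n the terms are at most 1/16, 1/5 and 1/8; the second uses n·b_n ≤ k_n³ with n
  -- ≥ 5.
  have hγb : γ + (shearSize n (q n) σ : ℝ) / (k n : ℝ) ^ 5 + ε ≤ 1 / k n := by
    have e1 : γ ≤ 1 / k n / 16 := by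
      refine hγ.le.trans ?_
      rw [div_div]
      refine one_div_le_one_div_of_le (by positivity) ?_
      have h4 : (1 : ℝ) ≤ (k n : ℝ) ^ 4 := one_le_pow₀ hk1
      have h3 : (k n : ℝ) ≤ (k n : ℝ) ^ 3 := le_self_pow₀ hk1 (by norm_num)
      exact mul_le_mul h3 (by linarith) (by norm_num) (by positivity)
    have e2 : (shearSize n (q n) σ : ℝ) / (k n : ℝ) ^ 5 ≤ 1 / k n / 5 := by
      rw [div_div, div_le_div_iff₀ (by positivity) (by positivity), one_mul]
      have h1 : (n : ℝ) * shearSize n (q n) σ ≤ (k n : ℝ) ^ 3 := by exact_mod_cast hsh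
      have h2 : (0 : ℝ) ≤ shearSize n (q n) σ := Nat.cast_nonneg _
      calc (shearSize n (q n) σ : ℝ) * (k n * 5) = (5 * shearSize n (q n) σ) * k n := by ring
        _ ≤ (k n : ℝ) ^ 3 * k n := by
            gcongr
            exact (mul_le_mul_of_nonneg_right hn5 h2).trans h1
        _ = (k n : ℝ) ^ 4 := by ring
        _ ≤ _ := pow_le_pow_right₀ hk1 (by norm_num)
    have e3 : ε ≤ 1 / k n / 8 := by rw [div_div, mul_comm]; exact hε8
    have e4 : 0 ≤ 1 / (k n : ℝ) := by positivity
    linarith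
  have hbk : 1 / (shearSize n (q n) σ : ℝ) < 3 / k n := by
    rw [div_lt_div_iff₀ (by linarith) hk0]
    linarith
  have hs : volume.real (innerHeights n (k n))ᶜ ≤ 3 / (n : ℝ) ^ 2 :=
    ENNReal.toReal_le_of_le_ofReal (by positivity)
      ((volume_innerHeights_compl_le hk).trans (ENNReal.ofReal_le_ofReal (hS.strip_defect_le hn1)))
  have hd : 50 / (k n : ℝ) ^ 2 ≤ 1 / 2 := by
    rw [div_le_iff₀ (by positivity)]
    nlinarith
  have hψb : ∀ X, |ψ X| ≤ 1 := fun X => by rw [abs_of_nonneg (hψ0 X)]; exact hψ1 X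
  have hf : Integrable fun X => ψ (projExt (g' n) (projExt Φ X)) - ∫ Y, ψ Y :=
    (integrable_of_continuous (hψ.comp ((hS.area_g' n hn1).1.continuous_projExt.comp
      hΦ.1.continuous_projExt)) fun _ => hψb _).sub (integrable_const _)
  have hE : ∀ (i : Fin (N n)) (j : Fin (k n)), _ := fun i j =>
    abs_setIntegral_element_sub_le (hS.shear n hn1) (hS.area_g' n hn1) (hS.close_g n hn1)
      (lt_of_le_of_lt hεm (by linarith)) (by
        have : (4 : ℝ) ≤ k n := by linarith
        exact_mod_cast this) hε8 hγb (by omega) hbk hΦ hψ hψ0 hψ1 hw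
      (fun l => (hS.base n hn1).measurableSet i l)
      (fun l l' hll => (hS.base n hn1).disjoint i l i l' fun h => hll (congrArg Prod.snd h))
      (fun l l' => (hS.base n hn1).same_measure i l i l') (e := 150 / (n : ℝ)) (by positivity)
      hd hs (hdist i) hδ.le hε₁.le hε₂.le j
  refine (abs_setIntegral_union_sub_le (hS.base n hn1) hf hE A).trans ?_
  have hE0 : 0 ≤ 3 * w + 4 * (150 / (n : ℝ)) + 2 * (1 + 150 / (n : ℝ)) * (3 / (n : ℝ) ^ 2)
      + 2 * (50 / (k n : ℝ) ^ 2) := by positivity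
  refine (mul_le_of_le_one_right hE0 measureReal_le_one).trans ?_
  have f1 : 150 / (n : ℝ) ≤ 30 := by rw [div_le_iff₀ (by linarith)]; linarith
  have f2 : 3 / (n : ℝ) ^ 2 ≤ 3 / n := by
    gcongr; exact le_self_pow₀ (by linarith) (by norm_num)
  have f3 : 50 / (k n : ℝ) ^ 2 ≤ 50 / n := by
    gcongr; exact hkn.trans (le_self_pow₀ hk1 (by norm_num))
  have f4 : 2 * (1 + 150 / (n : ℝ)) * (3 / (n : ℝ) ^ 2) ≤ 2 * (1 + 30) * (3 / n) := by
    gcongr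
  -- The numerators over n add up to 600 + 186 + 100 = 886, which leaves 114.
  have f5 : 3 * w + 1000 / (n : ℝ) - (3 * w + 4 * (150 / (n : ℝ)) + 2 * (1 + 30) * (3 / n)
      + 2 * (50 / n)) = 114 / n := by ring
  have f6 : 0 ≤ 114 / (n : ℝ) := by positivity
  linarith

/-- The derivatives of the analytic shears converge to the identity. -/
theorem ae_tendsto_jac (hS : IsClosePair σ k l q p g φ g' φ' N I) :
    ∀ᵐ z : Torus, ∀ i j, Tendsto (fun n => jac (g' n) (torusRep z) i j) atTop
      (𝓝 ((1 : Matrix (Fin 2) (Fin 2) ℝ) i j)) := by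
  have hsum : ∑' n, volume {z : Torus | z 1 ∉ innerHeights (n + 1) (k (n + 1))} ≠ ⊤ := by
    refine ne_top_of_le_ne_top ?_ (ENNReal.tsum_le_tsum (g := fun n : ℕ =>
      ENNReal.ofReal (3 / ((n + 1 : ℕ) : ℝ) ^ 2)) fun n => ?_)
    · refine Summable.tsum_ofReal_ne_top ?_
      have h := (Real.summable_one_div_nat_pow (p := 2)).2 one_lt_two
      have := ((summable_nat_add_iff 1).2 h).mul_left 3
      refine this.congr fun n => ?_
      ring
    · refine le_trans (le_of_eq ?_) ((volume_innerHeights_compl_le (hS.par.one_le_k (n := n + 1)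
        (by omega))).trans (ENNReal.ofReal_le_ofReal (hS.strip_defect_le (by omega))))
      exact (measurePreserving_eval (fun _ : Fin 2 => (volume : Measure UnitAddCircle))
        1).measure_preimage (measurableSet_innerHeights _ _).compl.nullMeasurableSet
  filter_upwards [ae_eventually_notMem hsum] with z hz i j
  rw [tendsto_iff_dist_tendsto_zero]
  have hle : ∀ᶠ n : ℕ in atTop, dist (jac (g' n) (torusRep z) i j)
      ((1 : Matrix (Fin 2) (Fin 2) ℝ) i j) ≤ 1 / (k n : ℝ) := by
    obtain ⟨n₀, h₀⟩ := eventually_atTop.1 hz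
    filter_upwards [eventually_ge_atTop (n₀ + 1)] with n hn
    obtain ⟨m, rfl⟩ := Nat.exists_eq_add_of_le' (show 1 ≤ n by omega)
    have hm := h₀ m (by omega)
    simp only [not_not] at hm
    have hm1 : 1 ≤ m + 1 := by omega
    obtain ⟨-, -, -, hjac, -⟩ := (hS.shear (m + 1) hm1).exists_translation hm
    have h0 : dist (z 1) (z 1) < stripMargin (m + 1) (k (m + 1)) := by
      rw [dist_self]
      have := hS.par.one_le_k_real hm1
      exact lt_of_lt_of_le (by positivity) (hS.par.le_stripMargin hm1)
    rw [← hjac z h0, dist_comm, Real.dist_eq]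
    refine ((hS.shear (m + 1) hm1).area.1.abs_jac_sub_le (hS.area_g' _ hm1).1 (s := 2) one_le_two
      _ i j).trans ((preDist_lt_of_diffeoDist_lt (hS.close_g _ hm1)).le.trans
      ((hS.precision_le_one hm1).trans ?_))
    have := hS.par.one_le_k_real hm1
    gcongr
    linarith
  have hk : Tendsto (fun n => 1 / (k n : ℝ)) atTop (𝓝 0) :=
    tendsto_const_nhds.div_atTop hS.par.tendsto_k
  exact squeeze_zero' (Eventually.of_forall fun _ => dist_nonneg) hle hk

/-- The inverses of the analytic shears asymptotically preserve Lebesgue measure on the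
projectivized tangent bundle. -/
theorem exists_integralClose_inv (hS : IsClosePair σ k l q p g φ g' φ' N I) :
    ∃ τ : ℕ → ℝ, Tendsto τ atTop (𝓝 0) ∧ ∀ n, 1 ≤ n →
      IntegralClose ((volume : Measure ProjBundle).map (projExt (⇑(g' n)⁻¹))) volume (τ n) := by
  have hone : metricMeasure (transportedMetric (1 : Equiv.Perm Plane)) = volume := by
    rw [← IsAreaDiffeo.one.map_projExt]
    have : projExt (⇑(1 : Equiv.Perm Plane)) = id := funext projExt_one
    rw [this, Measure.map_id]
  -- The metric transported by the inverse shear involves the derivative of the shear itself, which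
  -- tends to the identity, so the limit is the flat metric.
  have hlim : ∀ᵐ z : Torus, Tendsto (fun n => transportedMetric (g' (n + 1))⁻¹ z) atTop
      (𝓝 (transportedMetric 1 z)) := by
    filter_upwards [hS.ae_tendsto_jac] with z hz
    have h1 : transportedMetric 1 z = 1 := by
      have : jac (⇑(1 : Equiv.Perm Plane)⁻¹) (torusRep z) = 1 := by rw [inv_one]; exact jac_id _
      rw [transportedMetric, this, Matrix.transpose_one, one_mul]
    have h2 : Tendsto (fun n => jac (g' n) (torusRep z)) atTop
        (𝓝 (1 : Matrix (Fin 2) (Fin 2) ℝ)) :=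
      tendsto_pi_nhds.2 fun i => tendsto_pi_nhds.2 fun j => hz i j
    have h3 : Continuous fun W : Matrix (Fin 2) (Fin 2) ℝ => Wᵀ * W := by fun_prop
    have h4 := ((h3.tendsto 1).comp h2).comp (tendsto_add_atTop_nat 1)
    rw [h1]
    simpa only [transportedMetric, inv_inv, Matrix.transpose_one, one_mul, Function.comp_def]
      using h4
  obtain ⟨-, τ, hτ, h⟩ := exists_integralClose_metricMeasure
    (fun n => (hS.area_g' (n + 1) (by omega)).inv)
    IsAreaDiffeo.one.measurable_transportedMetric hlim
  rw [hone] at h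
  refine ⟨fun n => τ (n - 1), hτ.comp (tendsto_sub_atTop_nat 1), fun n hn => ?_⟩
  have := h (n - 1)
  rwa [Nat.sub_add_cancel hn] at this

end IsClosePair

/-! ### Mixing from equidistribution -/

section Abstract

variable {X : Type*} [MeasurableSpace X] {μ ν : Measure X}

theorem abs_setIntegral_sub_setIntegral_le [IsFiniteMeasure ν] {A B : Set X} (hA : MeasurableSet A)
    (hB : MeasurableSet B) {f : X → ℝ} (hf : Measurable f) (h1 : ∀ x, |f x| ≤ 1) :
    |(∫ x in A, f x ∂ν) - ∫ x in B, f x ∂ν| ≤ ν.real (symmDiff A B) := by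
  have hi : Integrable f ν := integrable_of_abs_le hf h1
  rw [← integral_indicator hA, ← integral_indicator hB,
    ← integral_sub (hi.indicator hA) (hi.indicator hB),
    ← integral_indicator_one (hA.symmDiff hB)]
  refine abs_integral_le_integral_abs.trans (integral_mono
    ((hi.indicator hA).sub (hi.indicator hB)).abs
    ((integrable_const (1 : ℝ)).indicator (hA.symmDiff hB)) fun x => ?_)
  have h0 := h1 x
  by_cases ha : x ∈ A <;> by_cases hb : x ∈ B <;>
    simp [ha, hb, mem_symmDiff, h0]

theorem integral_comp_le_of_integralClose [IsFiniteMeasure ν] {S : X → X} (hS : Measurable S) {τ : ℝ}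
    (hSν : IntegralClose (ν.map S) ν τ) {u : X → ℝ} (hu : Measurable u) {M : ℝ} (hM : 0 < M)
    (hb : ∀ x, |u x| ≤ M) : ∫ x, u (S x) ∂ν ≤ (∫ x, u x ∂ν) + M * τ := by
  have h := hSν.abs_sub_le hu hM hb
  rw [integral_map hS.aemeasurable hu.aestronglyMeasurable] at h
  linarith [(abs_le.1 h).2]

/-- An L¹ error survives composition with S up to 2τ because S almost preserves ν; the 2 bounds |u -
v|. -/
theorem abs_setIntegral_comp_sub_le [IsFiniteMeasure ν] {S : X → X} (hS : Measurable S) {τ : ℝ}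
    (hSν : IntegralClose (ν.map S) ν τ) {u v : X → ℝ} (hu : Measurable u) (hv : Measurable v)
    (hu1 : ∀ x, |u x| ≤ 1) (hv1 : ∀ x, |v x| ≤ 1) (A : Set X) :
    |(∫ x in A, u (S x) ∂ν) - ∫ x in A, v (S x) ∂ν| ≤ (∫ x, |u x - v x| ∂ν) + 2 * τ := by
  have hui : Integrable (fun x => u (S x)) ν := integrable_of_abs_le (hu.comp hS) fun _ => hu1 _
  have hvi : Integrable (fun x => v (S x)) ν := integrable_of_abs_le (hv.comp hS) fun _ => hv1 _
  have h2 : ∀ x, |(|u x - v x|)| ≤ 2 := fun x => by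
    rw [abs_abs]
    have := abs_sub (u x) (v x)
    linarith [hu1 x, hv1 x]
  rw [← integral_sub hui.integrableOn hvi.integrableOn]
  refine abs_integral_le_integral_abs.trans ?_
  refine (setIntegral_le_integral (hui.sub hvi).abs
    (Eventually.of_forall fun _ => abs_nonneg _)).trans ?_
  exact integral_comp_le_of_integralClose hS hSν (u := fun x => |u x - v x|) (hu.sub hv).abs
    two_pos h2

variable [IsProbabilityMeasure μ] [IsProbabilityMeasure ν] {P S E : ℕ → X → X} {τ τ' c : ℕ → ℝ}
  {A : Set X} {D : ℕ → Set X} {v : X → ℝ} {w : ℕ → X → ℝ}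

/-- Equidistribution of the images of sets under conjugated maps implies mixing. -/
theorem tendsto_setIntegral_comp_of_equidistribution (hP : ∀ n, MeasurableEmbedding (P n))
    (hS : ∀ n, Measurable (S n)) (hSP : ∀ n x, S n (P n x) = P n (E n x))
    (hτ : Tendsto τ atTop (𝓝 0)) (hPν : ∀ n, IntegralClose (μ.map (P n)) ν (τ n))
    (hτ' : Tendsto τ' atTop (𝓝 0)) (hSν : ∀ n, IntegralClose (ν.map (S n)) ν (τ' n))
    (hv : Measurable v) (hw : ∀ n, Measurable (w n)) (hv1 : ∀ x, |v x| ≤ 1)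
    (hw1 : ∀ n x, |w n x| ≤ 1) (hwv : ∀ᵐ x ∂ν, Tendsto (fun n => w n x) atTop (𝓝 (v x)))
    (hA : MeasurableSet A) (hD : ∀ n, MeasurableSet (D n))
    (hAD : Tendsto (fun n => ν (symmDiff A (P n '' D n))) atTop (𝓝 0))
    (hE : ∀ n, Measurable (E n))
    (hc : Tendsto c atTop (𝓝 (∫ x, v x ∂ν)))
    (heq : Tendsto (fun n => ∫ x in D n, (w n (P n (E n x)) - c n) ∂μ) atTop (𝓝 0)) :
    Tendsto (fun n => ∫ x in A, v (S n x) ∂ν) atTop (𝓝 (ν.real A * ∫ x, v x ∂ν)) := by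
  have hADr : Tendsto (fun n => ν.real (symmDiff A (P n '' D n))) atTop (𝓝 0) := by
    simpa [Measure.real, Function.comp_def] using (ENNReal.tendsto_toReal ENNReal.zero_ne_top).comp hAD
  have hB : ∀ n, MeasurableSet (P n '' D n) := fun n => (hP n).measurableSet_image.2 (hD n)
  have hwi : ∀ n, Integrable (w n) ν := fun n => integrable_of_abs_le (hw n) (hw1 n)
  have hvi : Integrable v ν := integrable_of_abs_le hv hv1
  -- replacing the limit function
  have h1 : Tendsto (fun n => ∫ x, |v x - w n x| ∂ν) atTop (𝓝 0) := by
    have := tendsto_integral_of_dominated_convergence (μ := ν) (F := fun n x => |v x - w n x|)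
      (f := fun _ => 0) (fun _ => 2) (fun n => (hv.sub (hw n)).abs.aestronglyMeasurable)
      (integrable_const _) (fun n => Eventually.of_forall fun x => by
        rw [Real.norm_eq_abs, abs_abs]
        linarith [abs_sub (v x) (w n x), hv1 x, hw1 n x]) ?_
    · simpa using this
    · filter_upwards [hwv] with x hx
      simpa using ((tendsto_const_nhds (x := v x)).sub hx).abs
  have h2 : ∀ n, |(∫ x in A, v (S n x) ∂ν) - ∫ x in A, w n (S n x) ∂ν|
      ≤ (∫ x, |v x - w n x| ∂ν) + 2 * τ' n := fun n =>
    abs_setIntegral_comp_sub_le (hS n) (hSν n) hv (hw n) hv1 (hw1 n) A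
  -- replacing the set
  have h3 : ∀ n, |(∫ x in A, w n (S n x) ∂ν) - ∫ x in P n '' D n, w n (S n x) ∂ν|
      ≤ ν.real (symmDiff A (P n '' D n)) := fun n =>
    abs_setIntegral_sub_setIntegral_le hA (hB n) ((hw n).comp (hS n)) fun _ => hw1 n _
  -- replacing the measure
  have h4 : ∀ n, |(∫ x in D n, w n (P n (E n x)) ∂μ) - ∫ x in P n '' D n, w n (S n x) ∂ν|
      ≤ τ n := fun n => by
    have := hPν n ((P n '' D n).indicator fun x => w n (S n x))
      (((hw n).comp (hS n)).indicator (hB n)) fun x => by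
        by_cases hx : x ∈ P n '' D n
        · rw [indicator_of_mem hx]; exact hw1 n _
        · rw [indicator_of_notMem hx]; simp
    rw [integral_indicator (hB n), integral_indicator (hB n), (hP n).setIntegral_map,
      (hP n).injective.preimage_image] at this
    simpa only [hSP] using this
  have h5 : ∀ n, |μ.real (D n) - ν.real (P n '' D n)| ≤ τ n := fun n => by
    have := hPν n ((P n '' D n).indicator fun _ => 1) (measurable_const.indicator (hB n))
      fun x => by by_cases hx : x ∈ P n '' D n <;> simp [hx]
    rw [integral_indicator (hB n), integral_indicator (hB n), (hP n).setIntegral_map,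
      (hP n).injective.preimage_image] at this
    simpa using this
  have h6 : ∀ n, |ν.real A - ν.real (P n '' D n)| ≤ ν.real (symmDiff A (P n '' D n)) := fun n =>
    abs_measureReal_sub_le_measureReal_symmDiff hA.nullMeasurableSet (hB n).nullMeasurableSet
  have h7 : ∀ n, ∫ x in D n, (w n (P n (E n x)) - c n) ∂μ
      = (∫ x in D n, w n (P n (E n x)) ∂μ) - μ.real (D n) * c n := fun n => by
    have hi : Integrable (fun x => w n (P n (E n x))) μ :=
      integrable_of_abs_le ((hw n).comp ((hP n).measurable.comp (hE n))) fun _ => hw1 n _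
    rw [integral_sub hi.integrableOn (integrable_const _), setIntegral_const, smul_eq_mul]
  have hDlim : Tendsto (fun n => μ.real (D n)) atTop (𝓝 (ν.real A)) := by
    refine tendsto_iff_dist_tendsto_zero.2 (squeeze_zero (fun _ => dist_nonneg) (fun n => ?_)
      (by simpa using hτ.add hADr))
    rw [Real.dist_eq]
    refine (abs_sub_le _ (ν.real (P n '' D n)) _).trans (add_le_add (h5 n) ?_)
    rw [abs_sub_comm]; exact h6 n
  have hlim : Tendsto (fun n => ∫ x in D n, w n (P n (E n x)) ∂μ) atTop
      (𝓝 (ν.real A * ∫ x, v x ∂ν)) := by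
    have := heq.add (hDlim.mul hc)
    rw [zero_add] at this
    refine this.congr fun n => ?_
    rw [h7]; ring
  have hdiff : Tendsto (fun n => (∫ x in A, v (S n x) ∂ν)
      - ∫ x in D n, w n (P n (E n x)) ∂μ) atTop (𝓝 0) := by
    refine squeeze_zero_norm (fun n => ?_) (by
      simpa using ((h1.add (hτ'.const_mul 2)).add hADr).add hτ)
    rw [Real.norm_eq_abs]
    have a2 := h2 n
    have a3 := h3 n
    have a4 := h4 n
    rw [abs_le] at a2 a3 a4 ⊢
    constructor <;> linarith
  simpa using hdiff.add hlim

/-- The maps almost preserve ν, so replacing ψ by an L¹-close function costs the same for all large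
n. -/
theorem tendsto_setIntegral_comp_of_approx (hS : ∀ n, Measurable (S n))
    (hτ' : Tendsto τ' atTop (𝓝 0)) (hSν : ∀ n, IntegralClose (ν.map (S n)) ν (τ' n))
    {ψ : X → ℝ} (hψ : Measurable ψ) (hψ1 : ∀ x, |ψ x| ≤ 1)
    (h : ∀ ε > 0, ∃ v : X → ℝ, Measurable v ∧ (∀ x, |v x| ≤ 1) ∧ ∫ x, |ψ x - v x| ∂ν ≤ ε ∧
      Tendsto (fun n => ∫ x in A, v (S n x) ∂ν) atTop (𝓝 (ν.real A * ∫ x, v x ∂ν))) :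
    Tendsto (fun n => ∫ x in A, ψ (S n x) ∂ν) atTop (𝓝 (ν.real A * ∫ x, ψ x ∂ν)) := by
  refine Metric.tendsto_atTop.2 fun η hη => ?_
  obtain ⟨v, hv, hv1, hψv, hlim⟩ := h (η / 5) (by positivity)
  obtain ⟨n₁, h₁⟩ := Metric.tendsto_atTop.1 hlim (η / 5) (by positivity)
  obtain ⟨n₂, h₂⟩ := eventually_atTop.1 (hτ'.eventually (gt_mem_nhds (show 0 < η / 5 by positivity)))
  refine ⟨max n₁ n₂, fun n hn => ?_⟩
  have a1 := h₁ n (le_of_max_le_left hn)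
  have a2 := h₂ n (le_of_max_le_right hn)
  have a3 := abs_setIntegral_comp_sub_le (hS n) (hSν n) hψ hv hψ1 hv1 A
  have a4 : |ν.real A * (∫ x, v x ∂ν) - ν.real A * ∫ x, ψ x ∂ν| ≤ η / 5 := by
    rw [← mul_sub, abs_mul, abs_of_nonneg measureReal_nonneg]
    refine (mul_le_of_le_one_left (abs_nonneg _) measureReal_le_one).trans ?_
    rw [abs_sub_comm, ← integral_sub (integrable_of_abs_le hψ hψ1) (integrable_of_abs_le hv hv1)]
    exact abs_integral_le_integral_abs.trans hψv
  rw [Real.dist_eq] at a1 ⊢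
  rw [abs_lt] at a1 ⊢
  rw [abs_le] at a3 a4
  constructor <;> linarith

end Abstract

theorem dist_le_projDist (X Y : ProjBundle) : dist X Y ≤ projDist X Y := by
  have h0 : dist (X.1 0) (Y.1 0) ≤ projDist X Y := Real.le_sqrt_of_sq_le (by
    nlinarith [sq_nonneg (dist (X.1 1) (Y.1 1)), sq_nonneg (dist X.2 Y.2)])
  have h1 : dist (X.1 1) (Y.1 1) ≤ projDist X Y := Real.le_sqrt_of_sq_le (by
    nlinarith [sq_nonneg (dist (X.1 0) (Y.1 0)), sq_nonneg (dist X.2 Y.2)])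
  have h2 : dist X.2 Y.2 ≤ projDist X Y := Real.le_sqrt_of_sq_le (by
    nlinarith [sq_nonneg (dist (X.1 0) (Y.1 0)), sq_nonneg (dist (X.1 1) (Y.1 1))])
  rw [Prod.dist_eq]
  refine max_le ((dist_pi_le_iff (Real.sqrt_nonneg _)).2 fun i => ?_) h2
  fin_cases i
  · exact h0
  · exact h1

theorem exists_iUnion_eq_sUnion {N k : ℕ} {I : Fin N → Fin k → Set Torus}
    {P : ProjBundle → ProjBundle} {C : Set (Set ProjBundle)}
    (hC : C ⊆ (fun S => P '' S) '' bundlePartition I) :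
    ∃ A : Set (Fin N × Fin k),
      P '' (⋃ a : A, (⋃ l, I a.1.1 l) ×ˢ dirArc k a.1.2) = ⋃₀ C := by
  refine ⟨{a | P '' ((⋃ l, I a.1 l) ×ˢ dirArc k a.2) ∈ C}, ?_⟩
  rw [image_iUnion]
  ext X
  simp only [mem_iUnion, mem_sUnion]
  constructor
  · rintro ⟨⟨a, ha⟩, hX⟩
    exact ⟨_, ha, hX⟩
  · rintro ⟨T, hT, hX⟩
    obtain ⟨_, ⟨i, j, rfl⟩, rfl⟩ := hC hT
    exact ⟨⟨(i, j), hT⟩, hX⟩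

theorem AbC.IsTorusDiffeo.measurableEmbedding_projExt {F : Equiv.Perm Plane} (hF : IsTorusDiffeo F) :
    MeasurableEmbedding (projExt F) := by
  refine hF.measurable_projExt.measurableEmbedding fun X Y h => ?_
  rw [← hF.projExt_inv_projExt X, h, hF.projExt_inv_projExt]

namespace IsClosePair

variable {σ : ℝ} {k l q : ℕ → ℕ} {p : ℕ → ℤ} {g φ g' φ' : ℕ → Equiv.Perm Plane}
  {N : ℕ → ℕ} {I : ∀ n, Fin (N n) → Fin (k n) → Set Torus}

/-- The function `χ` composed with the projectivized derivative of `H_{n-1}` varies slowly. -/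
theorem eventually_abs_sub_le (hS : IsClosePair σ k l q p g φ g' φ' N I) {χ : ProjBundle → ℝ}
    (hχ : Continuous χ) {η : ℝ} (hη : 0 < η) : ∀ᶠ n in atTop, ∀ X Y, projDist X Y < 3 / k (n + 1) →
      |χ (projExt (conjMap g φ n) X) - χ (projExt (conjMap g φ n) Y)| ≤ η := by
  obtain ⟨r, hr, h⟩ := Metric.uniformContinuous_iff.1
    (CompactSpace.uniformContinuous_of_continuous hχ) η hη
  have h1 : Tendsto (fun n : ℕ => 1 / ((n + 1 : ℕ) : ℝ) ^ 2) atTop (𝓝 0) := by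
    have : Tendsto (fun n : ℕ => 1 / (n : ℝ) ^ 2) atTop (𝓝 0) :=
      tendsto_const_nhds.div_atTop ((tendsto_pow_atTop two_ne_zero).comp tendsto_natCast_atTop_atTop)
    exact this.comp (tendsto_add_atTop_nat 1)
  filter_upwards [h1.eventually (gt_mem_nhds hr)] with n hn X Y hXY
  have h2 := hS.par.diam (n + 1) (by omega) X Y hXY
  rw [Nat.add_sub_cancel] at h2
  have h3 := h (lt_of_le_of_lt ((dist_le_projDist _ _).trans h2) hn)
  exact h3.le

variable {m : ℕ → ℕ} {α : ℕ → ℝ} {ν : Measure ProjBundle} {γ δ ε₁ ε₂ : ℕ → ℝ}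

/-- The iterates of the approximating maps are mixing along the sequence `m`. -/
theorem tendsto_setIntegral_abcMap (hS : IsClosePair σ k l q p g φ g' φ' N I) (hσ : 1 / 4 < σ)
    (hshear : ∀ n, 4 < n → n * shearSize n (q n) σ ≤ k n ^ 3)
    [IsProbabilityMeasure ν] (hνvol : ν ≪ volume) {τ : ℕ → ℝ} (hτ : Tendsto τ atTop (𝓝 0))
    (hcl : ∀ n, IntegralClose ((volume : Measure ProjBundle).map (projExt (conjMap g' φ' n))) ν (τ n))
    (hν : ConvergesToPoints ν fun n =>
      (fun S => (projExt (conjMap g' φ' (n - 1)) ∘ projExt (g' n)) '' S) '' bundlePartition (I n))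
    (hγ : ∀ n, 1 ≤ n → γ n < 1 / ((k n : ℝ) ^ 3 * q n))
    (hδ : ∀ n, 1 ≤ n → δ n < 50 / (k n : ℝ) ^ 2)
    (hε₁ : ∀ n, 1 ≤ n → ε₁ n < 150 / (n : ℝ))
    (hε₂ : ∀ n, 1 ≤ n → ε₂ n < 150 / (n : ℝ))
    (hdist : ∀ n, 1 ≤ n → ∀ i,
      IsDistributing (innerMap φ' α m n) (I n i) (γ n) (δ n) (ε₁ n) (ε₂ n))
    {A : Set ProjBundle} (hA : MeasurableSet A) {ψ : ProjBundle → ℝ} (hψ : Measurable ψ)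
    (hψ0 : ∀ X, 0 ≤ ψ X) (hψ1 : ∀ X, ψ X ≤ 1) :
    Tendsto (fun n => ∫ X in A, ψ (projExt (⇑(abcMap (conjMap g' φ') α (n + 1) ^ m (n + 1))) X) ∂ν)
      atTop (𝓝 (ν.real A * ∫ X, ψ X ∂ν)) := by
  have hg' : ∀ n, IsAreaDiffeo (g' (n + 1)) := fun n => hS.area_g' _ (by omega)
  have hH' := hS.area_conj'
  have hΦ : ∀ n, IsAreaDiffeo (innerMap φ' α m (n + 1)) := fun n =>
    ((hS.area_φ' _ (by omega)).mul ((IsAreaDiffeo.rot _).pow _)).mul (hS.area_φ' _ (by omega)).inv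
  have hf : ∀ n, IsAreaDiffeo (abcMap (conjMap g' φ') α (n + 1) ^ m (n + 1)) := fun n =>
    ((((hH' _).mul (IsAreaDiffeo.rot _)).mul (hH' _).inv)).pow _
  -- With indices shifted by one to avoid n - 1, this map conjugates the inner map Φ̂_{n+1} to
  -- f̂_{n+1}^{m_{n+1}}.
  set P : ℕ → ProjBundle → ProjBundle := fun n =>
    projExt (⇑(conjMap g' φ' n * g' (n + 1))) with hPdef
  set S : ℕ → ProjBundle → ProjBundle := fun n =>
    projExt (⇑(abcMap (conjMap g' φ') α (n + 1) ^ m (n + 1))) with hSdef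
  set E : ℕ → ProjBundle → ProjBundle := fun n => projExt (⇑(innerMap φ' α m (n + 1))) with hEdef
  have hPeq : ∀ n, P n = projExt (conjMap g' φ' n) ∘ projExt (g' (n + 1)) := fun n => funext fun X =>
    (hH' n).1.projExt_mul (hg' n).1 X
  have hPE : ∀ n, MeasurableEmbedding (P n) := fun n =>
    ((hH' n).mul (hg' n)).1.measurableEmbedding_projExt
  have hSm : ∀ n, Measurable (S n) := fun n => (hf n).1.measurable_projExt
  have hSP : ∀ n X, S n (P n X) = P n (E n X) := fun n X => by
    simp only [hSdef, hPdef, hEdef]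
    rw [← (hf n).1.projExt_mul ((hH' n).mul (hg' n)).1,
      ← ((hH' n).mul (hg' n)).1.projExt_mul (hΦ n).1]
    congr 2
    rw [abcMap, conj_pow, innerMap, conjMap]
    group
  -- the measures
  obtain ⟨τ₂, hτ₂, h₂⟩ := hS.exists_integralClose_inv
  -- The shear almost preserves Lebesgue measure, so inserting it before Ĥ_n changes the image
  -- measure only slightly.
  have hPν : ∀ n, IntegralClose ((volume : Measure ProjBundle).map (P n)) ν (τ₂ (n + 1) + τ n) := by
    intro n
    have hgm := (hg' n).1.measurable_projExt
    have a1 := (h₂ (n + 1) (by omega)).map hgm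
    rw [Measure.map_map hgm (hg' n).inv.1.measurable_projExt] at a1
    have a2 : projExt (g' (n + 1)) ∘ projExt (⇑(g' (n + 1))⁻¹) = id :=
      funext fun X => (hg' n).1.projExt_projExt_inv X
    rw [a2, Measure.map_id] at a1
    have a3 := (a1.symm.map (hH' n).1.measurable_projExt).trans (hcl n)
    rwa [Measure.map_map (hH' n).1.measurable_projExt hgm, ← hPeq] at a3
  have hτP : Tendsto (fun n => τ₂ (n + 1) + τ n) atTop (𝓝 0) := by
    simpa using (hτ₂.comp (tendsto_add_atTop_nat 1)).add hτ
  have hSν : ∀ n, IntegralClose (ν.map (S n)) ν (τ (n + 1) + τ (n + 1)) := fun n => by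
    have a1 := ((hcl (n + 1)).map (hSm n)).symm
    rw [_root_.IsAreaDiffeo.map_projExt_map (hH' (n + 1)) (hf n) (t := α (n + 1 + 1)) (n := m (n + 1)) (by
      rw [abcMap, conj_pow]; group)] at a1
    exact a1.trans (hcl (n + 1))
  have hτS : Tendsto (fun n => τ (n + 1) + τ (n + 1)) atTop (𝓝 0) := by
    have := hτ.comp (tendsto_add_atTop_nat 1)
    simpa using this.add this
  -- the sets
  obtain ⟨C, hC, hCA⟩ := hν A hA
  choose B hB using fun n => exists_iUnion_eq_sUnion (hC (n + 1))
  have hCA' := hCA.comp (tendsto_add_atTop_nat 1)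
  set D : ℕ → Set ProjBundle := fun n =>
    ⋃ a : B n, (⋃ l, I (n + 1) a.1.1 l) ×ˢ dirArc (k (n + 1)) a.1.2 with hDdef
  have hD : ∀ n, MeasurableSet (D n) := fun n => MeasurableSet.iUnion fun a =>
    (MeasurableSet.iUnion fun l => (hS.base (n + 1) (by omega)).measurableSet a.1.1 l).prod
      (measurableSet_dirArc _ _)
  have hAD : Tendsto (fun n => ν (symmDiff A (P n '' D n))) atTop (𝓝 0) := by
    refine hCA'.congr fun n => ?_
    rw [Function.comp_apply, ← hB n, hPeq n]
    rfl
  -- the functions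
  obtain ⟨L, hL, hLlim, hLapp⟩ := hS.exists_limit hνvol
  refine tendsto_setIntegral_comp_of_approx hSm hτS hSν hψ
    (fun X => by rw [abs_of_nonneg (hψ0 X)]; exact hψ1 X) fun ε hε => ?_
  obtain ⟨χ₀, hχ₀⟩ := hLapp ψ hψ 1 (fun X => by rw [abs_of_nonneg (hψ0 X)]; exact hψ1 X) ε hε
  -- Clamping to [0, 1] does not increase the distance to ψ, which takes values there.
  set χ : ProjBundle → ℝ := fun X => max 0 (min 1 (χ₀ X)) with hχdef
  have hχ : Continuous χ := by fun_prop
  have hχ0 : ∀ X, 0 ≤ χ X := fun X => le_max_left _ _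
  have hχ1 : ∀ X, χ X ≤ 1 := fun X => max_le zero_le_one (min_le_left _ _)
  have hχb : ∀ X, |χ X| ≤ 1 := fun X => by rw [abs_of_nonneg (hχ0 X)]; exact hχ1 X
  have hχL : ∀ X, |ψ X - χ (L X)| ≤ |ψ X - χ₀ (L X)| := fun X => by
    have e : ψ X = max 0 (min 1 (ψ X)) := by
      rw [min_eq_right (hψ1 X), max_eq_right (hψ0 X)]
    calc |ψ X - χ (L X)| = |max 0 (min 1 (ψ X)) - max 0 (min 1 (χ₀ (L X)))| := by rw [← e]
      _ ≤ max |(0 : ℝ) - 0| |min 1 (ψ X) - min 1 (χ₀ (L X))| := abs_max_sub_max_le_max _ _ _ _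
      _ ≤ max |(0 : ℝ) - 0| (max |(1 : ℝ) - 1| |ψ X - χ₀ (L X)|) := by
          gcongr; exact abs_min_sub_min_le_max _ _ _ _
      _ = _ := by simp
  refine ⟨fun X => χ (L X), hχ.measurable.comp hL, fun X => hχb _, ?_, ?_⟩
  · refine le_trans (integral_mono ?_ ?_ hχL) hχ₀
    · exact ((integrable_of_abs_le hψ (M := 1) fun X => by
        rw [abs_of_nonneg (hψ0 X)]; exact hψ1 X).sub
        (integrable_of_abs_le (hχ.measurable.comp hL) fun X => hχb _)).abs
    · exact ((integrable_of_abs_le hψ (M := 1) fun X => by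
        rw [abs_of_nonneg (hψ0 X)]; exact hψ1 X).sub
        (integrable_of_abs_le (χ₀.continuous.measurable.comp hL) (M := ‖χ₀‖)
          fun X => χ₀.norm_coe_le_norm _)).abs
  set w : ℕ → ProjBundle → ℝ := fun n X => χ (projExt (compare g φ g' φ' n) X) with hwdef
  set ψ' : ℕ → ProjBundle → ℝ := fun n X => χ (projExt (conjMap g φ n) X) with hψ'def
  have hw : ∀ n, Measurable (w n) := fun n =>
    hχ.measurable.comp (hS.area_compare n).1.measurable_projExt
  -- The comparison map cancels Ĥ_n and leaves the smooth H_n, for which `diam` makes the function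
  -- slowly varying.
  have hwH : ∀ n X, w n (projExt (conjMap g' φ' n) X) = ψ' n X := fun n X => by
    simp only [hwdef, hψ'def]
    rw [← (hS.area_compare n).1.projExt_mul (hH' n).1, compare, inv_mul_cancel_right]
  have hwv : ∀ᵐ X ∂ν, Tendsto (fun n => w n X) atTop (𝓝 (χ (L X))) := by
    filter_upwards [hLlim] with X hX
    exact (hχ.tendsto _).comp hX
  have hc : Tendsto (fun n => ∫ X, ψ' n X) atTop (𝓝 (∫ X, χ (L X) ∂ν)) := by
    have a1 : Tendsto (fun n => ∫ X, w n X ∂ν) atTop (𝓝 (∫ X, χ (L X) ∂ν)) :=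
      tendsto_integral_of_dominated_convergence (fun _ => 1) (fun n => (hw n).aestronglyMeasurable)
        (integrable_const _) (fun n => Eventually.of_forall fun X => hχb _) hwv
    have a2 : ∀ n, |(∫ X, ψ' n X) - ∫ X, w n X ∂ν| ≤ τ n := fun n => by
      have := hcl n (w n) (hw n) fun X => hχb _
      rw [integral_map (hH' n).1.measurable_projExt.aemeasurable (hw n).aestronglyMeasurable] at this
      simpa only [hwH] using this
    have a3 : Tendsto (fun n => (∫ X, ψ' n X) - ∫ X, w n X ∂ν) atTop (𝓝 0) :=
      squeeze_zero_norm a2 hτ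
    simpa using a3.add a1
  refine tendsto_setIntegral_comp_of_equidistribution (μ := volume) (w := w) (c := fun n => ∫ X, ψ' n X)
    hPE hSm hSP hτP hPν hτS hSν (hχ.measurable.comp hL) hw (fun X => hχb _) (fun n X => hχb _) hwv hA
    hD hAD (fun n => (hΦ n).1.measurable_projExt) hc ?_
  have heq : ∀ n X, w n (P n (E n X)) = ψ' n (projExt (g' (n + 1)) (E n X)) := fun n X => by
    rw [hPeq, Function.comp_apply, hwH]
  simp only [heq]
  refine Metric.tendsto_atTop.2 fun η hη => ?_
  have h1000 : Tendsto (fun n : ℕ => 1000 / ((n + 1 : ℕ) : ℝ)) atTop (𝓝 0) :=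
    (tendsto_const_nhds.div_atTop tendsto_natCast_atTop_atTop).comp (tendsto_add_atTop_nat 1)
  -- The oscillation enters the equidistribution bound with factor 3, so η/6 accounts for half of η.
  obtain ⟨n₀, h₀⟩ := eventually_atTop.1 ((hS.eventually_abs_sub_le hχ
    (show 0 < η / 6 by positivity)).and (h1000.eventually (gt_mem_nhds (half_pos hη))))
  refine ⟨max n₀ 4, fun n hn => ?_⟩
  obtain ⟨hmod, hsmall⟩ := h₀ n (le_of_max_le_left hn)
  have hn4 : 4 < n + 1 := Nat.lt_succ_of_le (le_of_max_le_right hn)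
  have hn1 : 1 ≤ n + 1 := by omega
  have := hS.abs_setIntegral_sub_le hσ hn4 (hshear _ hn4) (hΦ n) (hγ _ hn1) (hδ _ hn1) (hε₁ _ hn1)
    (hε₂ _ hn1) (hdist _ hn1) (ψ := ψ' n) (hχ.comp (hS.area_conj n).1.continuous_projExt)
    (fun X => hχ0 _) (fun X => hχ1 _) hmod (B n)
  rw [Real.dist_eq, sub_zero]
  refine lt_of_le_of_lt this ?_
  linarith

end IsClosePair

/-! ### Mixing along a sequence implies weak mixing -/

section WeakMixing

variable {X : Type*} [MeasurableSpace X] {ν : Measure X} {T : X → X} {m : ℕ → ℕ}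

theorem ae_iterate_eq (hT : MeasurePreserving T ν ν) {h : X → ℂ} {ξ : ℂ}
    (he : ∀ᵐ x ∂ν, h (T x) = ξ * h x) (n : ℕ) : ∀ᵐ x ∂ν, h (T^[n] x) = ξ ^ n * h x := by
  induction n with
  | zero => exact Eventually.of_forall fun x => by simp
  | succ n ih =>
    filter_upwards [hT.quasiMeasurePreserving.ae ih, he] with x h1 h2
    rw [Function.iterate_succ_apply, h1, h2, pow_succ, mul_assoc]

theorem norm_eigenvalue_eq_one (hT : MeasurePreserving T ν ν) {h : X → ℂ} {ξ : ℂ} (hh : MemLp h 2 ν)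
    (he : ∀ᵐ x ∂ν, h (T x) = ξ * h x) (h0 : ¬ h =ᵐ[ν] 0) : ‖ξ‖ = 1 := by
  have h1 := eLpNorm_comp_measurePreserving (p := 2) hh.aestronglyMeasurable hT
  have h2 : eLpNorm (h ∘ T) 2 ν = ‖ξ‖ₑ * eLpNorm h 2 ν := by
    rw [← eLpNorm_const_smul]
    exact eLpNorm_congr_ae he
  rw [h1] at h2
  have h3 : eLpNorm h 2 ν ≠ 0 := fun e =>
    h0 ((eLpNorm_eq_zero_iff hh.aestronglyMeasurable two_ne_zero).1 e)
  have h4 : ‖ξ‖ₑ = 1 := by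
    have : 1 * eLpNorm h 2 ν = ‖ξ‖ₑ * eLpNorm h 2 ν := by rw [one_mul]; exact h2
    exact ((ENNReal.mul_left_inj h3 hh.eLpNorm_ne_top).1 this).symm
  simpa using congrArg ENNReal.toReal h4

/-- On a set A the integrals of F(h∘T^m) = F(ξ^m h) tend to that of F(ζh) along s, and by mixing to
ν(A) times the integral of F(h). As A is arbitrary, F(ζh) is constant. -/
theorem ae_eq_const_of_mixing [IsProbabilityMeasure ν] (hT : MeasurePreserving T ν ν)
    (hmix : ∀ A : Set X, MeasurableSet A → ∀ ψ : X → ℝ, Measurable ψ → (∀ x, 0 ≤ ψ x) →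
      (∀ x, ψ x ≤ 1) → Tendsto (fun n => ∫ x in A, ψ (T^[m n] x) ∂ν) atTop
        (𝓝 (ν.real A * ∫ x, ψ x ∂ν)))
    {h : X → ℂ} (hh : Measurable h) {ξ ζ : ℂ} (he : ∀ᵐ x ∂ν, h (T x) = ξ * h x) {s : ℕ → ℕ}
    (hs : StrictMono s) (hζ : Tendsto (fun n => ξ ^ m (s n)) atTop (𝓝 ζ)) {F : ℂ → ℝ}
    (hF : Continuous F) (hF0 : ∀ z, 0 ≤ F z) (hF1 : ∀ z, F z ≤ 1) :
    ∃ c : ℝ, ∀ᵐ x ∂ν, F (ζ * h x) = c := by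
  have hFb : ∀ z, |F z| ≤ 1 := fun z => by rw [abs_of_nonneg (hF0 z)]; exact hF1 z
  have hm : Measurable fun x => F (ζ * h x) := hF.measurable.comp (hh.const_mul ζ)
  refine ⟨∫ x, F (h x) ∂ν, Integrable.ae_eq_of_forall_setIntegral_eq (μ := ν) (fun x => F (ζ * h x))
    (fun _ => ∫ x, F (h x) ∂ν) (integrable_of_abs_le hm fun _ => hFb _) (integrable_const _)
    fun A hA _ => ?_⟩
  rw [setIntegral_const, smul_eq_mul]
  have h1 := (hmix A hA (fun x => F (h x)) (hF.measurable.comp hh) (fun _ => hF0 _)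
    fun _ => hF1 _).comp hs.tendsto_atTop
  refine tendsto_nhds_unique ?_ h1
  have h2 : ∀ n, ∫ x in A, F (h (T^[m (s n)] x)) ∂ν = ∫ x in A, F (ξ ^ m (s n) * h x) ∂ν := fun n =>
    integral_congr_ae (ae_restrict_of_ae ((ae_iterate_eq hT he (m (s n))).mono fun x hx => by
      simp only [hx]))
  simp only [Function.comp_def, h2]
  exact tendsto_integral_of_dominated_convergence (fun _ => 1)
    (fun n => (hF.measurable.comp (hh.const_mul _)).aestronglyMeasurable) (integrable_const _)
    (fun n => Eventually.of_forall fun x => hFb _)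
    (Eventually.of_forall fun x => (hF.tendsto _).comp (hζ.mul_const _))

/-- A map that is mixing along a sequence of iterates is weakly mixing. -/
theorem isWeaklyMixing_of_mixing [IsProbabilityMeasure ν] (hT : MeasurePreserving T ν ν)
    (hmix : ∀ A : Set X, MeasurableSet A → ∀ ψ : X → ℝ, Measurable ψ → (∀ x, 0 ≤ ψ x) →
      (∀ x, ψ x ≤ 1) → Tendsto (fun n => ∫ x in A, ψ (T^[m n] x) ∂ν) atTop
        (𝓝 (ν.real A * ∫ x, ψ x ∂ν))) : IsWeaklyMixing T ν := by
  refine ⟨inferInstance, hT, fun h ξ hh he => ?_⟩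
  by_cases h0 : h =ᵐ[ν] 0
  · exact ⟨0, h0⟩
  have hξ := norm_eigenvalue_eq_one hT hh he h0
  set h' := hh.aestronglyMeasurable.mk h with hh'
  have hae : h =ᵐ[ν] h' := hh.aestronglyMeasurable.ae_eq_mk
  have hm : Measurable h' := hh.aestronglyMeasurable.stronglyMeasurable_mk.measurable
  have he' : ∀ᵐ x ∂ν, h' (T x) = ξ * h' x := by
    filter_upwards [hT.quasiMeasurePreserving.ae hae, hae, he] with x h1 h2 h3
    rw [← h1, ← h2, h3]
  obtain ⟨ζ, hζ, s, hs, hlim⟩ := (isCompact_sphere (0 : ℂ) 1).tendsto_subseq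
    (x := fun n => ξ ^ m n) fun n => by simp [hξ]
  have hζ0 : ζ ≠ 0 := fun e => by simp [e] at hζ
  have hpos : ∀ z : ℂ, 0 < 1 + ‖z‖ := fun z => by positivity
  have hle : ∀ z : ℂ, ∀ a : ℝ, |a| ≤ ‖z‖ → 0 ≤ (1 + a / (1 + ‖z‖)) / 2 ∧
      (1 + a / (1 + ‖z‖)) / 2 ≤ 1 := fun z a ha => by
    have h1 : |a / (1 + ‖z‖)| ≤ 1 := by
      rw [abs_div, abs_of_pos (hpos z), div_le_one (hpos z)]
      linarith
    rw [abs_le] at h1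
    constructor <;> linarith
  have hcont : Continuous fun z : ℂ => 1 + ‖z‖ := by fun_prop
  -- The map z ↦ z/(1 + |z|) is injective and bounded; its real and imaginary parts, rescaled to [0,
  -- 1], are admissible test functions.
  obtain ⟨a, ha⟩ := ae_eq_const_of_mixing hT hmix hm he' hs hlim
    (F := fun z => (1 + z.re / (1 + ‖z‖)) / 2)
    ((continuous_const.add (Complex.continuous_re.div hcont fun z => (hpos z).ne')).div_const 2)
    (fun z => (hle z _ (Complex.abs_re_le_norm z)).1) fun z => (hle z _ (Complex.abs_re_le_norm z)).2
  obtain ⟨b, hb⟩ := ae_eq_const_of_mixing hT hmix hm he' hs hlim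
    (F := fun z => (1 + z.im / (1 + ‖z‖)) / 2)
    ((continuous_const.add (Complex.continuous_im.div hcont fun z => (hpos z).ne')).div_const 2)
    (fun z => (hle z _ (Complex.abs_im_le_norm z)).1) fun z => (hle z _ (Complex.abs_im_le_norm z)).2
  set d : ℂ := ⟨2 * a - 1, 2 * b - 1⟩ with hd
  -- Inverts z/(1 + |z|) = d, which gives 1 + |z| = 1/(1 - |d|), and then removes the factor ζ.
  refine ⟨ζ⁻¹ * (((1 - ‖d‖)⁻¹ : ℝ) * d), ?_⟩
  filter_upwards [hae, ha, hb] with x hx hax hbx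
  rw [hx, eq_inv_mul_iff_mul_eq₀ hζ0]
  set z := ζ * h' x
  have hz := hpos z
  have hzd : z = ((1 + ‖z‖ : ℝ) : ℂ) * d := by
    apply Complex.ext
    · rw [Complex.re_ofReal_mul, hd, ← hax]
      field_simp
      ring
    · rw [Complex.im_ofReal_mul, hd, ← hbx]
      field_simp
      ring
  have hnorm : ‖z‖ = (1 + ‖z‖) * ‖d‖ := by
    conv_lhs => rw [hzd, norm_mul, Complex.norm_real, Real.norm_of_nonneg hz.le]
  have h1 : (1 - ‖d‖)⁻¹ = 1 + ‖z‖ := inv_eq_of_mul_eq_one_left (by linarith)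
  rw [h1]
  exact hzd

end WeakMixing

/-! ### Assembly: invariance, passage from f̂_n to the limit, and weak mixing. -/

theorem proposition5
    (σ : ℝ) (hσ : σ ∈ Ioo (1 / 4 : ℝ) (1 / 2))
    (k l q m : ℕ → ℕ) (p : ℕ → ℤ) (α : ℕ → ℝ) (hα : ∀ n, α n = (p n : ℝ) / q n)
    -- the smooth conjugations `g n`, `φ n` and their analytic approximations `g' n`, `φ' n`
    (g φ g' φ' : ℕ → Equiv.Perm Plane)
    (hpar : IsParameterSystem k l q p (conjMap g φ))
    (hshear : ∀ n, 4 < n → n * shearSize n (q n) σ ≤ k n ^ 3)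
    (hg : ∀ n, 1 ≤ n → IsStepShear n (k n) (q n) σ (g n))
    (hφ : ∀ n, 1 ≤ n → IsAreaDiffeo (φ n) ∧ Commute (φ n) (rot (α n)))
    (hg' : ∀ n, 1 ≤ n → IsAnalyticApprox (α n)
      (precision n (k n) (l n) (q n) (conjMap g φ (n - 1)) (φ n)) (g n) (g' n))
    (hφ' : ∀ n, 1 ≤ n → IsAnalyticApprox (α n)
      (precision n (k n) (l n) (q n) (conjMap g φ (n - 1)) (φ n)) (φ n) (φ' n))
    -- the limit diffeomorphism
    (f : Equiv.Perm Plane) (hf : IsTorusDiffeo f)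
    (hlim : Tendsto (fun n => diffeoDist 1 (abcMap (conjMap g' φ') α n) f) atTop (𝓝 0))
    (hiter : ∀ n, 1 ≤ n →
      diffeoDist 1 (abcMap (conjMap g' φ') α n ^ m n) (f ^ m n) < 1 / 2 ^ n)
    -- the limit metric, which induces the measure on the projectivized tangent bundle
    (ω : Torus → Matrix (Fin 2) (Fin 2) ℝ) (hω : ∀ i j, Measurable fun z => ω z i j)
    (hωlim : ∀ᵐ z : Torus,
      Tendsto (fun n => transportedMetric (conjMap g' φ' n) z) atTop (𝓝 (ω z)))
    -- the partial partitions
    (N : ℕ → ℕ) (I : ∀ n, Fin (N n) → Fin (k n) → Set Torus)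
    (hI : ∀ n, 1 ≤ n → IsBasePartition n (k n) (q n) (⇑(g n * φ n)) (I n))
    (hη : ConvergesToPoints (metricMeasure ω) fun n => bundlePartition (I n))
    (hν : ConvergesToPoints (metricMeasure ω) fun n =>
      (fun S => (projExt (conjMap g' φ' (n - 1)) ∘ projExt (g' n)) '' S) '' bundlePartition (I n))
    -- the distribution property
    (γ δ ε₁ ε₂ : ℕ → ℝ)
    (hγ : ∀ n, 1 ≤ n → γ n < 1 / ((k n : ℝ) ^ 3 * q n))
    (hδ : ∀ n, 1 ≤ n → δ n < 50 / (k n : ℝ) ^ 2)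
    (hε₁ : ∀ n, 1 ≤ n → ε₁ n < 150 / (n : ℝ))
    (hε₂ : ∀ n, 1 ≤ n → ε₂ n < 150 / (n : ℝ))
    (hdist : ∀ n, 1 ≤ n → ∀ i,
      IsDistributing (innerMap φ' α m n) (I n i) (γ n) (δ n) (ε₁ n) (ε₂ n)) :
    IsWeaklyMixing (projExt f) (metricMeasure ω) := by
  have hS : IsClosePair σ k l q p g φ g' φ' N I :=
    { par := hpar
      shear := hg
      area := fun n hn => (hφ n hn).1
      area_g' := fun n hn => (hg' n hn).area
      area_φ' := fun n hn => (hφ' n hn).area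
      close_g := fun n hn => (hg' n hn).close
      close_φ := fun n hn => (hφ' n hn).close
      base := hI }
  have hH' := hS.area_conj'
  obtain ⟨hprob, τ, hτ, hcl⟩ := exists_integralClose_metricMeasure hH' hω hωlim
  have hF : ∀ n, IsAreaDiffeo (abcMap (conjMap g' φ') α n) := fun n =>
    ((hH' _).mul (IsAreaDiffeo.rot _)).mul (hH' _).inv
  have hT : MeasurePreserving (projExt f) (metricMeasure ω) (metricMeasure ω) := by
    refine measurePreserving_of_integralClose hτ hcl (fun n => (hF n).1.measurable_projExt)
      hf.measurable_projExt (fun n => ?_)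
      (tendsto_projExt_of_diffeoDist (fun n => (hF n).1) hf hlim)
    refine _root_.IsAreaDiffeo.map_projExt_map (hH' n) (hF n) (t := α (n + 1)) (n := 1) ?_
    rw [abcMap]; group
  have hiterate : ∀ (n : ℕ) (X : ProjBundle), projExt (⇑(f ^ n)) X = (projExt f)^[n] X := by
    intro n
    induction n with
    | zero => exact fun X => projExt_one X
    | succ n ih =>
      intro X
      rw [pow_succ, (hf.pow n).projExt_mul hf, ih, Function.iterate_succ_apply]
  have hTn : ∀ n, MeasurePreserving (projExt (⇑(f ^ n))) (metricMeasure ω) (metricMeasure ω) :=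
    fun n => by
      have : projExt (⇑(f ^ n)) = (projExt f)^[n] := funext (hiterate n)
      rw [this]; exact hT.iterate n
  have hconj : ∀ n, abcMap (conjMap g' φ') α n ^ m n * conjMap g' φ' n
      = conjMap g' φ' n * rot (α (n + 1)) ^ m n := fun n => by
    rw [abcMap, conj_pow]; group
  have hSν : ∀ n, IntegralClose ((metricMeasure ω).map (projExt (⇑(abcMap (conjMap g' φ') α n ^ m n))))
      (metricMeasure ω) (τ n + τ n) := fun n => by
    have a1 := ((hcl n).map ((hF n).pow (m n)).1.measurable_projExt).symm
    rw [_root_.IsAreaDiffeo.map_projExt_map (hH' n) ((hF n).pow (m n)) (hconj n)] at a1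
    exact a1.trans (hcl n)
  refine isWeaklyMixing_of_mixing (m := fun n => m (n + 1)) hT fun A hA ψ hψ hψ0 hψ1 => ?_
  have hψb : ∀ X, |ψ X| ≤ 1 := fun X => by rw [abs_of_nonneg (hψ0 X)]; exact hψ1 X
  -- The iterates of the limit map and of f̂_n agree asymptotically in μ̄-measure: the estimate
  -- holds for Lebesgue measure, and μ̄ is absolutely continuous.
  have h1 := (tendsto_integral_abs_comp_sub_comp (ν := metricMeasure ω)
    (S := fun n => projExt (⇑(abcMap (conjMap g' φ') α n ^ m n)))
    (T := fun n => projExt (⇑(f ^ m n))) (fun n => ((hF n).pow (m n)).1.measurable_projExt)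
    (fun n => hTn (m n)) (τ := fun n => τ n + τ n) (by simpa using hτ.add hτ) hSν
    (fun η hη => tendsto_metricMeasure_of_tendsto_volume
      (tendsto_volume_dist_projExt_lt hH' hωlim (fun n => (hF n).pow (m n)) (fun n => hf.pow (m n))
        hconj hiter hη)) hψ hψb).comp (tendsto_add_atTop_nat 1)
  have h2 := hS.tendsto_setIntegral_abcMap hσ.1 hshear (metricMeasure_absolutelyContinuous ω) hτ hcl
    hν hγ hδ hε₁ hε₂ hdist hA hψ hψ0 hψ1
  have h3 : Tendsto (fun n => (∫ X in A, ψ ((projExt f)^[m (n + 1)] X) ∂metricMeasure ω)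
      - ∫ X in A, ψ (projExt (⇑(abcMap (conjMap g' φ') α (n + 1) ^ m (n + 1))) X) ∂metricMeasure ω)
      atTop (𝓝 0) := by
    refine squeeze_zero_norm (fun n => ?_) h1
    simp only [← hiterate]
    have i1 : Integrable (fun X => ψ (projExt (⇑(f ^ m (n + 1))) X)) (metricMeasure ω) :=
      integrable_of_abs_le (hψ.comp (hf.pow _).measurable_projExt) fun _ => hψb _
    have i2 : Integrable (fun X => ψ (projExt (⇑(abcMap (conjMap g' φ') α (n + 1) ^ m (n + 1))) X))
        (metricMeasure ω) :=
      integrable_of_abs_le (hψ.comp ((hF (n + 1)).pow (m (n + 1))).1.measurable_projExt)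
        fun _ => hψb _
    rw [← integral_sub i1.integrableOn i2.integrableOn]
    exact (norm_integral_le_integral_norm _).trans (setIntegral_le_integral (i1.sub i2).abs
      (Eventually.of_forall fun _ => abs_nonneg _))
  simpa using h3.add h2
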